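/- Let $\Sigma$ be a finite alphabet of size $\sigma$. For a string ${\bf x}=x_1x_2\dots x_n\in\Sigma^n$ and $\alpha\in\Sigma$ let $I_\alpha({\bf x})=\{i \mid x_i=\alpha\}$, let $H_0=\sum_{\alpha}\frac{|I_\alpha|}{n}\lg\frac{n}{|I_\alpha|}$ (sum over the characters that occur) be the $0$th order entropy of ${\bf x}$, and let $T=\lg\binom{n}{|I_\alpha|}$ be the optimal size in bits of a compressed representation of $I_\alpha({\bf x})$; $\lg$ is the logarithm to base $2$. Work in the I/O model with blocks of $B$ bits and an internal memory of $M$ bits, and put $b=B/\lg n$. One I/O reads a block, writes a block, or sends at most $B$ bits to the output; computation in internal memory is free (besides a finite control with $O(1)$ states), and the content of internal memory persists between operations. Assume throughout that $n\ge 2$, $\sigma\le n$, $b\ge 2$ and $M\ge B\lg n$. Then a string ${\bf x}\in\Sigma^n$ can be stored in $O(nH_0+B)$ bits (that is, in $O(nH_0)$ bits up to $O(1)$ blocks; data kept in internal memory between operations is included) so that the following operations are supported. * A point query, given $\alpha\in\Sigma$, returns a compressed representation of $I_\alpha({\bf x})$ of $O(T+1)$ bits, using $O(T/B+\lg n)$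 I/Os in the worst case. * An update either appends a character to the end of ${\bf x}$, or changes the character in a position $i$ from its current value $\alpha=x_i$ to $\beta$ (given $i$, $\alpha$ and $\beta$). Updates take amortized $O\left(\frac{\lg n}{b}\right)$ I/Os: starting from the structure built for any initial string, the updates in any sequence of updates and point queries take $O\left(\sum \frac{\lg n}{b}\right)$ I/Os in total, where the sum is over these updates and $n$, $b$ are the values at the time of the update. At any time, the space and query bounds hold for the current string and its length $n$. All constants are universal. -/

import Mathlib

noncomputable section

namespace BitmapIndex

/-! ### Strings, position sets, entropy -/

/-- Binary logarithm of a natural number. -/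
def lg (n : ℕ) : ℝ := Real.logb 2 n

/-- The set `I_a(x)` of the (0-based) positions at which the character `a` occurs in `x`. -/
def positions {σ : ℕ} (a : Fin σ) (x : List (Fin σ)) : Finset ℕ :=
  (Finset.range x.length).filter (fun i => x[i]? = some a)

/-- The 0th order empirical entropy of `x`; a character that does not occur contributes `0`. -/
def entropy {σ : ℕ} (x : List (Fin σ)) : ℝ :=
  ∑ a : Fin σ, ((x.count a : ℝ) / x.length) * Real.logb 2 ((x.length : ℝ) / x.count a)

/-- `T`: the information-theoretic (optimal) size in bits of a compressed representation of
`I_a(x)`, a set of `z` positions out of `n`. -/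
def answerBits {σ : ℕ} (a : Fin σ) (x : List (Fin σ)) : ℝ :=
  lg (x.length.choose (positions a x).card)

/-- `b`: the number of words of `lg n` bits in a block of `B` bits. -/
def blockWords (n B : ℕ) : ℝ := B / lg n

/-- The standing assumptions on a string `x` over an alphabet of size `σ`, on the block size `B`
and on the size `M` of internal memory (both in bits): `σ ≤ n`, `b ≥ 2`, `M ≥ B lg n`. -/
structure Admissible {σ : ℕ} (B M : ℕ) (x : List (Fin σ)) : Prop where
  two_le_length : 2 ≤ x.length
  alphabet_le : σ ≤ x.length
  two_le_blockWords : 2 ≤ blockWords x.length B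
  memory : (B : ℝ) * lg x.length ≤ M

/-! ### Operations -/

/-- Updates of a string: append a character, or change the character in position `i` from `old`
to `new`, that is, clear bit `i` of the bitmap of `old` and set bit `i` of the bitmap of `new`. -/
inductive Update (σ : ℕ) where
  | append (a : Fin σ)
  | change (i : ℕ) (old new : Fin σ)

/-- A change has to name an existing position and the character that is currently there. -/
def Update.Valid {σ : ℕ} (x : List (Fin σ)) : Update σ → Prop
  | .append _ => True
  | .change i old _ => x[i]? = some old

/-- The string after an update. -/
def Update.apply {σ : ℕ} (x : List (Fin σ)) : Update σ → List (Fin σ)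
  | .append a => x ++ [a]
  | .change i _ new => x.set i new

/-- Requests to the data structure: updates and point queries. -/
inductive Request (σ : ℕ) where
  | update (u : Update σ)
  | query (a : Fin σ)

/-! ### The I/O model

Internal memory holds a bit string of at most `M` bits. External memory is an array of blocks of
`B` bits. One I/O reads one block, writes one block, or sends at most `B` bits to the output.
Computation in internal memory is free. Besides the internal memory there is a finite control
(program counter) whose number `q` of states does not depend on any parameter.
Internal memory, control and external memory persist from one request to the next. -/

/-- Control state and content of internal memory. -/
structure Internal (q : ℕ) where
  ctrl : Fin q
  mem : List Bool

/-- What a machine does next. -/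
inductive Action (B q : ℕ) where
  | read (addr : ℕ) (next : BitVec B → Internal q)
  | write (addr : ℕ) (block : BitVec B) (next : Internal q)
  | emit (bits : List Bool) (next : Internal q)
  | halt (next : Internal q)

/-- A machine chooses the next action from the request that is being served, its control state and
the content of its internal memory. -/
structure Machine (σ B q : ℕ) where
  step : Request σ → Internal q → Action B q

/-- A configuration: control, internal memory, and external memory. -/
structure Config (B q : ℕ) where
  int : Internal q
  disk : ℕ → BitVec B

/-- `Exec m M r c out k c'`: serving the request `r` from configuration `c`, the machine `m` halts
in configuration `c'` after exactly `k` I/Os, having output the bit string `out`, and its internal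
memory never holds more than `M` bits on the way. -/
inductive Exec {σ B q : ℕ} (m : Machine σ B q) (M : ℕ) (r : Request σ) :
    Config B q → List Bool → ℕ → Config B q → Prop
  | halt {c : Config B q} {s : Internal q} (h : m.step r c.int = .halt s)
      (hs : s.mem.length ≤ M) : Exec m M r c [] 0 ⟨s, c.disk⟩
  | read {c c' : Config B q} {addr : ℕ} {next : BitVec B → Internal q} {out : List Bool} {k : ℕ}
      (h : m.step r c.int = .read addr next) (hs : (next (c.disk addr)).mem.length ≤ M)
      (hrest : Exec m M r ⟨next (c.disk addr), c.disk⟩ out k c') : Exec m M r c out (k + 1) c'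
  | write {c c' : Config B q} {addr : ℕ} {block : BitVec B} {s : Internal q} {out : List Bool}
      {k : ℕ} (h : m.step r c.int = .write addr block s) (hs : s.mem.length ≤ M)
      (hrest : Exec m M r ⟨s, Function.update c.disk addr block⟩ out k c') :
      Exec m M r c out (k + 1) c'
  | emit {c c' : Config B q} {bits : List Bool} {s : Internal q} {out : List Bool} {k : ℕ}
      (h : m.step r c.int = .emit bits s) (hbits : bits.length ≤ B) (hs : s.mem.length ≤ M)
      (hrest : Exec m M r ⟨s, c.disk⟩ out k c') : Exec m M r c (bits ++ out) (k + 1) c'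

/-- `StoredIn c S`: the data retained in configuration `c` takes at most `S` bits, where the
content of internal memory is counted, and external memory is blank beyond an initial segment of
blocks, all of which are counted. -/
def StoredIn {B q : ℕ} (c : Config B q) (S : ℝ) : Prop :=
  ∃ s : ℕ, (∀ addr, s ≤ addr → c.disk addr = 0) ∧ ((c.int.mem.length + s * B : ℕ) : ℝ) ≤ S

/-- `Reachable m M x₀ c₀ x c t w`: some sequence of point queries and valid updates takes the string
from `x₀` to `x`, and the machine from configuration `c₀` to `c`; the updates of the sequence took `t`
I/Os altogether, and `w` is the sum over these updates of `lg n / b`, where `n` is the length of the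
string to which the update is applied. -/
inductive Reachable {σ B q : ℕ} (m : Machine σ B q) (M : ℕ) (x₀ : List (Fin σ)) (c₀ : Config B q) :
    List (Fin σ) → Config B q → ℕ → ℝ → Prop
  | start : Reachable m M x₀ c₀ x₀ c₀ 0 0
  | query {x : List (Fin σ)} {c c' : Config B q} {t : ℕ} {w : ℝ} {a : Fin σ} {out : List Bool}
      {k : ℕ} (h : Reachable m M x₀ c₀ x c t w) (hq : Exec m M (.query a) c out k c') :
      Reachable m M x₀ c₀ x c' t w
  | update {x : List (Fin σ)} {c c' : Config B q} {t : ℕ} {w : ℝ} {u : Update σ} {out : List Bool}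
      {k : ℕ} (h : Reachable m M x₀ c₀ x c t w) (hu : u.Valid x) (hadm : Admissible B M (u.apply x))
      (he : Exec m M (.update u) c out k c') :
      Reachable m M x₀ c₀ (u.apply x) c' (t + k) (w + lg x.length / blockWords x.length B)

end BitmapIndex

end

/-! The string is described by change points. For every character `a`, `chg` is the set of positions
at which the bitmap of `a` flips, and the key of such a position is the fixed-width code of `a`
followed by the position in binary, most significant bit first. The bitmap of `a` is then the set of
keys below one prefix. An update toggles at most four keys (`card_toggle`, `keys_apply`), and since
all changes are symmetric differences, they may be delayed and combined in any order.

A set of keys is measured by the number of nodes of its binary trie, which has a code of three bits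
per node (`length_trieCode`). If the rarer value of a bitmap occurs m times, there are O(m) change
points and their trie has O(m lg(n/m)) nodes (`trieSize_le_spread`). This is O(T) because (n/m)^m is
at most the binomial coefficient (`spread_le_lg_choose`), and over all characters it sums up to
O(nH_0 + lg n) (`trieSize_keys_le`): only one character can occur more often than half of the time,
and its complement is paid for by the other characters. The bitmap of all positions is exceptional,
having T = 0 but a nonempty trie; its answer is the empty output.

The keys are kept in a buffer tree. A finite set of strings, the cells, containing the empty one,
assigns every string to its longest prefix among the cells. A cell has a record of O(1) blocks with
its keys, pending changes for the strings below it, and the addresses of its neighbours. Its weight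
is the trie size of its keys plus 64B for every cell directly below. A cell that is too heavy
contains a prefix below which there is a suitable fraction of its weight (`exists_cut`) and is cut
there; a cell that is too light is absorbed by the cell above. Counting the cells below in the
weight bounds the degree, and it gives `card_below_le`: the charges for them amount to 64B per cell
altogether, so if all weights are at least 192B, the remainder consists of trie nodes, and the tries
of different cells are almost disjoint (`sum_trieSize_reg_le`). Hence there are few cells below a
prefix with a small trie. For the empty prefix this is the space bound, for the code of a character
the I/O bound of a query.

Updates are collected in internal memory. When they exceed a small fraction of a block, they become
pending changes at the root, and local operations repair the tree: some operation is always
appropriate (`Tree.exists_legal`), and it preserves the represented set and an invariant and lowers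
a potential by 64B for O(1) I/Os (`Tree.Inv.apply`). The potential of a pending key is its length
times the number of bits between the current cell and its end, and a flush moves it to a strictly
longer cell or to its destination. An update thus brings in O(lg² n), which amounts to lg² n / B =
lg n / b I/Os (`Holds.update`).

A query walks through the cells comparable to the code of the character, adding up keys and pending
changes modulo 2, and outputs the accumulated set whenever it outgrows a fixed fraction of the
memory. Changes that cancel cannot inflate the answer: either nothing has been sent before the end,
so that the accumulated set is exact, or so much has been sent that the pending changes, being
small, are negligible (`Context.query`).

All this needs memory for a large constant number of blocks, which M ≥ B lg n provides only if n is
large. Strings shorter than the constant N = 2^L live in the finite control. When the length reaches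
N, the string in the control is frozen, and external memory, so far blank, represents the difference
to it (`Stores`). `Reachable.stores` carries invariant and potential through a sequence of
operations. -/

noncomputable section

/-! ### Programs with I/Os, and machines that simulate them. -/

namespace BitmapIndex

/-! ### Straight-line I/O programs -/

/-- A program performing I/Os and computing a value of type `α`. -/
inductive Prog (B : ℕ) (α : Type) : Type
  | ret (a : α)
  | read (p : ℕ) (k : BitVec B → Prog B α)
  | write (p : ℕ) (b : BitVec B) (k : Prog B α)
  | emit (bits : List Bool) (k : Prog B α)

namespace Prog

variable {B : ℕ} {α β : Type}

def bind : Prog B α → (α → Prog B β) → Prog B β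
  | ret a, f => f a
  | read p k, f => read p (fun b => (k b).bind f)
  | write p b k, f => write p b (k.bind f)
  | emit bits k, f => emit bits (k.bind f)

/-- The value computed by a program. -/
def res : Prog B α → (ℕ → BitVec B) → α
  | ret a, _ => a
  | read p k, d => (k (d p)).res d
  | write p b k, d => k.res (Function.update d p b)
  | emit _ k, d => k.res d

/-- The content of external memory after a program. -/
def fin : Prog B α → (ℕ → BitVec B) → (ℕ → BitVec B)
  | ret _, d => d
  | read p k, d => (k (d p)).fin d
  | write p b k, d => k.fin (Function.update d p b)
  | emit _ k, d => k.fin d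

/-- The output of a program. -/
def out : Prog B α → (ℕ → BitVec B) → List Bool
  | ret _, _ => []
  | read p k, d => (k (d p)).out d
  | write p b k, d => k.out (Function.update d p b)
  | emit bits k, d => bits.take B ++ k.out d

/-- The number of I/Os of a program. -/
def cost : Prog B α → (ℕ → BitVec B) → ℕ
  | ret _, _ => 0
  | read p k, d => (k (d p)).cost d + 1
  | write p b k, d => k.cost (Function.update d p b) + 1
  | emit _ k, d => k.cost d + 1

/-- The number of reads of a program. -/
def reads : Prog B α → (ℕ → BitVec B) → ℕ
  | ret _, _ => 0
  | read p k, d => (k (d p)).reads d + 1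
  | write p b k, d => k.reads (Function.update d p b)
  | emit _ k, d => k.reads d

theorem reads_le_cost (P : Prog B α) : ∀ d, P.reads d ≤ P.cost d := by
  induction P with
  | ret a => intro d; simp [reads, cost]
  | read p k ih => intro d; simpa [reads, cost] using ih _ d
  | write p b k ih => intro d; simpa [reads, cost] using (ih _).trans (Nat.le_succ _)
  | emit bits k ih => intro d; simpa [reads, cost] using (ih _).trans (Nat.le_succ _)

@[simp] theorem res_bind (P : Prog B α) (f : α → Prog B β) :
    ∀ d, (P.bind f).res d = (f (P.res d)).res (P.fin d) := by
  induction P with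
  | ret a => intro d; rfl
  | read p k ih => intro d; exact ih _ d
  | write p b k ih => intro d; exact ih _
  | emit bits k ih => intro d; exact ih _

@[simp] theorem fin_bind (P : Prog B α) (f : α → Prog B β) :
    ∀ d, (P.bind f).fin d = (f (P.res d)).fin (P.fin d) := by
  induction P with
  | ret a => intro d; rfl
  | read p k ih => intro d; exact ih _ d
  | write p b k ih => intro d; exact ih _
  | emit bits k ih => intro d; exact ih _

@[simp] theorem out_bind (P : Prog B α) (f : α → Prog B β) :
    ∀ d, (P.bind f).out d = P.out d ++ (f (P.res d)).out (P.fin d) := by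
  induction P with
  | ret a => intro d; rfl
  | read p k ih => intro d; exact ih _ d
  | write p b k ih => intro d; exact ih _
  | emit bits k ih => intro d; simp [bind, out, res, fin, ih]

@[simp] theorem cost_bind (P : Prog B α) (f : α → Prog B β) :
    ∀ d, (P.bind f).cost d = P.cost d + (f (P.res d)).cost (P.fin d) := by
  induction P with
  | ret a => intro d; simp [bind, cost, res, fin]
  | read p k ih => intro d; simp only [bind, cost, res, fin, ih]; omega
  | write p b k ih => intro d; simp only [bind, cost, res, fin, ih]; omega
  | emit bits k ih => intro d; simp only [bind, cost, res, fin, ih]; omega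

/-- The program that remains after `j` I/Os, of which the reads were answered by `ans`. -/
def adv : Prog B α → List (BitVec B) → ℕ → Prog B α
  | read _ k, b :: ans, j + 1 => (k b).adv ans j
  | write _ _ k, ans, j + 1 => k.adv ans j
  | emit _ k, ans, j + 1 => k.adv ans j
  | P, _, _ => P

/-- `ans` holds exactly the answers to the reads among the first `j` I/Os. -/
def Full : Prog B α → List (BitVec B) → ℕ → Prop
  | _, [], 0 => True
  | read _ k, b :: ans, j + 1 => (k b).Full ans j
  | write _ _ k, ans, j + 1 => k.Full ans j
  | emit _ k, ans, j + 1 => k.Full ans j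
  | _, _, _ => False

@[simp] theorem adv_zero (P : Prog B α) : P.adv [] 0 = P := by
  cases P <;> simp [adv]

@[simp] theorem full_zero (P : Prog B α) : P.Full [] 0 := by
  cases P <;> simp [Full]

/-- The machine knows a running program only through its beginning and the recorded answers, and
replays it before every I/O. Recording one more I/O must therefore advance the replay by exactly one
node. -/
theorem adv_step (P : Prog B α) : ∀ (ans : List (BitVec B)) (j : ℕ), P.Full ans j →
    (∀ p k, P.adv ans j = read p k →
      ∀ b, P.Full (ans ++ [b]) (j + 1) ∧ P.adv (ans ++ [b]) (j + 1) = k b) ∧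
    (∀ p b k, P.adv ans j = write p b k →
      P.Full ans (j + 1) ∧ P.adv ans (j + 1) = k) ∧
    (∀ bits k, P.adv ans j = emit bits k →
      P.Full ans (j + 1) ∧ P.adv ans (j + 1) = k) := by
  induction P with
  | ret a =>
    intro ans j h
    refine ⟨fun p k e => ?_, fun p b k e => ?_, fun bits k e => ?_⟩ <;>
      cases ans <;> cases j <;> simp [adv] at e
  | read p k ih =>
    intro ans j h
    match ans, j, h with
    | [], 0, _ =>
      refine ⟨fun p' k' e b => ?_, fun p b k e => ?_, fun bits k e => ?_⟩
      · simp only [adv_zero, read.injEq] at e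
        obtain ⟨_, rfl⟩ := e
        simp [adv, Full]
      all_goals simp at e
    | b :: ans, j + 1, h =>
      have h' : (k b).Full ans j := h
      simpa [adv, Full] using ih b ans j h'
  | write p b k ih =>
    intro ans j h
    match ans, j, h with
    | [], 0, _ =>
      refine ⟨fun p' k' e b => ?_, fun p b k e => ?_, fun bits k e => ?_⟩
      · simp at e
      · simp only [adv_zero, write.injEq] at e
        obtain ⟨_, _, rfl⟩ := e
        simp [adv, Full]
      · simp at e
    | ans, j + 1, h =>
      have h' : k.Full ans j := by simpa [Full] using h
      simpa [adv, Full] using ih ans j h'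
  | emit bits k ih =>
    intro ans j h
    match ans, j, h with
    | [], 0, _ =>
      refine ⟨fun p' k' e b => ?_, fun p b k e => ?_, fun bits k e => ?_⟩
      · simp at e
      · simp at e
      · simp only [adv_zero, emit.injEq] at e
        obtain ⟨_, rfl⟩ := e
        simp [adv, Full]
    | ans, j + 1, h =>
      have h' : k.Full ans j := by simpa [Full] using h
      simpa [adv, Full] using ih ans j h'

end Prog

/-! ### Machines from programs

A machine whose states `S` are represented by a control state and a bit string, and which in every
state runs a program computing the next state, is simulated by a machine of the I/O model: the
internal memory holds the current state and the answers to the reads of the running program, and the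
control counts the I/Os of the running program. -/

/-- The bits of a block. -/
def blockBits {B : ℕ} (b : BitVec B) : List Bool := List.ofFn (fun i : Fin B => b[i])

@[simp] theorem length_blockBits {B : ℕ} (b : BitVec B) : (blockBits b).length = B := by
  simp [blockBits]

theorem blockBits_injective {B : ℕ} : Function.Injective (blockBits (B := B)) := by
  intro b c h
  have := List.ofFn_injective h
  ext i hi
  exact congrFun this ⟨i, hi⟩

theorem flatMap_blockBits_inj {B : ℕ} : ∀ (l l' : List (BitVec B)) (x x' : List Bool),
    l.length = l'.length → l.flatMap blockBits ++ x = l'.flatMap blockBits ++ x' →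
    l = l' ∧ x = x'
  | [], [], x, x', _, h => by simpa using h
  | a :: l, a' :: l', x, x', hl, h => by
    simp only [List.flatMap_cons, List.append_assoc] at h
    have h1 := List.append_inj h (by simp)
    have h2 := flatMap_blockBits_inj l l' x x' (by simpa using hl) h1.2
    exact ⟨by rw [blockBits_injective h1.1, h2.1], h2.2⟩
  | [], _ :: _, _, _, hl, _ => by simp at hl
  | _ :: _, [], _, _, hl, _ => by simp at hl

section Simulation

variable {σ B q : ℕ} {S : Type} (D : ℕ) (enc : S → Internal q)
  (step : Request σ → S → Prog B S)

/-- Representation of a state together with the progress of its program. -/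
def packed (s : S) (ans : List (BitVec B)) (j : ℕ) : Internal (q * ((D + 1) * (D + 1))) :=
  ⟨finProdFinEquiv ((enc s).ctrl,
      finProdFinEquiv (Fin.ofNat (D + 1) j, Fin.ofNat (D + 1) ans.length)),
    ans.flatMap blockBits ++ (enc s).mem⟩

/-- The control records the number of answers, so that the memory can be split into answers and
encoded state. Both counters are kept modulo `D + 1`, hence the bounds by `D`. -/
theorem packed_inj (henc : Function.Injective enc) {s s' : S} {ans ans' : List (BitVec B)}
    {j j' : ℕ} (hj : j ≤ D) (hj' : j' ≤ D) (ha : ans.length ≤ D) (ha' : ans'.length ≤ D)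
    (h : packed D enc s ans j = packed D enc s' ans' j') : s = s' ∧ ans = ans' ∧ j = j' := by
  simp only [packed, Internal.mk.injEq, EmbeddingLike.apply_eq_iff_eq, Prod.mk.injEq] at h
  obtain ⟨⟨h1, h2, h3⟩, h4⟩ := h
  have e2 := congrArg Fin.val h2
  have e3 := congrArg Fin.val h3
  simp only [Fin.ofNat, Nat.mod_eq_of_lt (Nat.lt_succ_of_le hj),
    Nat.mod_eq_of_lt (Nat.lt_succ_of_le hj'), Nat.mod_eq_of_lt (Nat.lt_succ_of_le ha),
    Nat.mod_eq_of_lt (Nat.lt_succ_of_le ha')] at e2 e3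
  have e4 := flatMap_blockBits_inj _ _ _ _ e3 h4
  refine ⟨henc ?_, e4.1, e2⟩
  cases hs : enc s; cases hs' : enc s'
  rw [hs, hs'] at h1 e4
  simp_all

/-- The internal state after an I/O. -/
def nextPacked (r : Request σ) (s : S) (ans : List (BitVec B)) (j : ℕ) :
    Internal (q * ((D + 1) * (D + 1))) :=
  match (step r s).adv ans j with
  -- A program that has come to its end is replaced at once by the beginning of the next one; the
  -- answers are dropped in the same transition.
  | .ret s' => packed (B := B) D enc s' [] 0
  | _ => packed D enc s ans j

/-- The action in a given state and progress of its program. -/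
def packedAction (r : Request σ) (s : S) (ans : List (BitVec B)) (j : ℕ) :
    Action B (q * ((D + 1) * (D + 1))) :=
  match (step r s).adv ans j with
  | .ret s' => .halt (packed (B := B) D enc s' [] 0)
  | .read p _ => .read p (fun b => nextPacked D enc step r s (ans ++ [b]) (j + 1))
  | .write p b _ => .write p b (nextPacked D enc step r s ans (j + 1))
  | .emit bits _ => .emit (bits.take B) (nextPacked D enc step r s ans (j + 1))

open Classical in
/-- The simulating machine. -/
def simMachine : Machine σ B (q * ((D + 1) * (D + 1))) where
  step r i :=
    if h : ∃ x : S × List (BitVec B) × ℕ, x.2.1.length ≤ D ∧ x.2.2 ≤ D ∧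
        packed D enc x.1 x.2.1 x.2.2 = i then
      packedAction D enc step r h.choose.1 h.choose.2.1 h.choose.2.2
    else .halt i

variable {D enc step}

/-- The state and progress recovered by choice are the intended ones, because the packing is
injective within the bounds on the counters. -/
theorem simMachine_step (henc : Function.Injective enc) (r : Request σ) {s : S}
    {ans : List (BitVec B)} {j : ℕ} (ha : ans.length ≤ D) (hj : j ≤ D) :
    (simMachine D enc step).step r (packed D enc s ans j) = packedAction D enc step r s ans j := by
  have h : ∃ x : S × List (BitVec B) × ℕ, x.2.1.length ≤ D ∧ x.2.2 ≤ D ∧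
      packed D enc x.1 x.2.1 x.2.2 = packed D enc s ans j := ⟨(s, ans, j), ha, hj, rfl⟩
  simp only [simMachine, dif_pos h]
  obtain ⟨e1, e2, e3⟩ := packed_inj D enc henc h.choose_spec.2.1 hj h.choose_spec.1 ha
    h.choose_spec.2.2
  rw [e1, e2, e3]

theorem length_packed_mem (s : S) (ans : List (BitVec B)) (j : ℕ) :
    (packed D enc s ans j).mem.length = ans.length * B + (enc s).mem.length := by
  simp [packed]

/-- Induction on what remains of the program. Meanwhile the memory holds the encoded old state and
`B` bits for each answered read, which explains the budget in terms of `reads`; the last I/O leads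
directly to the start of the next program, whose execution is a hypothesis. A program that is
already finished is excluded, since the machine would halt on it. -/
theorem exec_of_adv (henc : Function.Injective enc) (M : ℕ) (r : Request σ) (s : S)
    (c' : Config B (q * ((D + 1) * (D + 1)))) (o : List Bool) (k : ℕ) (P' : Prog B S) :
    ∀ (ans : List (BitVec B)) (j : ℕ) (d : ℕ → BitVec B), (step r s).Full ans j →
      (step r s).adv ans j = P' → (∀ s', P' ≠ .ret s') → P'.cost d + j ≤ D → ans.length ≤ j →
      (enc s).mem.length + (ans.length + P'.reads d) * B ≤ M →
      (enc (P'.res d)).mem.length ≤ M →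
      Exec (simMachine D enc step) M r ⟨packed (B := B) D enc (P'.res d) [] 0, P'.fin d⟩ o k c' →
      Exec (simMachine D enc step) M r ⟨packed D enc s ans j, d⟩ (P'.out d ++ o)
        (P'.cost d + k) c' := by
  have key : ∀ (Q : Prog B S) (ans : List (BitVec B)) (j : ℕ) (d : ℕ → BitVec B),
      (step r s).adv ans j = Q →
      (enc s).mem.length + (ans.length + Q.reads d) * B ≤ M →
      (enc (Q.res d)).mem.length ≤ M →
      (nextPacked D enc step r s ans j).mem.length ≤ M := by
    intro Q ans j d hQ h1 h2
    rw [nextPacked, hQ]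
    have h3 : (packed D enc s ans j).mem.length ≤ M := by
      rw [length_packed_mem]
      nlinarith [Nat.zero_le (Q.reads d * B)]
    cases Q with
    | ret a => simpa [length_packed_mem, Prog.res] using h2
    | read p k => exact h3
    | write p b k => exact h3
    | emit bits k => exact h3
  have key2 : ∀ (Q : Prog B S) (ans : List (BitVec B)) (j : ℕ) (d : ℕ → BitVec B),
      (step r s).adv ans j = Q →
      Exec (simMachine D enc step) M r ⟨packed (B := B) D enc (Q.res d) [] 0, Q.fin d⟩ o k c' →
      ((∀ s', Q ≠ .ret s') →
        Exec (simMachine D enc step) M r ⟨packed D enc s ans j, d⟩ (Q.out d ++ o)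
          (Q.cost d + k) c') →
      Exec (simMachine D enc step) M r ⟨nextPacked D enc step r s ans j, d⟩ (Q.out d ++ o)
        (Q.cost d + k) c' := by
    intro Q ans j d hQ h1 h2
    rw [nextPacked, hQ]
    cases Q with
    | ret a => simpa [Prog.out, Prog.cost, Prog.res, Prog.fin] using h1
    | read p k => exact h2 (by simp)
    | write p b k => exact h2 (by simp)
    | emit bits k => exact h2 (by simp)
  induction P' with
  | ret a => intro ans j d _ _ h; exact absurd rfl (h a)
  | read p kk ih =>
    intro ans j d hf ha hne hc hj hm hm' hex
    simp only [Prog.cost, Prog.reads, Prog.res, Prog.fin, Prog.out] at *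
    have hs := ((step r s).adv_step ans j hf).1 p kk ha (d p)
    have hm2 : (enc s).mem.length + ((ans ++ [d p]).length + (kk (d p)).reads d) * B ≤ M := by
      simp only [List.length_append, List.length_singleton]
      calc _ = (enc s).mem.length + (ans.length + ((kk (d p)).reads d + 1)) * B := by ring
        _ ≤ M := hm
    rw [show (kk (d p)).cost d + 1 + k = ((kk (d p)).cost d + k) + 1 by omega]
    refine Exec.read (addr := p)
      (next := fun b => nextPacked D enc step r s (ans ++ [b]) (j + 1)) ?_ ?_ ?_
    · rw [simMachine_step henc r (by omega) (by omega), packedAction, ha]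
    · exact key _ _ _ d hs.2 hm2 hm'
    · exact key2 _ _ _ d hs.2 hex (fun hne' => ih (d p) _ _ d hs.1 hs.2 hne' (by omega)
        (by simp; omega) hm2 hm' hex)
  | write p b kk ih =>
    intro ans j d hf ha hne hc hj hm hm' hex
    simp only [Prog.cost, Prog.reads, Prog.res, Prog.fin, Prog.out] at *
    have hs := ((step r s).adv_step ans j hf).2.1 p b kk ha
    rw [show kk.cost (Function.update d p b) + 1 + k
      = (kk.cost (Function.update d p b) + k) + 1 by omega]
    refine Exec.write (addr := p) (block := b)
      (s := nextPacked D enc step r s ans (j + 1)) ?_ ?_ ?_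
    · rw [simMachine_step henc r (by omega) (by omega), packedAction, ha]
    · exact key _ _ _ _ hs.2 hm hm'
    · exact key2 _ _ _ _ hs.2 hex (fun hne' => ih _ _ _ hs.1 hs.2 hne'
        (by dsimp only; omega) (by omega) hm hm' hex)
  | emit bits kk ih =>
    intro ans j d hf ha hne hc hj hm hm' hex
    simp only [Prog.cost, Prog.reads, Prog.res, Prog.fin, Prog.out] at *
    have hs := ((step r s).adv_step ans j hf).2.2 bits kk ha
    rw [show kk.cost d + 1 + k = (kk.cost d + k) + 1 by omega, List.append_assoc]
    refine Exec.emit (bits := bits.take B)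
      (s := nextPacked D enc step r s ans (j + 1)) ?_ (by simp) ?_ ?_
    · rw [simMachine_step henc r (by omega) (by omega), packedAction, ha]
    · exact key _ _ _ _ hs.2 hm hm'
    · exact key2 _ _ _ _ hs.2 hex (fun hne' => ih _ _ _ hs.1 hs.2 hne'
        (by dsimp only; omega) (by omega) hm hm' hex)

/-- Running a sequence of programs, from a state to a state in which the machine halts. -/
inductive Runs (D : ℕ) (enc : S → Internal q) (step : Request σ → S → Prog B S) (M : ℕ)
    (r : Request σ) : S → (ℕ → BitVec B) → List Bool → ℕ → S → (ℕ → BitVec B) → Prop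
  | halt {s s' : S} {d : ℕ → BitVec B} (h : step r s = .ret s') (hm : (enc s').mem.length ≤ M) :
      Runs D enc step M r s d [] 0 s' d
  | step {s s' : S} {d d' : ℕ → BitVec B} {o : List Bool} {k : ℕ}
      -- A program without I/Os is a halt of the simulating machine, so only the other constructor
      -- may use it.
      (hne : 0 < (step r s).cost d)
      (hc : (step r s).cost d ≤ D)
      (hm : (enc s).mem.length + (step r s).reads d * B ≤ M)
      (hm' : (enc ((step r s).res d)).mem.length ≤ M)
      (h : Runs D enc step M r ((step r s).res d) ((step r s).fin d) o k s' d') :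
      Runs D enc step M r s d ((step r s).out d ++ o) ((step r s).cost d + k) s' d'

/-- The configuration that represents a state. -/
def config (D : ℕ) (enc : S → Internal q) (s : S) (d : ℕ → BitVec B) :
    Config B (q * ((D + 1) * (D + 1))) :=
  ⟨packed (B := B) D enc s [] 0, d⟩

theorem exec_of_runs (henc : Function.Injective enc) {M : ℕ} {r : Request σ} {s s' : S}
    {d d' : ℕ → BitVec B} {o : List Bool} {k : ℕ} (h : Runs D enc step M r s d o k s' d') :
    Exec (simMachine D enc step) M r (config D enc s d) o k (config D enc s' d') := by
  induction h with
  | @halt s s' d h hm =>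
    refine Exec.halt (c := config D enc s d) ?_ (by simpa [length_packed_mem] using hm)
    simp only [config]
    rw [simMachine_step henc r (by simp) (by simp), packedAction, Prog.adv_zero, h]
  | @step s s' d d' o k hne hc hm hm' h ih =>
    refine exec_of_adv henc M r s _ o k _ [] 0 d (by simp) (by simp) ?_ (by omega)
      (by simp) (by simpa using hm) hm' ih
    intro s' e
    rw [e] at hne
    simp [Prog.cost] at hne

end Simulation

/-- `Reachable` speaks of arbitrary executions; determinism identifies them with the ones that are
constructed. -/
theorem Exec.unique {σ B q : ℕ} {m : Machine σ B q} {M : ℕ} {r : Request σ}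
    {c c₁ c₂ : Config B q} {o₁ o₂ : List Bool} {k₁ k₂ : ℕ} (h₁ : Exec m M r c o₁ k₁ c₁)
    (h₂ : Exec m M r c o₂ k₂ c₂) : o₁ = o₂ ∧ k₁ = k₂ ∧ c₁ = c₂ := by
  induction h₁ generalizing o₂ k₂ c₂ with
  | halt h hs =>
    cases h₂ <;> rename_i h' _ <;> simp_all
  | read h hs hr ih =>
    cases h₂ with
    | read h' hs' hr' =>
      rw [h] at h'
      simp only [Action.read.injEq] at h'
      obtain ⟨rfl, rfl⟩ := h'
      have := ih hr'
      simp_all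
    | halt h' => simp_all
    | write h' => simp_all
    | emit h' => simp_all
  | write h hs hr ih =>
    cases h₂ with
    | write h' hs' hr' =>
      rw [h] at h'
      simp only [Action.write.injEq] at h'
      obtain ⟨rfl, rfl, rfl⟩ := h'
      have := ih hr'
      simp_all
    | halt h' => simp_all
    | read h' => simp_all
    | emit h' => simp_all
  | emit h hb hs hr ih =>
    cases h₂ with
    | emit h' hb' hs' hr' =>
      rw [h] at h'
      simp only [Action.emit.injEq] at h'
      obtain ⟨rfl, rfl⟩ := h'
      have := ih hr'
      simp_all
    | halt h' => simp_all
    | write h' => simp_all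
    | read h' => simp_all

end BitmapIndex

/-! ### Tries of finite sets of strings, and uniquely decodable codes. -/

namespace BitmapIndex

/-! ### Sets of bit strings -/

abbrev Str := List Bool

/-- All prefixes of the strings in `Y`. -/
def pre (Y : Finset Str) : Finset Str := Y.biUnion (fun k => k.inits.toFinset)

@[simp] theorem mem_pre {Y : Finset Str} {p : Str} : p ∈ pre Y ↔ ∃ k ∈ Y, p <+: k := by
  simp [pre]

/-- The number of nodes of the binary trie of `Y`. -/
def trieSize (Y : Finset Str) : ℕ := (pre Y).card

/-- The number of bits, up to a constant factor, of a list of the strings in `Y`. -/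
def totalLen (Y : Finset Str) : ℕ := ∑ k ∈ Y, (k.length + 1)

theorem pre_mono {Y Z : Finset Str} (h : Y ⊆ Z) : pre Y ⊆ pre Z := by
  intro p hp
  simp only [mem_pre] at *
  obtain ⟨k, hk, hp⟩ := hp
  exact ⟨k, h hk, hp⟩

theorem trieSize_mono {Y Z : Finset Str} (h : Y ⊆ Z) : trieSize Y ≤ trieSize Z :=
  Finset.card_le_card (pre_mono h)

@[simp] theorem trieSize_empty : trieSize ∅ = 0 := by simp [trieSize, pre]

@[simp] theorem totalLen_empty : totalLen ∅ = 0 := by simp [totalLen]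

theorem trieSize_union_le (Y Z : Finset Str) : trieSize (Y ∪ Z) ≤ trieSize Y + trieSize Z := by
  have : pre (Y ∪ Z) ⊆ pre Y ∪ pre Z := by
    intro p hp
    simp only [mem_pre, Finset.mem_union] at *
    obtain ⟨k, hk | hk, hp⟩ := hp
    exacts [Or.inl ⟨k, hk, hp⟩, Or.inr ⟨k, hk, hp⟩]
  exact (Finset.card_le_card this).trans (Finset.card_union_le _ _)

theorem trieSize_le_totalLen (Y : Finset Str) : trieSize Y ≤ totalLen Y := by
  refine Finset.card_biUnion_le.trans (Finset.sum_le_sum fun k _ => ?_)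
  exact (List.toFinset_card_le _).trans (by simp)

theorem symmDiff_subset_union (Y Z : Finset Str) : symmDiff Y Z ⊆ Y ∪ Z :=
  symmDiff_le_sup (a := Y) (b := Z)

theorem trieSize_symmDiff_le (Y Z : Finset Str) :
    trieSize (symmDiff Y Z) ≤ trieSize Y + trieSize Z :=
  (trieSize_mono (symmDiff_subset_union Y Z)).trans (trieSize_union_le Y Z)

theorem trieSize_le_symmDiff (Y Z : Finset Str) :
    trieSize Y ≤ trieSize (symmDiff Y Z) + trieSize Z := by
  have h := trieSize_symmDiff_le (symmDiff Y Z) Z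
  rwa [symmDiff_symmDiff_cancel_right] at h

theorem totalLen_mono {Y Z : Finset Str} (h : Y ⊆ Z) : totalLen Y ≤ totalLen Z :=
  Finset.sum_le_sum_of_subset h

theorem totalLen_union_le (Y Z : Finset Str) : totalLen (Y ∪ Z) ≤ totalLen Y + totalLen Z := by
  have := Finset.sum_union_inter (s₁ := Y) (s₂ := Z) (f := fun k : Str => k.length + 1)
  unfold totalLen
  omega

theorem totalLen_symmDiff_le (Y Z : Finset Str) :
    totalLen (symmDiff Y Z) ≤ totalLen Y + totalLen Z :=
  (totalLen_mono (symmDiff_subset_union Y Z)).trans (totalLen_union_le Y Z)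

/-- The strings in `Y` that extend `a`, with `a` removed. -/
def strip (a : Str) (Y : Finset Str) : Finset Str :=
  (Y.filter (a <+: ·)).image (·.drop a.length)

@[simp] theorem mem_strip {a l : Str} {Y : Finset Str} : l ∈ strip a Y ↔ a ++ l ∈ Y := by
  simp only [strip, Finset.mem_image, Finset.mem_filter]
  constructor
  · rintro ⟨k, ⟨hk, t, rfl⟩, rfl⟩
    simpa using hk
  · intro h
    exact ⟨a ++ l, ⟨h, List.prefix_append _ _⟩, by simp⟩

@[simp] theorem strip_nil (Y : Finset Str) : strip [] Y = Y := by
  ext; simp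

theorem strip_symmDiff (a : Str) (Y Z : Finset Str) :
    strip a (symmDiff Y Z) = symmDiff (strip a Y) (strip a Z) := by
  ext; simp [Finset.mem_symmDiff]

theorem totalLen_strip_le (a : Str) (Y : Finset Str) : totalLen (strip a Y) ≤ totalLen Y := by
  have : totalLen (strip a Y) ≤ ∑ k ∈ (strip a Y).image (a ++ ·), (k.length + 1) := by
    rw [Finset.sum_image (fun x _ y _ h => List.append_cancel_left h)]
    exact Finset.sum_le_sum fun k _ => by simp
  refine this.trans (Finset.sum_le_sum_of_subset ?_)
  intro k hk
  simp only [Finset.mem_image, mem_strip] at hk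
  obtain ⟨l, hl, rfl⟩ := hk
  exact hl

/-- `pre (strip a Y)` is `strip a (pre Y)`. -/
theorem pre_strip (a : Str) (Y : Finset Str) : pre (strip a Y) = strip a (pre Y) := by
  ext p
  simp only [mem_pre, mem_strip]
  constructor
  · rintro ⟨k, hk, hp⟩
    exact ⟨a ++ k, hk, (List.prefix_append_right_inj a).2 hp⟩
  · rintro ⟨k, hk, t, ht⟩
    refine ⟨p ++ t, ?_, List.prefix_append _ _⟩
    rw [← List.append_assoc, ht]; exact hk

theorem trieSize_strip_le (a : Str) (Y : Finset Str) : trieSize (strip a Y) ≤ trieSize Y := by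
  rw [trieSize, pre_strip, strip]
  exact Finset.card_image_le.trans (Finset.card_filter_le _ _)

theorem card_strip (a : Str) (Y : Finset Str) :
    (strip a Y).card = (Y.filter (a <+: ·)).card := by
  rw [strip, Finset.card_image_of_injOn]
  intro x hx y hy h
  simp only [Finset.coe_filter, Set.mem_ofPred_eq] at hx hy
  obtain ⟨_, t, rfl⟩ := hx
  obtain ⟨_, u, rfl⟩ := hy
  simpa using h

/-- The root and the two subtries: the recursion on which `trieCode` is based. -/
theorem trieSize_eq {Y : Finset Str} (h : Y.Nonempty) :
    trieSize Y = 1 + trieSize (strip [false] Y) + trieSize (strip [true] Y) := by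
  have e : ∀ b, trieSize (strip [b] Y) = ((pre Y).filter ([b] <+: ·)).card := fun b => by
    rw [trieSize, pre_strip, card_strip]
  rw [e, e, trieSize]
  have hsplit : pre Y = {[]} ∪ ((pre Y).filter ([false] <+: ·) ∪ (pre Y).filter ([true] <+: ·)) := by
    ext p
    simp only [Finset.mem_union, Finset.mem_singleton, Finset.mem_filter]
    constructor
    · intro hp
      match p with
      | [] => exact Or.inl rfl
      | false :: p => exact Or.inr (Or.inl ⟨hp, p, rfl⟩)
      | true :: p => exact Or.inr (Or.inr ⟨hp, p, rfl⟩)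
    · rintro (rfl | h | h)
      · obtain ⟨k, hk⟩ := h
        exact mem_pre.2 ⟨k, hk, List.nil_prefix⟩
      exacts [h.1, h.1]
  conv_lhs => rw [hsplit]
  rw [Finset.card_union_of_disjoint, Finset.card_union_of_disjoint]
  · rw [Finset.card_singleton, Nat.add_assoc]
  · rw [Finset.disjoint_filter]
    rintro p _ ⟨t, rfl⟩ ⟨u, hu⟩
    simp at hu
  · simp

theorem trieSize_strip_lt {Y : Finset Str} (h : Y.Nonempty) (b : Bool) :
    trieSize (strip [b] Y) < trieSize Y := by
  have := trieSize_eq h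
  cases b <;> omega

/-! ### Codes -/

/-- Uniquely decodable from the left. -/
def PrefixInj {α : Type*} (c : α → Str) : Prop :=
  ∀ a b l l', c a ++ l = c b ++ l' → a = b ∧ l = l'

theorem PrefixInj.injective {α : Type*} {c : α → Str} (h : PrefixInj c) :
    Function.Injective c := fun a b e => (h a b [] [] (by simp [e])).1

/-- The code of a set of strings that describes its trie. -/
def trieCode (Y : Finset Str) : Str :=
  if _h : Y.Nonempty then
    true :: decide ([] ∈ Y) :: (trieCode (strip [false] Y) ++ trieCode (strip [true] Y))
  else [false]
termination_by trieSize Y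
decreasing_by all_goals exact trieSize_strip_lt _h _

theorem trieCode_empty : trieCode ∅ = [false] := by
  rw [trieCode]; simp

theorem trieCode_of_nonempty {Y : Finset Str} (h : Y.Nonempty) : trieCode Y =
    true :: decide ([] ∈ Y) :: (trieCode (strip [false] Y) ++ trieCode (strip [true] Y)) := by
  rw [trieCode]; simp [h]

/-- A binary tree with t nodes has t + 1 empty subtrees. A node costs two bits and an empty subtree
one. -/
theorem length_trieCode (Y : Finset Str) : (trieCode Y).length = 3 * trieSize Y + 1 := by
  induction hn : trieSize Y using Nat.strong_induction_on generalizing Y with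
  | _ n ih =>
    subst hn
    rcases Y.eq_empty_or_nonempty with rfl | h
    · simp [trieCode_empty]
    · have := trieSize_eq h
      simp only [trieCode_of_nonempty h, List.length_cons, List.length_append,
        ih _ (trieSize_strip_lt h _) _ rfl]
      omega

theorem prefixInj_trieCode : PrefixInj trieCode := by
  intro Y
  induction hn : trieSize Y using Nat.strong_induction_on generalizing Y with
  | _ n ih =>
    subst hn
    intro Z l l' e
    rcases Y.eq_empty_or_nonempty with rfl | h <;> rcases Z.eq_empty_or_nonempty with rfl | h'
    · simpa [trieCode_empty] using e
    · simp [trieCode_empty, trieCode_of_nonempty h'] at e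
    · simp [trieCode_empty, trieCode_of_nonempty h] at e
    · simp only [trieCode_of_nonempty h, trieCode_of_nonempty h', List.cons_append,
        List.append_assoc, List.cons.injEq, true_and, decide_eq_decide] at e
      obtain ⟨e0, e⟩ := e
      obtain ⟨e1, e⟩ := ih _ (trieSize_strip_lt h _) _ rfl _ _ _ e
      obtain ⟨e2, e⟩ := ih _ (trieSize_strip_lt h _) _ rfl _ _ _ e
      refine ⟨?_, e⟩
      ext p
      match p with
      | [] => exact e0
      | false :: p => simpa using Finset.ext_iff.1 e1 p
      | true :: p => simpa using Finset.ext_iff.1 e2 p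

/-- A code of natural numbers. -/
def natCode (n : ℕ) : Str :=
  List.replicate n.size true ++ false :: n.bits

theorem length_natCode (n : ℕ) : (natCode n).length = 2 * n.size + 1 := by
  simp [natCode, Nat.size_eq_bits_len]; omega

theorem replicate_append_inj {a b : ℕ} {l l' : Str}
    (h : List.replicate a true ++ false :: l = List.replicate b true ++ false :: l') :
    a = b ∧ l = l' := by
  induction a generalizing b with
  | zero => cases b <;> simp_all [List.replicate_succ]
  | succ a ih =>
    cases b with
    | zero => simp [List.replicate_succ] at h
    | succ b =>
      simp only [List.replicate_succ, List.cons_append, List.cons.injEq, true_and] at h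
      have := ih h
      exact ⟨by omega, this.2⟩

theorem nat_bits_injective : Function.Injective Nat.bits := by
  intro a b h
  have key : ∀ n : ℕ, n.bits.foldr Nat.bit 0 = n := by
    intro n
    induction n using Nat.binaryRec' with
    | zero => simp
    | bit b n hn ih => rw [Nat.bits_append_bit _ _ hn]; simp [ih]
  rw [← key a, h, key]

theorem prefixInj_natCode : PrefixInj natCode := by
  intro a b l l' h
  simp only [natCode, List.append_assoc, List.cons_append] at h
  obtain ⟨h1, h2⟩ := replicate_append_inj h
  have := List.append_inj h2 (by simpa [Nat.size_eq_bits_len] using h1)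
  exact ⟨nat_bits_injective this.1, this.2⟩

/-- A code of strings. -/
def strCode (s : Str) : Str := natCode s.length ++ s

theorem prefixInj_strCode : PrefixInj strCode := by
  intro a b l l' h
  simp only [strCode, List.append_assoc] at h
  obtain ⟨h1, h2⟩ := prefixInj_natCode _ _ _ _ h
  exact List.append_inj h2 h1

theorem nat_size_le_self (n : ℕ) : n.size ≤ n := Nat.size_le.2 Nat.lt_two_pow_self

theorem length_strCode_le (s : Str) : (strCode s).length ≤ 3 * s.length + 1 := by
  have := nat_size_le_self s.length
  simp only [strCode, List.length_append, length_natCode]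
  omega

theorem PrefixInj.pair {α β : Type*} {c : α → Str} {e : β → Str} (hc : PrefixInj c)
    (he : PrefixInj e) : PrefixInj (fun x : α × β => c x.1 ++ e x.2) := by
  rintro ⟨a, b⟩ ⟨a', b'⟩ l l' h
  simp only [List.append_assoc] at h
  obtain ⟨rfl, h1⟩ := hc _ _ _ _ h
  obtain ⟨rfl, h2⟩ := he _ _ _ _ h1
  exact ⟨rfl, h2⟩

/-- A code of lists. -/
def listCode {α : Type*} (c : α → Str) : List α → Str
  | [] => [false]
  | a :: l => true :: (c a ++ listCode c l)

theorem PrefixInj.listCode {α : Type*} {c : α → Str} (hc : PrefixInj c) :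
    PrefixInj (listCode c) := by
  intro a
  induction a with
  | nil => rintro (_ | ⟨b, m⟩) l l' h <;> simp_all [BitmapIndex.listCode]
  | cons a m ih =>
    rintro (_ | ⟨b, m'⟩) l l' h
    · simp [BitmapIndex.listCode] at h
    · simp only [BitmapIndex.listCode, List.cons_append, List.append_assoc, List.cons.injEq,
        true_and] at h
      obtain ⟨rfl, h1⟩ := hc _ _ _ _ h
      obtain ⟨rfl, h2⟩ := ih _ _ _ h1
      exact ⟨rfl, h2⟩

theorem length_listCode_le {α : Type*} (c : α → Str) (l : List α) (K : ℕ)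
    (h : ∀ a ∈ l, (c a).length ≤ K) : (listCode c l).length ≤ l.length * (K + 1) + 1 := by
  induction l with
  | nil => simp [listCode]
  | cons a l ih =>
    have h1 := ih fun x hx => h x (List.mem_cons_of_mem _ hx)
    have h2 := h a (by simp)
    simp only [listCode, List.length_cons, List.length_append, Nat.add_mul]
    omega

/-- A code of finite sets. -/
def finsetCode {α : Type*} (c : α → Str) (s : Finset α) : Str := listCode c s.toList

theorem PrefixInj.finsetCode {α : Type*} [DecidableEq α] {c : α → Str} (hc : PrefixInj c) :
    PrefixInj (finsetCode c) := by
  intro a b l l' h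
  obtain ⟨h1, h2⟩ := hc.listCode _ _ _ _ h
  refine ⟨?_, h2⟩
  rw [← Finset.toList_toFinset a, h1, Finset.toList_toFinset]

theorem length_finsetCode_le {α : Type*} (c : α → Str) (s : Finset α) (K : ℕ)
    (h : ∀ a ∈ s, (c a).length ≤ K) : (finsetCode c s).length ≤ s.card * (K + 1) + 1 := by
  have := length_listCode_le c s.toList K (by simpa using h)
  simpa [finsetCode] using this

end BitmapIndex

/-! ### Partition of the strings into cells. -/

namespace BitmapIndex

/-! ### Cells

A finite set `Q` of strings ("cells"), with `[] ∈ Q`, partitions the set of all strings: a string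
belongs to the longest cell that is a prefix of it. -/

/-- The longest prefix of `k` in `Q`. -/
def own (Q : Finset Str) (k : Str) : Str :=
  k.take (Nat.findGreatest (fun m => k.take m ∈ Q) k.length)

/-- The cell above the cell `c ≠ []`. -/
def par (Q : Finset Str) (c : Str) : Str := own Q c.dropLast

/-- The cells below the cell `v`. -/
def kids (Q : Finset Str) (v : Str) : Finset Str := Q.filter (fun c => c ≠ [] ∧ par Q c = v)

/-- The part of `R` that belongs to the cell `v`. -/
def reg (Q R : Finset Str) (v : Str) : Finset Str := R.filter (fun k => own Q k = v)

theorem prefix_antisymm {a b : Str} (h : a <+: b) (h' : b <+: a) : a = b :=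
  h.eq_of_length (le_antisymm h.length_le h'.length_le)

theorem prefix_comparable {a b k : Str} (h : a <+: k) (h' : b <+: k) : a <+: b ∨ b <+: a :=
  List.prefix_or_prefix_of_prefix h h'

theorem prefix_dropLast {a c : Str} (h : a <+: c) (hne : a ≠ c) : a <+: c.dropLast := by
  refine List.prefix_of_prefix_length_le h (List.dropLast_prefix c) ?_
  have h1 := h.length_le
  have h2 : a.length ≠ c.length := fun e => hne (h.eq_of_length e)
  simp; omega

theorem dropLast_ne {c : Str} (h : c ≠ []) : ¬ c <+: c.dropLast := by
  intro h'
  have := h'.length_le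
  have := List.length_pos_iff.2 h
  simp at *; omega

variable {Q R : Finset Str} {τ : ℕ}

section

variable (hQ : [] ∈ Q)

include hQ in
theorem own_mem (k : Str) : own Q k ∈ Q :=
  Nat.findGreatest_spec (P := fun m => k.take m ∈ Q) (Nat.zero_le k.length) (by simpa using hQ)

theorem own_prefix (Q : Finset Str) (k : Str) : own Q k <+: k := List.take_prefix _ _

theorem prefix_own {q k : Str} (hq : q ∈ Q) (h : q <+: k) : q <+: own Q k := by
  have e : k.take q.length = q := (List.prefix_iff_eq_take.1 h).symm
  have : q.length ≤ Nat.findGreatest (fun m => k.take m ∈ Q) k.length :=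
    Nat.le_findGreatest h.length_le (by rw [e]; exact hq)
  rw [own, ← e]
  exact List.prefix_of_prefix_length_le (List.take_prefix _ _) (List.take_prefix _ _)
    (by simp only [List.length_take]; omega)

/-- The prefixes of a string form a chain, so the cell of a string is determined by maximality. The
changes of the partition below are computed through this characterization. -/
theorem own_eq {v k : Str} (hv : v ∈ Q) (h : v <+: k) (hmax : ∀ q ∈ Q, q <+: k → q <+: v) :
    own Q k = v :=
  prefix_antisymm (hmax _ (own_mem_of hv h) (own_prefix Q k)) (prefix_own hv h)
where
  own_mem_of {Q : Finset Str} {v k : Str} (hv : v ∈ Q) (h : v <+: k) : own Q k ∈ Q := by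
    have e : k.take v.length = v := (List.prefix_iff_eq_take.1 h).symm
    exact Nat.findGreatest_spec (P := fun m => k.take m ∈ Q) h.length_le (by simpa [e] using hv)

theorem own_self {v : Str} (hv : v ∈ Q) : own Q v = v :=
  own_eq hv (List.prefix_refl v) fun _ _ h => h

/-- A string between `own Q k` and `k` has the same cell as `k`. -/
theorem own_between {k p : Str} (h1 : own Q k <+: p) (h2 : p <+: k) (hQ : [] ∈ Q) :
    own Q p = own Q k :=
  own_eq (own_mem hQ k) h1 fun _ hq h => prefix_own hq (h.trans h2)

include hQ in
theorem par_mem (c : Str) : par Q c ∈ Q := own_mem hQ _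

theorem par_prefix (Q : Finset Str) (c : Str) : par Q c <+: c :=
  (own_prefix Q _).trans (List.dropLast_prefix c)

theorem par_ne {c : Str} (h : c ≠ []) : par Q c ≠ c := fun e => by
  have := own_prefix Q c.dropLast
  rw [← par, e] at this
  exact dropLast_ne h this

theorem prefix_par {q c : Str} (hq : q ∈ Q) (h : q <+: c) (hne : q ≠ c) : q <+: par Q c :=
  prefix_own hq (prefix_dropLast h hne)

theorem par_length_lt {c : Str} (h : c ≠ []) : (par Q c).length < c.length :=
  lt_of_le_of_ne (par_prefix Q c).length_le fun e => par_ne h ((par_prefix Q c).eq_of_length e)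

theorem mem_kids {v c : Str} : c ∈ kids Q v ↔ c ∈ Q ∧ c ≠ [] ∧ par Q c = v := by
  simp [kids]

theorem mem_reg {v k : Str} : k ∈ reg Q R v ↔ k ∈ R ∧ own Q k = v := by
  simp [reg]

theorem prefix_of_mem_kids {v c : Str} (h : c ∈ kids Q v) : v <+: c := by
  obtain ⟨_, _, rfl⟩ := mem_kids.1 h
  exact par_prefix Q c

theorem ne_of_mem_kids {v c : Str} (h : c ∈ kids Q v) : c ≠ v := by
  obtain ⟨_, h0, rfl⟩ := mem_kids.1 h
  exact (par_ne h0).symm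

theorem prefix_of_mem_reg {v k : Str} (h : k ∈ reg Q R v) : v <+: k := by
  obtain ⟨_, rfl⟩ := mem_reg.1 h
  exact own_prefix Q k

/-- Climbing from `q` along `par`, the lengths decrease while `v` remains a prefix; the last cell
before `v` is the one wanted. -/
theorem exists_kid {v q : Str} (hv : v ∈ Q) (hq : q ∈ Q) (h : v <+: q) (hne : v ≠ q) :
    ∃ c ∈ kids Q v, c <+: q := by
  induction hn : q.length using Nat.strong_induction_on generalizing q with
  | _ n ih =>
    subst hn
    have hq0 : q ≠ [] := by
      rintro rfl
      exact hne (List.prefix_nil.1 h)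
    by_cases hp : par Q q = v
    · exact ⟨q, mem_kids.2 ⟨hq, hq0, hp⟩, List.prefix_refl q⟩
    · have hpm : par Q q ∈ Q := par_mem_of hv h hne
      obtain ⟨c, hc, hcq⟩ := ih _ (par_length_lt hq0) hpm (prefix_par hv h hne) (Ne.symm hp) rfl
      exact ⟨c, hc, hcq.trans (par_prefix Q q)⟩
where
  par_mem_of {Q : Finset Str} {v q : Str} (hv : v ∈ Q) (h : v <+: q) (hne : v ≠ q) :
      par Q q ∈ Q := own_eq.own_mem_of hv (prefix_dropLast h hne)

/-! ### Inserting and erasing a cell -/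

include hQ in
-- A new cell takes over exactly those of its extensions whose former cell is a prefix of it; any
-- longer cell keeps its strings.
theorem own_insert (h k : Str) :
    own (insert h Q) k = if h <+: k ∧ own Q k <+: h then h else own Q k := by
  split_ifs with hc
  · refine own_eq (Finset.mem_insert_self _ _) hc.1 fun q hq hqk => ?_
    rcases Finset.mem_insert.1 hq with rfl | hq
    · exact List.prefix_refl q
    · exact (prefix_own hq hqk).trans hc.2
  · refine own_eq (Finset.mem_insert_of_mem (own_mem hQ k)) (own_prefix Q k) fun q hq hqk => ?_
    rcases Finset.mem_insert.1 hq with rfl | hq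
    · rcases prefix_comparable hqk (own_prefix Q k) with h1 | h1
      · exact h1
      · exact absurd ⟨hqk, h1⟩ hc
    · exact prefix_own hq hqk

include hQ in
theorem own_erase {d : Str} (hd0 : d ≠ []) (k : Str) :
    own (Q.erase d) k = if own Q k = d then par Q d else own Q k := by
  split_ifs with hc
  · refine own_eq (Finset.mem_erase.2 ⟨par_ne hd0, par_mem hQ d⟩)
      ((par_prefix Q d).trans (hc ▸ own_prefix Q k)) fun q hq hqk => ?_
    obtain ⟨hne, hq⟩ := Finset.mem_erase.1 hq
    have := prefix_own hq hqk
    rw [hc] at this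
    exact prefix_par hq this hne
  · exact own_eq (Finset.mem_erase.2 ⟨hc, own_mem hQ k⟩) (own_prefix Q k) fun q hq hqk =>
      prefix_own (Finset.mem_of_mem_erase hq) hqk

include hQ in
-- For an extension `k` of `h`, a cell of `k` that is a prefix of `h` must be the cell of `h`. So
-- the insertion concerns a single old cell.
theorem own_insert' {v h k : Str} (hv : own Q h = v) :
    own (insert h Q) k = if h <+: k ∧ own Q k = v then h else own Q k := by
  rw [own_insert hQ]
  congr 1
  refine propext (and_congr_right fun hk => ⟨fun h1 => ?_, fun h1 => ?_⟩)
  · have h2 := prefix_own (own_mem hQ k) h1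
    rw [hv] at h2
    refine prefix_antisymm h2 (prefix_own (hv ▸ own_mem hQ h) ?_)
    exact (hv ▸ own_prefix Q h).trans hk
  · rw [h1, ← hv]; exact own_prefix Q h

include hQ in
theorem par_insert {v h c : Str} (hv : own Q h = v) (hh : h ∉ Q) (hc : c ∈ Q) :
    par (insert h Q) c = if h <+: c ∧ par Q c = v then h else par Q c := by
  rw [par, own_insert' hQ hv]
  congr 1
  refine propext (and_congr_left fun _ => ⟨fun h1 => h1.trans (List.dropLast_prefix c), fun h1 => ?_⟩)
  exact prefix_dropLast h1 (fun e => hh (e ▸ hc))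

include hQ in
theorem par_insert_self {v h : Str} (hv : own Q h = v) (hh : h ∉ Q) :
    par (insert h Q) h = v := by
  have h0 : h ≠ [] := fun e => hh (e ▸ hQ)
  have hvQ : v ∈ Q := hv ▸ own_mem hQ h
  have hvh : v <+: h := hv ▸ own_prefix Q h
  rw [par, own_insert' hQ hv, if_neg (fun h1 => dropLast_ne h0 h1.1)]
  refine own_eq hvQ (prefix_dropLast hvh (fun e => hh (e ▸ hvQ))) fun q hq hqk => ?_
  exact hv ▸ prefix_own hq (hqk.trans (List.dropLast_prefix h))

include hQ in
theorem par_erase {d c : Str} (hd0 : d ≠ []) :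
    par (Q.erase d) c = if par Q c = d then par Q d else par Q c := own_erase hQ hd0 _

section InsertErase

variable {v h d : Str}

include hQ in
-- Keys and kids of `v` are divided by whether they extend `h`, and no other cell notices. This
-- locality makes a cut a matter of O(1) records.
theorem reg_insert_self (hv : own Q h = v) (hh : h ∉ Q) :
    reg (insert h Q) R h = (reg Q R v).filter (h <+: ·) := by
  ext k
  simp only [mem_reg, own_insert' hQ hv, Finset.mem_filter]
  by_cases hk : h <+: k ∧ own Q k = v
  · simp [hk]
  · rw [if_neg hk]
    constructor
    · rintro ⟨_, rfl⟩; exact absurd (own_mem hQ k) hh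
    · rintro ⟨⟨_, h1⟩, h2⟩; exact absurd ⟨h2, h1⟩ hk

include hQ in
theorem reg_insert_own (hv : own Q h = v) (hh : h ∉ Q) :
    reg (insert h Q) R v = (reg Q R v).filter (fun k => ¬ h <+: k) := by
  ext k
  simp only [mem_reg, own_insert' hQ hv, Finset.mem_filter]
  have hne : h ≠ v := fun e => hh (e ▸ hv ▸ own_mem hQ h)
  by_cases hk : h <+: k ∧ own Q k = v
  · simp [hk, hne]
  · rw [if_neg hk]; tauto

include hQ in
theorem reg_insert_of_ne (hv : own Q h = v) {u : Str} (hu : u ≠ v) (hu' : u ≠ h) :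
    reg (insert h Q) R u = reg Q R u := by
  ext k
  simp only [mem_reg, own_insert' hQ hv]
  split_ifs with hk
  · simp [hu'.symm, hk.2, hu.symm]
  · rfl

include hQ in
theorem kids_insert_self (hv : own Q h = v) (hh : h ∉ Q) :
    kids (insert h Q) h = (kids Q v).filter (h <+: ·) := by
  ext c
  simp only [mem_kids, Finset.mem_insert, Finset.mem_filter]
  by_cases hc : c ∈ Q
  · rw [par_insert hQ hv hh hc]
    have : par Q c ≠ h := fun e => hh (e ▸ par_mem hQ c)
    split_ifs with h1 <;> tauto
  · have : par (insert h Q) h ≠ h := by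
      rw [par_insert_self hQ hv hh]; exact fun e => hh (e ▸ hv ▸ own_mem hQ h)
    constructor
    · rintro ⟨rfl | h1, _, h2⟩
      exacts [absurd h2 this, absurd h1 hc]
    · rintro ⟨⟨h1, _⟩, _⟩; exact absurd h1 hc

include hQ in
theorem kids_insert_own (hv : own Q h = v) (hh : h ∉ Q) :
    kids (insert h Q) v = insert h ((kids Q v).filter (fun c => ¬ h <+: c)) := by
  ext c
  have hne : h ≠ v := fun e => hh (e ▸ hv ▸ own_mem hQ h)
  simp only [mem_kids, Finset.mem_insert, Finset.mem_filter]
  by_cases hc : c ∈ Q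
  · rw [par_insert hQ hv hh hc]
    have : c ≠ h := fun e => hh (e ▸ hc)
    split_ifs with h1 <;> tauto
  · constructor
    · rintro ⟨rfl | h1, _, h2⟩
      exacts [Or.inl rfl, absurd h1 hc]
    · rintro (rfl | ⟨⟨h1, _⟩, _⟩)
      · exact ⟨Or.inl rfl, fun e => hh (e ▸ hQ), par_insert_self hQ hv hh⟩
      · exact absurd h1 hc

include hQ in
theorem kids_insert_of_ne (hv : own Q h = v) (hh : h ∉ Q) {u : Str} (hu : u ≠ v) (hu' : u ≠ h) :
    kids (insert h Q) u = kids Q u := by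
  ext c
  simp only [mem_kids, Finset.mem_insert]
  by_cases hc : c ∈ Q
  · rw [par_insert hQ hv hh hc]
    split_ifs with h1
    · simp [hu'.symm, h1.2, hu.symm]
    · simp [hc]
  · constructor
    · rintro ⟨rfl | h1, _, h2⟩
      · rw [par_insert_self hQ hv hh] at h2; exact absurd h2.symm hu
      · exact absurd h1 hc
    · rintro ⟨h1, _⟩; exact absurd h1 hc

include hQ in
-- Erasing a cell is local as well: its keys and its kids go to the cell above.
theorem reg_erase_par (hd : d ∈ kids Q v) : reg (Q.erase d) R v = reg Q R v ∪ reg Q R d := by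
  obtain ⟨hd, hd0, hv⟩ := mem_kids.1 hd
  ext k
  simp only [mem_reg, own_erase hQ hd0, Finset.mem_union, hv]
  split_ifs with h1
  · simp only [h1, and_true, iff_or_self]
    exact fun h => h.1
  · tauto

include hQ in
theorem reg_erase_of_ne (hd : d ∈ kids Q v) {u : Str} (hu : u ≠ v) (hu' : u ≠ d) :
    reg (Q.erase d) R u = reg Q R u := by
  obtain ⟨hd, hd0, hv⟩ := mem_kids.1 hd
  ext k
  simp only [mem_reg, own_erase hQ hd0, hv]
  split_ifs with h1
  · simp [h1, hu.symm, hu'.symm]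
  · rfl

include hQ in
theorem kids_erase_par (hd : d ∈ kids Q v) :
    kids (Q.erase d) v = (kids Q v).erase d ∪ kids Q d := by
  obtain ⟨hdQ, hd0, hv⟩ := mem_kids.1 hd
  ext c
  simp only [mem_kids, par_erase hQ hd0, Finset.mem_union, Finset.mem_erase, hv]
  have : par Q d ≠ d := par_ne hd0
  split_ifs with h1
  · constructor
    · rintro ⟨⟨_, h2⟩, h3, _⟩; exact Or.inr ⟨h2, h3, h1⟩
    · rintro (⟨h3, h2, h4, _⟩ | ⟨h2, h3, _⟩)
      · exact ⟨⟨h3, h2⟩, h4, rfl⟩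
      · exact ⟨⟨fun e => this (e ▸ h1), h2⟩, h3, rfl⟩
  · tauto

include hQ in
theorem kids_erase_of_ne (hd : d ∈ kids Q v) {u : Str} (hu : u ≠ v) (hu' : u ≠ d) :
    kids (Q.erase d) u = kids Q u := by
  obtain ⟨hdQ, hd0, hv⟩ := mem_kids.1 hd
  ext c
  simp only [mem_kids, par_erase hQ hd0, Finset.mem_erase, hv]
  split_ifs with h1
  · simp [h1, hu.symm, hu'.symm]
  · constructor
    · rintro ⟨⟨_, h2⟩, h3, h4⟩; exact ⟨h2, h3, h4⟩
    · rintro ⟨h2, h3, h4⟩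
      refine ⟨⟨?_, h2⟩, h3, h4⟩
      rintro rfl
      exact hu (h4.symm.trans hv)

end InsertErase

/-! ### Weights -/

/-- The weight of the cell `v`. -/
def wt (τ : ℕ) (Q R : Finset Str) (v : Str) : ℕ := trieSize (reg Q R v) + τ * (kids Q v).card

/-- The weight of the part of the cell `v` that extends `h`. -/
def wtIn (τ : ℕ) (Q R : Finset Str) (v h : Str) : ℕ :=
  trieSize ((reg Q R v).filter (h <+: ·)) + τ * ((kids Q v).filter (h <+: ·)).card

theorem wtIn_self (v : Str) : wtIn τ Q R v v = wt τ Q R v := by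
  rw [wtIn, wt, Finset.filter_true_of_mem fun k hk => prefix_of_mem_reg hk,
    Finset.filter_true_of_mem fun c hc => prefix_of_mem_kids hc]

/-- Below a kid of `v` there is nothing but that kid. -/
theorem wtIn_le_of_kid {v h c : Str} (hc : c ∈ kids Q v) (hch : c <+: h) :
    wtIn τ Q R v h ≤ τ := by
  have hvc := prefix_of_mem_kids hc
  have hcQ := (mem_kids.1 hc).1
  have e1 : (reg Q R v).filter (h <+: ·) = ∅ := by
    refine Finset.filter_false_of_mem fun k hk hhk => ?_
    have h1 := prefix_own hcQ (hch.trans hhk)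
    rw [(mem_reg.1 hk).2] at h1
    exact ne_of_mem_kids hc (prefix_antisymm h1 hvc)
  have e2 : (kids Q v).filter (h <+: ·) ⊆ {c} := by
    intro c' hc'
    obtain ⟨hc', hh⟩ := Finset.mem_filter.1 hc'
    rw [Finset.mem_singleton]
    by_contra hne
    have h1 := prefix_par hcQ (hch.trans hh) (Ne.symm hne)
    rw [(mem_kids.1 hc').2.2] at h1
    exact ne_of_mem_kids hc (prefix_antisymm h1 hvc)
  rw [wtIn, e1]
  have := Finset.card_le_card e2
  simp only [Finset.card_singleton] at this
  simp only [trieSize_empty, zero_add]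
  nlinarith

theorem prefix_cons_of_prefix {h k : Str} (hk : h <+: k) (hne : k ≠ h) :
    ∃ b : Bool, h ++ [b] <+: k := by
  obtain ⟨t, rfl⟩ := hk
  match t with
  | [] => simp at hne
  | b :: t => exact ⟨b, t, by simp⟩

/-- Whatever lies below `h` and is not `h` continues with one of two bits. The key `h` itself, if
present, has at most `E` prefixes. -/
theorem wtIn_le {E : ℕ} (hR : ∀ k ∈ R, k.length + 1 ≤ E) {v h : Str} (hh : h ∉ kids Q v) :
    wtIn τ Q R v h ≤ E + wtIn τ Q R v (h ++ [false]) + wtIn τ Q R v (h ++ [true]) := by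
  have h1 : (reg Q R v).filter (h <+: ·) ⊆
      (R.filter (· = h)) ∪ ((reg Q R v).filter (h ++ [false] <+: ·)
        ∪ (reg Q R v).filter (h ++ [true] <+: ·)) := by
    intro k hk
    obtain ⟨hk, hp⟩ := Finset.mem_filter.1 hk
    simp only [Finset.mem_union, Finset.mem_filter]
    by_cases e : k = h
    · exact Or.inl ⟨(mem_reg.1 hk).1, e⟩
    · obtain ⟨b, hb⟩ := prefix_cons_of_prefix hp e
      cases b
      exacts [Or.inr (Or.inl ⟨hk, hb⟩), Or.inr (Or.inr ⟨hk, hb⟩)]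
  have h2 : (kids Q v).filter (h <+: ·) ⊆ (kids Q v).filter (h ++ [false] <+: ·)
        ∪ (kids Q v).filter (h ++ [true] <+: ·) := by
    intro k hk
    obtain ⟨hk, hp⟩ := Finset.mem_filter.1 hk
    simp only [Finset.mem_union, Finset.mem_filter]
    have e : k ≠ h := fun e => hh (e ▸ hk)
    obtain ⟨b, hb⟩ := prefix_cons_of_prefix hp e
    cases b
    exacts [Or.inl ⟨hk, hb⟩, Or.inr ⟨hk, hb⟩]
  have h3 : trieSize (R.filter (· = h)) ≤ E := by
    by_cases hm : h ∈ R
    · refine (trieSize_le_totalLen _).trans ?_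
      rw [Finset.filter_eq' R h, if_pos hm]
      simpa [totalLen] using hR h hm
    · rw [Finset.filter_eq' R h, if_neg hm]; simp
  have h4 := (trieSize_mono h1).trans (trieSize_union_le _ _)
  have h5 := trieSize_union_le ((reg Q R v).filter (h ++ [false] <+: ·))
    ((reg Q R v).filter (h ++ [true] <+: ·))
  have h6 := (Finset.card_le_card h2).trans (Finset.card_union_le _ _)
  have h7 := Nat.mul_le_mul_left τ h6
  rw [Nat.mul_add] at h7
  unfold wtIn
  exact (Nat.add_le_add (h4.trans (Nat.add_le_add h3 h5)) h7).trans (le_of_eq (by ring))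

/-- A heavy cell contains a string below which there is a given fraction of its weight. -/
theorem exists_cut {E θ : ℕ} (hR : ∀ k ∈ R, k.length + 1 ≤ E) {v : Str} (hv : v ∈ Q)
    (hw : θ < wt τ Q R v) (hθ : 2 * τ + E ≤ θ) :
    ∃ h, h ∉ Q ∧ own Q h = v ∧ wtIn τ Q R v h ≤ θ ∧ θ ≤ 2 * wtIn τ Q R v h + E := by
  -- The candidates are the prefixes below `v` with more than the weight `θ`. Apart from `v` they
  -- are prefixes of keys or kids, so there are finitely many, and a longest one has two light
  -- extensions by one bit.
  let A := (pre (reg Q R v ∪ kids Q v) ∪ {v}).filter (fun h => v <+: h ∧ θ < wtIn τ Q R v h)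
  have hA : A.Nonempty := ⟨v, by simp [A, wtIn_self, hw]⟩
  obtain ⟨h0, h0A, hmax⟩ := A.exists_max_image List.length hA
  obtain ⟨_, hv0, hw0⟩ := Finset.mem_filter.1 h0A
  have hsmall : ∀ b : Bool, wtIn τ Q R v (h0 ++ [b]) ≤ θ := by
    intro b
    by_contra hlt
    rw [not_le] at hlt
    have hmem : h0 ++ [b] ∈ pre (reg Q R v ∪ kids Q v) := by
      by_contra hno
      have e1 : (reg Q R v).filter (h0 ++ [b] <+: ·) = ∅ :=
        Finset.filter_false_of_mem fun k hk hp =>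
          hno (mem_pre.2 ⟨k, Finset.mem_union_left _ hk, hp⟩)
      have e2 : (kids Q v).filter (h0 ++ [b] <+: ·) = ∅ :=
        Finset.filter_false_of_mem fun k hk hp =>
          hno (mem_pre.2 ⟨k, Finset.mem_union_right _ hk, hp⟩)
      rw [wtIn, e1, e2] at hlt
      simp at hlt
    have := hmax (h0 ++ [b]) (Finset.mem_filter.2
      ⟨Finset.mem_union_left _ hmem, hv0.trans (List.prefix_append _ _), hlt⟩)
    simp at this
  -- A kid accounts for at most `τ`, so `h0` is too heavy to be one, and its weight is shared by its
  -- two extensions.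
  have hnk : h0 ∉ kids Q v := fun hk => by
    have := wtIn_le_of_kid (τ := τ) (R := R) hk (List.prefix_refl h0)
    omega
  have hsum := wtIn_le (τ := τ) hR hnk
  obtain ⟨b, hb⟩ : ∃ b : Bool, θ < 2 * wtIn τ Q R v (h0 ++ [b]) + E := by
    by_contra hno
    have h1 := fun b => not_lt.1 (not_exists.1 hno b)
    have h2 := h1 false
    have h3 := h1 true
    omega
  have hvh : v <+: h0 ++ [b] := hv0.trans (List.prefix_append _ _)
  -- The heavier extension weighs more than `τ`, by the hypothesis on `θ`; hence it is not below any
  -- kid of `v`.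
  have hown : own Q (h0 ++ [b]) = v := by
    refine own_eq hv hvh fun q hq hqh => ?_
    rcases prefix_comparable hqh hvh with h1 | h1
    · exact h1
    · by_cases e : v = q
      · exact e ▸ List.prefix_refl _
      · obtain ⟨c, hc, hcq⟩ := exists_kid hv hq h1 e
        have := wtIn_le_of_kid (τ := τ) (R := R) hc (hcq.trans hqh)
        omega
  refine ⟨h0 ++ [b], fun hmem => ?_, hown, hsmall b, hb.le⟩
  rw [own_self hmem] at hown
  have := hv0.length_le
  rw [← hown] at this
  simp at this

/-- The cells that strictly extend `a`. -/
def below (Q : Finset Str) (a : Str) : Finset Str := Q.filter (fun v => a <+: v ∧ v ≠ a)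

theorem trieSize_le_strip {a : Str} {Y : Finset Str} (h : ∀ k ∈ Y, a <+: k) :
    trieSize Y ≤ trieSize (strip a Y) + (a.length + 1) := by
  have : pre Y ⊆ (strip a (pre Y)).image (a ++ ·) ∪ a.inits.toFinset := by
    intro p hp
    obtain ⟨k, hk, hpk⟩ := mem_pre.1 hp
    rw [Finset.mem_union]
    rcases prefix_comparable hpk (h k hk) with h1 | ⟨t, rfl⟩
    · exact Or.inr (by simpa using h1)
    · exact Or.inl (Finset.mem_image.2 ⟨t, by simpa using hp, rfl⟩)
  refine (Finset.card_le_card this).trans ((Finset.card_union_le _ _).trans ?_)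
  rw [← pre_strip]
  refine Nat.add_le_add Finset.card_image_le ?_
  exact (List.toFinset_card_le _).trans (by simp)

/-- The tries of the cells together are not much larger than the trie of their union. -/
theorem sum_trieSize_reg_le {E : ℕ} (hQ : [] ∈ Q) (hE : ∀ v ∈ Q, v.length + 1 ≤ E) (a : Str) :
    ∑ v ∈ Q, trieSize (strip a (reg Q R v)) ≤ trieSize (strip a R) + (below Q a).card * E := by
  have hmem : ∀ {v p k : Str}, v ∈ Q → own Q (a ++ k) = v → p <+: k → v <+: a ++ p →
      own Q (a ++ p) = v := by
    intro v p k hv hk hp hvp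
    exact (own_between (hk ▸ hvp) ((List.prefix_append_right_inj a).2 hp) hQ).trans hk
  -- Nodes of the trie of `v` that extend `v` belong to the cell `v`, so they are distinct for
  -- distinct cells. Nodes above `v` are at most `E` in number, and they matter only if `v` is
  -- strictly below `a`: otherwise stripping `a` has removed them or has left nothing.
  have h1 : ∀ v ∈ Q, trieSize (strip a (reg Q R v)) ≤
      ((pre (strip a R)).filter (fun p => own Q (a ++ p) = v)).card
        + if v ∈ below Q a then E else 0 := by
    intro v hv
    split_ifs with hb
    · obtain ⟨_, ⟨u, rfl⟩, hne⟩ := Finset.mem_filter.1 hb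
      have hsub : pre (strip a (reg Q R (a ++ u))) ⊆
          (pre (strip a R)).filter (fun p => own Q (a ++ p) = a ++ u) ∪ u.inits.toFinset := by
        intro p hp
        obtain ⟨k, hk, hpk⟩ := mem_pre.1 hp
        obtain ⟨hkR, hko⟩ := mem_reg.1 (mem_strip.1 hk)
        have huk : u <+: k := by
          have := own_prefix Q (a ++ k)
          rw [hko] at this
          exact (List.prefix_append_right_inj a).1 this
        rw [Finset.mem_union]
        rcases prefix_comparable hpk huk with h1 | h1
        · exact Or.inr (by simpa using h1)
        · refine Or.inl (Finset.mem_filter.2 ⟨mem_pre.2 ⟨k, mem_strip.2 hkR, hpk⟩, ?_⟩)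
          exact hmem hv hko hpk ((List.prefix_append_right_inj a).2 h1)
      refine (Finset.card_le_card hsub).trans ((Finset.card_union_le _ _).trans ?_)
      refine Nat.add_le_add_left ((List.toFinset_card_le _).trans ?_) _
      have := hE _ hv
      simp at this ⊢
      omega
    · refine Finset.card_le_card fun p hp => ?_
      obtain ⟨k, hk, hpk⟩ := mem_pre.1 hp
      obtain ⟨hkR, hko⟩ := mem_reg.1 (mem_strip.1 hk)
      refine Finset.mem_filter.2 ⟨mem_pre.2 ⟨k, mem_strip.2 hkR, hpk⟩, ?_⟩
      have h2 : v <+: a := by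
        have h3 := own_prefix Q (a ++ k)
        rw [hko] at h3
        rcases prefix_comparable h3 (List.prefix_append a k) with h4 | h4
        · exact h4
        · by_cases e : v = a
          · exact e ▸ List.prefix_refl _
          · exact absurd (Finset.mem_filter.2 ⟨hv, h4, e⟩) hb
      exact hmem hv hko hpk (h2.trans (List.prefix_append _ _))
  refine (Finset.sum_le_sum h1).trans ?_
  rw [Finset.sum_add_distrib]
  refine Nat.add_le_add (le_of_eq ?_) (le_of_eq ?_)
  · rw [trieSize, Finset.card_eq_sum_card_fiberwise (f := fun p => own Q (a ++ p)) (t := Q)]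
    exact fun p _ => own_mem hQ _
  · rw [← Finset.sum_filter, Finset.sum_const, smul_eq_mul]
    congr 2
    ext v
    simp [below]

/-- If the cells strictly below `a` are not too light, then there are not many of them. -/
theorem card_below_le {E : ℕ} (hQ : [] ∈ Q) (hE : ∀ v ∈ Q, v.length + 1 ≤ E) (a : Str)
    (hw : ∀ v ∈ below Q a, 3 * τ ≤ wt τ Q R v) :
    2 * τ * (below Q a).card ≤ trieSize (strip a R) + (below Q a).card * (2 * E) := by
  -- Sets of kids are disjoint and stay below `a`. So the kids use up only `τ` per cell on average,
  -- and of the weight `3 * τ` at least `2 * τ` per cell must come from tries.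
  have h1 : ∑ v ∈ below Q a, (kids Q v).card ≤ (below Q a).card := by
    rw [← Finset.card_biUnion]
    · refine Finset.card_le_card fun c hc => ?_
      obtain ⟨v, hv, hcv⟩ := Finset.mem_biUnion.1 hc
      obtain ⟨hvQ, hav, hne⟩ := Finset.mem_filter.1 hv
      refine Finset.mem_filter.2 ⟨(mem_kids.1 hcv).1, hav.trans (prefix_of_mem_kids hcv), ?_⟩
      rintro rfl
      exact hne (prefix_antisymm (prefix_of_mem_kids hcv) hav)
    · intro v _ u _ hvu
      rw [Function.onFun, Finset.disjoint_left]
      intro c hc hc'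
      exact hvu ((mem_kids.1 hc).2.2.symm.trans (mem_kids.1 hc').2.2)
  have h2 : ∑ v ∈ below Q a, trieSize (reg Q R v) ≤
      ∑ v ∈ below Q a, (trieSize (strip a (reg Q R v)) + E) := by
    refine Finset.sum_le_sum fun v hv => ?_
    obtain ⟨hvQ, hav, hne⟩ := Finset.mem_filter.1 hv
    refine (trieSize_le_strip (a := a) fun k hk => hav.trans (prefix_of_mem_reg hk)).trans ?_
    have := hE v hvQ
    have := hav.length_le
    omega
  have h3 : ∑ v ∈ below Q a, trieSize (strip a (reg Q R v)) ≤
      ∑ v ∈ Q, trieSize (strip a (reg Q R v)) :=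
    Finset.sum_le_sum_of_subset (Finset.filter_subset _ _)
  have h4 := sum_trieSize_reg_le (R := R) hQ hE a
  have h5 : (below Q a).card * (3 * τ) ≤ ∑ v ∈ below Q a, wt τ Q R v := by
    rw [← smul_eq_mul]
    exact Finset.card_nsmul_le_sum _ _ _ hw
  have h6 : ∑ v ∈ below Q a, wt τ Q R v = ∑ v ∈ below Q a, trieSize (reg Q R v)
      + τ * ∑ v ∈ below Q a, (kids Q v).card := by
    simp only [wt, Finset.sum_add_distrib, Finset.mul_sum]
  rw [Finset.sum_add_distrib, Finset.sum_const, smul_eq_mul] at h2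
  have h7 := Nat.mul_le_mul_left τ h1
  nlinarith

end

end BitmapIndex

/-! ### Buffer trees and their local operations. -/

namespace BitmapIndex

/-! ### Trees of cells with pending keys -/

/-- A set `R` of keys distributed over cells `Q`, with a set `P v` of pending changes at every
cell `v`. -/
structure Tree where
  Q : Finset Str
  R : Finset Str
  P : Str → Finset Str

/-- The number of bits of pending changes that a settled cell may have. -/
def cap (B : ℕ) : ℕ := B / 65536

namespace Tree

/-- The weight of a cell. -/
def wt (B : ℕ) (T : Tree) (v : Str) : ℕ := BitmapIndex.wt (64 * B) T.Q T.R v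

/-- Well-formed trees, with keys and cells of less than `E` bits. -/
structure WF (E : ℕ) (T : Tree) : Prop where
  root : [] ∈ T.Q
  pend_empty : ∀ v, v ∉ T.Q → T.P v = ∅
  pend_prefix : ∀ v, ∀ k ∈ T.P v, v <+: k
  lenR : ∀ k ∈ T.R, k.length + 1 ≤ E
  lenP : ∀ v, ∀ k ∈ T.P v, k.length + 1 ≤ E
  lenQ : ∀ v ∈ T.Q, v.length + 1 ≤ E

end Tree

/-- The weight `w` and the pending changes `p` of a cell that needs no work. -/
def Good (B w : ℕ) (p : Finset Str) : Prop := totalLen p ≤ cap B ∧ 192 * B ≤ w ∧ w ≤ 4096 * B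

/-- The weight `w` and the pending changes `p` of a cell that has to be visited. -/
def Unsettled (B w : ℕ) (p : Finset Str) : Prop :=
  cap B < totalLen p ∨ 4096 * B < w ∨ w < 192 * B ∧ p ≠ ∅

/-- Operations at a cell. -/
inductive Op
  | absorb (d : Str)
  | down (d : Str)
  | cut (h : Str)
  | flush (C : Finset Str)
  | up

/-- The keys in `C` that extend none of the cells in `ks`. -/
def ownPart (ks C : Finset Str) : Finset Str := C.filter (fun k => ∀ d ∈ ks, ¬ d <+: k)

/-- Local conditions under which an operation at the cell `v` is appropriate: `rg`, `p`, `ks` are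
the keys, pending changes and cells below of `v`, and `kw`, `kp` the weights and pending changes of
these cells. -/
def Legal (B : ℕ) (v : Str) (rg p ks : Finset Str) (kw : Str → ℕ) (kp : Str → Finset Str) :
    Op → Prop
  | .absorb d => d ∈ ks ∧ kw d < 192 * B ∧ kp d = ∅
  | .down d => d ∈ ks ∧ Unsettled B (kw d) (kp d)
  | .cut h => (∀ d ∈ ks, Good B (kw d) (kp d)) ∧ 4096 * B < trieSize rg + 64 * B * ks.card ∧
      v <+: h ∧ h ≠ v ∧ (∀ d ∈ ks, ¬ d <+: h) ∧
      960 * B ≤ trieSize (rg.filter (h <+: ·)) + 64 * B * (ks.filter (h <+: ·)).card ∧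
      trieSize (rg.filter (h <+: ·)) + 64 * B * (ks.filter (h <+: ·)).card ≤ 2048 * B
  -- Either a chunk with a constant fraction of an overfull set of pending changes, all for one
  -- destination, or everything at a light cell, which then is ready to be absorbed.
  | .flush C => (∀ d ∈ ks, Good B (kw d) (kp d)) ∧ trieSize rg + 64 * B * ks.card ≤ 4096 * B ∧
      C ⊆ p ∧
      (cap B < 81 * totalLen C ∧
        (C = ownPart ks p ∨ ∃ d ∈ ks, (∀ k ∈ C, d <+: k) ∧ totalLen C ≤ cap B + 1 + 4 * B) ∨
       v ≠ [] ∧ trieSize rg + 64 * B * ks.card < 192 * B ∧ p ≠ ∅ ∧ C = p ∧ totalLen C ≤ cap B)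
  | .up => (∀ d ∈ ks, Good B (kw d) (kp d)) ∧ trieSize rg + 64 * B * ks.card ≤ 4096 * B ∧
      totalLen p ≤ cap B ∧ (v = [] ∨ 192 * B ≤ trieSize rg + 64 * B * ks.card ∨ p = ∅)

/-- Weights and pending changes enter only for the cells below, whose records the machine reads. -/
theorem Legal.congr {B : ℕ} {v : Str} {rg p ks : Finset Str} {kw kw' : Str → ℕ}
    {kp kp' : Str → Finset Str} {o : Op} (h : Legal B v rg p ks kw kp o)
    (hw : ∀ d ∈ ks, kw' d = kw d) (hp : ∀ d ∈ ks, kp' d = kp d) :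
    Legal B v rg p ks kw' kp' o := by
  have hg : (∀ d ∈ ks, Good B (kw d) (kp d)) → ∀ d ∈ ks, Good B (kw' d) (kp' d) := by
    intro h d hd
    rw [hw d hd, hp d hd]
    exact h d hd
  cases o with
  | absorb d =>
    obtain ⟨h1, h2⟩ := h
    exact ⟨h1, by rwa [hw d h1, hp d h1]⟩
  | down d =>
    obtain ⟨h1, h2⟩ := h
    exact ⟨h1, by rwa [hw d h1, hp d h1]⟩
  | cut h => exact ⟨hg h.1, h.2⟩
  | flush C => exact ⟨hg h.1, h.2⟩
  | up => exact ⟨hg h.1, h.2⟩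

/-- Appropriate operations of a tree at the cell `v`. -/
def Tree.Legal (B : ℕ) (T : Tree) (v : Str) (o : Op) : Prop :=
  BitmapIndex.Legal B v (reg T.Q T.R v) (T.P v) (kids T.Q v) (T.wt B) T.P o

/-- Keys are added one by one until `m` is reached; the last one overshoots by at most `E`. -/
theorem exists_chunk {E : ℕ} (m : ℕ) (S : Finset Str) (hS : ∀ k ∈ S, k.length + 1 ≤ E) :
    ∃ C ⊆ S, totalLen C ≤ m + E ∧ min (totalLen S) m ≤ totalLen C := by
  induction S using Finset.induction_on with
  | empty => exact ⟨∅, subset_rfl, by simp, by simp⟩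
  | insert k S hk ih =>
    obtain ⟨C, hC, h1, h2⟩ := ih fun k hk => hS k (Finset.mem_insert_of_mem hk)
    by_cases hm : m ≤ totalLen C
    · exact ⟨C, hC.trans (Finset.subset_insert _ _), h1, (min_le_right _ _).trans hm⟩
    · have hkC : k ∉ C := fun h => hk (hC h)
      have e1 : totalLen (insert k C) = k.length + 1 + totalLen C := Finset.sum_insert hkC
      have e2 : totalLen (insert k S) = k.length + 1 + totalLen S := Finset.sum_insert hk
      have := hS k (Finset.mem_insert_self _ _)
      refine ⟨insert k C, Finset.insert_subset_insert _ hC, ?_, ?_⟩ <;> omega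

theorem ownPart_subset (ks C : Finset Str) : ownPart ks C ⊆ C := Finset.filter_subset _ _

/-- Pigeonhole: every pending key is either for the cell itself or below one of at most `K` kids. -/
theorem exists_share (ks p : Finset Str) (K : ℕ) (hK : ks.card ≤ K) :
    ∃ S, (S = ownPart ks p ∨ ∃ d ∈ ks, S = p.filter (d <+: ·)) ∧
      totalLen p ≤ (K + 1) * totalLen S := by
  by_contra hno
  push Not at hno
  set x := totalLen p / (K + 1) with hx
  have hle : ∀ S, (S = ownPart ks p ∨ ∃ d ∈ ks, S = p.filter (d <+: ·)) →
      totalLen S * (K + 1) < totalLen p := fun S hS => by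
    rw [mul_comm]; exact hno S hS
  have hsub : p ⊆ ownPart ks p ∪ ks.biUnion (fun d => p.filter (d <+: ·)) := by
    intro k hk
    simp only [ownPart, Finset.mem_union, Finset.mem_filter, Finset.mem_biUnion]
    by_cases h : ∀ d ∈ ks, ¬ d <+: k
    · exact Or.inl ⟨hk, h⟩
    · push Not at h
      obtain ⟨d, hd, hdk⟩ := h
      exact Or.inr ⟨d, hd, hk, hdk⟩
  have h1 := (totalLen_mono hsub).trans (totalLen_union_le _ _)
  have h2 : totalLen (ks.biUnion (fun d => p.filter (d <+: ·))) ≤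
      ∑ d ∈ ks, totalLen (p.filter (d <+: ·)) := by
    clear h1 hsub hle hno hK
    induction ks using Finset.induction_on with
    | empty => simp
    | insert d ks hd ih =>
      rw [Finset.biUnion_insert, Finset.sum_insert hd]
      exact (totalLen_union_le _ _).trans (Nat.add_le_add_left ih _)
  have h3 : (∑ d ∈ ks, totalLen (p.filter (d <+: ·))) * (K + 1) ≤ ks.card * totalLen p := by
    rw [Finset.sum_mul, ← smul_eq_mul]
    exact Finset.sum_le_card_nsmul _ _ _ fun d hd => (hle _ (Or.inr ⟨d, hd, rfl⟩)).le
  have h4 := hle _ (Or.inl rfl)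
  have h5 := Nat.mul_le_mul_right (totalLen p) hK
  have h6 := Nat.mul_le_mul_right (K + 1) (h1.trans (Nat.add_le_add_left h2 _))
  rw [Nat.add_mul, Nat.mul_add] at h6
  have : K * totalLen p = totalLen p * K := mul_comm _ _
  omega

section

variable {B E : ℕ} {T : Tree}

theorem kids_card_le {K v : _} (hw : T.wt B v < 64 * B * (K + 1)) : (kids T.Q v).card ≤ K := by
  have h1 : 64 * B * (kids T.Q v).card < 64 * B * (K + 1) :=
    lt_of_le_of_lt (Nat.le_add_left _ _) hw
  exact Nat.le_of_lt_succ (lt_of_mul_lt_mul_left h1 (Nat.zero_le _))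

/-- The right-hand side can be checked in the record of `v`, which shows the kids of `v` but no
other cells. -/
theorem own_eq_iff {Q : Finset Str} (hQ : [] ∈ Q) {v k : Str} (hv : v ∈ Q) (hk : v <+: k) :
    own Q k = v ↔ ∀ d ∈ kids Q v, ¬ d <+: k := by
  constructor
  · rintro h d hd hdk
    have := prefix_own (mem_kids.1 hd).1 hdk
    rw [h] at this
    exact ne_of_mem_kids hd (prefix_antisymm this (prefix_of_mem_kids hd))
  · intro h
    by_contra hne
    obtain ⟨c, hc, hck⟩ := exists_kid hv (own_mem hQ k) (prefix_own hv hk) (Ne.symm hne)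
    exact h c hc (hck.trans (own_prefix Q k))

theorem not_unsettled_good {w : ℕ} {p : Finset Str} (h : ¬ Unsettled B w p)
    (h' : ¬ (w < 192 * B ∧ p = ∅)) : Good B w p := by
  unfold Unsettled at h
  unfold Good
  by_cases hp : p = ∅
  · simp only [hp, and_true, ne_eq, not_true, and_false, or_false, totalLen_empty] at *
    omega
  · simp only [hp, and_false, ne_eq, not_false_eq_true, and_true] at *
    omega

/-- The cases are tried in order of priority. Light empty kids are absorbed and unsettled kids
visited first, so that at a cut, a flush or a move upwards all kids are good. Then excess weight is
cut off, and pending changes are flushed if there are too many of them or if they prevent an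
absorption. -/
theorem Tree.exists_legal (hT : T.WF E) (hE : E ≤ 4 * B) (hB : 0 < B) {v : Str} (hv : v ∈ T.Q) :
    ∃ o, T.Legal B v o := by
  by_cases h1 : ∃ d ∈ kids T.Q v, T.wt B d < 192 * B ∧ T.P d = ∅
  · obtain ⟨d, hd, h⟩ := h1
    exact ⟨.absorb d, hd, h⟩
  by_cases h2 : ∃ d ∈ kids T.Q v, Unsettled B (T.wt B d) (T.P d)
  · obtain ⟨d, hd, h⟩ := h2
    exact ⟨.down d, hd, h⟩
  have hg : ∀ d ∈ kids T.Q v, Good B (T.wt B d) (T.P d) := fun d hd =>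
    not_unsettled_good (fun h => h2 ⟨d, hd, h⟩) (fun h => h1 ⟨d, hd, h⟩)
  by_cases h3 : 4096 * B < T.wt B v
  -- With `θ = 2048 * B` and `E ≤ 4 * B` the piece weighs at least `1022 * B`.
  · obtain ⟨h, hh, ho, h4, h5⟩ := exists_cut (τ := 64 * B) (E := E) (θ := 2048 * B) hT.lenR hv
      (by have := h3; unfold Tree.wt at this; omega) (by omega)
    have hvh : v <+: h := ho ▸ own_prefix _ h
    refine ⟨.cut h, hg, h3, hvh, fun e => hh (e ▸ hv), (own_eq_iff hT.root hv hvh).1 ho, ?_, h4⟩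
    change 960 * B ≤ wtIn (64 * B) T.Q T.R v h
    omega
  rw [not_lt] at h3
  by_cases h4 : cap B < totalLen (T.P v)
  -- A weight of at most `4096 * B` allows for no more than 80 kids; with the cell itself there are
  -- at most 81 destinations.
  · obtain ⟨S, hS, hle⟩ := exists_share (kids T.Q v) (T.P v) 80
      (kids_card_le (B := B) (by omega))
    rcases hS with rfl | ⟨d, hd, hS⟩
    · exact ⟨.flush _, hg, h3, ownPart_subset _ _, Or.inl ⟨by omega, Or.inl rfl⟩⟩
    -- What goes to a kid is limited to little more than `cap B` bits, lest the pending changes of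
    -- the kid overflow its record. The part for the cell itself is taken as a whole.
    · obtain ⟨C, hC, h5, h6⟩ := exists_chunk (E := E) (cap B + 1) S
        fun k hk => hT.lenP v k (Finset.mem_filter.1 (hS ▸ hk)).1
      refine ⟨.flush C, hg, h3, hC.trans (hS ▸ Finset.filter_subset _ _), Or.inl ⟨by omega, Or.inr
        ⟨d, hd, fun k hk => (Finset.mem_filter.1 (hS ▸ hC hk)).2, by omega⟩⟩⟩
  rw [not_lt] at h4
  by_cases h5 : v = [] ∨ 192 * B ≤ T.wt B v ∨ T.P v = ∅
  · exact ⟨.up, hg, h3, h4, h5⟩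
  · push Not at h5
    exact ⟨.flush (T.P v), hg, h3, subset_rfl, Or.inr ⟨h5.1, h5.2.1, h5.2.2.ne_empty, rfl, h4⟩⟩

/-! ### Operations on trees -/

namespace Tree

def absorb (T : Tree) (d : Str) : Tree := ⟨T.Q.erase d, T.R, T.P⟩

def cut (T : Tree) (h : Str) : Tree := ⟨insert h T.Q, T.R, T.P⟩

def flush (T : Tree) (v : Str) (C : Finset Str) : Tree where
  Q := T.Q
  R := symmDiff T.R (ownPart (kids T.Q v) C)
  P u := if u = v then T.P v \ C else
    if u ∈ kids T.Q v then symmDiff (T.P u) (C.filter (u <+: ·)) else T.P u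

/-- Pending keys extend `v`, so those below no kid of `v` belong to the cell `v`; the keys of other
cells are not affected. -/
theorem reg_flush (hT : T.WF E) {v : Str} (hv : v ∈ T.Q) {C : Finset Str} (hC : C ⊆ T.P v)
    (u : Str) : reg T.Q (T.flush v C).R u =
      if u = v then symmDiff (reg T.Q T.R v) (ownPart (kids T.Q v) C) else reg T.Q T.R u := by
  have key : ∀ k ∈ ownPart (kids T.Q v) C, own T.Q k = v := fun k hk =>
    (own_eq_iff hT.root hv (hT.pend_prefix v k (hC (ownPart_subset _ _ hk)))).2
      (Finset.mem_filter.1 hk).2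
  ext k
  have := key k
  split_ifs with h
  · subst h
    simp only [flush, mem_reg, Finset.mem_symmDiff]
    tauto
  · simp only [flush, mem_reg, Finset.mem_symmDiff]
    constructor
    · rintro ⟨h1 | h1, h2⟩
      · exact ⟨h1.1, h2⟩
      · exact absurd (h2.symm.trans (this h1.1)) h
    · rintro ⟨h1, h2⟩
      exact ⟨Or.inl ⟨h1, fun h3 => h (h2.symm.trans (this h3))⟩, h2⟩

theorem WF.absorb (hT : T.WF E) {v d : Str} (hd : d ∈ kids T.Q v) (hp : T.P d = ∅) :
    (T.absorb d).WF E where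
  root := Finset.mem_erase.2 ⟨(mem_kids.1 hd).2.1.symm, hT.root⟩
  pend_empty u hu := by
    by_cases e : u = d
    · exact e ▸ hp
    · exact hT.pend_empty u fun h => hu (Finset.mem_erase.2 ⟨e, h⟩)
  pend_prefix := hT.pend_prefix
  lenR := hT.lenR
  lenP := hT.lenP
  lenQ v hv := hT.lenQ v (Finset.mem_of_mem_erase hv)

theorem WF.cut (hT : T.WF E) {h : Str} (hl : h.length + 1 ≤ E) : (T.cut h).WF E where
  root := Finset.mem_insert_of_mem hT.root
  pend_empty u hu := hT.pend_empty u fun h => hu (Finset.mem_insert_of_mem h)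
  pend_prefix := hT.pend_prefix
  lenR := hT.lenR
  lenP := hT.lenP
  lenQ v hv := by
    rcases Finset.mem_insert.1 hv with rfl | hv
    exacts [hl, hT.lenQ v hv]

theorem WF.flush (hT : T.WF E) {v : Str} (hv : v ∈ T.Q) {C : Finset Str} (hC : C ⊆ T.P v) :
    (T.flush v C).WF E where
  root := hT.root
  pend_empty u hu := by
    have h1 : u ≠ v := fun e => hu (e ▸ hv)
    have h2 : u ∉ kids T.Q v := fun h => hu (mem_kids.1 h).1
    simpa [Tree.flush, h1, h2] using hT.pend_empty u hu
  pend_prefix u k hk := by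
    simp only [Tree.flush] at hk
    split_ifs at hk with h1 h2
    · exact h1 ▸ hT.pend_prefix v k (Finset.sdiff_subset hk)
    · rcases Finset.mem_symmDiff.1 hk with h | h
      · exact hT.pend_prefix u k h.1
      · exact (Finset.mem_filter.1 h.1).2
    · exact hT.pend_prefix u k hk
  lenR k hk := by
    rcases Finset.mem_symmDiff.1 hk with h | h
    · exact hT.lenR k h.1
    · exact hT.lenP v k (hC (ownPart_subset _ _ h.1))
  lenP u k hk := by
    simp only [Tree.flush] at hk
    split_ifs at hk with h1 h2
    · exact hT.lenP v k (Finset.sdiff_subset hk)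
    · rcases Finset.mem_symmDiff.1 hk with h | h
      · exact hT.lenP u k h.1
      · exact hT.lenP v k (hC (Finset.mem_filter.1 h.1).1)
    · exact hT.lenP u k hk
  lenQ := hT.lenQ

/-! ### The represented set -/

/-- The indicator function of a finite set of strings, modulo 2. -/
def _root_.BitmapIndex.ind (Y : Finset Str) (k : Str) : ZMod 2 := if k ∈ Y then 1 else 0

theorem _root_.BitmapIndex.ind_symmDiff (Y Z : Finset Str) (k : Str) :
    ind (symmDiff Y Z) k = ind Y k + ind Z k := by
  by_cases hy : k ∈ Y <;> by_cases hz : k ∈ Z <;>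
    simp [ind, Finset.mem_symmDiff, hy, hz, CharTwo.add_self_eq_zero]

theorem _root_.BitmapIndex.ind_injective {Y Z : Finset Str} (h : ∀ k, ind Y k = ind Z k) :
    Y = Z := by
  ext k
  have := h k
  by_cases hy : k ∈ Y <;> by_cases hz : k ∈ Z <;> simp_all [ind]

@[simp] theorem _root_.BitmapIndex.ind_empty (k : Str) : ind ∅ k = 0 := by simp [ind]

/-- The indicator function of the set that a tree represents. -/
def content (T : Tree) (k : Str) : ZMod 2 := ind T.R k + ∑ v ∈ T.Q, ind (T.P v) k

theorem content_absorb {d : Str} (hp : T.P d = ∅) (k : Str) :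
    (T.absorb d).content k = T.content k := by
  simp only [content, absorb]
  congr 1
  refine Finset.sum_erase _ (by simp [hp])

theorem content_cut (hT : T.WF E) {h : Str} (hh : h ∉ T.Q) (k : Str) :
    (T.cut h).content k = T.content k := by
  simp [content, cut, Finset.sum_insert hh, hT.pend_empty h hh]

theorem not_prefix_of_kids {v d e : Str} (hd : d ∈ kids T.Q v)
    (he : e ∈ kids T.Q v) (hne : d ≠ e) {k : Str} (hdk : d <+: k) : ¬ e <+: k := by
  intro hek
  rcases prefix_comparable hdk hek with h | h
  · have := prefix_par (mem_kids.1 hd).1 h hne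
    rw [(mem_kids.1 he).2.2] at this
    exact ne_of_mem_kids hd (prefix_antisymm this (prefix_of_mem_kids hd))
  · have := prefix_par (mem_kids.1 he).1 h hne.symm
    rw [(mem_kids.1 hd).2.2] at this
    exact ne_of_mem_kids he (prefix_antisymm this (prefix_of_mem_kids he))

/-- A key of `C` leaves the pending changes of `v` and is toggled at exactly one other place, among
the keys or at the only kid that is a prefix of it; kids of a cell are pairwise incomparable. -/
theorem content_flush {v : Str} (hv : v ∈ T.Q) {C : Finset Str} (hC : C ⊆ T.P v)
    (k : Str) : (T.flush v C).content k = T.content k := by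
  have hvk : v ∉ kids T.Q v := fun h => ne_of_mem_kids h rfl
  have h1 : ∀ u ∈ T.Q, ind ((T.flush v C).P u) k = ind (T.P u) k
      + ((if u = v then ind C k else 0) +
        (if u ∈ kids T.Q v then ind (C.filter (u <+: ·)) k else 0)) := by
    intro u _
    simp only [flush]
    by_cases e : u = v
    · subst e
      rw [if_pos rfl, if_pos rfl, if_neg hvk]
      by_cases h : k ∈ C
      · simp [ind, h, hC h, CharTwo.add_self_eq_zero]
      · simp [ind, h]
    · simp only [if_neg e]
      split_ifs with h
      · simp [ind_symmDiff]
      · simp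
  have h2 : ∑ u ∈ T.Q, (if u ∈ kids T.Q v then ind (C.filter (u <+: ·)) k else 0)
      = ∑ u ∈ kids T.Q v, ind (C.filter (u <+: ·)) k := by
    rw [← Finset.sum_filter]
    refine Finset.sum_congr ?_ fun _ _ => rfl
    ext u
    simp only [Finset.mem_filter, mem_kids]
    tauto
  have h3 : ind C k = ind (ownPart (kids T.Q v) C) k
      + ∑ u ∈ kids T.Q v, ind (C.filter (u <+: ·)) k := by
    by_cases hk : k ∈ C
    · by_cases h : ∃ d ∈ kids T.Q v, d <+: k
      · obtain ⟨d, hd, hdk⟩ := h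
        rw [Finset.sum_eq_single_of_mem d hd fun e he hne => by
          simp [ind, not_prefix_of_kids hd he hne.symm hdk]]
        have : ¬ ∀ d ∈ kids T.Q v, ¬ d <+: k := fun h => h d hd hdk
        simp [ind, ownPart, hk, hdk, this]
      · push Not at h
        rw [Finset.sum_eq_zero fun e he => by simp [ind, h e he]]
        simp [ind, ownPart, hk]
        exact h
    · rw [Finset.sum_eq_zero fun e he => by simp [ind, hk]]
      simp [ind, ownPart, hk]
  have h4 : ∑ u ∈ T.Q, ind ((T.flush v C).P u) k = ∑ u ∈ T.Q, ind (T.P u) k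
      + (ind C k + ∑ u ∈ kids T.Q v, ind (C.filter (u <+: ·)) k) := by
    rw [Finset.sum_congr rfl h1, Finset.sum_add_distrib, Finset.sum_add_distrib, h2,
      Finset.sum_ite_eq' T.Q v, if_pos hv]
  have h5 : (T.flush v C).content k = ind (T.flush v C).R k
    + ∑ u ∈ T.Q, ind ((T.flush v C).P u) k := rfl
  rw [h5, h4, h3, content, flush, ind_symmDiff]
  have h6 : ∀ a b c d : ZMod 2, a + b + (c + (b + d + d)) = a + c := by decide
  exact h6 _ _ _ _

end Tree

end

end BitmapIndex

/-! ### Weights and the invariant under local operations. -/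

namespace BitmapIndex

variable {B E : ℕ} {T : Tree}

/-! ### Weights after an operation -/

namespace Tree

/-- The charge of `64 * B` for the kid `d` disappears; apart from that, tries and sets of kids are
united. -/
theorem wt_absorb (hT : T.WF E) {v d : Str} (hd : d ∈ kids T.Q v) :
    (T.absorb d).wt B v + 64 * B ≤ T.wt B v + T.wt B d ∧
      T.wt B v ≤ (T.absorb d).wt B v + 64 * B := by
  have e1 : reg (T.absorb d).Q (T.absorb d).R v = reg T.Q T.R v ∪ reg T.Q T.R d :=
    reg_erase_par hT.root hd
  have e2 : kids (T.absorb d).Q v = (kids T.Q v).erase d ∪ kids T.Q d := kids_erase_par hT.root hd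
  have h1 := trieSize_union_le (reg T.Q T.R v) (reg T.Q T.R d)
  have h2 := trieSize_mono (Finset.subset_union_left (s₁ := reg T.Q T.R v) (s₂ := reg T.Q T.R d))
  have h3 := Finset.card_union_le ((kids T.Q v).erase d) (kids T.Q d)
  have h4 := Finset.card_le_card
    (Finset.subset_union_left (s₁ := (kids T.Q v).erase d) (s₂ := kids T.Q d))
  have h5 := Finset.card_erase_add_one hd
  unfold wt BitmapIndex.wt
  rw [e1, e2]
  constructor
  · nlinarith
  · nlinarith

theorem wt_absorb_of_ne (hT : T.WF E) {v d : Str} (hd : d ∈ kids T.Q v) {u : Str} (hu : u ≠ v)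
    (hu' : u ≠ d) : (T.absorb d).wt B u = T.wt B u := by
  unfold wt BitmapIndex.wt absorb
  rw [reg_erase_of_ne hT.root hd hu hu', kids_erase_of_ne hT.root hd hu hu']

theorem wt_cut_self (hT : T.WF E) {v h : Str} (hv : own T.Q h = v) (hh : h ∉ T.Q) :
    (T.cut h).wt B h = wtIn (64 * B) T.Q T.R v h := by
  unfold wt BitmapIndex.wt cut wtIn
  rw [reg_insert_self hT.root hv hh, kids_insert_self hT.root hv hh]

theorem wt_cut_of_ne (hT : T.WF E) {v h : Str} (hv : own T.Q h = v) (hh : h ∉ T.Q) {u : Str}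
    (hu : u ≠ v) (hu' : u ≠ h) : (T.cut h).wt B u = T.wt B u := by
  unfold wt BitmapIndex.wt cut
  rw [reg_insert_of_ne hT.root hv hu hu', kids_insert_of_ne hT.root hv hh hu hu']

/-- The two tries share only proper prefixes of `h`. -/
theorem _root_.BitmapIndex.trieSize_filter_add_le (Y : Finset Str) (h : Str) :
    trieSize (Y.filter (h <+: ·)) + trieSize (Y.filter (fun k => ¬ h <+: k))
      ≤ trieSize Y + h.length := by
  unfold trieSize
  rw [← Finset.card_union_add_card_inter]
  refine Nat.add_le_add (Finset.card_le_card (Finset.union_subset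
    (pre_mono (Finset.filter_subset _ _)) (pre_mono (Finset.filter_subset _ _)))) ?_
  have : pre (Y.filter (h <+: ·)) ∩ pre (Y.filter (fun k => ¬ h <+: k))
      ⊆ (Finset.range h.length).image (fun i => h.take i) := by
    intro p hp
    obtain ⟨hp1, hp2⟩ := Finset.mem_inter.1 hp
    obtain ⟨k, hk, hpk⟩ := mem_pre.1 hp1
    obtain ⟨l, hl, hpl⟩ := mem_pre.1 hp2
    have hne : ¬ h <+: p := fun hhp => (Finset.mem_filter.1 hl).2 (hhp.trans hpl)
    have hph : p <+: h := (prefix_comparable hpk (Finset.mem_filter.1 hk).2).resolve_right hne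
    refine Finset.mem_image.2 ⟨p.length, Finset.mem_range.2 (lt_of_le_of_ne hph.length_le
      fun e => hne ?_), (List.prefix_iff_eq_take.1 hph).symm⟩
    rw [hph.eq_of_length e]
  exact (Finset.card_le_card this).trans (Finset.card_image_le.trans (by simp))

theorem wt_cut (hT : T.WF E) {v h : Str} (hv : own T.Q h = v) (hh : h ∉ T.Q)
    (hl : h.length + 1 ≤ E) :
    (T.cut h).wt B v + wtIn (64 * B) T.Q T.R v h ≤ T.wt B v + 64 * B + E ∧
      T.wt B v ≤ (T.cut h).wt B v + wtIn (64 * B) T.Q T.R v h := by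
  have e1 : reg (T.cut h).Q (T.cut h).R v = (reg T.Q T.R v).filter (fun k => ¬ h <+: k) :=
    reg_insert_own hT.root hv hh
  have e2 : kids (T.cut h).Q v = insert h ((kids T.Q v).filter (fun c => ¬ h <+: c)) :=
    kids_insert_own hT.root hv hh
  have hc : h ∉ (kids T.Q v).filter (fun c => ¬ h <+: c) := fun hc =>
    hh (mem_kids.1 (Finset.mem_filter.1 hc).1).1
  have h1 := trieSize_filter_add_le (reg T.Q T.R v) h
  have h2 := Finset.card_filter_add_card_filter_not (s := kids T.Q v) (h <+: ·)
  have h3 := trieSize_union_le ((reg T.Q T.R v).filter (h <+: ·))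
    ((reg T.Q T.R v).filter (fun k => ¬ h <+: k))
  rw [Finset.filter_union_filter_not_eq] at h3
  unfold wt BitmapIndex.wt wtIn
  rw [e1, e2, Finset.card_insert_of_notMem hc, ← h2]
  constructor
  · nlinarith
  · nlinarith

theorem wt_flush_of_ne (hT : T.WF E) {v : Str} (hv : v ∈ T.Q) {C : Finset Str} (hC : C ⊆ T.P v)
    {u : Str} (hu : u ≠ v) : (T.flush v C).wt B u = T.wt B u := by
  have := reg_flush hT hv hC u
  rw [if_neg hu] at this
  unfold wt BitmapIndex.wt
  rw [← this]
  rfl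

theorem wt_flush (hT : T.WF E) {v : Str} (hv : v ∈ T.Q) {C : Finset Str} (hC : C ⊆ T.P v) :
    (T.flush v C).wt B v ≤ T.wt B v + totalLen (ownPart (kids T.Q v) C) ∧
      T.wt B v ≤ (T.flush v C).wt B v + totalLen (ownPart (kids T.Q v) C) := by
  have h1 := reg_flush hT hv hC v
  rw [if_pos rfl] at h1
  have h2 := trieSize_symmDiff_le (reg T.Q T.R v) (ownPart (kids T.Q v) C)
  have h3 := trieSize_le_symmDiff (reg T.Q T.R v) (ownPart (kids T.Q v) C)
  have h4 := trieSize_le_totalLen (ownPart (kids T.Q v) C)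
  have e : (T.flush v C).wt B v = trieSize (symmDiff (reg T.Q T.R v) (ownPart (kids T.Q v) C))
      + 64 * B * (kids T.Q v).card := by rw [← h1]; rfl
  have e' : T.wt B v = trieSize (reg T.Q T.R v) + 64 * B * (kids T.Q v).card := rfl
  constructor <;> omega

/-! ### The invariant of the work on a tree -/

abbrev Good (B : ℕ) (T : Tree) (v : Str) : Prop := BitmapIndex.Good B (T.wt B v) (T.P v)

abbrev Unsettled (B : ℕ) (T : Tree) (v : Str) : Prop :=
  BitmapIndex.Unsettled B (T.wt B v) (T.P v)

open Classical in
/-- The cells below `v` that are not good or above `cur`. -/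
def bad (B : ℕ) (T : Tree) (cur v : Str) : Finset Str :=
  (kids T.Q v).filter (fun d => ¬ T.Good B d ∨ d <+: cur)

theorem mem_bad {cur v d : Str} :
    d ∈ T.bad B cur v ↔ d ∈ kids T.Q v ∧ (¬ T.Good B d ∨ d <+: cur) := by
  simp [bad]

/-- The state of a tree in the course of the work at the cell `cur`. -/
structure Inv (B E : ℕ) (T : Tree) (cur : Str) : Prop where
  wf : T.WF E
  mem : cur ∈ T.Q
  len : ∀ v, totalLen (T.P v) ≤ 20 * B
  -- A bad kid may have to be absorbed, so `192 * B` of weight are reserved for it in advance. This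
  -- keeps records on the path within their size.
  on : ∀ v ∈ T.Q, v <+: cur → T.wt B v + 192 * B * (T.bad B cur v).card ≤ 4756 * B
  -- Cells off the path need work only if they hang directly on the path, and even these are not too
  -- heavy.
  off : ∀ v ∈ T.Q, ¬ v <+: cur → T.Good B v ∨ par T.Q v <+: cur ∧ T.wt B v ≤ 4096 * B

theorem Inv.good_of_kid {cur u d : Str} (h : T.Inv B E cur) (hd : d ∈ kids T.Q u)
    (hu : ¬ u <+: cur) : T.Good B d := by
  obtain ⟨h1, _, h2⟩ := mem_kids.1 hd
  refine (h.off d h1 fun h3 => hu ((prefix_of_mem_kids hd).trans h3)).resolve_right fun h3 => ?_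
  exact hu (h2 ▸ h3.1)

theorem not_prefix_of_mem_kids {v d : Str} (h : d ∈ kids T.Q v) : ¬ d <+: v := fun h' =>
  ne_of_mem_kids h (prefix_antisymm h' (prefix_of_mem_kids h))

/-- The kids of `d` are good because `d` was off the path, so `d` starts without reservations. The
cells above it have reserved for `d` already, since it was not good. -/
theorem Inv.down {v d : Str} (h : T.Inv B E v) (hd : d ∈ kids T.Q v) (hu : ¬ T.Good B d) :
    T.Inv B E d := by
  have hvd := prefix_of_mem_kids hd
  have hnd := not_prefix_of_mem_kids hd
  have hdQ := (mem_kids.1 hd).1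
  have hpre : ∀ u ∈ T.Q, u <+: d → u = d ∨ u <+: v := by
    intro u hu hud
    by_cases e : u = d
    · exact Or.inl e
    · exact Or.inr ((mem_kids.1 hd).2.2 ▸ prefix_par hu hud e)
  refine ⟨h.wf, hdQ, h.len, fun u huQ hud => ?_, fun u huQ hud => ?_⟩
  · rcases hpre u huQ hud with rfl | huv
    · have h1 : T.bad B u u = ∅ := by
        refine Finset.eq_empty_of_forall_notMem fun c hc => ?_
        obtain ⟨h1, h2⟩ := mem_bad.1 hc
        exact h2.elim (fun h3 => h3 (h.good_of_kid h1 hnd)) (not_prefix_of_mem_kids h1)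
      rw [h1]
      have := ((h.off u hdQ hnd).resolve_left hu).2
      simp
      omega
    · refine (Nat.add_le_add_left (Nat.mul_le_mul_left _ (Finset.card_le_card ?_)) _).trans
        (h.on u huQ huv)
      intro c hc
      obtain ⟨h1, h2⟩ := mem_bad.1 hc
      refine mem_bad.2 ⟨h1, h2.elim Or.inl fun h3 => ?_⟩
      rcases hpre c (mem_kids.1 h1).1 h3 with rfl | h4
      exacts [Or.inl hu, Or.inr h4]
  · rcases h.off u huQ (fun h1 => hud (h1.trans hvd)) with h1 | ⟨h1, h2⟩
    exacts [Or.inl h1, Or.inr ⟨h1.trans hvd, h2⟩]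

/-- The cell that is left need not be good: it becomes a cell off the path directly below the new
current one. -/
theorem Inv.up {v : Str} (h : T.Inv B E v) (hw : T.wt B v ≤ 4096 * B)
    (hg : ∀ d ∈ kids T.Q v, T.Good B d) : T.Inv B E (par T.Q v) := by
  have hp := par_prefix T.Q v
  refine ⟨h.wf, par_mem h.wf.root v, h.len, fun u huQ hup => ?_, fun u huQ hup => ?_⟩
  · refine (Nat.add_le_add_left (Nat.mul_le_mul_left _ (Finset.card_le_card ?_)) _).trans
        (h.on u huQ (hup.trans hp))
    intro c hc
    obtain ⟨h1, h2⟩ := mem_bad.1 hc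
    exact mem_bad.2 ⟨h1, h2.imp_right fun h3 => h3.trans hp⟩
  · by_cases e : u = v
    · exact Or.inr ⟨e ▸ List.prefix_refl _, e ▸ hw⟩
    · have huv : ¬ u <+: v := fun h1 => hup (prefix_par huQ h1 e)
      rcases h.off u huQ huv with h1 | ⟨h1, h2⟩
      · exact Or.inl h1
      · by_cases e' : par T.Q u = v
        · refine Or.inl (hg u (mem_kids.2 ⟨huQ, ?_, e'⟩))
          rintro rfl
          exact hup (List.nil_prefix)
        · exact Or.inr ⟨prefix_par (par_mem h.wf.root u) h1 e', h2⟩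

theorem good_absorb_iff (hT : T.WF E) {v d : Str} (hd : d ∈ kids T.Q v) {u : Str} (hu : u ≠ v)
    (hu' : u ≠ d) : (T.absorb d).Good B u ↔ T.Good B u := by
  unfold Good
  rw [wt_absorb_of_ne hT hd hu hu']
  rfl

/-- The weight of `v` grows by less than `128 * B` while a reservation of `192 * B` is released; the
kids inherited from `d` are good. -/
theorem Inv.absorb {v d : Str} (h : T.Inv B E v) (hB : 0 < B) (hd : d ∈ kids T.Q v)
    (hw : T.wt B d < 192 * B) (hp : T.P d = ∅) : (T.absorb d).Inv B E v := by
  have hwf := h.wf.absorb hd hp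
  have hne := ne_of_mem_kids hd
  have hnd := not_prefix_of_mem_kids hd
  have hdQ := (mem_kids.1 hd).1
  have hdv := (mem_kids.1 hd).2.2
  have hbadd : ¬ T.Good B d := fun hg => absurd hg.2.1 (by omega)
  refine ⟨hwf, Finset.mem_erase.2 ⟨hne.symm, h.mem⟩, h.len, fun u huQ huv => ?_,
    fun u huQ huv => ?_⟩
  · obtain ⟨hud, huQ⟩ := Finset.mem_erase.1 huQ
    by_cases e : u = v
    · subst e
      have h1 := (wt_absorb (B := B) h.wf hd).1
      have h2 : (T.absorb d).bad B u u ⊆ (T.bad B u u).erase d := by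
        intro c hc
        obtain ⟨hc, hcb⟩ := mem_bad.1 hc
        have hcg : ¬ T.Good B c := by
          rcases hcb with h3 | h3
          · rwa [good_absorb_iff h.wf hd (ne_of_mem_kids hc)
              (Finset.mem_erase.1 (mem_kids.1 hc).1).1] at h3
          · exact absurd h3 (not_prefix_of_mem_kids hc)
        have hc' : c ∈ (kids T.Q u).erase d ∪ kids T.Q d := by
          rw [← kids_erase_par h.wf.root hd]; exact hc
        rcases Finset.mem_union.1 hc' with h3 | h3
        · exact Finset.mem_erase.2 ⟨(Finset.mem_erase.1 h3).1,
            mem_bad.2 ⟨(Finset.mem_erase.1 h3).2, Or.inl hcg⟩⟩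
        · exact absurd (h.good_of_kid h3 hnd) hcg
      have h3 := Finset.card_le_card h2
      have h4 := Finset.card_erase_add_one (mem_bad.2 ⟨hd, Or.inl hbadd⟩ : d ∈ T.bad B u u)
      have h5 := h.on u huQ huv
      rw [← h4] at h5
      nlinarith
    · rw [wt_absorb_of_ne h.wf hd e hud]
      refine (Nat.add_le_add_left (Nat.mul_le_mul_left _ (Finset.card_le_card ?_)) _).trans
        (h.on u huQ huv)
      intro c hc
      obtain ⟨hc, hcb⟩ := mem_bad.1 hc
      have hc1 : c ∈ kids T.Q u := by
        rwa [← kids_erase_of_ne h.wf.root hd e hud]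
      refine mem_bad.2 ⟨hc1, ?_⟩
      by_cases e' : c = v
      · exact Or.inr (e' ▸ List.prefix_refl _)
      · rwa [good_absorb_iff h.wf hd e' (Finset.mem_erase.1 (mem_kids.1 hc).1).1] at hcb
  · obtain ⟨hud, huQ⟩ := Finset.mem_erase.1 huQ
    have e : u ≠ v := fun e => huv (e ▸ List.prefix_refl _)
    rw [good_absorb_iff h.wf hd e hud, wt_absorb_of_ne h.wf hd e hud]
    refine (h.off u huQ huv).imp_right fun h1 => ⟨?_, h1.2⟩
    change par (T.Q.erase d) u <+: v
    rw [par_erase h.wf.root (mem_kids.1 hd).2.1]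
    split_ifs
    · rw [hdv]
    · exact h1.1

/-- The new cell is good by the choice of the cut, so it needs no reservation, and `v` loses far
more than the new charge of `64 * B` and the at most `E` duplicated nodes. -/
theorem Inv.cut {v h : Str} (hI : T.Inv B E v) (hE : E ≤ 4 * B)
    (hv : own T.Q h = v) (hh : h ∉ T.Q) (hl : h.length + 1 ≤ E)
    (hg : ∀ d ∈ kids T.Q v, T.Good B d)
    (hw : 960 * B ≤ wtIn (64 * B) T.Q T.R v h) (hw' : wtIn (64 * B) T.Q T.R v h ≤ 2048 * B) :
    (T.cut h).Inv B E v := by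
  have hT := hI.wf
  have hwf := hT.cut hl
  have hvh : v <+: h := hv ▸ own_prefix _ _
  have hne : h ≠ v := fun e => hh (e ▸ hI.mem)
  have hnv : ¬ h <+: v := fun e => hne (prefix_antisymm e hvh)
  have hgood : ∀ u, u ≠ v → u ≠ h → ((T.cut h).Good B u ↔ T.Good B u) := fun u h1 h2 => by
    unfold Good
    rw [wt_cut_of_ne hT hv hh h1 h2]
    rfl
  have hgh : (T.cut h).Good B h := by
    unfold Good BitmapIndex.Good
    rw [wt_cut_self hT hv hh]
    refine ⟨?_, by omega, by omega⟩
    change totalLen (T.P h) ≤ _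
    simp [hT.pend_empty h hh]
  have hpar : ∀ u ∈ T.Q, par (T.cut h).Q u = if h <+: u ∧ par T.Q u = v then h else par T.Q u :=
    fun u hu => par_insert hT.root hv hh hu
  refine ⟨hwf, Finset.mem_insert_of_mem hI.mem, hI.len, fun u huQ huv => ?_, fun u huQ huv => ?_⟩
  · have huh : u ≠ h := fun e => hnv (e ▸ huv)
    have huQ : u ∈ T.Q := (Finset.mem_insert.1 huQ).resolve_left huh
    by_cases e : u = v
    · subst e
      have h1 := (wt_cut (B := B) hT hv hh hl).1
      have h2 : (T.cut h).bad B u u = ∅ := by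
        refine Finset.eq_empty_of_forall_notMem fun c hc => ?_
        obtain ⟨hc, hcb⟩ := mem_bad.1 hc
        have hc1 : c ∈ insert h ((kids T.Q u).filter (fun c => ¬ h <+: c)) := by
          rw [← kids_insert_own hT.root hv hh]; exact hc
        rcases hcb with h3 | h3
        · rcases Finset.mem_insert.1 hc1 with rfl | h4
          · exact h3 hgh
          · have h5 := (Finset.mem_filter.1 h4).1
            refine h3 ((hgood c (ne_of_mem_kids h5) fun e => ?_).2 (hg c h5))
            exact hh (e ▸ (mem_kids.1 h5).1)
        · exact not_prefix_of_mem_kids hc h3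
      have h3 := hI.on u huQ huv
      rw [h2]
      simp
      omega
    · rw [wt_cut_of_ne hT hv hh e huh]
      refine (Nat.add_le_add_left (Nat.mul_le_mul_left _ (Finset.card_le_card ?_)) _).trans
        (hI.on u huQ huv)
      intro c hc
      obtain ⟨hc, hcb⟩ := mem_bad.1 hc
      have hc1 : c ∈ kids T.Q u := by rwa [← kids_insert_of_ne hT.root hv hh e huh]
      refine mem_bad.2 ⟨hc1, ?_⟩
      by_cases e' : c = v
      · exact Or.inr (e' ▸ List.prefix_refl _)
      · rwa [hgood c e' fun e'' => hh (e'' ▸ (mem_kids.1 hc1).1)] at hcb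
  · by_cases huh : u = h
    · exact Or.inl (huh ▸ hgh)
    · have huQ : u ∈ T.Q := (Finset.mem_insert.1 huQ).resolve_left huh
      have e : u ≠ v := fun e => huv (e ▸ List.prefix_refl _)
      rw [hgood u e huh, wt_cut_of_ne hT hv hh e huh, hpar u huQ]
      rcases hI.off u huQ huv with h1 | ⟨h1, h2⟩
      · exact Or.inl h1
      · split_ifs with h3
        · refine Or.inl (hg u (mem_kids.2 ⟨huQ, ?_, h3.2⟩))
          rintro rfl
          exact huv List.nil_prefix
        · exact Or.inr ⟨h1, h2⟩

open Classical in
/-- The cells in `ks` that have extensions in `C`. -/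
def _root_.BitmapIndex.hit (ks C : Finset Str) : Finset Str :=
  ks.filter (fun d => ∃ k ∈ C, d <+: k)

theorem _root_.BitmapIndex.mem_hit {ks C : Finset Str} {d : Str} :
    d ∈ hit ks C ↔ d ∈ ks ∧ ∃ k ∈ C, d <+: k := by simp [hit]

theorem flush_P_of_not_hit {v u : Str} {C : Finset Str} (hu : u ≠ v)
    (h : u ∉ hit (kids T.Q v) C) : (T.flush v C).P u = T.P u := by
  simp only [Tree.flush, if_neg hu]
  split_ifs with h1
  · have : C.filter (u <+: ·) = ∅ := Finset.filter_false_of_mem fun k hk hp =>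
      h (mem_hit.2 ⟨h1, k, hk, hp⟩)
    rw [this]
    exact symmDiff_bot _
  · rfl

/-- Only kids that receive keys can become bad. The keys that `v` takes itself change its weight by
at most `20 * B`, and 4736 + 20 = 4756. -/
theorem Inv.flush {v : Str} {C : Finset Str} (h : T.Inv B E v) (hC : C ⊆ T.P v)
    (hg : ∀ d ∈ kids T.Q v, T.Good B d) (hw : T.wt B v ≤ 4096 * B)
    (hd : ∀ d ∈ kids T.Q v, totalLen (C.filter (d <+: ·)) ≤ 19 * B)
    (hb : T.wt B v + 192 * B * (hit (kids T.Q v) C).card ≤ 4736 * B) : (T.flush v C).Inv B E v := by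
  have hT := h.wf
  have hcap : cap B ≤ B := Nat.div_le_self _ _
  have hgood : ∀ u, u ≠ v → u ∉ kids T.Q v → ((T.flush v C).Good B u ↔ T.Good B u) := by
    intro u h1 h2
    unfold Good
    rw [wt_flush_of_ne hT h.mem hC h1]
    simp [Tree.flush, h1, h2]
  have hkids : ∀ u, kids (T.flush v C).Q u = kids T.Q u := fun _ => rfl
  refine ⟨hT.flush h.mem hC, h.mem, fun u => ?_, fun u huQ huv => ?_, fun u huQ huv => ?_⟩
  · simp only [Tree.flush]
    split_ifs with h1 h2
    · exact (totalLen_mono Finset.sdiff_subset).trans (h.len v)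
    · have h3 := (hg u h2).1
      have h4 := hd u h2
      exact (totalLen_symmDiff_le _ _).trans (by omega)
    · exact h.len u
  · by_cases e : u = v
    · subst e
      have h1 := (wt_flush (B := B) hT h.mem hC).1
      have h2 : totalLen (ownPart (kids T.Q u) C) ≤ 20 * B :=
        (totalLen_mono ((ownPart_subset _ _).trans hC)).trans (h.len u)
      have h3 : (T.flush u C).bad B u u ⊆ hit (kids T.Q u) C := by
        intro c hc
        obtain ⟨hc, hcb⟩ := mem_bad.1 hc
        have hcg := hcb.resolve_right (not_prefix_of_mem_kids hc)
        by_contra hno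
        refine hcg ?_
        have h4 := hg c hc
        unfold Good at h4 ⊢
        rwa [wt_flush_of_ne hT h.mem hC (ne_of_mem_kids hc),
          flush_P_of_not_hit (ne_of_mem_kids hc) hno]
      have h4 := Nat.mul_le_mul_left (192 * B) (Finset.card_le_card h3)
      omega
    · rw [wt_flush_of_ne hT h.mem hC e]
      refine (Nat.add_le_add_left (Nat.mul_le_mul_left _ (Finset.card_le_card ?_)) _).trans
        (h.on u huQ huv)
      intro c hc
      obtain ⟨hc, hcb⟩ := mem_bad.1 hc
      have hc1 : c ∈ kids T.Q u := hc
      refine mem_bad.2 ⟨hc1, ?_⟩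
      by_cases e' : c = v
      · exact Or.inr (e' ▸ List.prefix_refl _)
      · rwa [hgood c e' fun h1 => e ((mem_kids.1 hc1).2.2.symm.trans (mem_kids.1 h1).2.2)] at hcb
  · have e : u ≠ v := fun e => huv (e ▸ List.prefix_refl _)
    rw [wt_flush_of_ne hT h.mem hC e]
    by_cases hk : u ∈ kids T.Q v
    · refine Or.inr ⟨?_, (hg u hk).2.2⟩
      change par T.Q u <+: v
      rw [(mem_kids.1 hk).2.2]
    · rw [hgood u e hk]
      exact h.off u huQ huv

end Tree

end BitmapIndex

/-! ### The potential, and progress of local operations. -/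

namespace BitmapIndex

variable {B E : ℕ} {T : Tree}

/-! ### The potential of a tree -/

/-- The potential of a set of keys that are pending at depth `v`. -/
def heat (v : Str) (Y : Finset Str) : ℕ := ∑ k ∈ Y, (k.length + 1) * (k.length - v.length + 1)

@[simp] theorem heat_empty (v : Str) : heat v ∅ = 0 := by simp [heat]

theorem heat_mono (v : Str) {Y Z : Finset Str} (h : Y ⊆ Z) : heat v Y ≤ heat v Z :=
  Finset.sum_le_sum_of_subset h

theorem heat_symmDiff_le (v : Str) (Y Z : Finset Str) :
    heat v (symmDiff Y Z) ≤ heat v Y + heat v Z := by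
  refine (heat_mono v (symmDiff_subset_union Y Z)).trans ?_
  unfold heat
  rw [← Finset.sum_union_inter]
  exact Nat.le_add_right _ _

namespace Tree

/-- The potential of the weight `w` of the cell `v`. -/
def strain (B : ℕ) (v : Str) (w : ℕ) : ℕ :=
  -- Zero for weights from `448 * B` to `2048 * B`, where the cells of an initial tree lie. A cell
  -- below `192 * B` has enough to pay for its absorption, a cell above `4096 * B` for its cut. The
  -- root is never absorbed and may be light.
  (if v = [] then 0 else 8 * (448 * B - w)) + 4 * (w - 2048 * B)

/-- The potential of the pending changes. -/
def heat (T : Tree) : ℕ := ∑ v ∈ T.Q, BitmapIndex.heat v (T.P v)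

/-- The potential of the weights. -/
def stress (B : ℕ) (T : Tree) : ℕ := ∑ v ∈ T.Q, strain B v (T.wt B v)

/-- The number of cells above the current one. -/
def depth (T : Tree) (cur : Str) : ℕ := (T.Q.filter (· <+: cur)).card

open Classical in
/-- The number of cells that have to be visited. -/
def unsettled (B : ℕ) (T : Tree) (cur : Str) : Finset Str :=
  T.Q.filter (fun v => ¬ v <+: cur ∧ T.Unsettled B v)

open Classical in
/-- The light cells with pending changes. -/
def hungry (B : ℕ) (T : Tree) : Finset Str :=
  T.Q.filter (fun v => v ≠ [] ∧ T.wt B v < 192 * B ∧ T.P v ≠ ∅)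

theorem mem_unsettled {cur v : Str} :
    v ∈ T.unsettled B cur ↔ v ∈ T.Q ∧ ¬ v <+: cur ∧ T.Unsettled B v := by simp [unsettled]

theorem mem_hungry {v : Str} :
    v ∈ T.hungry B ↔ v ∈ T.Q ∧ v ≠ [] ∧ T.wt B v < 192 * B ∧ T.P v ≠ ∅ := by simp [hungry]

/-- The part of the potential that does not depend on a current cell. -/
def rest (B : ℕ) (T : Tree) : ℕ := 2 ^ 33 * T.heat + T.stress B

/-- The potential in the course of the work at the cell `cur`. -/
def pot (B : ℕ) (T : Tree) (cur : Str) : ℕ :=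
  -- A step down adds one to the depth and removes an unsettled cell worth two. Emptying a hungry
  -- cell gains six and unsettles at most two kids, worth four.
  T.rest B + 64 * B * (T.depth cur + 2 * (T.unsettled B cur).card + 6 * (T.hungry B).card)

theorem pot_down (hT : T.WF E) {v d : Str} (hd : d ∈ kids T.Q v) (hu : T.Unsettled B d) :
    T.pot B d + 64 * B ≤ T.pot B v := by
  have hdQ := (mem_kids.1 hd).1
  have hvd := prefix_of_mem_kids hd
  have h1 : T.Q.filter (· <+: d) ⊆ insert d (T.Q.filter (· <+: v)) := by
    intro u hu
    obtain ⟨huQ, hud⟩ := Finset.mem_filter.1 hu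
    by_cases e : u = d
    · exact Finset.mem_insert.2 (Or.inl e)
    · refine Finset.mem_insert_of_mem (Finset.mem_filter.2 ⟨huQ, ?_⟩)
      exact (mem_kids.1 hd).2.2 ▸ prefix_par huQ hud e
  have h2 : insert d (T.unsettled B d) ⊆ T.unsettled B v := by
    intro u huu
    rcases Finset.mem_insert.1 huu with rfl | huu
    · exact mem_unsettled.2 ⟨hdQ, not_prefix_of_mem_kids hd, hu⟩
    · obtain ⟨h1, h2, h3⟩ := mem_unsettled.1 huu
      exact mem_unsettled.2 ⟨h1, fun h => h2 (h.trans hvd), h3⟩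
  have h3 := (Finset.card_le_card h1).trans (Finset.card_insert_le _ _)
  have h4 := Finset.card_le_card h2
  rw [Finset.card_insert_of_notMem fun h => (mem_unsettled.1 h).2.1 (List.prefix_refl _)] at h4
  unfold pot depth
  have : T.WF E := hT
  nlinarith

theorem pot_up (hT : T.WF E) {v : Str} (hvQ : v ∈ T.Q) (hv : v ≠ []) (hu : ¬ T.Unsettled B v) :
    T.pot B (par T.Q v) + 64 * B ≤ T.pot B v := by
  have hp := par_prefix T.Q v
  have h1 : insert v (T.Q.filter (· <+: par T.Q v)) ⊆ T.Q.filter (· <+: v) := by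
    intro u hu
    rcases Finset.mem_insert.1 hu with rfl | hu
    · exact Finset.mem_filter.2 ⟨hvQ, List.prefix_refl _⟩
    · obtain ⟨huQ, hup⟩ := Finset.mem_filter.1 hu
      exact Finset.mem_filter.2 ⟨huQ, hup.trans hp⟩
  have h2 : T.unsettled B (par T.Q v) ⊆ T.unsettled B v := by
    intro u huu
    obtain ⟨h1, h2, h3⟩ := mem_unsettled.1 huu
    refine mem_unsettled.2 ⟨h1, fun h => ?_, h3⟩
    by_cases e : u = v
    · exact hu (e ▸ h3)
    · exact h2 (prefix_par h1 h e)
  have h3 := Finset.card_le_card h1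
  have h5 : v ∉ T.Q.filter (· <+: par T.Q v) := fun h => par_ne hv
    (prefix_antisymm hp (Finset.mem_filter.1 h).2)
  rw [Finset.card_insert_of_notMem h5] at h3
  have h4 := Finset.card_le_card h2
  unfold pot depth
  have : T.WF E := hT
  nlinarith

theorem rest_le_pot_nil (hT : T.WF E) : T.rest B + 64 * B ≤ T.pot B [] := by
  have : 0 < (T.Q.filter (· <+: [])).card :=
    Finset.card_pos.2 ⟨[], Finset.mem_filter.2 ⟨hT.root, List.prefix_refl _⟩⟩
  unfold pot depth
  nlinarith

/-- The strain of `d`, more than `2048 * B`, vanishes. The weight of `v` falls by at most `64 * B`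
or rises by less than `128 * B`, either of which costs no more than `512 * B`, and one new hungry
cell costs `384 * B`. -/
theorem pot_absorb (hT : T.WF E) {v d : Str} (hv : v ∈ T.Q) (hd : d ∈ kids T.Q v)
    (hw : T.wt B d < 192 * B) (hp : T.P d = ∅) :
    (T.absorb d).pot B v + 64 * B ≤ T.pot B v := by
  have hne := ne_of_mem_kids hd
  obtain ⟨hdQ, hd0, -⟩ := mem_kids.1 hd
  obtain ⟨hw1, hw2⟩ := wt_absorb (B := B) hT hd
  have h1 : (T.absorb d).heat = T.heat :=
    Finset.sum_erase (f := fun v => BitmapIndex.heat v (T.P v)) (a := d) T.Q (by simp [hp])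
  have hvE : v ∈ T.Q.erase d := Finset.mem_erase.2 ⟨hne.symm, hv⟩
  have h2 : (T.absorb d).stress B + 1024 * B ≤ T.stress B := by
    have e1 : T.stress B = strain B d (T.wt B d) + (strain B v (T.wt B v)
        + ∑ u ∈ (T.Q.erase d).erase v, strain B u (T.wt B u)) := by
      rw [Finset.add_sum_erase _ (fun u => strain B u (T.wt B u)) hvE,
        Finset.add_sum_erase _ (fun u => strain B u (T.wt B u)) hdQ]
      rfl
    have e2 : (T.absorb d).stress B = strain B v ((T.absorb d).wt B v)
        + ∑ u ∈ (T.Q.erase d).erase v, strain B u (T.wt B u) := by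
      change ∑ u ∈ T.Q.erase d, strain B u ((T.absorb d).wt B u) = _
      rw [← Finset.add_sum_erase _ _ hvE]
      congr 1
      refine Finset.sum_congr rfl fun u hu => ?_
      obtain ⟨h1, h2⟩ := Finset.mem_erase.1 hu
      rw [wt_absorb_of_ne hT hd h1 (Finset.mem_erase.1 h2).1]
    rw [e1, e2]
    unfold strain
    rw [if_neg hd0]
    split_ifs <;> omega
  have h3 : (T.absorb d).depth v ≤ T.depth v :=
    Finset.card_le_card (Finset.filter_subset_filter _ (Finset.erase_subset _ _))
  have h4 : (T.absorb d).unsettled B v ⊆ T.unsettled B v := by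
    intro u hu
    obtain ⟨h1, h2, h3⟩ := mem_unsettled.1 hu
    obtain ⟨h4, h5⟩ := Finset.mem_erase.1 h1
    refine mem_unsettled.2 ⟨h5, h2, ?_⟩
    unfold Unsettled at h3
    rwa [wt_absorb_of_ne hT hd (fun e => h2 (e ▸ List.prefix_refl _)) h4] at h3
  have h5 : (T.absorb d).hungry B ⊆ insert v (T.hungry B) := by
    intro u hu
    obtain ⟨h1, h2, h3, h6⟩ := mem_hungry.1 hu
    obtain ⟨h4, h5⟩ := Finset.mem_erase.1 h1
    by_cases e : u = v
    · exact Finset.mem_insert.2 (Or.inl e)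
    · rw [wt_absorb_of_ne hT hd e h4] at h3
      exact Finset.mem_insert_of_mem (mem_hungry.2 ⟨h5, h2, h3, h6⟩)
  have h6 := Finset.card_le_card h4
  have h7 := (Finset.card_le_card h5).trans (Finset.card_insert_le _ _)
  unfold pot rest
  rw [h1]
  nlinarith

/-- The new cell is in the range without strain. The rest of `v` still weighs more than `2048 * B`,
so its loss of weight counts four times, and nothing becomes unsettled or hungry. -/
theorem pot_cut (hT : T.WF E) (hE : E ≤ 4 * B) {v h : Str} (hvQ : v ∈ T.Q)
    (hv : own T.Q h = v) (hh : h ∉ T.Q) (hl : h.length + 1 ≤ E) (hbig : 4096 * B < T.wt B v)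
    (hw : 960 * B ≤ wtIn (64 * B) T.Q T.R v h) (hw' : wtIn (64 * B) T.Q T.R v h ≤ 2048 * B) :
    (T.cut h).pot B v + 64 * B ≤ T.pot B v := by
  have hvh : v <+: h := hv ▸ own_prefix _ _
  have hne : h ≠ v := fun e => hh (e ▸ hvQ)
  have hnv : ¬ h <+: v := fun e => hne (prefix_antisymm e hvh)
  obtain ⟨hw1, hw2⟩ := wt_cut (B := B) hT hv hh hl
  have hw3 := wt_cut_self (B := B) hT hv hh
  have hPh : T.P h = ∅ := hT.pend_empty h hh
  have h1 : (T.cut h).heat = T.heat := by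
    simp [heat, Tree.cut, Finset.sum_insert hh, hPh]
  have h2 : (T.cut h).stress B + 64 * B ≤ T.stress B := by
    have e1 : T.stress B = strain B v (T.wt B v)
        + ∑ u ∈ T.Q.erase v, strain B u (T.wt B u) :=
      (Finset.add_sum_erase _ (fun u => strain B u (T.wt B u)) hvQ).symm
    have e2 : (T.cut h).stress B = strain B h ((T.cut h).wt B h) + (strain B v ((T.cut h).wt B v)
        + ∑ u ∈ T.Q.erase v, strain B u (T.wt B u)) := by
      change ∑ u ∈ insert h T.Q, strain B u ((T.cut h).wt B u) = _
      rw [Finset.sum_insert hh, ← Finset.add_sum_erase _ _ hvQ]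
      congr 2
      refine Finset.sum_congr rfl fun u hu => ?_
      obtain ⟨h1, h2⟩ := Finset.mem_erase.1 hu
      rw [wt_cut_of_ne hT hv hh h1 fun e => hh (e ▸ h2)]
    rw [e1, e2, hw3]
    unfold strain
    split_ifs <;> omega
  have h3 : (T.cut h).depth v = T.depth v := by
    unfold depth
    congr 1
    change (insert h T.Q).filter _ = _
    rw [Finset.filter_insert, if_neg hnv]
  have hcases : ∀ u ∈ (T.cut h).Q, u = h ∨ u ∈ T.Q := fun u hu => Finset.mem_insert.1 hu
  have h4 : (T.cut h).unsettled B v ⊆ T.unsettled B v := by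
    intro u hu
    obtain ⟨h1, h2, h3⟩ := mem_unsettled.1 hu
    unfold Unsettled at h3
    rcases hcases u h1 with rfl | h1
    · rw [hw3] at h3
      rcases h3 with h3 | h3 | ⟨h3, -⟩
      · simp [Tree.cut, hPh] at h3
      · omega
      · omega
    · rw [wt_cut_of_ne hT hv hh (fun e => h2 (e ▸ List.prefix_refl _)) fun e => hh (e ▸ h1)] at h3
      exact mem_unsettled.2 ⟨h1, h2, h3⟩
  have h5 : (T.cut h).hungry B ⊆ T.hungry B := by
    intro u hu
    obtain ⟨h1, h2, h3, h6⟩ := mem_hungry.1 hu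
    rcases hcases u h1 with rfl | h1
    · omega
    · by_cases e : u = v
      · subst e; omega
      · rw [wt_cut_of_ne hT hv hh e fun e => hh (e ▸ h1)] at h3
        exact mem_hungry.2 ⟨h1, h2, h3, h6⟩
  have h6 := Finset.card_le_card h4
  have h7 := Finset.card_le_card h5
  unfold pot rest
  rw [h1, h3]
  nlinarith

/-- A key that goes to a kid gets a smaller second factor, as the kid is strictly longer than `v`; a
key that reaches its destination gives up at least its own length plus one. -/
theorem heat_flush {v : Str} (hv : v ∈ T.Q) {C : Finset Str} (hC : C ⊆ T.P v) :
    (T.flush v C).heat + totalLen C ≤ T.heat := by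
  have hvk : v ∉ kids T.Q v := fun h => ne_of_mem_kids h rfl
  have h1 : ∀ u ∈ T.Q, BitmapIndex.heat u ((T.flush v C).P u)
      + (if u = v then BitmapIndex.heat v C else 0) ≤ BitmapIndex.heat u (T.P u) +
        (if u ∈ kids T.Q v then BitmapIndex.heat u (C.filter (u <+: ·)) else 0) := by
    intro u _
    simp only [flush]
    by_cases e : u = v
    · subst e
      rw [if_pos rfl, if_pos rfl, if_neg hvk]
      exact (Finset.sum_sdiff hC).le
    · simp only [if_neg e]
      split_ifs with h
      · simpa using heat_symmDiff_le _ _ _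
      · simp
  have h2 : ∑ u ∈ T.Q, (if u ∈ kids T.Q v then BitmapIndex.heat u (C.filter (u <+: ·)) else 0)
      = ∑ u ∈ kids T.Q v, BitmapIndex.heat u (C.filter (u <+: ·)) := by
    rw [← Finset.sum_filter]
    refine Finset.sum_congr ?_ fun _ _ => rfl
    ext u
    simp only [Finset.mem_filter, mem_kids]
    tauto
  have h3 : ∑ u ∈ kids T.Q v, BitmapIndex.heat u (C.filter (u <+: ·)) + totalLen C
      ≤ BitmapIndex.heat v C := by
    have e : ∑ u ∈ kids T.Q v, BitmapIndex.heat u (C.filter (u <+: ·)) = ∑ k ∈ C,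
        ∑ u ∈ kids T.Q v, if u <+: k then (k.length + 1) * (k.length - u.length + 1) else 0 := by
      rw [Finset.sum_comm]
      simp only [BitmapIndex.heat, Finset.sum_filter]
    rw [e, totalLen, ← Finset.sum_add_distrib]
    refine Finset.sum_le_sum fun k hk => ?_
    by_cases h : ∃ d ∈ kids T.Q v, d <+: k
    · obtain ⟨d, hd, hdk⟩ := h
      rw [Finset.sum_eq_single_of_mem d hd fun e he hne =>
        if_neg (not_prefix_of_kids hd he hne.symm hdk), if_pos hdk]
      have h4 : v.length < d.length := lt_of_le_of_ne (prefix_of_mem_kids hd).length_le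
        fun e => ne_of_mem_kids hd ((prefix_of_mem_kids hd).eq_of_length e).symm
      have h5 := hdk.length_le
      rw [← Nat.mul_succ]
      exact Nat.mul_le_mul_left _ (by omega)
    · push Not at h
      rw [Finset.sum_eq_zero fun e he => if_neg (h e he), zero_add]
      exact Nat.le_mul_of_pos_right _ (Nat.succ_pos _)
  have h4 := Finset.sum_le_sum h1
  rw [Finset.sum_add_distrib, Finset.sum_add_distrib, h2, Finset.sum_ite_eq' T.Q v, if_pos hv] at h4
  change ∑ u ∈ T.Q, BitmapIndex.heat u ((T.flush v C).P u) + _ ≤ ∑ u ∈ T.Q, _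
  omega

/-- Strain has slopes of at most eight, and the weight of `v` changes by no more than the length of
what it takes. -/
theorem stress_flush (hT : T.WF E) {v : Str} (hv : v ∈ T.Q) {C : Finset Str} (hC : C ⊆ T.P v) :
    (T.flush v C).stress B ≤ T.stress B + 8 * totalLen C := by
  obtain ⟨h1, h2⟩ := wt_flush (B := B) hT hv hC
  have h3 := totalLen_mono (ownPart_subset (kids T.Q v) C)
  have e1 : T.stress B = strain B v (T.wt B v)
      + ∑ u ∈ T.Q.erase v, strain B u (T.wt B u) :=
    (Finset.add_sum_erase _ (fun u => strain B u (T.wt B u)) hv).symm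
  have e2 : (T.flush v C).stress B = strain B v ((T.flush v C).wt B v)
      + ∑ u ∈ T.Q.erase v, strain B u (T.wt B u) := by
    change ∑ u ∈ T.Q, strain B u ((T.flush v C).wt B u) = _
    rw [← Finset.add_sum_erase _ _ hv]
    congr 1
    refine Finset.sum_congr rfl fun u hu => ?_
    rw [wt_flush_of_ne hT hv hC (Finset.mem_erase.1 hu).1]
  rw [e1, e2]
  unfold strain
  split_ifs <;> omega

theorem unsettled_flush (hT : T.WF E) {v : Str} (hv : v ∈ T.Q) {C : Finset Str} (hC : C ⊆ T.P v) :
    (T.flush v C).unsettled B v ⊆ T.unsettled B v ∪ hit (kids T.Q v) C := by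
  intro u hu
  obtain ⟨h1, h2, h3⟩ := mem_unsettled.1 hu
  have e : u ≠ v := fun e => h2 (e ▸ List.prefix_refl _)
  by_cases hh : u ∈ hit (kids T.Q v) C
  · exact Finset.mem_union_right _ hh
  · unfold Unsettled at h3
    rw [wt_flush_of_ne hT hv hC e, flush_P_of_not_hit e hh] at h3
    exact Finset.mem_union_left _ (mem_unsettled.2 ⟨h1, h2, h3⟩)

theorem hungry_flush (hT : T.WF E) {v : Str} (hv : v ∈ T.Q) {C : Finset Str} (hC : C ⊆ T.P v)
    (hg : ∀ d ∈ kids T.Q v, T.Good B d) : (T.flush v C).hungry B ⊆ insert v (T.hungry B) := by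
  intro u hu
  obtain ⟨h1, h2, h3, h4⟩ := mem_hungry.1 hu
  by_cases e : u = v
  · exact Finset.mem_insert.2 (Or.inl e)
  · rw [wt_flush_of_ne hT hv hC e] at h3
    by_cases hh : u ∈ hit (kids T.Q v) C
    · exact absurd (hg u (mem_hit.1 hh).1).2.1 (by omega)
    · rw [flush_P_of_not_hit e hh] at h4
      exact Finset.mem_insert_of_mem (mem_hungry.2 ⟨h1, h2, h3, h4⟩)

theorem _root_.BitmapIndex.not_prefix_of_mem_ownPart {ks C : Finset Str} {k d : Str}
    (hk : k ∈ ownPart ks C) (hd : d ∈ ks) : ¬ d <+: k :=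
  (Finset.mem_filter.1 hk).2 d hd

/-- The tree after an operation at the cell `v`. -/
def apply (T : Tree) (v : Str) : Op → Tree
  | .absorb d => T.absorb d
  | .down _ => T
  | .cut h => T.cut h
  | .flush C => T.flush v C
  | .up => T

/-- The current cell after an operation at the cell `v`. -/
def move (T : Tree) (v : Str) : Op → Str
  | .down d => d
  | .up => par T.Q v
  | _ => v

theorem hit_card_of_chunk {v : Str} {C : Finset Str}
    (h : C = ownPart (kids T.Q v) (T.P v) ∨ ∃ d ∈ kids T.Q v, ∀ k ∈ C, d <+: k) :
    (hit (kids T.Q v) C).card ≤ 1 := by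
  rcases h with h | ⟨d, hd, h⟩
  · rw [Finset.card_eq_zero.2 ?_]
    · exact zero_le_one
    · refine Finset.eq_empty_of_forall_notMem fun u hu => ?_
      obtain ⟨h1, k, hk, h2⟩ := mem_hit.1 hu
      rw [h] at hk
      exact (Finset.mem_filter.1 hk).2 u h1 h2
  · refine Finset.card_le_one_iff_subset_singleton.2 ⟨d, fun u hu => ?_⟩
    obtain ⟨h1, k, hk, h2⟩ := mem_hit.1 hu
    rw [Finset.mem_singleton]
    by_contra hne
    exact not_prefix_of_kids h1 hd hne h2 (h k hk)

/-- A chunk pays with its heat for one unsettled and one hungry cell. A light cell may have little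
heat to flush, but it ceases to be hungry, and with a weight below `192 * B` it has at most two kids
to unsettle. -/
theorem pot_flush (hT : T.WF E) {v : Str} (hv : v ∈ T.Q) {C : Finset Str}
    (hl : T.Legal B v (.flush C)) : (T.flush v C).pot B v + 64 * B ≤ T.pot B v := by
  obtain ⟨hg, hw, hC, hl⟩ := hl
  have h1 := heat_flush hv hC
  have h2 := stress_flush (B := B) hT hv hC
  have h3 := (Finset.card_le_card (unsettled_flush (B := B) hT hv hC)).trans
    (Finset.card_union_le _ _)
  have h4 := hungry_flush hT hv hC hg
  have h5 : (T.flush v C).depth v = T.depth v := rfl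
  unfold pot rest
  rw [h5]
  rcases hl with ⟨h6, h7⟩ | ⟨h6, h7, h8, rfl, h9⟩
  · have h8 := hit_card_of_chunk (h7.imp_right fun ⟨d, hd, h, _⟩ => ⟨d, hd, h⟩)
    have h9 := (Finset.card_le_card h4).trans (Finset.card_insert_le _ _)
    have h10 : B < 65536 * (cap B + 1) := by
      unfold cap
      omega
    have h11 : (T.flush v C).depth v = T.depth v := rfl
    have h12 : T.depth v + 2 * ((T.flush v C).unsettled B v).card
        + 6 * ((T.flush v C).hungry B).card ≤ (T.depth v + 2 * (T.unsettled B v).card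
        + 6 * (T.hungry B).card) + 8 := by omega
    have h13 := Nat.mul_le_mul_left (64 * B) h12
    rw [Nat.mul_add _ _ 8] at h13
    omega
  · have h8' : (hit (kids T.Q v) (T.P v)).card ≤ 2 := by
      refine (Finset.card_le_card (Finset.filter_subset _ _)).trans ?_
      exact kids_card_le (B := B) (T := T) (by unfold wt BitmapIndex.wt; omega)
    have hmem : v ∈ T.hungry B := mem_hungry.2 ⟨hv, h6, h7, h8⟩
    have h10 : (T.flush v (T.P v)).hungry B ⊆ (T.hungry B).erase v := by
      intro u hu
      have hu' := h4 hu
      rw [Finset.insert_eq_of_mem hmem] at hu'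
      refine Finset.mem_erase.2 ⟨?_, hu'⟩
      rintro rfl
      exact (mem_hungry.1 hu).2.2.2 (by simp [Tree.flush])
    have h11 := Finset.card_le_card h10
    have h12 := Finset.card_erase_add_one hmem
    have h13 : T.depth v + 2 * ((T.flush v (T.P v)).unsettled B v).card
        + 6 * ((T.flush v (T.P v)).hungry B).card + 1 ≤ (T.depth v + 2 * (T.unsettled B v).card
        + 6 * (T.hungry B).card) := by omega
    have h14 := Nat.mul_le_mul_left (64 * B) h13
    rw [Nat.mul_add] at h14
    omega

theorem Legal.cut_own (hT : T.WF E) {v h : Str} (hv : v ∈ T.Q) (hl : T.Legal B v (.cut h)) :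
    own T.Q h = v ∧ h ∉ T.Q := by
  obtain ⟨_, _, h1, h2, h3, _⟩ := hl
  have := (own_eq_iff hT.root hv h1).2 h3
  exact ⟨this, fun hh => h2 (own_self hh ▸ this)⟩

/-- The piece has positive weight, so `h` is a prefix of a key or of a cell. -/
theorem Legal.cut_length (hT : T.WF E) (hB : 0 < B) {v h : Str} (hl : T.Legal B v (.cut h)) :
    h.length + 1 ≤ E := by
  obtain ⟨_, _, _, _, h3, h4, _⟩ := hl
  have : (kids T.Q v).filter (h <+: ·) = ∅ ∨ ∃ d ∈ T.Q, h <+: d := by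
    rcases ((kids T.Q v).filter (h <+: ·)).eq_empty_or_nonempty with e | ⟨d, hd⟩
    · exact Or.inl e
    · exact Or.inr ⟨d, (mem_kids.1 (Finset.mem_filter.1 hd).1).1, (Finset.mem_filter.1 hd).2⟩
  rcases this with e | ⟨d, hd, hhd⟩
  · rw [e] at h4
    rcases ((reg T.Q T.R v).filter (h <+: ·)).eq_empty_or_nonempty with e' | ⟨k, hk⟩
    · rw [e'] at h4
      simp at h4
      omega
    · obtain ⟨h5, h6⟩ := Finset.mem_filter.1 hk
      have := hT.lenR k (mem_reg.1 h5).1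
      have := h6.length_le
      omega
  · have := hT.lenQ d hd
    have := hhd.length_le
    omega

/-- An appropriate operation maintains the invariant, the represented set, and decreases the
potential, unless the work is done. -/
theorem Inv.apply {v : Str} {o : Op} (h : T.Inv B E v) (hE : E ≤ 4 * B) (hB : 0 < B)
    (hl : T.Legal B v o) (hup : o = .up → v ≠ []) :
    (T.apply v o).Inv B E (T.move v o) ∧ (T.apply v o).pot B (T.move v o) + 64 * B ≤ T.pot B v ∧
      ∀ k, (T.apply v o).content k = T.content k := by
  cases o with
  | absorb d =>
    obtain ⟨h1, h2, h3⟩ := hl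
    exact ⟨h.absorb hB h1 h2 h3, pot_absorb h.wf h.mem h1 h2 h3, content_absorb h3⟩
  | down d =>
    obtain ⟨h1, h2⟩ := hl
    refine ⟨h.down h1 ?_, pot_down h.wf h1 h2, fun _ => rfl⟩
    intro hg
    have h3 : totalLen (T.P d) ≤ cap B := hg.1
    have h4 : 192 * B ≤ T.wt B d ∧ T.wt B d ≤ 4096 * B := hg.2
    unfold BitmapIndex.Unsettled at h2
    omega
  | cut c =>
    obtain ⟨h1, h2⟩ := hl.cut_own h.wf h.mem
    have h3 := hl.cut_length h.wf hB
    obtain ⟨h4, h5, _, _, _, h6, h7⟩ := hl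
    exact ⟨h.cut hE h1 h2 h3 h4 h6 h7, pot_cut h.wf hE h.mem h1 h2 h3 h5 h6 h7,
      content_cut h.wf h2⟩
  | flush C =>
    refine ⟨?_, pot_flush h.wf h.mem hl, content_flush h.mem hl.2.2.1⟩
    obtain ⟨hg, hw, hC, hl⟩ := hl
    have hcap : cap B ≤ B := Nat.div_le_self _ _
    have hf : ∀ d, totalLen (C.filter (d <+: ·)) ≤ totalLen C :=
      fun d => totalLen_mono (Finset.filter_subset _ _)
    rcases hl with ⟨h6, h7⟩ | ⟨h6, h7, h8, rfl, h9⟩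
    · have h8 := hit_card_of_chunk (h7.imp_right fun ⟨d, hd, h, _⟩ => ⟨d, hd, h⟩)
      have h9 := Nat.mul_le_mul_left (192 * B) h8
      refine h.flush hC hg hw (fun d hd => ?_) ?_
      · rcases h7 with rfl | ⟨e, _, _, h7⟩
        · rw [Finset.filter_false_of_mem fun k hk => not_prefix_of_mem_ownPart hk hd]
          simp
        · have := hf d
          omega
      · change trieSize _ + 64 * B * _ + _ ≤ _
        omega
    · have h8' : (hit (kids T.Q v) (T.P v)).card ≤ 2 := by
        refine (Finset.card_le_card (Finset.filter_subset _ _)).trans ?_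
        exact kids_card_le (B := B) (T := T) (by unfold wt BitmapIndex.wt; omega)
      have h10 := Nat.mul_le_mul_left (192 * B) h8'
      refine h.flush hC hg hw (fun d hd => ?_) ?_
      · have := hf d
        omega
      · change trieSize _ + 64 * B * _ + _ ≤ _
        omega
  | up =>
    obtain ⟨h1, h2, h3, h4⟩ := hl
    have hv := hup rfl
    refine ⟨h.up h2 h1, pot_up h.wf h.mem hv ?_, fun _ => rfl⟩
    have h2' : T.wt B v ≤ 4096 * B := h2
    have h4' : v = [] ∨ 192 * B ≤ T.wt B v ∨ T.P v = ∅ := h4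
    rintro (h5 | h5 | ⟨h5, h6⟩)
    · omega
    · omega
    · rcases h4' with h4 | h4 | h4
      · exact hv h4
      · omega
      · exact h6 h4

/-- A tree without unsettled cells. -/
structure Settled (B E : ℕ) (T : Tree) : Prop where
  wf : T.WF E
  len : totalLen (T.P []) ≤ cap B
  wt_root : T.wt B [] ≤ 4096 * B
  good : ∀ v ∈ T.Q, v ≠ [] → T.Good B v

theorem Inv.settled (h : T.Inv B E []) (hl : T.Legal B [] .up) : T.Settled B E := by
  obtain ⟨h1, h2, h3, -⟩ := hl
  refine ⟨h.wf, h3, h2, fun v hv hv0 => ?_⟩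
  rcases h.off v hv (fun h => hv0 (List.prefix_nil.1 h)) with h4 | h4
  · exact h4
  · exact h1 v (mem_kids.2 ⟨hv, hv0, List.prefix_nil.1 h4.1⟩)

theorem Settled.pend_le (h : T.Settled B E) (v : Str) : totalLen (T.P v) ≤ cap B := by
  by_cases hv : v ∈ T.Q
  · by_cases e : v = []
    · exact e ▸ h.len
    · exact (h.good v hv e).1
  · simp [h.wf.pend_empty v hv]

theorem Settled.wt_le (h : T.Settled B E) {v : Str} (hv : v ∈ T.Q) : T.wt B v ≤ 4096 * B := by
  by_cases e : v = []
  · exact e ▸ h.wt_root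
  · exact (h.good v hv e).2.2

/-- Adding pending changes at the root. -/
def load (T : Tree) (Y : Finset Str) : Tree :=
  ⟨T.Q, T.R, fun v => if v = [] then symmDiff (T.P []) Y else T.P v⟩

theorem wt_load (Y : Finset Str) (v : Str) : (T.load Y).wt B v = T.wt B v := rfl

theorem WF.load (hT : T.WF E) {Y : Finset Str} (hY : ∀ k ∈ Y, k.length + 1 ≤ E) :
    (T.load Y).WF E where
  root := hT.root
  pend_empty v hv := by
    have : v ≠ [] := fun e => hv (e ▸ hT.root)
    simpa [Tree.load, this] using hT.pend_empty v hv
  pend_prefix v k hk := by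
    simp only [Tree.load] at hk
    split_ifs at hk with h
    · exact h ▸ List.nil_prefix
    · exact hT.pend_prefix v k hk
  lenR := hT.lenR
  lenP v k hk := by
    simp only [Tree.load] at hk
    split_ifs at hk with h
    · rcases Finset.mem_symmDiff.1 hk with h | h
      exacts [hT.lenP _ _ h.1, hY k h.1]
    · exact hT.lenP v k hk
  lenQ := hT.lenQ

theorem content_load (hT : T.WF E) (Y : Finset Str) (k : Str) :
    (T.load Y).content k = T.content k + ind Y k := by
  change ind T.R k + ∑ v ∈ T.Q, _ = ind T.R k + _ + _
  rw [← Finset.add_sum_erase _ _ hT.root, ← Finset.add_sum_erase _ _ hT.root]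
  have : ∑ v ∈ T.Q.erase [], ind ((T.load Y).P v) k = ∑ v ∈ T.Q.erase [], ind (T.P v) k := by
    refine Finset.sum_congr rfl fun v hv => ?_
    simp [Tree.load, (Finset.mem_erase.1 hv).1]
  rw [this]
  simp only [Tree.load, if_true, ind_symmDiff]
  ring

theorem rest_load (hT : T.WF E) (Y : Finset Str) :
    (T.load Y).rest B ≤ T.rest B + 2 ^ 33 * BitmapIndex.heat [] Y := by
  have : (T.load Y).heat ≤ T.heat + BitmapIndex.heat [] Y := by
    change ∑ v ∈ T.Q, _ ≤ ∑ v ∈ T.Q, _ + _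
    rw [← Finset.add_sum_erase _ _ hT.root, ← Finset.add_sum_erase _ _ hT.root]
    have : ∑ v ∈ T.Q.erase [], BitmapIndex.heat v ((T.load Y).P v)
        = ∑ v ∈ T.Q.erase [], BitmapIndex.heat v (T.P v) := by
      refine Finset.sum_congr rfl fun v hv => ?_
      simp [Tree.load, (Finset.mem_erase.1 hv).1]
    rw [this]
    have h2 : BitmapIndex.heat [] ((T.load Y).P []) ≤ BitmapIndex.heat [] (T.P [])
        + BitmapIndex.heat [] Y := by
      simpa [Tree.load] using heat_symmDiff_le [] (T.P []) Y
    exact (Nat.add_le_add_right h2 _).trans (le_of_eq (Nat.add_right_comm _ _ _))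
  have h3 : (T.load Y).stress B = T.stress B := rfl
  unfold rest
  rw [h3]
  omega

theorem Settled.inv_load (h : T.Settled B E) {Y : Finset Str} (hY : ∀ k ∈ Y, k.length + 1 ≤ E)
    (hl : totalLen Y ≤ 19 * B) : (T.load Y).Inv B E [] := by
  have hcap : cap B ≤ B := Nat.div_le_self _ _
  have hgood : ∀ v, v ≠ [] → ((T.load Y).Good B v ↔ T.Good B v) := fun v hv => by
    unfold Good
    rw [wt_load]
    simp [Tree.load, hv]
  refine ⟨h.wf.load hY, h.wf.root, fun v => ?_, fun v hv hv0 => ?_, fun v hv hv0 => Or.inl ?_⟩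
  · simp only [Tree.load]
    have h0 := h.len
    split_ifs
    · exact (totalLen_symmDiff_le _ _).trans (by omega)
    · exact (h.pend_le v).trans (by omega)
  · obtain rfl := List.prefix_nil.1 hv0
    have : (T.load Y).bad B [] [] = ∅ := by
      refine Finset.eq_empty_of_forall_notMem fun c hc => ?_
      obtain ⟨h1, h2⟩ := mem_bad.1 hc
      have hc0 := (mem_kids.1 h1).2.1
      rcases h2 with h2 | h2
      · exact h2 ((hgood c hc0).2 (h.good c (mem_kids.1 h1).1 hc0))
      · exact hc0 (List.prefix_nil.1 h2)
    rw [this, wt_load]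
    have := h.wt_root
    simp
    omega
  · have : v ≠ [] := fun e => hv0 (e ▸ List.prefix_refl _)
    exact (hgood v this).2 (h.good v hv this)

/-- Loading touches the root only, which is neither counted as unsettled nor as hungry; just the
depth of the root is added. -/
theorem Settled.pot_load_le (h : T.Settled B E) (Y : Finset Str) :
    (T.load Y).pot B [] ≤ (T.load Y).rest B + 64 * B := by
  have hgood : ∀ v, v ≠ [] → v ∈ T.Q → (T.load Y).Good B v := fun v hv hvQ => by
    have := h.good v hvQ hv
    unfold Good at this ⊢
    rw [wt_load]
    simpa [Tree.load, hv] using this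
  have h1 : (T.load Y).unsettled B [] = ∅ := by
    refine Finset.eq_empty_of_forall_notMem fun v hv => ?_
    obtain ⟨h1, h2, h3⟩ := mem_unsettled.1 hv
    obtain ⟨h4, h5, h6⟩ := hgood v (fun e => h2 (e ▸ List.prefix_refl _)) h1
    unfold Unsettled BitmapIndex.Unsettled at h3
    omega
  have h2 : (T.load Y).hungry B = ∅ := by
    refine Finset.eq_empty_of_forall_notMem fun v hv => ?_
    obtain ⟨h1, h2, h3, _⟩ := mem_hungry.1 hv
    obtain ⟨h4, h5, h6⟩ := hgood v h2 h1
    omega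
  have h3 : (T.load Y).depth [] ≤ 1 := by
    refine Finset.card_le_one_iff_subset_singleton.2 ⟨[], fun v hv => ?_⟩
    simpa using (Finset.mem_filter.1 hv).2
  unfold pot
  rw [h1, h2]
  simp only [Finset.card_empty]
  nlinarith

end Tree

end BitmapIndex

/-! ### Coding of records in blocks. -/

namespace BitmapIndex

/-! ### Records in blocks -/

/-- The `i`-th block of a bit string. -/
def bitsBlock (B : ℕ) (l : Str) (i : ℕ) : BitVec B :=
  (BitVec.ofBoolListLE (List.ofFn fun j : Fin B => l.getD (i * B + j) false)).cast (by simp)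

theorem getLsbD_bitsBlock {B : ℕ} (l : Str) (i : ℕ) {j : ℕ} (hj : j < B) :
    (bitsBlock B l i).getLsbD j = l.getD (i * B + j) false := by
  rw [bitsBlock, BitVec.getLsbD_cast, BitVec.getLsbD_ofBoolListLE,
    List.getD_eq_getElem _ _ (by simpa using hj), List.getElem_ofFn]

/-- The blocks of a bit string, padded to `R` blocks. -/
def packBlocks (B R : ℕ) (l : Str) : List (BitVec B) := (List.range R).map (bitsBlock B l)

@[simp] theorem length_packBlocks (B R : ℕ) (l : Str) : (packBlocks B R l).length = R := by
  simp [packBlocks]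

theorem packBlocks_nil (B R : ℕ) : packBlocks B R [] = List.replicate R 0 := by
  refine List.ext_getElem (by simp) fun i h1 h2 => ?_
  simp only [packBlocks, List.getElem_map, List.getElem_range, List.getElem_replicate]
  refine BitVec.eq_of_getLsbD_eq fun j hj => ?_
  rw [getLsbD_bitsBlock _ _ hj]
  simp

theorem getD_eq_of_packBlocks {B R : ℕ} {l l' : Str} (hl : l.length ≤ R * B)
    (hl' : l'.length ≤ R * B) (h : packBlocks B R l = packBlocks B R l') (m : ℕ) :
    l.getD m false = l'.getD m false := by
  by_cases hm : m < R * B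
  · have hB : 0 < B := by
      rcases Nat.eq_zero_or_pos B with rfl | h
      · simp at hm
      · exact h
    have hi : m / B < R := Nat.div_lt_of_lt_mul (by rwa [mul_comm])
    have e : bitsBlock B l (m / B) = bitsBlock B l' (m / B) := by
      have := congrArg (fun x => x[m / B]?) h
      simpa [packBlocks, hi] using this
    have e2 := congrArg (fun b => b.getLsbD (m % B)) e
    simp only [getLsbD_bitsBlock _ _ (Nat.mod_lt m hB)] at e2
    have e3 : m / B * B + m % B = m := Nat.div_add_mod' m B
    rwa [e3] at e2
  · rw [List.getD_eq_default _ _ (by omega), List.getD_eq_default _ _ (by omega)]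

/-- Padding with zeros can be undone if a nonempty string ends with `true`. -/
theorem eq_of_getD_eq {l l' : Str} (h : ∀ m, l.getD m false = l'.getD m false)
    (hl : l = [] ∨ ∃ t, l = t ++ [true]) (hl' : l' = [] ∨ ∃ t, l' = t ++ [true]) : l = l' := by
  have key : ∀ {l l' : Str}, (∀ m, l.getD m false = l'.getD m false) →
      (l' = [] ∨ ∃ t, l' = t ++ [true]) → l'.length ≤ l.length := by
    intro l l' h hl'
    rcases hl' with rfl | ⟨t, rfl⟩
    · simp
    · by_contra hlt
      rw [List.length_append, List.length_singleton] at hlt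
      have := h t.length
      rw [List.getD_eq_default _ _ (by omega)] at this
      simp at this
  refine List.ext_getElem (le_antisymm (key (fun m => (h m).symm) hl) (key h hl'))
    fun i h1 h2 => ?_
  have := h i
  rwa [List.getD_eq_getElem _ _ h1, List.getD_eq_getElem _ _ h2] at this

theorem exists_recSize : ∃ n : ℕ, n = 32768 := ⟨_, rfl⟩

/-- The number of blocks that hold the record of a cell; a number that does not unfold. -/
def recSize : ℕ := exists_recSize.choose

theorem recSize_eq : recSize = 32768 := exists_recSize.choose_spec

/-- The record of a cell: the address of the cell above, the keys and pending changes of the cell,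
and the cells below with their addresses. -/
structure Rec where
  cell : Str
  up : ℕ
  reg : Finset Str
  pend : Finset Str
  kid : Finset (Str × ℕ)

namespace Rec

/-- The record of the only cell of an empty tree. -/
def blank : Rec := ⟨[], 0, ∅, ∅, ∅⟩

def code (r : Rec) : Str :=
  strCode r.cell ++ (natCode r.up ++ (trieCode r.reg ++ (trieCode r.pend ++
    finsetCode (fun x : Str × ℕ => strCode x.1 ++ natCode x.2) r.kid)))

theorem code_injective : Function.Injective code := by
  rintro ⟨a1, a2, a3, a4, a5⟩ ⟨b1, b2, b3, b4, b5⟩ h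
  simp only [code] at h
  obtain ⟨rfl, h1⟩ := prefixInj_strCode _ _ _ _ h
  obtain ⟨rfl, h2⟩ := prefixInj_natCode _ _ _ _ h1
  obtain ⟨rfl, h3⟩ := prefixInj_trieCode _ _ _ _ h2
  obtain ⟨rfl, h4⟩ := prefixInj_trieCode _ _ _ _ h3
  obtain rfl := (prefixInj_strCode.pair prefixInj_natCode).finsetCode.injective h4
  rfl

/-- The record fits into its blocks. -/
def Fits (B : ℕ) (r : Rec) : Prop := r.code.length < recSize * B

open Classical in
-- The final `true` separates the code from the padding. The blank record has no bits, so zero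
-- blocks hold it: freed records look like unused memory, and blank memory is a tree without keys.
def bits (r : Rec) : Str := if r = blank then [] else r.code ++ [true]

def blocks (B : ℕ) (r : Rec) : List (BitVec B) := packBlocks B recSize r.bits

@[simp] theorem length_blocks (B : ℕ) (r : Rec) : (r.blocks B).length = recSize := by
  simp [blocks]

theorem blocks_blank (B : ℕ) : blank.blocks B = List.replicate recSize 0 := by
  simp [blocks, bits, packBlocks_nil]

theorem blocks_injOn {B : ℕ} {r r' : Rec} (h : r.Fits B) (h' : r'.Fits B)
    (e : r.blocks B = r'.blocks B) : r = r' := by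
  have hl : ∀ {r : Rec}, r.Fits B → r.bits.length ≤ recSize * B := by
    intro r h
    unfold bits
    unfold Fits at h
    split_ifs
    · simp
    · simp only [List.length_append, List.length_singleton]; omega
  have hb : ∀ r : Rec, r.bits = [] ∨ ∃ t, r.bits = t ++ [true] := by
    intro r
    unfold bits
    split_ifs
    exacts [Or.inl rfl, Or.inr ⟨_, rfl⟩]
  have := eq_of_getD_eq (getD_eq_of_packBlocks (hl h) (hl h') e) (hb r) (hb r')
  unfold bits at this
  split_ifs at this with h1 h2 h2
  · rw [h1, h2]
  · simp at this
  · simp at this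
  · exact code_injective (List.append_left_injective _ this)

open Classical in
/-- The record in given blocks. -/
def ofBlocks (B : ℕ) (l : List (BitVec B)) : Rec :=
  if h : ∃ r : Rec, r.Fits B ∧ r.blocks B = l then h.choose else blank

theorem ofBlocks_blocks {B : ℕ} {r : Rec} (h : r.Fits B) : ofBlocks B (r.blocks B) = r := by
  have h' : ∃ r' : Rec, r'.Fits B ∧ r'.blocks B = r.blocks B := ⟨r, h, rfl⟩
  rw [ofBlocks, dif_pos h']
  exact blocks_injOn h'.choose_spec.1 h h'.choose_spec.2

theorem length_code_le {B E N a : ℕ} {r : Rec} (h1 : r.cell.length + 1 ≤ E) (h2 : r.up < 2 ^ N)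
    (h3 : trieSize r.reg ≤ a) (h4 : trieSize r.pend ≤ 20 * B) {K : ℕ} (h5 : r.kid.card ≤ K)
    (h6 : ∀ x ∈ r.kid, x.1.length + 1 ≤ E ∧ x.2 < 2 ^ N) :
    r.code.length ≤ 3 * E + 2 * N + 3 * a + 60 * B + K * (3 * E + 2 * N + 1) + 4 := by
  have e1 := length_strCode_le r.cell
  have e2 : r.up.size ≤ N := Nat.size_le.2 h2
  have e3 := length_finsetCode_le (fun x : Str × ℕ => strCode x.1 ++ natCode x.2) r.kid
    (3 * E + 2 * N) fun x hx => by
      obtain ⟨h7, h8⟩ := h6 x hx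
      have e1 := length_strCode_le x.1
      have e2 : x.2.size ≤ N := Nat.size_le.2 h8
      simp only [List.length_append, length_natCode]
      omega
  have e4 := e3.trans (Nat.add_le_add_right (Nat.mul_le_mul_right _ h5) 1)
  simp only [code, List.length_append, length_natCode, length_trieCode]
  omega

end Rec

/-! ### Reading and writing several blocks -/

variable {B : ℕ}

/-- The blocks from address `p` on. -/
def seg (d : ℕ → BitVec B) (p k : ℕ) : List (BitVec B) := (List.range k).map fun i => d (p + i)

/-- External memory after writing blocks from address `p` on. -/
def put (d : ℕ → BitVec B) (p : ℕ) (l : List (BitVec B)) : ℕ → BitVec B := fun a =>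
  if p ≤ a ∧ a < p + l.length then l.getD (a - p) 0 else d a

theorem seg_succ (d : ℕ → BitVec B) (p k : ℕ) : seg d p (k + 1) = d p :: seg d (p + 1) k := by
  simp only [seg, List.range_succ_eq_map, List.map_cons, List.map_map, Nat.add_zero]
  congr 2
  funext i
  simp only [Function.comp, Nat.succ_eq_add_one]
  congr 1
  omega

theorem put_nil (d : ℕ → BitVec B) (p : ℕ) : put d p [] = d := by
  funext a
  simp only [put, List.length_nil]
  rw [if_neg (by omega)]

theorem put_cons (d : ℕ → BitVec B) (p : ℕ) (b : BitVec B) (l : List (BitVec B)) :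
    put (Function.update d p b) (p + 1) l = put d p (b :: l) := by
  funext a
  simp only [put, List.length_cons]
  by_cases h : p + 1 ≤ a ∧ a < p + 1 + l.length
  · rw [if_pos h, if_pos (by omega)]
    obtain ⟨c, rfl⟩ : ∃ c, a = p + 1 + c := ⟨a - (p + 1), by omega⟩
    rw [show p + 1 + c - (p + 1) = c by omega, show p + 1 + c - p = c + 1 by omega]
    simp
  · rw [if_neg h]
    by_cases e : a = p
    · subst e
      rw [if_pos (by omega)]
      simp
    · rw [if_neg (by omega), Function.update_of_ne e]

theorem seg_put_self (d : ℕ → BitVec B) (p : ℕ) (l : List (BitVec B)) :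
    seg (put d p l) p l.length = l := by
  refine List.ext_getElem (by simp [seg]) fun i h1 h2 => ?_
  simp only [seg, List.getElem_map, List.getElem_range, put]
  rw [if_pos (by omega), Nat.add_sub_cancel_left, List.getD_eq_getElem _ _ h2]

theorem seg_put_of_disjoint (d : ℕ → BitVec B) {p q k : ℕ} {l : List (BitVec B)}
    (h : p + l.length ≤ q ∨ q + k ≤ p) : seg (put d p l) q k = seg d q k := by
  refine List.map_congr_left fun i hi => ?_
  have := List.mem_range.1 hi
  simp only [put]
  rw [if_neg (by omega)]

namespace Prog

def readList (p : ℕ) : ℕ → Prog B (List (BitVec B))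
  | 0 => ret []
  | k + 1 => .read p fun b => (readList (p + 1) k).bind fun l => ret (b :: l)

theorem readList_spec (d : ℕ → BitVec B) : ∀ (k p : ℕ),
    (readList p k).res d = seg d p k ∧ (readList p k).fin d = d ∧
      (readList (B := B) p k).out d = [] ∧ (readList (B := B) p k).cost d = k
  | 0, p => by simp [readList, seg, res, fin, out, cost]
  | k + 1, p => by
    obtain ⟨h1, h2, h3, h4⟩ := readList_spec d k (p + 1)
    refine ⟨?_, ?_, ?_, ?_⟩
    · simp [readList, res, h1, seg_succ]
    · simp [readList, fin, h2]
    · simp [readList, out, h3]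
    · simp [readList, cost, h4]

def writeList (p : ℕ) : List (BitVec B) → Prog B Unit
  | [] => ret ()
  | b :: l => .write p b (writeList (p + 1) l)

theorem writeList_spec : ∀ (l : List (BitVec B)) (p : ℕ) (d : ℕ → BitVec B),
    (writeList p l).fin d = put d p l ∧ (writeList p l).out d = [] ∧
      (writeList p l).cost d = l.length
  | [], p, d => by simp [writeList, put_nil, fin, out, cost]
  | b :: l, p, d => by
    obtain ⟨h1, h2, h3⟩ := writeList_spec l (p + 1) (Function.update d p b)
    refine ⟨?_, ?_, ?_⟩
    · simp [writeList, fin, h1, put_cons]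
    · simp [writeList, out, h2]
    · simp [writeList, cost, h3]

/-- Reading the record at address `p`. -/
def getRec (p : ℕ) : Prog B Rec :=
  (readList (recSize * p) recSize).bind fun l => ret (Rec.ofBlocks B l)

/-- Writing a record to address `p`. -/
def setRec (p : ℕ) (r : Rec) : Prog B Unit := writeList (recSize * p) (r.blocks B)

def getRecs : List ℕ → Prog B (List Rec)
  | [] => ret []
  | p :: ps => (getRec p).bind fun r => (getRecs ps).bind fun rs => ret (r :: rs)

def setRecs : List (ℕ × Rec) → Prog B Unit
  | [] => ret ()
  | w :: ws => (setRec w.1 w.2).bind fun _ => setRecs ws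

end Prog

/-- The record at address `p`. -/
def recAt (d : ℕ → BitVec B) (p : ℕ) : Rec := Rec.ofBlocks B (seg d (recSize * p) recSize)

/-- External memory after writing records. -/
def putRecs (d : ℕ → BitVec B) : List (ℕ × Rec) → ℕ → BitVec B
  | [] => d
  | w :: ws => putRecs (put d (recSize * w.1) (w.2.blocks B)) ws

namespace Prog

theorem getRec_spec (p : ℕ) (d : ℕ → BitVec B) :
    (getRec p).res d = recAt d p ∧ (getRec p).fin d = d ∧ (getRec (B := B) p).out d = [] ∧
      (getRec (B := B) p).cost d = recSize := by
  obtain ⟨h1, h2, h3, h4⟩ := readList_spec d recSize (recSize * p)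
  simp [getRec, h1, h2, h3, h4, recAt, res, fin, out, cost]

theorem getRecs_spec (d : ℕ → BitVec B) : ∀ ps : List ℕ,
    (getRecs ps).res d = ps.map (recAt d) ∧ (getRecs ps).fin d = d ∧
      (getRecs (B := B) ps).out d = [] ∧ (getRecs (B := B) ps).cost d = ps.length * recSize
  | [] => by simp [getRecs, res, fin, out, cost]
  | p :: ps => by
    obtain ⟨h1, h2, h3, h4⟩ := getRec_spec p d
    obtain ⟨g1, g2, g3, g4⟩ := getRecs_spec d ps
    simp [getRecs, h1, h2, h3, h4, g1, g2, g3, g4, res, fin, out, cost, Nat.add_mul, Nat.add_comm]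

theorem setRecs_spec : ∀ (ws : List (ℕ × Rec)) (d : ℕ → BitVec B),
    (setRecs ws).fin d = putRecs d ws ∧ (setRecs (B := B) ws).out d = [] ∧
      (setRecs (B := B) ws).cost d = ws.length * recSize
  | [], d => by simp [setRecs, putRecs, fin, out, cost]
  | w :: ws, d => by
    obtain ⟨h1, h2, h3⟩ := writeList_spec (w.2.blocks B) (recSize * w.1) d
    obtain ⟨g1, g2, g3⟩ := setRecs_spec ws (put d (recSize * w.1) (w.2.blocks B))
    simp [setRecs, setRec, h1, h2, h3, g1, g2, g3, putRecs, Nat.add_mul, Nat.add_comm]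

end Prog

theorem seg_put_blocks (d : ℕ → BitVec B) (p q : ℕ) (r : Rec) :
    seg (put d (recSize * p) (r.blocks B)) (recSize * q) recSize =
      if p = q then r.blocks B else seg d (recSize * q) recSize := by
  split_ifs with h
  · subst h
    have := seg_put_self d (recSize * p) (r.blocks B)
    rwa [Rec.length_blocks] at this
  · refine seg_put_of_disjoint d ?_
    rw [Rec.length_blocks]
    rcases Nat.lt_or_gt_of_ne h with h | h
    · left
      have := Nat.mul_le_mul_left recSize (Nat.succ_le_of_lt h)
      rwa [Nat.mul_succ] at this
    · right
      have := Nat.mul_le_mul_left recSize (Nat.succ_le_of_lt h)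
      rwa [Nat.mul_succ] at this

theorem put_of_ge (d : ℕ → BitVec B) {p s a : ℕ} (r : Rec) (hp : p < s) (ha : recSize * s ≤ a) :
    put d (recSize * p) (r.blocks B) a = d a := by
  have := Nat.mul_le_mul_left recSize (Nat.succ_le_of_lt hp)
  rw [Nat.mul_succ] at this
  rw [put, if_neg (by rw [Rec.length_blocks]; omega)]

theorem putRecs_of_ge {s a : ℕ} (ha : recSize * s ≤ a) : ∀ (ws : List (ℕ × Rec))
    (d : ℕ → BitVec B), (∀ w ∈ ws, w.1 < s) → putRecs d ws a = d a
  | [], d, _ => rfl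
  | w :: ws, d, h => by
    rw [putRecs, putRecs_of_ge ha ws _ fun x hx => h x (List.mem_cons_of_mem _ hx),
      put_of_ge d _ (h w (by simp)) ha]

theorem seg_putRecs {q : ℕ} {r : Rec} : ∀ (ws : List (ℕ × Rec)) (d : ℕ → BitVec B),
    (∀ w ∈ ws, w.1 = q → w.2 = r) →
    ((∀ w ∈ ws, w.1 ≠ q) → seg d (recSize * q) recSize = r.blocks B) →
    seg (putRecs d ws) (recSize * q) recSize = r.blocks B
  | [], d, _, h => h (by simp)
  | w :: ws, d, h1, h2 => by
    refine seg_putRecs ws _ (fun x hx => h1 x (List.mem_cons_of_mem _ hx)) fun h3 => ?_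
    rw [seg_put_blocks]
    split_ifs with e
    · rw [h1 w (by simp) e]
    · refine h2 fun x hx => ?_
      rcases List.mem_cons.1 hx with rfl | hx
      exacts [e, h3 x hx]

end BitmapIndex

/-! ### Representation of a tree by records at addresses. -/

namespace BitmapIndex

variable {B E : ℕ} {T : Tree} {ad : Str → ℕ} {s : ℕ} {d : ℕ → BitVec B}

/-! ### Trees in external memory -/

/-- The record of a cell; `ad` are the addresses of the cells. -/
def recOf (T : Tree) (ad : Str → ℕ) (q : Str) : Rec :=
  ⟨q, ad (par T.Q q), reg T.Q T.R q, T.P q, (kids T.Q q).image fun c => (c, ad c)⟩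

/-- External memory represents a tree, in records `0, ..., s - 1`. -/
structure Rep (T : Tree) (ad : Str → ℕ) (s : ℕ) (d : ℕ → BitVec B) : Prop where
  inj : Set.InjOn ad T.Q
  lt : ∀ q ∈ T.Q, ad q < s
  root : ad [] = 0
  blocks : ∀ q ∈ T.Q, seg d (recSize * ad q) recSize = (recOf T ad q).blocks B
  zero : ∀ a, recSize * s ≤ a → d a = 0

/-- There are `2 ^ E - 1` strings of length less than `E`; so the number of cells, and with it every
address, has at most `E` bits. -/
theorem card_le_of_length : ∀ {E : ℕ} {Q : Finset Str},
    (∀ q ∈ Q, q.length + 1 ≤ E) → Q.card + 1 ≤ 2 ^ E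
  | 0, Q, h => by
    have : Q = ∅ := Finset.eq_empty_of_forall_notMem fun q hq => by have := h q hq; omega
    simp [this]
  | E + 1, Q, h => by
    have hs : ∀ b : Bool, (strip [b] Q).card + 1 ≤ 2 ^ E := fun b =>
      card_le_of_length (Q := strip [b] Q) fun q hq => by
        have := h _ (mem_strip.1 hq)
        simp at this
        omega
    have h1 : Q ⊆ {[]} ∪ ((strip [false] Q).image (false :: ·) ∪
        (strip [true] Q).image (true :: ·)) := by
      intro q hq
      match q with
      | [] => simp
      | false :: q => simpa using hq
      | true :: q => simpa using hq
    have h2 := (Finset.card_le_card h1).trans ((Finset.card_union_le _ _).trans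
      (Nat.add_le_add_left ((Finset.card_union_le _ _).trans
        (Nat.add_le_add Finset.card_image_le Finset.card_image_le)) _))
    have h5 := hs false
    have h6 := hs true
    rw [Finset.card_singleton] at h2
    rw [pow_succ]
    omega

/-- The cells are not too large for their records. -/
def Tree.Slim (B : ℕ) (T : Tree) : Prop :=
  ∀ q ∈ T.Q, T.wt B q ≤ 4756 * B ∧ totalLen (T.P q) ≤ 20 * B

theorem Tree.Inv.slim {cur : Str} (h : T.Inv B E cur) : T.Slim B := fun q hq => by
  refine ⟨?_, h.len q⟩
  by_cases hc : q <+: cur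
  · exact (Nat.le_add_right _ _).trans (h.on q hq hc)
  · rcases h.off q hq hc with h1 | h1
    · have := h1.2.2
      omega
    · have := h1.2
      omega

theorem Tree.Settled.slim (h : T.Settled B E) : T.Slim B := fun q hq => by
  have h1 := h.wt_le hq
  have h2 := h.pend_le q
  have hcap : cap B ≤ B := Nat.div_le_self _ _
  omega

theorem Tree.Slim.kids_card (h : T.Slim B) (hB : 0 < B) {q : Str} (hq : q ∈ T.Q) :
    (kids T.Q q).card ≤ 74 :=
  kids_card_le (B := B) (by have := (h q hq).1; omega)

theorem card_kid (T : Tree) (ad : Str → ℕ) (q : Str) :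
    (recOf T ad q).kid.card = (kids T.Q q).card :=
  Finset.card_image_of_injective _ fun _ _ h => (Prod.mk.inj h).1

theorem fits_recOf (hT : T.WF E) (hE : E ≤ 4 * B) (hB : 0 < B) (hS : T.Slim B)
    (hlt : ∀ q ∈ T.Q, ad q < s) (hs : s ≤ T.Q.card + 1) {q : Str} (hq : q ∈ T.Q) :
    (recOf T ad q).Fits B := by
  have hs2 : s ≤ 2 ^ E := hs.trans (card_le_of_length (Q := T.Q) hT.lenQ)
  have h2 : ∀ q ∈ T.Q, ad q < 2 ^ E := fun q hq => (hlt q hq).trans_le hs2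
  have := Rec.length_code_le (B := B) (E := E) (N := E) (a := 4756 * B) (K := 74)
    (r := recOf T ad q) (hT.lenQ q hq) (h2 _ (par_mem hT.root q))
    ((Nat.le_add_right _ _).trans (hS q hq).1)
    ((trieSize_le_totalLen _).trans (hS q hq).2)
    (by rw [card_kid]; exact hS.kids_card hB hq)
    (by
      intro x hx
      obtain ⟨c, hc, rfl⟩ := Finset.mem_image.1 hx
      have hcQ := (mem_kids.1 hc).1
      exact ⟨hT.lenQ c hcQ, h2 c hcQ⟩)
  unfold Rec.Fits
  -- With lengths and addresses of at most `4 * B` bits, the code has no more than `15828 * B + 78`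
  -- bits.
  rw [recSize_eq]
  omega

theorem Rep.recAt (h : Rep T ad s d) {q : Str} (hq : q ∈ T.Q) (hf : (recOf T ad q).Fits B) :
    recAt d (ad q) = recOf T ad q := by
  rw [BitmapIndex.recAt, h.blocks q hq, Rec.ofBlocks_blocks hf]

/-- Reduces the operations to a comparison of records: what is written belongs to the new tree, and
what is not written is the same in both trees. -/
theorem Rep.write (h : Rep T ad s d) {T' : Tree} {ad' : Str → ℕ} {s' : ℕ}
    (ws : List (ℕ × Rec)) (hs : s ≤ s') (hinj : Set.InjOn ad' T'.Q) (hlt : ∀ q ∈ T'.Q, ad' q < s')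
    (hroot : ad' [] = 0) (hw : ∀ w ∈ ws, ∃ q ∈ T'.Q, w.1 = ad' q ∧ w.2 = recOf T' ad' q)
    (hu : ∀ q ∈ T'.Q, (∀ w ∈ ws, w.1 ≠ ad' q) →
      q ∈ T.Q ∧ ad q = ad' q ∧ recOf T ad q = recOf T' ad' q) :
    Rep T' ad' s' (putRecs d ws) where
  inj := hinj
  lt := hlt
  root := hroot
  blocks q hq := by
    refine seg_putRecs ws d (fun w hw1 hw2 => ?_) fun h1 => ?_
    · obtain ⟨q', hq', e1, e2⟩ := hw w hw1
      rw [e2, hinj hq' hq (e1.symm.trans hw2)]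
    · obtain ⟨h2, h3, h4⟩ := hu q hq h1
      rw [← h3, ← h4]
      exact h.blocks q h2
  zero a ha := by
    rw [putRecs_of_ge ha ws d fun w hw1 => ?_]
    · exact h.zero a ((Nat.mul_le_mul_left _ hs).trans ha)
    · obtain ⟨q, hq, e, _⟩ := hw w hw1
      rw [e]
      exact hlt q hq

theorem Rep.clear (h : Rep T ad s d) (hs : 0 < s) (hlt : ∀ q ∈ T.Q, ad q ≠ s - 1) :
    Rep T ad (s - 1) (put d (recSize * (s - 1)) (Rec.blank.blocks B)) where
  inj := h.inj
  lt q hq := by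
    have := h.lt q hq
    have := hlt q hq
    omega
  root := h.root
  blocks q hq := by
    rw [seg_put_blocks, if_neg (hlt q hq).symm]
    exact h.blocks q hq
  zero a ha := by
    rw [Rec.blocks_blank, put]
    split_ifs with h1
    · rw [List.getD_eq_getElem _ _ (by omega), List.getElem_replicate]
    · refine h.zero a ?_
      rw [List.length_replicate] at h1
      have : recSize * (s - 1) + recSize = recSize * s := by
        rw [← Nat.mul_succ]; congr 1; omega
      omega

/-! ### Changes of records -/

theorem par_nil (hQ : [] ∈ T.Q) : par T.Q [] = [] := by
  rw [par, List.dropLast_nil, own_self hQ]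

/-- The records that change in a flush at `v`. -/
theorem Rep.flush (h : Rep T ad s d) (hT : T.WF E) {v : Str} (hv : v ∈ T.Q) {C : Finset Str}
    (hC : C ⊆ T.P v) {ws : List (ℕ × Rec)}
    (hws : ∀ w, w ∈ ws ↔ w = (ad v, { recOf T ad v with
        reg := symmDiff (reg T.Q T.R v) (ownPart (kids T.Q v) C), pend := T.P v \ C }) ∨
      ∃ c ∈ kids T.Q v, w = (ad c, { recOf T ad c with
        pend := symmDiff (T.P c) (C.filter (c <+: ·)) })) :
    Rep (T.flush v C) ad s (putRecs d ws) := by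
  have hreg := fun u => Tree.reg_flush hT hv hC u
  refine h.write ws le_rfl h.inj h.lt h.root (fun w hw => ?_) fun q hq hq' => ⟨hq, rfl, ?_⟩
  · rcases (hws w).1 hw with rfl | ⟨c, hc, rfl⟩
    · refine ⟨v, hv, rfl, ?_⟩
      have h1 := hreg v
      rw [if_pos rfl] at h1
      unfold recOf
      rw [← h1]
      simp [Tree.flush]
    · refine ⟨c, (mem_kids.1 hc).1, rfl, ?_⟩
      have h1 := hreg c
      rw [if_neg (ne_of_mem_kids hc)] at h1
      unfold recOf
      rw [← h1]
      simp [Tree.flush, hc, ne_of_mem_kids hc]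
  · have hqv : q ≠ v := by
      rintro rfl
      exact hq' _ ((hws _).2 (Or.inl rfl)) rfl
    have hqk : q ∉ kids T.Q v := fun hk => hq' _ ((hws _).2 (Or.inr ⟨q, hk, rfl⟩)) rfl
    have h1 := hreg q
    rw [if_neg hqv] at h1
    unfold recOf
    rw [← h1]
    simp [Tree.flush, hqv, hqk]

theorem Rep.load (h : Rep T ad s d) (hT : T.WF E) (Y : Finset Str) :
    Rep (T.load Y) ad s
      (putRecs d [(0, { recOf T ad [] with pend := symmDiff (T.P []) Y })]) := by
  refine h.write _ le_rfl h.inj h.lt h.root (fun w hw => ?_) fun q hq hq' => ⟨hq, rfl, ?_⟩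
  · rw [List.mem_singleton] at hw
    subst hw
    exact ⟨[], hT.root, h.root.symm, by simp [recOf, Tree.load]⟩
  · have hq0 : q ≠ [] := by
      rintro rfl
      exact hq' _ (List.mem_singleton.2 rfl) h.root.symm
    simp [recOf, Tree.load, hq0]

/-- The records that change when the cell `c` below `v` is absorbed. -/
theorem Rep.absorb (h : Rep T ad s d) (hT : T.WF E) {v c : Str} (hc : c ∈ kids T.Q v)
    {ws : List (ℕ × Rec)}
    (hws : ∀ w, w ∈ ws ↔ w = (ad v, { recOf T ad v with
        reg := reg T.Q T.R v ∪ reg T.Q T.R c,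
        kid := (recOf T ad v).kid.filter (fun x => x.1 ≠ c) ∪ (recOf T ad c).kid }) ∨
      ∃ e ∈ kids T.Q c, w = (ad e, { recOf T ad e with up := ad v })) :
    Rep (T.absorb c) ad s (putRecs d ws) := by
  obtain ⟨hcQ, hc0, hcv⟩ := mem_kids.1 hc
  have hvQ : v ∈ T.Q := hcv ▸ par_mem hT.root c
  have hsub : ∀ q ∈ (T.absorb c).Q, q ∈ T.Q := fun q hq => Finset.mem_of_mem_erase hq
  have hpar : ∀ q, par (T.absorb c).Q q = if par T.Q q = c then v else par T.Q q := fun q => by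
    rw [← hcv]; exact par_erase hT.root hc0
  have hne := ne_of_mem_kids hc
  refine h.write ws le_rfl (h.inj.mono fun q hq => hsub q hq) (fun q hq => h.lt q (hsub q hq)) h.root
    (fun w hw => ?_) fun q hq hq' => ⟨hsub q hq, rfl, ?_⟩
  · rcases (hws w).1 hw with rfl | ⟨e, he, rfl⟩
    · refine ⟨v, Finset.mem_erase.2 ⟨hne.symm, hvQ⟩, rfl, ?_⟩
      have h1 : par T.Q v ≠ c := fun e => by
        have h2 := par_prefix T.Q v
        rw [e] at h2
        exact Tree.not_prefix_of_mem_kids hc h2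
      have h2 : reg (T.absorb c).Q (T.absorb c).R v = reg T.Q T.R v ∪ reg T.Q T.R c :=
        reg_erase_par hT.root hc
      have h3 : kids (T.absorb c).Q v = (kids T.Q v).erase c ∪ kids T.Q c :=
        kids_erase_par hT.root hc
      simp only [recOf, hpar, if_neg h1, h2, h3, Rec.mk.injEq, true_and]
      refine ⟨rfl, ?_⟩
      ext ⟨x, p⟩
      simp only [Finset.mem_union, Finset.mem_filter, Finset.mem_image, Finset.mem_erase,
        Prod.mk.injEq]
      constructor
      · rintro (⟨⟨y, hy, rfl, rfl⟩, hx⟩ | ⟨y, hy, rfl, rfl⟩)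
        exacts [⟨y, Or.inl ⟨hx, hy⟩, rfl, rfl⟩, ⟨y, Or.inr hy, rfl, rfl⟩]
      · rintro ⟨y, ⟨hx, hy⟩ | hy, rfl, rfl⟩
        exacts [Or.inl ⟨⟨y, hy, rfl, rfl⟩, hx⟩, Or.inr ⟨y, hy, rfl, rfl⟩]
    · obtain ⟨heQ, -, hec⟩ := mem_kids.1 he
      have hev : e ≠ v := by
        rintro rfl
        exact Tree.not_prefix_of_mem_kids hc (prefix_of_mem_kids he)
      refine ⟨e, Finset.mem_erase.2 ⟨ne_of_mem_kids he, heQ⟩, rfl, ?_⟩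
      simp only [recOf, hpar, if_pos hec]
      unfold Tree.absorb
      rw [reg_erase_of_ne hT.root hc hev (ne_of_mem_kids he),
        kids_erase_of_ne hT.root hc hev (ne_of_mem_kids he)]
  · have hqc : q ≠ c := (Finset.mem_erase.1 hq).1
    have hqv : q ≠ v := by
      rintro rfl
      exact hq' _ ((hws _).2 (Or.inl rfl)) rfl
    have hqp : par T.Q q ≠ c := fun e => by
      have hq0 : q ≠ [] := by
        rintro rfl
        rw [par_nil hT.root] at e
        exact hc0 e.symm
      exact hq' _ ((hws _).2 (Or.inr ⟨q, mem_kids.2 ⟨hsub q hq, hq0, e⟩, rfl⟩)) rfl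
    simp only [recOf, hpar, if_neg hqp]
    unfold Tree.absorb
    rw [reg_erase_of_ne hT.root hc hqv hqc, kids_erase_of_ne hT.root hc hqv hqc]

/-- The records that change when a cell `c` is cut off from `v`. -/
theorem Rep.cut (h : Rep T ad s d) (hT : T.WF E) {v c : Str} (hv : v ∈ T.Q) (hc : own T.Q c = v)
    (hcQ : c ∉ T.Q) {ws : List (ℕ × Rec)}
    (hws : ∀ w, w ∈ ws ↔ w = (ad v, { recOf T ad v with
        reg := (reg T.Q T.R v).filter (fun k => ¬ c <+: k),
        kid := insert (c, s) ((recOf T ad v).kid.filter (fun x => ¬ c <+: x.1)) }) ∨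
      w = (s, ⟨c, ad v, (reg T.Q T.R v).filter (c <+: ·), ∅,
        (recOf T ad v).kid.filter (fun x => c <+: x.1)⟩) ∨
      ∃ e ∈ kids T.Q v, c <+: e ∧ w = (ad e, { recOf T ad e with up := s })) :
    Rep (T.cut c) (Function.update ad c s) (s + 1) (putRecs d ws) := by
  have hne : ∀ q ∈ T.Q, q ≠ c := fun q hq e => hcQ (e ▸ hq)
  have had : ∀ q ∈ T.Q, Function.update ad c s q = ad q := fun q hq =>
    Function.update_of_ne (hne q hq) _ _
  have hcases : ∀ q ∈ (T.cut c).Q, q = c ∨ q ∈ T.Q := fun q hq => Finset.mem_insert.1 hq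
  have hpar : ∀ q ∈ T.Q, par (T.cut c).Q q = if c <+: q ∧ par T.Q q = v then c else par T.Q q :=
    fun q hq => par_insert hT.root hc hcQ hq
  have himg : ∀ S : Finset Str, S ⊆ T.Q →
      S.image (fun e => (e, Function.update ad c s e)) = S.image fun e => (e, ad e) := by
    intro S hS
    refine Finset.image_congr fun e he => ?_
    simp only [had e (hS he)]
  have hsubk : ∀ q, kids T.Q q ⊆ T.Q := fun q => Finset.filter_subset _ _
  have hvc : v <+: c := hc ▸ own_prefix _ _
  have hcv : ¬ c <+: v := fun e => hne v hv (prefix_antisymm hvc e)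
  refine h.write ws (Nat.le_succ s) ?_ ?_ ?_ (fun w hw => ?_) fun q hq hq' => ?_
  · intro q hq q' hq' e
    rcases hcases q hq with rfl | h1 <;> rcases hcases q' hq' with rfl | h2
    · rfl
    · rw [Function.update_self, had q' h2] at e
      exact absurd (h.lt q' h2) (by omega)
    · rw [Function.update_self, had q h1] at e
      exact absurd (h.lt q h1) (by omega)
    · rw [had q h1, had q' h2] at e
      exact h.inj h1 h2 e
  · intro q hq
    rcases hcases q hq with rfl | h1
    · rw [Function.update_self]; omega
    · rw [had q h1]
      exact (h.lt q h1).trans (Nat.lt_succ_self s)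
  · rw [had [] hT.root, h.root]
  · rcases (hws w).1 hw with rfl | rfl | ⟨e, he, hce, rfl⟩
    · refine ⟨v, Finset.mem_insert_of_mem hv, (had v hv).symm, ?_⟩
      have h1 : par (T.cut c).Q v = par T.Q v := by
        rw [hpar v hv, if_neg fun h => hcv h.1]
      have h2 : reg (T.cut c).Q (T.cut c).R v = (reg T.Q T.R v).filter (fun k => ¬ c <+: k) :=
        reg_insert_own hT.root hc hcQ
      have h3 : kids (T.cut c).Q v = insert c ((kids T.Q v).filter (fun e => ¬ c <+: e)) :=
        kids_insert_own hT.root hc hcQ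
      simp only [recOf, h1, h2, h3, had _ (par_mem hT.root v), Finset.image_insert,
        Function.update_self, himg _ ((Finset.filter_subset _ _).trans (hsubk v)), Finset.filter_image]
      rfl
    · refine ⟨c, Finset.mem_insert_self _ _, (Function.update_self c s ad).symm, ?_⟩
      have h1 : par (T.cut c).Q c = v := par_insert_self hT.root hc hcQ
      have h2 : reg (T.cut c).Q (T.cut c).R c = (reg T.Q T.R v).filter (c <+: ·) :=
        reg_insert_self hT.root hc hcQ
      have h3 : kids (T.cut c).Q c = (kids T.Q v).filter (c <+: ·) :=
        kids_insert_self hT.root hc hcQ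
      have h4 : (T.cut c).P c = ∅ := hT.pend_empty c hcQ
      simp only [recOf, h1, h2, h3, h4, had v hv,
        himg _ ((Finset.filter_subset _ _).trans (hsubk v)), Finset.filter_image]
    · obtain ⟨heQ, he0, hev⟩ := mem_kids.1 he
      refine ⟨e, Finset.mem_insert_of_mem heQ, (had e heQ).symm, ?_⟩
      have h1 : par (T.cut c).Q e = c := by
        rw [hpar e heQ, if_pos ⟨hce, hev⟩]
      simp only [recOf, h1, Function.update_self]
      unfold Tree.cut
      rw [reg_insert_of_ne hT.root hc (ne_of_mem_kids he) (hne e heQ),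
        kids_insert_of_ne hT.root hc hcQ (ne_of_mem_kids he) (hne e heQ), himg _ (hsubk e)]
  · rcases hcases q hq with rfl | hqQ
    · exact absurd rfl ((Function.update_self q s ad) ▸ hq' _ ((hws _).2 (Or.inr (Or.inl rfl))))
    · rw [had q hqQ] at hq' ⊢
      have hqv : q ≠ v := by
        rintro rfl
        exact hq' _ ((hws _).2 (Or.inl rfl)) rfl
      have hqp : ¬ (c <+: q ∧ par T.Q q = v) := by
        rintro ⟨h1, h2⟩
        have hq0 : q ≠ [] := by
          rintro rfl
          exact hne [] hT.root (List.prefix_nil.1 h1).symm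
        exact hq' _ ((hws _).2 (Or.inr (Or.inr ⟨q, mem_kids.2 ⟨hqQ, hq0, h2⟩, h1, rfl⟩))) rfl
      refine ⟨hqQ, rfl, ?_⟩
      simp only [recOf, hpar q hqQ, if_neg hqp, had _ (par_mem hT.root q)]
      unfold Tree.cut
      rw [reg_insert_of_ne hT.root hc hqv (hne q hqQ),
        kids_insert_of_ne hT.root hc hcQ hqv (hne q hqQ), himg _ (hsubk q)]

/-- The records that change when the last record moves to the free address `p`. -/
theorem Rep.relocate (h : Rep T ad s d) (hT : T.WF E) {p : ℕ} (hp : p + 1 < s)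
    (hfree : ∀ q ∈ T.Q, ad q ≠ p) {l : Str} (hl : l ∈ T.Q) (hls : ad l = s - 1)
    {ws : List (ℕ × Rec)}
    (hws : ∀ w, w ∈ ws ↔ w = (p, recOf T ad l) ∨
      w = (ad (par T.Q l), { recOf T ad (par T.Q l) with
        kid := (recOf T ad (par T.Q l)).kid.image
          (fun x => if x.2 = s - 1 then (x.1, p) else x) }) ∨
      ∃ e ∈ kids T.Q l, w = (ad e, { recOf T ad e with up := p })) :
    Rep T (fun q => if ad q = s - 1 then p else ad q) (s - 1)
      (put (putRecs d ws) (recSize * (s - 1)) (Rec.blank.blocks B)) := by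
  set ad' : Str → ℕ := fun q => if ad q = s - 1 then p else ad q with had'
  have hadl : ad' l = p := by simp [had', hls]
  have hadq : ∀ q ∈ T.Q, q ≠ l → ad' q = ad q := fun q hq hne => by
    simp only [had']
    rw [if_neg fun e => hne (h.inj hq hl (e.trans hls.symm))]
  have hl0 : l ≠ [] := by
    rintro rfl
    have := h.root
    omega
  have hlp : par T.Q l ∈ T.Q := par_mem hT.root l
  have hrec : ∀ q ∈ T.Q, q ≠ par T.Q l → par T.Q q ≠ l → recOf T ad' q = recOf T ad q := by
    intro q hq h1 h2
    simp only [recOf, hadq _ (par_mem hT.root q) h2, Rec.mk.injEq, true_and]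
    refine Finset.image_congr fun e he => ?_
    have he' := mem_kids.1 he
    have : e ≠ l := by
      rintro rfl
      exact h1 he'.2.2.symm
    simp only [hadq e he'.1 this]
  have hmain : Rep T ad' s (putRecs d ws) := by
    refine h.write ws le_rfl ?_ ?_ ?_ (fun w hw => ?_) fun q hq hq' => ?_
    · intro q hq q' hq' e
      by_cases h1 : q = l <;> by_cases h2 : q' = l
      · rw [h1, h2]
      · rw [h1, hadl, hadq q' hq' h2] at e
        exact absurd e.symm (hfree q' hq')
      · rw [h2, hadl, hadq q hq h1] at e
        exact absurd e (hfree q hq)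
      · rw [hadq q hq h1, hadq q' hq' h2] at e
        exact h.inj hq hq' e
    · intro q hq
      simp only [had']
      split_ifs
      · omega
      · exact h.lt q hq
    · rw [hadq [] hT.root hl0.symm, h.root]
    · rcases (hws w).1 hw with rfl | rfl | ⟨e, he, rfl⟩
      · exact ⟨l, hl, hadl.symm, (hrec l hl (par_ne hl0).symm (par_ne hl0)).symm⟩
      · refine ⟨_, hlp, (hadq _ hlp (par_ne hl0)).symm, ?_⟩
        have h1 : par T.Q (par T.Q l) ≠ l := fun e => by
          have h2 := (par_prefix T.Q (par T.Q l)).length_le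
          rw [e] at h2
          have := par_length_lt (Q := T.Q) hl0
          omega
        simp only [recOf, hadq _ (par_mem hT.root _) h1, Rec.mk.injEq, true_and,
          Finset.image_image]
        refine Finset.image_congr fun e he => ?_
        simp only [Function.comp, had']
        split_ifs <;> rfl
      · obtain ⟨heQ, he0, hel⟩ := mem_kids.1 he
        have hne := ne_of_mem_kids he
        refine ⟨e, heQ, (hadq e heQ hne).symm, ?_⟩
        simp only [recOf, hel, hadl, Rec.mk.injEq, true_and]
        refine Finset.image_congr fun x hx => ?_
        have hx' := mem_kids.1 hx
        have : x ≠ l := by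
          rintro rfl
          exact Tree.not_prefix_of_mem_kids he (prefix_of_mem_kids hx)
        simp only [hadq x hx'.1 this]
    · have hql : q ≠ l := by
        rintro rfl
        exact hq' _ ((hws _).2 (Or.inl rfl)) hadl.symm
      have h1 : q ≠ par T.Q l := by
        rintro rfl
        exact hq' _ ((hws _).2 (Or.inr (Or.inl rfl))) (hadq _ hq hql).symm
      have h2 : par T.Q q ≠ l := fun e => by
        have hq0 : q ≠ [] := by
          rintro rfl
          rw [par_nil hT.root] at e
          exact hl0 e.symm
        exact hq' _ ((hws _).2 (Or.inr (Or.inr ⟨q, mem_kids.2 ⟨hq, hq0, e⟩, rfl⟩)))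
          (hadq q hq hql).symm
      exact ⟨hq, (hadq q hq hql).symm, (hrec q hq h1 h2).symm⟩
  refine hmain.clear (by omega) fun q hq => ?_
  simp only [had']
  split_ifs with h1
  · omega
  · exact h1

end BitmapIndex

/-! ### Programs for the local operations. -/

namespace BitmapIndex

variable {B E : ℕ} {T : Tree} {ad : Str → ℕ} {s : ℕ} {d : ℕ → BitVec B}

/-! ### The work at a cell -/

open Classical in
/-- The address of a cell below. -/
def Rec.addr (r : Rec) (c : Str) : ℕ := if h : ∃ p, (c, p) ∈ r.kid then h.choose else 0

theorem addr_recOf {q c : Str} (hc : c ∈ kids T.Q q) : (recOf T ad q).addr c = ad c := by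
  have h : ∃ p, (c, p) ∈ (recOf T ad q).kid := ⟨ad c, Finset.mem_image.2 ⟨c, hc, rfl⟩⟩
  rw [Rec.addr, dif_pos h]
  obtain ⟨e, he, h2⟩ := Finset.mem_image.1 h.choose_spec
  obtain ⟨rfl, h4⟩ := Prod.mk.inj h2
  exact h4.symm

/-- The record of the cell `c` in a list of records. -/
def findRec (rs : List Rec) (c : Str) : Rec := (rs.find? fun r => r.cell = c).getD Rec.blank

theorem findRec_map {ks : List (Str × ℕ)} {c : Str} (hc : c ∈ ks.map Prod.fst) :
    findRec (ks.map fun x => recOf T ad x.1) c = recOf T ad c := by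
  induction ks with
  | nil => simp at hc
  | cons x ks ih =>
    simp only [List.map_cons, List.mem_cons] at hc
    by_cases e : x.1 = c
    · simp [findRec, recOf, e]
    · have := ih (hc.resolve_left (Ne.symm e))
      simp only [findRec, List.map_cons] at this ⊢
      rw [List.find?_cons_of_neg (by simp [recOf, e])]
      exact this

/-- The addresses of the cells below. -/
def Rec.kidAddrs (r : Rec) : List ℕ := r.kid.toList.map Prod.snd

theorem length_kidAddrs (q : Str) : (recOf T ad q).kidAddrs.length = (kids T.Q q).card := by
  simp [Rec.kidAddrs, card_kid]

theorem mem_kid {q : Str} {x : Str × ℕ} :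
    x ∈ (recOf T ad q).kid ↔ ∃ c ∈ kids T.Q q, x = (c, ad c) := by
  simp [recOf, eq_comm]

theorem mem_kid_map {q : Str} {α : Type} (f : Str × ℕ → α) (w : α) :
    w ∈ (recOf T ad q).kid.toList.map f ↔ ∃ c ∈ kids T.Q q, w = f (c, ad c) := by
  simp only [List.mem_map, Finset.mem_toList, mem_kid]
  constructor
  · rintro ⟨x, ⟨c, hc, rfl⟩, rfl⟩
    exact ⟨c, hc, rfl⟩
  · rintro ⟨c, hc, rfl⟩
    exact ⟨_, ⟨c, hc, rfl⟩, rfl⟩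

/-- External memory represents a tree, and the records of the cells can be read. -/
structure Ok (B E : ℕ) (T : Tree) (ad : Str → ℕ) (s : ℕ) (d : ℕ → BitVec B) : Prop where
  wf : T.WF E
  le : E ≤ 4 * B
  pos : 0 < B
  slim : T.Slim B
  size : s ≤ T.Q.card + 1
  rep : Rep T ad s d

theorem Ok.recAt (h : Ok B E T ad s d) {q : Str} (hq : q ∈ T.Q) :
    recAt d (ad q) = recOf T ad q :=
  h.rep.recAt hq (fits_recOf h.wf h.le h.pos h.slim h.rep.lt h.size hq)

theorem Ok.map_kidAddrs (h : Ok B E T ad s d) (q : Str) :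
    (recOf T ad q).kidAddrs.map (BitmapIndex.recAt d) =
      (recOf T ad q).kid.toList.map fun x => recOf T ad x.1 := by
  rw [Rec.kidAddrs, List.map_map]
  refine List.map_congr_left fun x hx => ?_
  obtain ⟨c, hc, rfl⟩ := mem_kid.1 (Finset.mem_toList.1 hx)
  exact h.recAt (mem_kids.1 hc).1

theorem findRec_kid {q c : Str} (hc : c ∈ kids T.Q q) :
    findRec ((recOf T ad q).kid.toList.map fun x => recOf T ad x.1) c = recOf T ad c := by
  refine findRec_map ((mem_kid_map _ _).2 ⟨c, hc, rfl⟩)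

theorem Ok.length_kidAddrs_le (h : Ok B E T ad s d) {q : Str} (hq : q ∈ T.Q) :
    (recOf T ad q).kidAddrs.length ≤ 74 := by
  rw [length_kidAddrs]
  exact h.slim.kids_card h.pos hq

namespace Prog

theorem getRec_ok (h : Ok B E T ad s d) {q : Str} (hq : q ∈ T.Q) :
    (getRec (ad q)).res d = recOf T ad q ∧ (getRec (ad q)).fin d = d ∧
      (getRec (B := B) (ad q)).out d = [] ∧ (getRec (B := B) (ad q)).cost d = recSize := by
  obtain ⟨h1, h2⟩ := getRec_spec (ad q) d
  exact ⟨h1.trans (h.recAt hq), h2⟩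

theorem getKids_ok (h : Ok B E T ad s d) {q : Str} (hq : q ∈ T.Q) :
    (getRecs (recOf T ad q).kidAddrs).res d
        = (recOf T ad q).kid.toList.map (fun x => recOf T ad x.1) ∧
      (getRecs (recOf T ad q).kidAddrs).fin d = d ∧
      (getRecs (B := B) (recOf T ad q).kidAddrs).out d = [] ∧
      (getRecs (B := B) (recOf T ad q).kidAddrs).cost d ≤ 74 * recSize := by
  obtain ⟨h1, h2, h3, h4⟩ := getRecs_spec d (recOf T ad q).kidAddrs
  exact ⟨h1.trans (h.map_kidAddrs q), h2, h3,
    h4.trans_le (Nat.mul_le_mul_right _ (h.length_kidAddrs_le hq))⟩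

/-- Moving the last of `s` records to the free address `p`. -/
def relocate (p s : ℕ) : Prog B Unit :=
  if p + 1 = s then setRec (s - 1) Rec.blank else
    (getRec (s - 1)).bind fun l => (getRec l.up).bind fun r =>
      (getRecs l.kidAddrs).bind fun rs =>
        (setRecs ((p, l) :: (l.up, { r with
            kid := r.kid.image (fun x => if x.2 = s - 1 then (x.1, p) else x) }) ::
          l.kid.toList.map fun x => (x.2, { findRec rs x.1 with up := p }))).bind fun _ =>
            setRec (s - 1) Rec.blank

/-- As `p` is the only free address below `s`, counting yields a cell at `s - 1`, unless `p` is that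
address. It moves to `p`, so that the records stay contiguous and external memory stays short; only
the cell above and the cells below refer to it. -/
theorem relocate_spec (h : Ok B E T ad s d) (hs : s = T.Q.card + 1) {p : ℕ} (hp : p < s)
    (hfree : ∀ q ∈ T.Q, ad q ≠ p) :
    Rep T (fun q => if ad q = s - 1 then p else ad q) (s - 1) ((relocate p s).fin d) ∧
      (relocate (B := B) p s).out d = [] ∧ (relocate (B := B) p s).cost d ≤ 200 * recSize := by
  by_cases e : p + 1 = s
  · obtain ⟨h1, h2, h3⟩ := writeList_spec (Rec.blank.blocks B) (recSize * (s - 1)) d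
    simp only [relocate, if_pos e, setRec, h1, h2, h3, Rec.length_blocks, true_and]
    have h4 : ∀ q ∈ T.Q, ad q ≠ s - 1 := fun q hq e' => hfree q hq (by omega)
    have h5 := h.rep.clear (by omega) h4
    have h6 : (fun q => if ad q = s - 1 then p else ad q) = ad := by
      funext q
      split_ifs
      · omega
      · rfl
    rw [h6]
    exact ⟨h5, by omega⟩
  · have himg : T.Q.image ad = (Finset.range s).erase p := by
      refine Finset.eq_of_subset_of_card_le (fun a ha => ?_) ?_
      · obtain ⟨q, hq, rfl⟩ := Finset.mem_image.1 ha
        exact Finset.mem_erase.2 ⟨hfree q hq, Finset.mem_range.2 (h.rep.lt q hq)⟩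
      · rw [Finset.card_image_of_injOn h.rep.inj, Finset.card_erase_of_mem (Finset.mem_range.2 hp),
          Finset.card_range]
        omega
    obtain ⟨l, hl, hls⟩ : ∃ l ∈ T.Q, ad l = s - 1 := by
      have : s - 1 ∈ T.Q.image ad := by
        rw [himg]
        exact Finset.mem_erase.2 ⟨by omega, Finset.mem_range.2 (by omega)⟩
      simpa using this
    obtain ⟨a1, a2, a3, a4⟩ := getRec_ok h hl
    rw [hls] at a1 a2 a3 a4
    obtain ⟨b1, b2, b3, b4⟩ := getRec_ok h (par_mem h.wf.root l)
    obtain ⟨c1, c2, c3, c4⟩ := getKids_ok h hl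
    set ws : List (ℕ × Rec) := (p, recOf T ad l) :: (ad (par T.Q l), { recOf T ad (par T.Q l) with
        kid := (recOf T ad (par T.Q l)).kid.image
          (fun x => if x.2 = s - 1 then (x.1, p) else x) }) ::
      (recOf T ad l).kid.toList.map (fun x => (x.2, { findRec ((recOf T ad l).kid.toList.map
        fun x => recOf T ad x.1) x.1 with up := p })) with hws
    obtain ⟨e1, e2, e3⟩ := setRecs_spec ws d
    obtain ⟨f1, f2, f3⟩ := writeList_spec (Rec.blank.blocks B) (recSize * (s - 1)) (putRecs d ws)
    have hup : (recOf T ad l).up = ad (par T.Q l) := rfl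
    simp only [relocate, if_neg e, fin_bind, out_bind, cost_bind, a1, a2, a3, a4, hup, b1, b2, b3,
      b4, c1, c2, c3, setRec, List.nil_append]
    rw [← hws]
    simp only [e1, e2, e3, f1, f2, f3, List.nil_append, true_and, Rec.length_blocks]
    refine ⟨h.rep.relocate h.wf (by omega) hfree hl hls fun w => ?_, ?_⟩
    · simp only [hws, List.mem_cons, mem_kid_map]
      refine or_congr_right (or_congr_right (exists_congr fun c => and_congr_right fun hc => ?_))
      rw [findRec_kid hc]
    · have h1 := h.length_kidAddrs_le hl
      have h2 : ws.length ≤ 76 := by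
        simp only [hws, List.length_cons, List.length_map]
        simp only [Rec.kidAddrs, List.length_map] at h1
        omega
      have h3 := Nat.mul_le_mul_right recSize h2
      omega

end Prog

open Classical in
/-- An appropriate operation at the cell with record `r`, where `kr` are the records of the cells
below. -/
def chooseOp (B : ℕ) (r : Rec) (kr : Str → Rec) : Op :=
  if h : ∃ o, Legal B r.cell r.reg r.pend (r.kid.image Prod.fst)
      (fun c => trieSize (kr c).reg + 64 * B * (kr c).kid.card) (fun c => (kr c).pend) o then
    h.choose else .up

theorem image_fst_kid (q : Str) : (recOf T ad q).kid.image Prod.fst = kids T.Q q := by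
  simp [recOf, Finset.image_image, Function.comp_def]

/-- The records of `v` and its kids determine which operations are appropriate, so the choice can be
made in internal memory. -/
theorem chooseOp_legal {v : Str} {kr : Str → Rec} (hk : ∀ c ∈ kids T.Q v, kr c = recOf T ad c)
    (h : ∃ o, T.Legal B v o) : T.Legal B v (chooseOp B (recOf T ad v) kr) := by
  have hw : ∀ c ∈ kids T.Q v, trieSize (kr c).reg + 64 * B * (kr c).kid.card = T.wt B c := by
    intro c hc
    rw [hk c hc, card_kid]
    rfl
  have hp : ∀ c ∈ kids T.Q v, (kr c).pend = T.P c := fun c hc => by rw [hk c hc]; rfl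
  have h' : ∃ o, Legal B (recOf T ad v).cell (recOf T ad v).reg (recOf T ad v).pend
      ((recOf T ad v).kid.image Prod.fst)
      (fun c => trieSize (kr c).reg + 64 * B * (kr c).kid.card) (fun c => (kr c).pend) o := by
    obtain ⟨o, ho⟩ := h
    rw [image_fst_kid]
    exact ⟨o, Legal.congr ho hw hp⟩
  rw [chooseOp, dif_pos h']
  have := h'.choose_spec
  generalize h'.choose = o at this
  rw [image_fst_kid] at this
  exact Legal.congr this (fun c hc => (hw c hc).symm) fun c hc => (hp c hc).symm

namespace Prog

/-- Performing an operation at the cell with record `r` at address `a`. The result is the address of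
the new current cell, the new number of records, and whether the work is done. -/
def operate (a s : ℕ) (r : Rec) (kr : Str → Rec) : Op → Prog B (ℕ × ℕ × Bool)
  | .up => ret (r.up, s, decide (r.cell = []))
  | .down c => ret (r.addr c, s, false)
  | .cut c => (setRecs ((a, { r with
        reg := r.reg.filter (fun k => ¬ c <+: k),
        kid := insert (c, s) (r.kid.filter (fun x => ¬ c <+: x.1)) }) ::
      (s, ⟨c, a, r.reg.filter (c <+: ·), ∅, r.kid.filter (fun x => c <+: x.1)⟩) ::
      (r.kid.filter (fun x => c <+: x.1)).toList.map fun x => (x.2, { kr x.1 with up := s }))).bind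
        fun _ => ret (a, s + 1, false)
  | .flush C => (setRecs ((a, { r with
        reg := symmDiff r.reg (ownPart (r.kid.image Prod.fst) C), pend := r.pend \ C }) ::
      r.kid.toList.map fun x => (x.2, { kr x.1 with
        pend := symmDiff (kr x.1).pend (C.filter (x.1 <+: ·)) }))).bind
        fun _ => ret (a, s, false)
  | .absorb c => (getRecs (kr c).kidAddrs).bind fun gs =>
      (setRecs ((a, { r with
          reg := r.reg ∪ (kr c).reg,
          kid := r.kid.filter (fun x => x.1 ≠ c) ∪ (kr c).kid }) ::
        (kr c).kid.toList.map fun x => (x.2, { findRec gs x.1 with up := a }))).bind fun _ =>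
          (relocate (r.addr c) s).bind fun _ =>
            ret (if a = s - 1 then r.addr c else a, s - 1, false)

/-- The work at the cell with address `a`. -/
def work (a s : ℕ) : Prog B (ℕ × ℕ × Bool) :=
  (getRec a).bind fun r => (getRecs r.kidAddrs).bind fun rs =>
    operate a s r (findRec rs) (chooseOp B r (findRec rs))

end Prog

/-- The state of external memory in the course of the work at the cell `v`. -/
structure Busy (B E : ℕ) (T : Tree) (ad : Str → ℕ) (v : Str) (d : ℕ → BitVec B) : Prop where
  inv : T.Inv B E v
  le : E ≤ 4 * B
  pos : 0 < B
  rep : Rep T ad T.Q.card d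

theorem Busy.ok {v : Str} (h : Busy B E T ad v d) : Ok B E T ad T.Q.card d :=
  ⟨h.inv.wf, h.le, h.pos, h.inv.slim, Nat.le_succ _, h.rep⟩

theorem Prog.operate_spec {v : Str} (h : Busy B E T ad v d) {kr : Str → Rec}
    (hk : ∀ c ∈ kids T.Q v, kr c = recOf T ad c) {o : Op} (ho : T.Legal B v o)
    (hup : o = .up → v ≠ []) :
    (operate (B := B) (ad v) T.Q.card (recOf T ad v) kr o).out d = [] ∧
    (operate (B := B) (ad v) T.Q.card (recOf T ad v) kr o).cost d ≤ 400 * recSize ∧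
    ∃ ad', (operate (B := B) (ad v) T.Q.card (recOf T ad v) kr o).res d
        = (ad' (T.move v o), (T.apply v o).Q.card, false) ∧
      Rep (T.apply v o) ad' (T.apply v o).Q.card
        ((operate (ad v) T.Q.card (recOf T ad v) kr o).fin d) := by
  have hv := h.inv.mem
  have hT := h.inv.wf
  have hlen := h.ok.length_kidAddrs_le hv
  simp only [Rec.kidAddrs, List.length_map] at hlen
  cases o with
  | up =>
    refine ⟨rfl, Nat.zero_le _, ad, ?_, h.rep⟩
    have : (recOf T ad v).cell ≠ [] := hup rfl
    simp only [operate, res, this, decide_false]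
    rfl
  | down c =>
    refine ⟨rfl, Nat.zero_le _, ad, ?_, h.rep⟩
    simp only [operate, res, addr_recOf ho.1]
    rfl
  | flush C =>
    set ws : List (ℕ × Rec) := (ad v, { recOf T ad v with
        reg := symmDiff (recOf T ad v).reg (ownPart ((recOf T ad v).kid.image Prod.fst) C),
        pend := (recOf T ad v).pend \ C }) ::
      (recOf T ad v).kid.toList.map (fun x => (x.2, { kr x.1 with
        pend := symmDiff (kr x.1).pend (C.filter (x.1 <+: ·)) })) with hws
    obtain ⟨e1, e2, e3⟩ := setRecs_spec ws d
    simp only [operate, fin_bind, out_bind, cost_bind, res_bind]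
    rw [← hws]
    simp only [e1, e2, e3, fin, out, cost, res]
    refine ⟨rfl, ?_, ad, rfl, ?_⟩
    · have : ws.length ≤ 75 := by
        simp only [hws, List.length_cons, List.length_map]
        omega
      exact Nat.mul_le_mul_right _ (by omega)
    · refine h.rep.flush hT hv ho.2.2.1 fun w => ?_
      simp only [hws, List.mem_cons, mem_kid_map, image_fst_kid]
      refine or_congr_right (exists_congr fun c => and_congr_right fun hc => ?_)
      rw [hk c hc]
      rfl
  | cut c =>
    obtain ⟨ho1, ho2⟩ := ho.cut_own hT hv
    set ws : List (ℕ × Rec) := (ad v, { recOf T ad v with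
        reg := (recOf T ad v).reg.filter (fun k => ¬ c <+: k),
        kid := insert (c, T.Q.card) ((recOf T ad v).kid.filter (fun x => ¬ c <+: x.1)) }) ::
      (T.Q.card, ⟨c, ad v, (recOf T ad v).reg.filter (c <+: ·), ∅,
        (recOf T ad v).kid.filter (fun x => c <+: x.1)⟩) ::
      ((recOf T ad v).kid.filter (fun x => c <+: x.1)).toList.map
        (fun x => (x.2, { kr x.1 with up := T.Q.card })) with hws
    obtain ⟨e1, e2, e3⟩ := setRecs_spec ws d
    simp only [operate, fin_bind, out_bind, cost_bind, res_bind]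
    rw [← hws]
    simp only [e1, e2, e3, fin, out, cost, res]
    have hcard : (T.cut c).Q.card = T.Q.card + 1 := Finset.card_insert_of_notMem ho2
    refine ⟨rfl, ?_, Function.update ad c T.Q.card, ?_, ?_⟩
    · have : ws.length ≤ 76 := by
        simp only [hws, List.length_cons, List.length_map, Finset.length_toList] at hlen ⊢
        have := Finset.card_filter_le (recOf T ad v).kid (fun x => c <+: x.1)
        omega
      exact Nat.mul_le_mul_right _ (by omega)
    · have : v ≠ c := fun e => ho2 (e ▸ hv)
      simp only [Tree.move, Tree.apply, hcard, Function.update_of_ne this]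
    · have := h.rep.cut hT hv ho1 ho2 (ws := ws) fun w => ?_
      · rw [← hcard] at this
        exact this
      · simp only [hws, List.mem_cons, List.mem_map, Finset.mem_toList, Finset.mem_filter, mem_kid]
        refine or_congr_right (or_congr_right ⟨?_, ?_⟩)
        · rintro ⟨x, ⟨⟨e, he, rfl⟩, hce⟩, rfl⟩
          exact ⟨e, he, hce, by rw [hk e he]⟩
        · rintro ⟨e, he, hce, rfl⟩
          exact ⟨_, ⟨⟨e, he, rfl⟩, hce⟩, by rw [hk e he]⟩
  | absorb c =>
    obtain ⟨hc, hcw, hcp⟩ := ho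
    have hcQ := (mem_kids.1 hc).1
    have hI := h.inv.absorb h.pos hc hcw hcp
    have hcard : (T.absorb c).Q.card + 1 = T.Q.card := Finset.card_erase_add_one hcQ
    obtain ⟨b1, b2, b3, b4⟩ := getKids_ok h.ok hcQ
    set ws : List (ℕ × Rec) := (ad v, { recOf T ad v with
          reg := (recOf T ad v).reg ∪ (recOf T ad c).reg,
          kid := (recOf T ad v).kid.filter (fun x => x.1 ≠ c) ∪ (recOf T ad c).kid }) ::
        (recOf T ad c).kid.toList.map (fun x => (x.2, { findRec ((recOf T ad c).kid.toList.map
          fun x => recOf T ad x.1) x.1 with up := ad v })) with hws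
    obtain ⟨e1, e2, e3⟩ := setRecs_spec ws d
    have hrep : Rep (T.absorb c) ad T.Q.card (putRecs d ws) := by
      refine h.rep.absorb hT hc fun w => ?_
      simp only [hws, List.mem_cons, mem_kid_map]
      refine or_congr_right (exists_congr fun e => and_congr_right fun he => ?_)
      rw [findRec_kid he]
    have hok : Ok B E (T.absorb c) ad T.Q.card (putRecs d ws) :=
      ⟨hI.wf, h.le, h.pos, hI.slim, hcard.ge, hrep⟩
    -- The address of the absorbed cell is the free one, since addresses are injective on the old
    -- cells.
    obtain ⟨f1, f2, f3⟩ := relocate_spec hok hcard.symm (h.rep.lt c hcQ) fun q hq e => by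
      obtain ⟨h1, h2⟩ := Finset.mem_erase.1 hq
      exact h1 (h.rep.inj h2 hcQ e)
    have hcard' : (T.absorb c).Q.card = T.Q.card - 1 := by omega
    simp only [operate, fin_bind, out_bind, cost_bind, res_bind, hk c hc, b1, b2, b3,
      addr_recOf hc]
    rw [← hws]
    simp only [e1, e2, e3, fin, out, cost, res, f2, List.append_nil, Nat.add_zero]
    refine ⟨trivial, ?_, fun q => if ad q = T.Q.card - 1 then ad c else ad q, ?_, ?_⟩
    · have h1 := h.ok.length_kidAddrs_le hcQ
      have h2 : ws.length ≤ 75 := by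
        simp only [hws, List.length_cons, List.length_map]
        simp only [Rec.kidAddrs, List.length_map] at h1
        omega
      have h3 := Nat.mul_le_mul_right recSize h2
      omega
    · change _ = (_, (T.absorb c).Q.card, false)
      rw [hcard']
      rfl
    · change Rep (T.absorb c) _ (T.absorb c).Q.card _
      rw [hcard']
      exact f1

/-- The work at a cell makes progress. -/
theorem Prog.work_spec {v : Str} (h : Busy B E T ad v d) :
    (work (B := B) (ad v) T.Q.card).out d = [] ∧
    0 < (work (B := B) (ad v) T.Q.card).cost d ∧
    (work (B := B) (ad v) T.Q.card).cost d ≤ 500 * recSize ∧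
    (((work (B := B) (ad v) T.Q.card).res d).2 = (T.Q.card, true) ∧
        (work (ad v) T.Q.card).fin d = d ∧ T.Settled B E ∧ v = [] ∨
      ∃ T' ad' v', (work (B := B) (ad v) T.Q.card).res d = (ad' v', T'.Q.card, false) ∧
        Busy B E T' ad' v' ((work (ad v) T.Q.card).fin d) ∧
        T'.pot B v' + 64 * B ≤ T.pot B v ∧ ∀ k, T'.content k = T.content k) := by
  have hv := h.inv.mem
  obtain ⟨a1, a2, a3, a4⟩ := getRec_ok h.ok hv
  obtain ⟨b1, b2, b3, b4⟩ := getKids_ok h.ok hv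
  set kr := findRec ((recOf T ad v).kid.toList.map fun x => recOf T ad x.1) with hkr
  have hk : ∀ c ∈ kids T.Q v, kr c = recOf T ad c := fun c hc => findRec_kid hc
  have ho := chooseOp_legal (B := B) hk (Tree.exists_legal h.inv.wf h.le h.pos hv)
  have hpos : 0 < recSize := by rw [recSize_eq]; omega
  simp only [work, res_bind, fin_bind, out_bind, cost_bind, a1, a2, a3, a4, b1, b2, b3,
    List.nil_append]
  rw [← hkr]
  generalize chooseOp B (recOf T ad v) kr = o at ho
  by_cases hup : o = .up → v ≠ []
  · obtain ⟨c1, c2, ad', c3, c4⟩ := operate_spec h hk ho hup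
    obtain ⟨g1, g2, g3⟩ := h.inv.apply h.le h.pos ho hup
    exact ⟨c1, by omega, by omega, Or.inr ⟨_, ad', _, c3, ⟨g1, h.le, h.pos, c4⟩, g2, g3⟩⟩
  · push Not at hup
    obtain ⟨rfl, rfl⟩ := hup
    refine ⟨rfl, by omega, ?_, Or.inl ⟨?_, rfl, h.inv.settled ho, rfl⟩⟩
    · simp only [operate, cost]
      omega
    · simp [operate, res, recOf]

end BitmapIndex

/-! ### Initial trees, and the number and size of cells below a prefix. -/

namespace BitmapIndex

variable {B E : ℕ} {T : Tree}

/-! ### Building a tree -/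

/-- A tree without pending changes. -/
def Tree.clean (Q R : Finset Str) : Tree := ⟨Q, R, fun _ => ∅⟩

theorem exists_prefix_of_wtIn {τ : ℕ} {Q R : Finset Str} {v h : Str} (hw : 0 < wtIn τ Q R v h) :
    ∃ k, (k ∈ R ∨ k ∈ Q) ∧ h <+: k := by
  by_contra hno
  push Not at hno
  have e1 : (reg Q R v).filter (h <+: ·) = ∅ :=
    Finset.filter_false_of_mem fun k hk => hno k (Or.inl (mem_reg.1 hk).1)
  have e2 : (kids Q v).filter (h <+: ·) = ∅ :=
    Finset.filter_false_of_mem fun k hk => hno k (Or.inr (mem_kids.1 hk).1)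
  rw [wtIn, e1, e2] at hw
  simp at hw

/-- Starting from one cell, heavy cells are cut as long as there are any. This ends because there
are fewer than `2 ^ E` possible cells. -/
theorem exists_clean {R : Finset Str} (hR : ∀ k ∈ R, k.length + 1 ≤ E) (hE : E ≤ 4 * B)
    (hB : 0 < B) (hE0 : 0 < E) :
    ∃ Q, (Tree.clean Q R).WF E ∧ (∀ q ∈ Q, (Tree.clean Q R).wt B q ≤ 2048 * B) ∧
      ∀ q ∈ Q, q ≠ [] → 448 * B ≤ (Tree.clean Q R).wt B q := by
  have key : ∀ (n : ℕ) (Q : Finset Str), 2 ^ E - Q.card = n → (Tree.clean Q R).WF E →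
      (∀ q ∈ Q, q ≠ [] → 448 * B ≤ (Tree.clean Q R).wt B q) →
      ∃ Q, (Tree.clean Q R).WF E ∧ (∀ q ∈ Q, (Tree.clean Q R).wt B q ≤ 2048 * B) ∧
        ∀ q ∈ Q, q ≠ [] → 448 * B ≤ (Tree.clean Q R).wt B q := by
    intro n
    induction n using Nat.strong_induction_on with
    | _ n ih =>
      intro Q hn hT hw
      by_cases hall : ∀ q ∈ Q, (Tree.clean Q R).wt B q ≤ 2048 * B
      · exact ⟨Q, hT, hall, hw⟩
      · push Not at hall
        obtain ⟨v, hv, hvw⟩ := hall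
        -- A piece weighs between `510 * B` and `1024 * B`, and more than `1024 * B` remain at `v`,
        -- so neither part falls below `448 * B`.
        obtain ⟨h, hh, ho, h1, h2⟩ := exists_cut (τ := 64 * B) (E := E) (θ := 1024 * B) hT.lenR hv
          (show 1024 * B < (Tree.clean Q R).wt B v by omega) (by omega)
        change wtIn (64 * B) Q R v h ≤ _ at h1
        change _ ≤ 2 * wtIn (64 * B) Q R v h + E at h2
        obtain ⟨k, hk, hhk⟩ := exists_prefix_of_wtIn (τ := 64 * B) (Q := Q) (R := R) (v := v)
          (h := h) (by omega)
        have hl : h.length + 1 ≤ E := by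
          have h3 := hhk.length_le
          have h4 : k.length + 1 ≤ E := hk.elim (hR k) (hT.lenQ k)
          omega
        have hT' : (Tree.clean (insert h Q) R).WF E := Tree.WF.cut hT hl
        have hc := card_le_of_length hT'.lenQ
        have hc' : (insert h Q).card = Q.card + 1 := Finset.card_insert_of_notMem hh
        change (insert h Q).card + 1 ≤ _ at hc
        refine ih _ ?_ (insert h Q) rfl hT' fun q hq hq0 => ?_
        · omega
        · change 448 * B ≤ ((Tree.clean Q R).cut h).wt B q
          by_cases e : q = h
          · subst e
            rw [Tree.wt_cut_self hT ho hh]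
            change 448 * B ≤ wtIn (64 * B) Q R v q
            omega
          · by_cases e' : q = v
            · subst e'
              have h3 := (Tree.wt_cut (B := B) hT ho hh hl).2
              change _ ≤ _ + wtIn (64 * B) Q R q h at h3
              omega
            · rw [Tree.wt_cut_of_ne hT ho hh e' e]
              exact hw q ((Finset.mem_insert.1 hq).resolve_left e) hq0
  refine key _ {[]} rfl ⟨by simp [Tree.clean], fun _ _ => rfl, ?_, hR, ?_, ?_⟩ ?_
  · intro v k hk
    simp [Tree.clean] at hk
  · intro v k hk
    simp [Tree.clean] at hk
  · intro v hv
    obtain rfl : v = [] := by simpa [Tree.clean] using hv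
    simp; omega
  · intro q hq hq0
    exact absurd (by simpa using hq) hq0

/-- Every set of keys is represented by a settled tree without potential. -/
theorem exists_settled {R : Finset Str} (hR : ∀ k ∈ R, k.length + 1 ≤ E) (hE : E ≤ 4 * B)
    (hB : 0 < B) (hE0 : 0 < E) :
    ∃ T : Tree, T.Settled B E ∧ T.rest B = 0 ∧ ∀ k, T.content k = ind R k := by
  obtain ⟨Q, hT, h1, h2⟩ := exists_clean hR hE hB hE0
  refine ⟨Tree.clean Q R, ⟨hT, by simp [Tree.clean], ?_, fun v hv hv0 => ?_⟩, ?_, fun k => ?_⟩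
  · have := h1 [] hT.root
    omega
  · have h3 := h1 v hv
    have h4 := h2 v hv hv0
    refine ⟨by simp [Tree.clean], ?_, ?_⟩
    · omega
    · omega
  · have h3 : (Tree.clean Q R).heat = 0 := by simp [Tree.heat, Tree.clean]
    have h4 : (Tree.clean Q R).stress B = 0 := by
      refine Finset.sum_eq_zero fun v hv => ?_
      have h5 := h1 v hv
      have h6 := h2 v hv
      unfold Tree.strain
      split_ifs with h0
      · omega
      · have := h6 h0
        omega
    rw [Tree.rest, h3, h4]
    omega
  · simp [Tree.content, Tree.clean]

/-- The tree of one cell without keys. -/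
theorem settled_trivial (hE0 : 0 < E) :
    (Tree.clean {[]} ∅).Settled B E ∧ (Tree.clean {[]} ∅).rest B = 0 ∧
      ∀ k, (Tree.clean {[]} ∅).content k = 0 := by
  have hT : (Tree.clean {[]} ∅).WF E := by
    refine ⟨by simp [Tree.clean], fun _ _ => rfl, ?_, ?_, ?_, ?_⟩
    · intro v k hk
      simp [Tree.clean] at hk
    · intro k hk
      simp [Tree.clean] at hk
    · intro v k hk
      simp [Tree.clean] at hk
    · intro v hv
      obtain rfl : v = [] := by simpa [Tree.clean] using hv
      simp; omega
  have hk : kids {[]} [] = ∅ := by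
    refine Finset.eq_empty_of_forall_notMem fun c hc => ?_
    obtain ⟨h1, h2, _⟩ := mem_kids.1 hc
    exact h2 (by simpa using h1)
  have hr : reg {[]} ∅ [] = ∅ := Finset.filter_empty _
  have hw : (Tree.clean {[]} ∅).wt B [] = 0 := by
    simp [Tree.wt, wt, Tree.clean, hr, hk]
  refine ⟨⟨hT, by simp [Tree.clean], by rw [hw]; exact Nat.zero_le _, fun v hv hv0 => ?_⟩, ?_,
    fun k => by simp [Tree.content, Tree.clean]⟩
  · exact absurd (by simpa [Tree.clean] using hv) hv0
  · have h3 : (Tree.clean {[]} ∅).heat = 0 := by simp [Tree.heat, Tree.clean]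
    have h4 : (Tree.clean {[]} ∅).stress B = 0 := by
      refine Finset.sum_eq_zero fun v hv => ?_
      obtain rfl : v = [] := by simpa [Tree.clean] using hv
      rw [hw]
      simp [Tree.strain]
    rw [Tree.rest, h3, h4]
    omega

/-! ### Counting cells -/

/-- The cells that are comparable to `a`. -/
def comp (Q : Finset Str) (a : Str) : Finset Str := Q.filter (fun v => v <+: a ∨ a <+: v)

theorem card_comp_le (Q : Finset Str) (a : Str) :
    (comp Q a).card ≤ a.length + 1 + (below Q a).card := by
  have : comp Q a ⊆ a.inits.toFinset ∪ below Q a := by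
    intro v hv
    obtain ⟨h1, h2⟩ := Finset.mem_filter.1 hv
    rw [Finset.mem_union]
    by_cases h3 : v <+: a
    · exact Or.inl (by simpa using h3)
    · refine Or.inr (Finset.mem_filter.2 ⟨h1, h2.resolve_left h3, ?_⟩)
      rintro rfl
      exact h3 (List.prefix_refl _)
  refine (Finset.card_le_card this).trans ((Finset.card_union_le _ _).trans ?_)
  refine Nat.add_le_add_right ((List.toFinset_card_le _).trans ?_) _
  simp

theorem strip_eq_empty {v a : Str} {Y : Finset Str} (hY : ∀ k ∈ Y, v <+: k)
    (h : ¬ (v <+: a ∨ a <+: v)) : strip a Y = ∅ := by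
  refine Finset.eq_empty_of_forall_notMem fun k hk => h ?_
  exact prefix_comparable (hY _ (mem_strip.1 hk)) (List.prefix_append a k)

theorem ind_strip (a : Str) (Y : Finset Str) (k : Str) : ind (strip a Y) k = ind Y (a ++ k) := by
  simp [ind]

/-- Modulo 2, `T.R` is the sum of `K`, the buffer and all pending changes. Pending changes extend
their cell, so only cells comparable to `a` contribute below `a`. -/
theorem trieSize_strip_R_le (hT : T.WF E) {K buf : Finset Str}
    (hK : ∀ k, ind K k = ind buf k + T.content k) (a : Str) {c : ℕ}
    (hP : ∀ v, totalLen (T.P v) ≤ c) :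
    trieSize (strip a T.R) ≤ trieSize (strip a K) + totalLen buf + (comp T.Q a).card * c := by
  have h1 : strip a T.R ⊆ strip a K ∪ (strip a buf ∪
      (comp T.Q a).biUnion fun v => strip a (T.P v)) := by
    intro k hk
    by_contra hno
    simp only [Finset.mem_union, Finset.mem_biUnion, not_or, not_exists, not_and] at hno
    obtain ⟨h1, h2, h3⟩ := hno
    have h4 : ∑ v ∈ T.Q, ind (T.P v) (a ++ k) = 0 := by
      refine Finset.sum_eq_zero fun v hv => ?_
      rw [← ind_strip]
      by_cases hc : v <+: a ∨ a <+: v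
      · simp [ind, h3 v (Finset.mem_filter.2 ⟨hv, hc⟩)]
      · rw [strip_eq_empty (hT.pend_prefix v) hc, ind_empty]
    have h5 := hK (a ++ k)
    rw [Tree.content, h4, ← ind_strip, ← ind_strip, ← ind_strip a T.R] at h5
    simp [ind, h1, h2, hk] at h5
  have h2 : trieSize ((comp T.Q a).biUnion fun v => strip a (T.P v)) ≤ (comp T.Q a).card * c := by
    have h3 : ∀ S : Finset Str, trieSize (S.biUnion fun v => strip a (T.P v)) ≤ S.card * c := by
      intro S
      induction S using Finset.induction_on with
      | empty => simp
      | insert v S hv ih =>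
        rw [Finset.biUnion_insert, Finset.card_insert_of_notMem hv]
        have h4 := trieSize_union_le (strip a (T.P v)) (S.biUnion fun v => strip a (T.P v))
        have h5 := (trieSize_le_totalLen _).trans ((totalLen_strip_le a (T.P v)).trans (hP v))
        rw [Nat.add_mul]
        omega
    exact h3 _
  have h3 := (trieSize_le_totalLen _).trans (totalLen_strip_le a buf)
  have h4 := trieSize_union_le (strip a K) (strip a buf ∪
      (comp T.Q a).biUnion fun v => strip a (T.P v))
  have h5 := trieSize_union_le (strip a buf) ((comp T.Q a).biUnion fun v => strip a (T.P v))
  have h6 := trieSize_mono h1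
  omega

/-- There are few cells below `a` if few keys extend `a`. -/
theorem Tree.Settled.card_below_le (h : T.Settled B E) (hE : E ≤ 4 * B) {K buf : Finset Str}
    (hK : ∀ k, ind K k = ind buf k + T.content k) (hbuf : totalLen buf ≤ cap B) (a : Str) :
    119 * B * (below T.Q a).card ≤ trieSize (strip a K) + (a.length + 2) * cap B := by
  -- The least weight `192 * B` of a good cell is `3 * τ`. Of `2 * τ = 128 * B` per cell, up to `8 *
  -- B` are lost to `2 * E` and `B` to pending changes, which leaves `119 * B`.
  have h1 := BitmapIndex.card_below_le (τ := 64 * B) (R := T.R) h.wf.root h.wf.lenQ a fun v hv => by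
    obtain ⟨h1, h2, h3⟩ := Finset.mem_filter.1 hv
    have hv0 : v ≠ [] := by
      rintro rfl
      exact h3 (List.prefix_nil.1 h2).symm
    have := (h.good v h1 hv0).2.1
    change 3 * (64 * B) ≤ T.wt B v
    omega
  have h2 := trieSize_strip_R_le h.wf hK a h.pend_le
  have h3 := Nat.mul_le_mul_right (cap B) (card_comp_le T.Q a)
  have hcap : cap B ≤ B := Nat.div_le_self _ _
  have h4 := Nat.mul_le_mul_left (below T.Q a).card hcap
  have h5 := Nat.mul_le_mul_left (below T.Q a).card hE
  nlinarith

/-- The total size of the tries of the cells. -/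
theorem Tree.Settled.sum_trieSize_le (h : T.Settled B E) (hE : E ≤ 4 * B) {K buf : Finset Str}
    (hK : ∀ k, ind K k = ind buf k + T.content k) (hbuf : totalLen buf ≤ cap B) (a : Str) :
    totalLen buf + ∑ v ∈ comp T.Q a, (trieSize (strip a (reg T.Q T.R v)) + totalLen (T.P v))
      ≤ 2 * trieSize (strip a K) + 3 * ((a.length + 2) * cap B) := by
  -- Duplicated prefixes and pending changes add at most `6 * B` for each cell below `a`; by this
  -- bound that is a small fraction of the trie.
  have h0 := h.card_below_le hE hK hbuf a
  have h1 := sum_trieSize_reg_le (R := T.R) h.wf.root h.wf.lenQ a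
  have h2 := trieSize_strip_R_le h.wf hK a h.pend_le
  have h3 := Nat.mul_le_mul_right (cap B) (card_comp_le T.Q a)
  have hcap : cap B ≤ B := Nat.div_le_self _ _
  have h4 := Nat.mul_le_mul_left (below T.Q a).card hcap
  have h5 := Nat.mul_le_mul_left (below T.Q a).card hE
  have h6 : ∑ v ∈ comp T.Q a, totalLen (T.P v) ≤ (comp T.Q a).card * cap B := by
    rw [← smul_eq_mul]
    exact Finset.sum_le_card_nsmul _ _ _ fun v _ => h.pend_le v
  have h7 : ∑ v ∈ comp T.Q a, trieSize (strip a (reg T.Q T.R v)) ≤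
      ∑ v ∈ T.Q, trieSize (strip a (reg T.Q T.R v)) :=
    Finset.sum_le_sum_of_subset (Finset.filter_subset _ _)
  rw [Finset.sum_add_distrib]
  nlinarith

end BitmapIndex

/-! ### Strings as sets of keys, and decoding of answers. -/

namespace BitmapIndex

/-! ### Keys -/

/-- The positions at which the bitmap of `a` changes. -/
def chg (a : ℕ) (x : List ℕ) : Finset ℕ :=
  -- The position after the last one is included, where a run that reaches the end of the string is
  -- closed.
  (Finset.range (x.length + 1)).filter
    (fun j => ¬ (x[j]? = some a ↔ (0 < j ∧ x[j - 1]? = some a)))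

theorem mem_chg {a : ℕ} {x : List ℕ} {j : ℕ} :
    j ∈ chg a x ↔ ¬ (x[j]? = some a ↔ (0 < j ∧ x[j - 1]? = some a)) := by
  simp only [chg, Finset.mem_filter, Finset.mem_range, and_iff_right_iff_imp]
  intro h
  by_contra hj
  refine h ?_
  rw [List.getElem?_eq_none (by omega), List.getElem?_eq_none (by omega)]
  simp

theorem le_of_mem_chg {a : ℕ} {x : List ℕ} {j : ℕ} (h : j ∈ chg a x) : j ≤ x.length := by
  have := Finset.mem_range.1 (Finset.mem_filter.1 h).1
  omega

/-- Flipping one bit of a bitmap toggles its two boundaries as change points, and absent positions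
count as zeros. -/
theorem chg_append (a b : ℕ) (x : List ℕ) :
    chg a (x ++ [b]) = symmDiff (chg a x) (if a = b then {x.length, x.length + 1} else ∅) := by
  ext j
  rw [mem_chg, Finset.mem_symmDiff, mem_chg]
  have h1 : ∀ i, (x ++ [b])[i]? = some a ↔ (x[i]? = some a ∨ i = x.length ∧ b = a) := by
    intro i
    rcases lt_trichotomy i x.length with h | h | h
    · rw [List.getElem?_append_left h]
      constructor
      · exact Or.inl
      · rintro (h1 | h1)
        exacts [h1, absurd h1.1 h.ne]
    · subst h
      simp
    · rw [List.getElem?_eq_none (by simp; omega), List.getElem?_eq_none (by omega)]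
      simp
      omega
  have h2 : x[x.length]? ≠ some a := by simp
  have h3 : ∀ i, x[i]? = some a → i < x.length := by
    intro i hi
    by_contra h
    rw [List.getElem?_eq_none (by omega)] at hi
    simp at hi
  have h4 : x[x.length + 1]? ≠ some a := fun h => absurd (h3 _ h) (by omega)
  rw [h1, h1]
  by_cases hab : a = b
  · subst hab
    simp only [if_true, Finset.mem_insert, Finset.mem_singleton, and_true]
    rcases lt_trichotomy j x.length with h | h | h
    · have e1 : ¬ j = x.length := by omega
      have e2 : ¬ j - 1 = x.length := by omega
      have e3 : ¬ j = x.length + 1 := by omega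
      simp [e1, e2, e3]
    · subst h
      simp only [h2, true_or]
      by_cases h0 : 0 < x.length
      · have e2 : ¬ x.length - 1 = x.length := by omega
        simp [e2]
      · simp [h0]
    · have e1 : ¬ j = x.length := by omega
      have e4 : ¬ x[j]? = some a := fun h => absurd (h3 _ h) (by omega)
      have e5 : ¬ x[j - 1]? = some a := fun h => absurd (h3 _ h) (by omega)
      have e6 : j - 1 = x.length ↔ j = x.length + 1 := by omega
      have e7 : 0 < j := by omega
      simp [e1, e4, e5, e6, e7]
  · have hba : ¬ b = a := fun e => hab e.symm
    simp [hab, hba]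

/-- One flip for the old character and one for the new; if they are equal, the flips cancel. -/
theorem chg_set (a b c i : ℕ) (x : List ℕ) (hx : x[i]? = some b) :
    chg a (x.set i c) = symmDiff (chg a x) (symmDiff (if a = b then {i, i + 1} else ∅)
      (if a = c then {i, i + 1} else ∅)) := by
  have hi : i < x.length := by
    by_contra h
    rw [List.getElem?_eq_none (by omega)] at hx
    simp at hx
  have h1 : ∀ j, (x.set i c)[j]? = some a ↔ (if j = i then a = c else x[j]? = some a) := by
    intro j
    by_cases h : j = i
    · subst h
      simp [hi, eq_comm]
    · rw [List.getElem?_set_ne (Ne.symm h), if_neg h]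
  ext j
  have h2 : j - 1 = i ∧ 0 < j ↔ j = i + 1 := by omega
  have h3 : x[i]? = some a ↔ a = b := by rw [hx]; simp [eq_comm]
  have key : ∀ p q : Prop, (p ↔ p) ∧ (q ↔ q) := fun _ _ => ⟨Iff.rfl, Iff.rfl⟩
  simp only [Finset.mem_symmDiff, mem_chg, h1]
  by_cases e1 : j = i
  · subst e1
    have e2 : ¬ (j - 1 = j ∧ 0 < j) := by omega
    have e3 : (0 < j ∧ if j - 1 = j then a = c else x[j - 1]? = some a) ↔
        (0 < j ∧ x[j - 1]? = some a) := by
      refine and_congr_right fun h => ?_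
      rw [if_neg (by omega)]
    rw [e3, if_pos rfl, h3]
    generalize (0 < j ∧ x[j - 1]? = some a) = p
    by_cases hb : a = b <;> by_cases hc : a = c <;> by_cases hp : p <;> simp [hb, hc, hp] <;> grind
  · by_cases e2 : j = i + 1
    · subst e2
      simp only [if_neg e1, Nat.add_sub_cancel, if_true, h3, Nat.succ_pos, true_and]
      generalize (x[i + 1]? = some a) = p
      by_cases hb : a = b <;> by_cases hc : a = c <;> by_cases hp : p <;> simp [hb, hc, hp] <;> grind
    · have e3 : (0 < j ∧ if j - 1 = i then a = c else x[j - 1]? = some a) ↔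
          (0 < j ∧ x[j - 1]? = some a) := by
        refine and_congr_right fun h => ?_
        rw [if_neg (by omega)]
      have e4 : ∀ p : Prop, ∀ [Decidable p], j ∉ (if p then ({i, i + 1} : Finset ℕ) else ∅) := by
        intro p _
        split_ifs
        · simp [e1, e2]
        · simp
      rw [e3, if_neg e1]
      simp [e4]

/-- The binary representation of a position, most significant bit first. -/
def posCode (j : ℕ) : Str := j.bits.reverse

theorem posCode_injective : Function.Injective posCode := fun _ _ h =>
  nat_bits_injective (List.reverse_injective h)

theorem length_posCode (j : ℕ) : (posCode j).length = j.size := by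
  simp [posCode, Nat.size_eq_bits_len]

/-- The code of a character with `w` bits. -/
def charCode (w a : ℕ) : Str := List.ofFn fun i : Fin w => a.testBit i

@[simp] theorem length_charCode (w a : ℕ) : (charCode w a).length = w := by simp [charCode]

theorem charCode_inj {w a b : ℕ} (ha : a < 2 ^ w) (hb : b < 2 ^ w)
    (h : charCode w a = charCode w b) : a = b := by
  have h1 := List.ofFn_injective h
  refine Nat.eq_of_testBit_eq fun i => ?_
  by_cases hi : i < w
  · exact congrFun h1 ⟨i, hi⟩
  · have : 2 ^ w ≤ 2 ^ i := Nat.pow_le_pow_right (by norm_num) (by omega)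
    rw [Nat.testBit_lt_two_pow (ha.trans_le this), Nat.testBit_lt_two_pow (hb.trans_le this)]

/-- The keys of sets of positions for every character. -/
def glue (σ : ℕ) (D : ℕ → Finset ℕ) : Finset Str :=
  (Finset.range σ).biUnion fun a => (D a).image fun j => charCode σ.size a ++ posCode j

theorem mem_glue {σ : ℕ} {D : ℕ → Finset ℕ} {k : Str} :
    k ∈ glue σ D ↔ ∃ a < σ, ∃ j ∈ D a, charCode σ.size a ++ posCode j = k := by
  simp [glue]

/-- Codes of characters have the same width, so none is a proper prefix of another. -/
theorem strip_glue {σ : ℕ} (D : ℕ → Finset ℕ) {a : ℕ} (ha : a < σ) :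
    strip (charCode σ.size a) (glue σ D) = (D a).image posCode := by
  ext t
  simp only [mem_strip, mem_glue, Finset.mem_image]
  have hw : ∀ b < σ, b < 2 ^ σ.size := fun b hb => hb.trans (Nat.lt_size_self σ)
  constructor
  · rintro ⟨b, hb, j, hj, e⟩
    obtain ⟨h1, h2⟩ := List.append_inj e (by simp)
    obtain rfl := charCode_inj (hw b hb) (hw a ha) h1
    exact ⟨j, hj, h2⟩
  · rintro ⟨j, hj, rfl⟩
    exact ⟨a, ha, j, hj, rfl⟩

theorem glue_symmDiff (σ : ℕ) (D D' : ℕ → Finset ℕ) :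
    glue σ (fun a => symmDiff (D a) (D' a)) = symmDiff (glue σ D) (glue σ D') := by
  have key : ∀ {D : ℕ → Finset ℕ} {k : Str}, k ∈ glue σ D → ∃ a < σ, ∃ j,
      charCode σ.size a ++ posCode j = k := by
    intro D k hk
    obtain ⟨a, ha, j, _, e⟩ := mem_glue.1 hk
    exact ⟨a, ha, j, e⟩
  have key2 : ∀ (D : ℕ → Finset ℕ) {a j : ℕ}, a < σ →
      (charCode σ.size a ++ posCode j ∈ glue σ D ↔ j ∈ D a) := by
    intro D a j ha
    rw [← mem_strip, strip_glue D ha, posCode_injective.mem_finset_image]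
  ext k
  by_cases hk : ∃ a < σ, ∃ j, charCode σ.size a ++ posCode j = k
  · obtain ⟨a, ha, j, rfl⟩ := hk
    simp only [Finset.mem_symmDiff, key2 _ ha]
  · have h1 : ∀ D : ℕ → Finset ℕ, k ∉ glue σ D := fun D h => hk (key h)
    simp [Finset.mem_symmDiff, h1]

/-- The keys of a string over `σ` characters. -/
def keys (σ : ℕ) (x : List ℕ) : Finset Str := glue σ fun a => chg a x

/-- The positions that change for the character `a` in an update of a string of length `n`. -/
def touched {σ : ℕ} (n : ℕ) (a : ℕ) : Update σ → Finset ℕ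
  | .append b => if a = b then {n, n + 1} else ∅
  | .change i b c => symmDiff (if a = b then {i, i + 1} else ∅) (if a = c then {i, i + 1} else ∅)

/-- The keys that change in an update of a string of length `n`. -/
def toggle {σ : ℕ} (n : ℕ) (u : Update σ) : Finset Str := glue σ fun a => touched n a u

/-- The characters of a string as natural numbers. -/
def nat {σ : ℕ} (x : List (Fin σ)) : List ℕ := x.map Fin.val

theorem getElem?_nat {σ : ℕ} (x : List (Fin σ)) (i : ℕ) (a : Fin σ) :
    (nat x)[i]? = some (a : ℕ) ↔ x[i]? = some a := by
  simp [nat, Fin.val_inj]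

theorem keys_apply {σ : ℕ} (x : List (Fin σ)) (u : Update σ) (hu : u.Valid x) :
    keys σ (nat (u.apply x)) = symmDiff (keys σ (nat x)) (toggle x.length u) := by
  unfold keys toggle
  rw [← glue_symmDiff]
  congr 1
  funext a
  cases u with
  | append b =>
    have : nat (x ++ [b]) = nat x ++ [(b : ℕ)] := by simp [nat]
    simp only [Update.apply, touched, this, chg_append]
    simp [nat]
  | change i b c =>
    have h1 : nat (x.set i c) = (nat x).set i c := by simp [nat, List.map_set]
    simp only [Update.apply, touched, h1]
    exact chg_set a b c i (nat x) ((getElem?_nat x i b).2 hu)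

/-- A bound on the lengths of the keys of a string of length `n`. -/
def keyLen (σ n : ℕ) : ℕ := σ.size + n.size + 1

theorem keyLen_mono {σ m n : ℕ} (h : m ≤ n) : keyLen σ m ≤ keyLen σ n := by
  have := Nat.size_le_size h
  unfold keyLen
  omega

theorem length_glue {σ n : ℕ} {D : ℕ → Finset ℕ} (h : ∀ a, ∀ j ∈ D a, j ≤ n) :
    ∀ k ∈ glue σ D, k.length + 1 ≤ keyLen σ n := by
  intro k hk
  obtain ⟨a, _, j, hj, rfl⟩ := mem_glue.1 hk
  have := Nat.size_le_size (h a j hj)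
  simp only [List.length_append, length_charCode, length_posCode, keyLen]
  omega

theorem length_keys {σ : ℕ} (x : List ℕ) : ∀ k ∈ keys σ x, k.length + 1 ≤ keyLen σ x.length :=
  length_glue fun _ _ h => le_of_mem_chg h

theorem length_apply {σ : ℕ} (x : List (Fin σ)) (u : Update σ) :
    x.length ≤ (u.apply x).length ∧ (u.apply x).length ≤ x.length + 1 := by
  cases u <;> simp [Update.apply]

theorem touched_le {σ : ℕ} (x : List (Fin σ)) (u : Update σ) (hu : u.Valid x) (a j : ℕ)
    (hj : j ∈ touched x.length a u) : j ≤ (u.apply x).length := by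
  cases u with
  | append b =>
    simp only [touched] at hj
    simp only [Update.apply, List.length_append, List.length_singleton]
    split_ifs at hj
    · simp only [Finset.mem_insert, Finset.mem_singleton] at hj
      omega
    · simp at hj
  | change i b c =>
    have hi : i < x.length := by
      by_contra h
      have : x[i]? = some b := hu
      rw [List.getElem?_eq_none (by omega)] at this
      simp at this
    have := symmDiff_le_sup (a := (if a = b then ({i, i + 1} : Finset ℕ) else ∅))
      (b := (if a = c then ({i, i + 1} : Finset ℕ) else ∅)) hj
    simp only [Finset.sup_eq_union, Finset.mem_union] at this
    simp only [Update.apply, List.length_set]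
    split_ifs at this <;> simp at this <;> omega

theorem length_toggle {σ : ℕ} (x : List (Fin σ)) (u : Update σ) (hu : u.Valid x) :
    ∀ k ∈ toggle x.length u, k.length + 1 ≤ keyLen σ (u.apply x).length :=
  length_glue fun a j hj => touched_le x u hu a j hj

theorem card_toggle {σ : ℕ} (n : ℕ) (u : Update σ) : (toggle n u).card ≤ 4 := by
  have key : ∀ (b : ℕ) (p : ℕ), glue σ (fun a => if a = b then {p, p + 1} else ∅) ⊆
      {charCode σ.size b ++ posCode p, charCode σ.size b ++ posCode (p + 1)} := by
    intro b p k hk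
    obtain ⟨a, _, j, hj, rfl⟩ := mem_glue.1 hk
    split_ifs at hj with h
    · subst h
      simp only [Finset.mem_insert, Finset.mem_singleton] at hj ⊢
      rcases hj with rfl | rfl <;> simp
    · simp at hj
  cases u with
  | append b => exact (Finset.card_le_card (key b n)).trans (Finset.card_le_two.trans (by norm_num))
  | change i b c =>
    unfold toggle touched
    rw [glue_symmDiff]
    refine (Finset.card_le_card (symmDiff_subset_union _ _)).trans
      ((Finset.card_union_le _ _).trans ?_)
    have h1 := (Finset.card_le_card (key b i)).trans Finset.card_le_two
    have h2 := (Finset.card_le_card (key c i)).trans Finset.card_le_two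
    omega

/-! ### Decoding answers -/

/-- The set of positions below `n` that is described by codes of change points. -/
def decodeSet (n : ℕ) (D : Finset Str) : Finset ℕ :=
  (Finset.range n).filter fun i => Odd ((Finset.range (i + 1)).filter fun j => posCode j ∈ D).card

/-- Taking together several sets of change points. -/
def xorAll (L : List (Finset Str)) : Finset Str := L.foldr symmDiff ∅

open Classical in
/-- Decoding an answer to a query. -/
def decode (n : ℕ) (out : List Bool) : Finset ℕ :=
  -- For the set of all positions `T = 0`, and O(1) bits cannot hold the change point at the end of
  -- the string. The empty output is reserved for it.
  if out = [] then Finset.range n else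
    if h : ∃ L : List (Finset Str), L.flatMap trieCode = out then decodeSet n (xorAll h.choose)
    else ∅

theorem trieCode_ne_nil (Y : Finset Str) : trieCode Y ≠ [] := by
  intro h
  have := length_trieCode Y
  rw [h] at this
  simp at this

theorem flatMap_trieCode_injective : ∀ {L L' : List (Finset Str)},
    L.flatMap trieCode = L'.flatMap trieCode → L = L'
  | [], [], _ => rfl
  | [], Y :: L', h => absurd h.symm (by simp [trieCode_ne_nil])
  | Y :: L, [], h => absurd h (by simp [trieCode_ne_nil])
  | Y :: L, Z :: L', h => by
    obtain ⟨rfl, h1⟩ := prefixInj_trieCode _ _ _ _ h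
    rw [flatMap_trieCode_injective h1]

theorem decode_flatMap (n : ℕ) {L : List (Finset Str)} (hL : L ≠ []) :
    decode n (L.flatMap trieCode) = decodeSet n (xorAll L) := by
  have h1 : L.flatMap trieCode ≠ [] := fun h =>
    hL (flatMap_trieCode_injective (L' := []) h)
  have h2 : ∃ L' : List (Finset Str), L'.flatMap trieCode = L.flatMap trieCode := ⟨L, rfl⟩
  rw [decode, if_neg h1, dif_pos h2, flatMap_trieCode_injective h2.choose_spec]

/-- Membership starts with absence before position 0 and flips at each change point. -/
theorem getElem?_iff_odd (a : ℕ) (x : List ℕ) (i : ℕ) :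
    x[i]? = some a ↔ Odd ((Finset.range (i + 1)).filter fun j => j ∈ chg a x).card := by
  induction i with
  | zero =>
    have : (0 ∈ chg a x) ↔ x[0]? = some a := by rw [mem_chg]; simp
    rw [← this, Finset.range_one, Finset.filter_singleton]
    split_ifs with h <;> simp [h]
  | succ i ih =>
    have h1 : (i + 1 ∈ chg a x) ↔ ¬ (x[i + 1]? = some a ↔ x[i]? = some a) := by
      rw [mem_chg]; simp
    rw [Finset.range_add_one, Finset.filter_insert]
    split_ifs with h
    · rw [Finset.card_insert_of_notMem (by simp), Nat.odd_add_one, ← ih]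
      tauto
    · rw [← ih]
      tauto

theorem decodeSet_chg {σ : ℕ} (x : List (Fin σ)) (a : Fin σ) :
    decodeSet x.length ((chg a (nat x)).image posCode) = positions a x := by
  unfold decodeSet positions
  refine Finset.filter_congr fun i _ => ?_
  rw [← getElem?_nat, getElem?_iff_odd]
  simp only [posCode_injective.mem_finset_image]

theorem xorAll_append (L L' : List (Finset Str)) :
    xorAll (L ++ L') = symmDiff (xorAll L) (xorAll L') := by
  induction L with
  | nil =>
    change xorAll L' = symmDiff ∅ _
    exact (bot_symmDiff _).symm
  | cons Y L ih =>
    change symmDiff Y (xorAll (L ++ L')) = symmDiff (symmDiff Y (xorAll L)) (xorAll L')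
    rw [ih, symmDiff_assoc]

end BitmapIndex

/-! ### States and programs of the machine. -/

namespace BitmapIndex

/-! ### The states of the machine -/

/-- What the machine is doing. -/
inductive Phase
  | still | work | done | enter | next | dump | fin | spell

namespace Phase

def index : Phase → Fin 8
  | still => 0 | work => 1 | done => 2 | enter => 3 | next => 4 | dump => 5 | fin => 6 | spell => 7

theorem index_injective : Function.Injective index := by
  intro p q h
  cases p <;> cases q <;> first | rfl | simp [index] at h

instance : Finite Phase := Finite.of_injective _ index_injective

end Phase

/-- Strings of at most `N` characters below `N`. -/
abbrev Word (N : ℕ) := {l : List (Fin N) // l.length ≤ N}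

instance (N : ℕ) : Finite (Word N) := (List.finite_length_le (Fin N) N).to_subtype

def Word.str {N : ℕ} (y : Word N) : List ℕ := nat y.1

/-- A string as a short string. -/
def clip (N : ℕ) [NeZero N] (x : List ℕ) : Word N :=
  ⟨(x.map (Fin.ofNat N)).take N, by simp⟩

theorem str_clip {N : ℕ} [NeZero N] {x : List ℕ} (h : x.length ≤ N) (h' : ∀ c ∈ x, c < N) :
    (clip N x).str = x := by
  change ((x.map (Fin.ofNat N)).take N).map Fin.val = x
  rw [List.take_of_length_le (by simpa using h), List.map_map]
  conv_rhs => rw [← List.map_id x]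
  refine List.map_congr_left fun c hc => ?_
  simp [Fin.ofNat, Nat.mod_eq_of_lt (h' c hc)]

theorem Word.length_str {N : ℕ} (y : Word N) : y.str.length ≤ N := by
  simpa [Word.str, nat] using y.2

/-- The content of the internal memory of a machine that uses external memory: the length of the
string, the number of cells, the changes that are not in external memory, and the state of the
running operation. -/
structure Work where
  n : ℕ
  s : ℕ
  buf : Finset Str
  addr : ℕ
  last : Str
  acc : Finset Str
  obuf : Str

namespace Work

def code (w : Work) : Str :=
  natCode w.n ++ (natCode w.s ++ (trieCode w.buf ++ (natCode w.addr ++ (strCode w.last ++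
    (trieCode w.acc ++ strCode w.obuf)))))

theorem code_injective : Function.Injective code := by
  rintro ⟨a1, a2, a3, a4, a5, a6, a7⟩ ⟨b1, b2, b3, b4, b5, b6, b7⟩ h
  simp only [code] at h
  obtain ⟨rfl, h1⟩ := prefixInj_natCode _ _ _ _ h
  obtain ⟨rfl, h2⟩ := prefixInj_natCode _ _ _ _ h1
  obtain ⟨rfl, h3⟩ := prefixInj_trieCode _ _ _ _ h2
  obtain ⟨rfl, h4⟩ := prefixInj_natCode _ _ _ _ h3
  obtain ⟨rfl, h5⟩ := prefixInj_strCode _ _ _ _ h4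
  obtain ⟨rfl, h6⟩ := prefixInj_trieCode _ _ _ _ h5
  obtain rfl := prefixInj_strCode.injective h6
  rfl

theorem code_ne_nil (w : Work) : w.code ≠ [] := by
  intro h
  have := congrArg List.length h
  simp [code, length_natCode] at this

theorem length_code_le (w : Work) : w.code.length ≤ 2 * w.n.size + 2 * w.s.size +
    3 * trieSize w.buf + 2 * w.addr.size + 3 * w.last.length + 3 * trieSize w.acc +
    3 * w.obuf.length + 7 := by
  have h1 := length_strCode_le w.last
  have h2 := length_strCode_le w.obuf
  simp only [code, List.length_append, length_natCode, length_trieCode]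
  omega

/-- Forgetting the running operation. -/
def normal (w : Work) : Work := { w with addr := 0, last := [], acc := ∅, obuf := [] }

end Work

/-- The largest number of blocks of an answer about a short string. -/
def spellBound (N : ℕ) : ℕ := 3 * (N + 1) ^ 2 + 1

/-- The states of the machine. -/
structure State (N : ℕ) where
  -- The string itself while it is shorter than `N`; later the frozen string relative to which
  -- external memory is kept.
  y : Word N
  phase : Phase
  -- Whether a part of the answer has been sent, after which the empty output is not available any
  -- more.
  dumped : Bool
  -- The block of the answer about the frozen string that is due; such answers have bounded length,
  -- so the control can count their blocks.
  j : Fin (spellBound N + 1)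
  mem : Option Work

abbrev Control (N : ℕ) := Word N × Phase × Bool × Fin (spellBound N + 1)

def State.enc {N : ℕ} (s : State N) : Internal (Nat.card (Control N)) :=
  ⟨Finite.equivFin (Control N) (s.y, s.phase, s.dumped, s.j),
    match s.mem with
    | none => []
    | some w => w.code⟩

theorem State.enc_injective {N : ℕ} : Function.Injective (State.enc (N := N)) := by
  rintro ⟨y, p, b, j, m⟩ ⟨y', p', b', j', m'⟩ h
  simp only [State.enc, Internal.mk.injEq, EmbeddingLike.apply_eq_iff_eq, Prod.mk.injEq] at h
  obtain ⟨⟨rfl, rfl, rfl, rfl⟩, h⟩ := h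
  cases m <;> cases m' <;> simp only at h
  · rfl
  · exact absurd h.symm (Work.code_ne_nil _)
  · exact absurd h (Work.code_ne_nil _)
  · rw [Work.code_injective h]

/-! ### The programs of the machine -/

/-- An update of a string of natural numbers. -/
def Update.applyNat {σ : ℕ} (x : List ℕ) : Update σ → List ℕ
  | .append a => x ++ [(a : ℕ)]
  | .change i _ b => x.set i b

theorem Update.applyNat_nat {σ : ℕ} (u : Update σ) (x : List (Fin σ)) :
    u.applyNat (nat x) = nat (u.apply x) := by
  cases u <;> simp [applyNat, Update.apply, nat, List.map_set]

/-- The length of a string of length `n` after an update. -/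
def Update.lengthAfter {σ : ℕ} (n : ℕ) : Update σ → ℕ
  | .append _ => n + 1
  | .change _ _ _ => n

theorem Update.lengthAfter_length {σ : ℕ} (u : Update σ) (x : List (Fin σ)) :
    u.lengthAfter x.length = (u.apply x).length := by
  cases u <;> simp [lengthAfter, Update.apply]

section Step

variable {N : ℕ} [NeZero N] {σ B M : ℕ}

/-- The cells below that are comparable to `a`. -/
def Rec.branches (r : Rec) (a : Str) : List (Str × ℕ) :=
  r.kid.toList.filter fun x => x.1 <+: a ∨ a <+: x.1

/-- What follows the entry of the cell `c`; everything if `c` is empty. -/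
def after (c : Str) (l : List (Str × ℕ)) : List (Str × ℕ) :=
  if c = [] then l else (l.dropWhile fun x => x.1 ≠ c).tail

/-- The changes for the character `a` that a state keeps in the control. -/
def State.frozen (s : State N) (σ : ℕ) (a : Fin σ) : Finset Str :=
  strip (charCode σ.size a) (keys σ s.y.str)

def State.finish (s : State N) : State N :=
  ⟨s.y, .still, false, 0, s.mem.map Work.normal⟩

/-- Output of a block of the answer about the frozen string. -/
def spellStep (a : Fin σ) (s : State N) : Prog B (State N) :=
  let c := trieCode (s.frozen σ a)
  .emit ((c.drop (s.j * B)).take B) (.ret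
    (if c.length ≤ (s.j + 1) * B then { s with phase := .done }
      else { s with phase := .spell, j := Fin.ofNat _ (s.j + 1) }))

/-- Output of a block of the prepared answer. -/
def emitStep (s : State N) (w : Work) (p : Phase) : Prog B (State N) :=
  .emit (w.obuf.take B) (.ret
    { s with
      phase := if w.obuf.drop B = [] then p else s.phase
      mem := some { w with obuf := w.obuf.drop B } })

/-- Collecting the changes at a cell. -/
def enterStep (M : ℕ) (a : Str) (s : State N) (w : Work) : Prog B (State N) :=
  (Prog.getRec w.addr).bind fun r =>
    let X := symmDiff w.acc (strip a (symmDiff r.reg r.pend))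
    -- A set that is too large is output with a code of its own, and accumulation starts again from
    -- the empty set. Decoding adds up all the sets modulo 2.
    if trieSize X ≤ M / 64 then
      .ret { s with phase := .next, mem := some { w with last := [], acc := X } }
    else .ret { s with
      phase := .dump, dumped := true,
      mem := some { w with last := [], acc := ∅, obuf := trieCode X } }

/-- Going to the next cell. -/
def nextStep (a : Fin σ) (s : State N) (w : Work) : Prog B (State N) :=
  (Prog.getRec w.addr).bind fun r =>
    -- The walk needs no stack: the kid visited last tells where to continue, and the record tells
    -- the way up.
    match after w.last (r.branches (charCode σ.size a)) with
    | x :: _ => .ret { s with phase := .enter, mem := some { w with addr := x.2 } }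
    | [] =>
      if r.cell = [] then
        if s.dumped = false ∧
            decodeSet w.n (symmDiff w.acc (s.frozen σ a)) = Finset.range w.n then
          .ret { s with phase := .done }
        else .ret { s with phase := .fin, mem := some { w with obuf := trieCode w.acc } }
      else .ret { s with mem := some { w with addr := r.up, last := r.cell } }

/-- Taking account of an update of a string in external memory. -/
def updateStep (u : Update σ) (s : State N) (w : Work) : Prog B (State N) :=
  let Y := symmDiff w.buf (toggle w.n u)
  if totalLen Y ≤ cap B then
    .ret { s with mem := some { w with n := u.lengthAfter w.n, buf := Y } }
  else
    (Prog.getRec 0).bind fun r =>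
      (Prog.setRecs [(0, { r with pend := symmDiff r.pend Y })]).bind fun _ =>
        .ret { s with
          phase := .work, mem := some { w with n := u.lengthAfter w.n, buf := ∅, addr := 0 } }

def workStep (s : State N) (w : Work) : Prog B (State N) :=
  (Prog.work w.addr w.s).bind fun z =>
    .ret { s with
      phase := if z.2.2 then .done else .work
      mem := some { w with addr := if z.2.2 then 0 else z.1, s := z.2.1 } }

/-- Taking account of an update of a string in the control. -/
def growStep (u : Update σ) (s : State N) : Prog B (State N) :=
  let y := clip N (u.applyNat s.y.str)
  .ret { s with
    y := y
    mem := if y.str.length < N then none else some ⟨N, 1, ∅, 0, [], ∅, []⟩ }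

/-- The programs of the machine. -/
def stepProg (M : ℕ) (r : Request σ) (s : State N) : Prog B (State N) :=
  match r, s.phase, s.mem with
  | .update u, .still, none => growStep u s
  | .update u, .still, some w => updateStep u s w
  | .update _, .work, some w => workStep s w
  | .query a, .still, none =>
    if decodeSet s.y.str.length (s.frozen σ a) = Finset.range s.y.str.length then .ret s
    else spellStep a s
  | .query a, .still, some w =>
    enterStep M (charCode σ.size a) s { w with acc := strip (charCode σ.size a) w.buf }
  | .query a, .enter, some w => enterStep M (charCode σ.size a) s w
  | .query a, .next, some w => nextStep a s w
  | .query _, .dump, some w => emitStep s w .next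
  | .query _, .fin, some w => emitStep s w .spell
  | .query a, .spell, _ => spellStep a s
  | _, _, _ => .ret s.finish

end Step

/-! ### Parameters -/

/-- The internal memory is large enough for strings in external memory. -/
structure Roomy (B M E : ℕ) : Prop where
  pos : 0 < B
  le : E ≤ 4 * B
  large : 2 ^ 30 * B ≤ M
  mul_le : B * E ≤ 3 * M

/-- The bound on the number of I/Os of a program of the machine. -/
def maxCost : ℕ := 600 * recSize + 1

end BitmapIndex

/-! ### The walk of a query. -/

namespace BitmapIndex

/-! ### Composition of runs -/

section Leads

variable {σ B q : ℕ} {S : Type} {D : ℕ} {enc : S → Internal q}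
  {step : Request σ → S → Prog B S} {M : ℕ} {r : Request σ} {d : ℕ → BitVec B}

/-- From the state `s`, the machine gets to the state `t` without changing external memory. -/
def Leads (D : ℕ) (enc : S → Internal q) (step : Request σ → S → Prog B S) (M : ℕ)
    (r : Request σ) (d : ℕ → BitVec B) (s : S) (o : List Bool) (k : ℕ) (t : S) : Prop :=
  ∀ o' k' s' d', Runs D enc step M r t d o' k' s' d' →
    Runs D enc step M r s d (o ++ o') (k + k') s' d'

theorem Leads.refl (s : S) : Leads D enc step M r d s [] 0 s := fun o' k' s' d' h => by
  simpa using h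

theorem Leads.trans {s t u : S} {o o' : List Bool} {k k' : ℕ}
    (h : Leads D enc step M r d s o k t) (h' : Leads D enc step M r d t o' k' u) :
    Leads D enc step M r d s (o ++ o') (k + k') u := fun o'' k'' s' d' hr => by
  rw [List.append_assoc, add_assoc]
  exact h _ _ _ _ (h' _ _ _ _ hr)

theorem Leads.of_step {s t : S} {o : List Bool} {k : ℕ} (ho : (step r s).out d = o)
    (hk : (step r s).cost d = k) (hk0 : 0 < k) (hkD : k ≤ D) (ht : (step r s).res d = t)
    (hf : (step r s).fin d = d) (hm : (enc s).mem.length + k * B ≤ M)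
    (hm' : (enc t).mem.length ≤ M) : Leads D enc step M r d s o k t := by
  subst ho hk ht
  intro o' k' s' d' h
  refine Runs.step hk0 hkD ?_ hm' (by rwa [hf])
  exact (Nat.add_le_add_left (Nat.mul_le_mul_right _ (Prog.reads_le_cost _ _)) _).trans hm

end Leads

/-! ### Walking through the cells comparable to a string -/

variable {B E M : ℕ} {T : Tree} {ad : Str → ℕ} {d : ℕ → BitVec B}

/-- The cells comparable to `a` below the cell `v`, and `v` itself. -/
def branch (Q : Finset Str) (a v : Str) : Finset Str := (comp Q a).filter (v <+: ·)

theorem mem_branch {Q : Finset Str} {a v u : Str} :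
    u ∈ branch Q a v ↔ (u ∈ Q ∧ (u <+: a ∨ a <+: u)) ∧ v <+: u := by
  simp [branch, comp]

theorem branch_nil (Q : Finset Str) (a : Str) : branch Q a [] = comp Q a :=
  Finset.filter_true_of_mem fun _ _ => List.nil_prefix

/-- The cells in the branches of a list. -/
def branches (Q : Finset Str) (a : Str) (l : List (Str × ℕ)) : Finset Str :=
  (comp Q a).filter fun u => ∃ x ∈ l, x.1 <+: u

theorem mem_branches {Q : Finset Str} {a u : Str} {l : List (Str × ℕ)} :
    u ∈ branches Q a l ↔ u ∈ comp Q a ∧ ∃ x ∈ l, x.1 <+: u := by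
  simp [branches]

theorem branches_cons (Q : Finset Str) (a : Str) (x : Str × ℕ) (l : List (Str × ℕ)) :
    branches Q a (x :: l) = branch Q a x.1 ∪ branches Q a l := by
  ext u
  simp only [branches, branch, Finset.mem_filter, Finset.mem_union, List.mem_cons,
    exists_eq_or_imp]
  tauto

theorem mem_branches_recOf {a v : Str} {x : Str × ℕ} :
    x ∈ (recOf T ad v).branches a ↔
      ∃ c ∈ kids T.Q v, (c <+: a ∨ a <+: c) ∧ x = (c, ad c) := by
  simp only [Rec.branches, List.mem_filter, Finset.mem_toList, mem_kid, decide_eq_true_eq]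
  constructor
  · rintro ⟨⟨c, hc, rfl⟩, h⟩
    exact ⟨c, hc, h, rfl⟩
  · rintro ⟨c, hc, h, rfl⟩
    exact ⟨⟨c, hc, rfl⟩, h⟩

theorem nodup_branches (a v : Str) : (((recOf T ad v).branches a).map Prod.fst).Nodup := by
  refine List.Nodup.map_on ?_ (List.Nodup.filter _ (Finset.nodup_toList _))
  intro x hx y hy e
  obtain ⟨c, _, _, rfl⟩ := mem_branches_recOf.1 hx
  obtain ⟨c', _, _, rfl⟩ := mem_branches_recOf.1 hy
  simp only at e
  rw [e]

theorem branch_eq {a v : Str} (hv : v ∈ T.Q) (ha : v <+: a ∨ a <+: v) :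
    branch T.Q a v = {v} ∪ branches T.Q a ((recOf T ad v).branches a) := by
  ext u
  simp only [Finset.mem_union, Finset.mem_singleton, mem_branches, mem_branches_recOf]
  rw [mem_branch]
  constructor
  · rintro ⟨⟨hu, hua⟩, hvu⟩
    by_cases e : u = v
    · exact Or.inl e
    · obtain ⟨c, hc, hcu⟩ := exists_kid hv hu hvu (Ne.symm e)
      refine Or.inr ⟨Finset.mem_filter.2 ⟨hu, hua⟩, _, ⟨c, hc, ?_, rfl⟩, hcu⟩
      rcases hua with h | h
      · exact Or.inl (hcu.trans h)
      · exact prefix_comparable hcu h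
  · rintro (rfl | ⟨hu, x, ⟨c, hc, hca, rfl⟩, hcu⟩)
    · exact ⟨⟨hv, ha⟩, List.prefix_refl _⟩
    · exact ⟨Finset.mem_filter.1 hu, (prefix_of_mem_kids hc).trans hcu⟩

theorem disjoint_self_branches (a v : Str) :
    Disjoint {v} (branches T.Q a ((recOf T ad v).branches a)) := by
  rw [Finset.disjoint_singleton_left, mem_branches]
  rintro ⟨_, x, hx, h⟩
  obtain ⟨c, hc, _, rfl⟩ := mem_branches_recOf.1 hx
  exact Tree.not_prefix_of_mem_kids hc h

theorem disjoint_branch_branches {a v : Str} {x : Str × ℕ} {l : List (Str × ℕ)}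
    (hl : ∀ y ∈ x :: l, y ∈ (recOf T ad v).branches a) (hn : ((x :: l).map Prod.fst).Nodup) :
    Disjoint (branch T.Q a x.1) (branches T.Q a l) := by
  rw [Finset.disjoint_left]
  intro u hu hu'
  obtain ⟨_, hxu⟩ := mem_branch.1 hu
  obtain ⟨_, y, hy, hyu⟩ := mem_branches.1 hu'
  obtain ⟨c, hc, _, rfl⟩ := mem_branches_recOf.1 (hl x (by simp))
  obtain ⟨e, he, _, rfl⟩ := mem_branches_recOf.1 (hl y (by simp [hy]))
  have hne : c ≠ e := by
    rintro rfl
    simp only [List.map_cons, List.nodup_cons, List.mem_map] at hn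
    exact hn.1 ⟨_, hy, rfl⟩
  simp only at hxu hyu
  have key : ∀ c e, c ∈ kids T.Q v → e ∈ kids T.Q v → c ≠ e → ¬ c <+: e := by
    intro c e hc he hne h
    have h1 := prefix_par (mem_kids.1 hc).1 h hne
    rw [(mem_kids.1 he).2.2] at h1
    exact Tree.not_prefix_of_mem_kids hc h1
  rcases prefix_comparable hxu hyu with h | h
  · exact key _ _ hc he hne h
  · exact key _ _ he hc hne.symm h

theorem after_suffix (c : Str) (l : List (Str × ℕ)) : after c l <:+ l := by
  unfold after
  split_ifs
  · exact List.suffix_refl _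
  · exact (List.tail_suffix _).trans (List.dropWhile_suffix _)

/-- The kids are listed in the same order each time the record is read, and without repetition, so
the last one visited determines the rest. -/
theorem after_of_after {c : Str} {l : List (Str × ℕ)} {x : Str × ℕ} {t : List (Str × ℕ)}
    (hl : (l.map Prod.fst).Nodup) (h : after c l = x :: t) (hx : x.1 ≠ []) : after x.1 l = t := by
  obtain ⟨p, rfl⟩ : ∃ p, p ++ x :: t = l := by rw [← h]; exact after_suffix c l
  have hp : ∀ y ∈ p, y.1 ≠ x.1 := by
    intro y hy e
    rw [List.map_append, List.nodup_append] at hl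
    exact hl.2.2 y.1 (List.mem_map.2 ⟨y, hy, rfl⟩) x.1 (by simp) e
  rw [after, if_neg hx, List.dropWhile_append_of_pos (by simpa using hp),
    List.dropWhile_cons_of_neg (by simp)]
  rfl

/-- The changes at the cell `v` below `a`. -/
def cellVal (T : Tree) (a v k : Str) : ZMod 2 :=
  ind (reg T.Q T.R v) (a ++ k) + ind (T.P v) (a ++ k)

def cellSize (T : Tree) (a v : Str) : ℕ :=
  trieSize (strip a (reg T.Q T.R v)) + totalLen (T.P v)

/-- The effect of a walk through the cells `S` that starts with the changes `acc`, ends with the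
changes `acc'`, and has output the sets of changes `W`, with `k` I/Os. -/
structure Walk (B θ : ℕ) (T : Tree) (a : Str) (S : Finset Str) (acc : Finset Str)
    (W : List (Finset Str)) (acc' : Finset Str) (c k : ℕ) : Prop where
  sum : ∀ k, ind acc' k + ind (xorAll W) k = ind acc k + ∑ v ∈ S, cellVal T a v k
  size : (W.map trieSize).sum + trieSize acc' ≤ trieSize acc + ∑ v ∈ S, cellSize T a v
  large : ∀ Y ∈ W, θ < trieSize Y
  small : trieSize acc' ≤ θ
  -- Sending l bits takes at most 1 + l / B I/Os. The number `c` is for the cells, everything else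
  -- is charged to the output.
  cost : k * B ≤ c * B + (W.flatMap trieCode).length

theorem Walk.trans {θ c c' k k' : ℕ} {a : Str} {S S' acc acc' acc'' : Finset Str}
    {W W' : List (Finset Str)} (h : Walk B θ T a S acc W acc' c k)
    (h' : Walk B θ T a S' acc' W' acc'' c' k') (hS : Disjoint S S') :
    Walk B θ T a (S ∪ S') acc (W ++ W') acc'' (c + c') (k + k') where
  sum x := by
    have h1 := h.sum x
    have h2 := h'.sum x
    rw [xorAll_append, ind_symmDiff, Finset.sum_union hS]
    linear_combination h1 + h2
  size := by
    have h1 := h.size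
    have h2 := h'.size
    rw [Finset.sum_union hS, List.map_append, List.sum_append]
    omega
  large Y hY := (List.mem_append.1 hY).elim (h.large Y) (h'.large Y)
  small := h'.small
  cost := by
    have h1 := h.cost
    have h2 := h'.cost
    rw [List.flatMap_append, List.length_append, Nat.add_mul, Nat.add_mul]
    omega

theorem Walk.refl {θ : ℕ} {a : Str} {acc : Finset Str} (h : trieSize acc ≤ θ) :
    Walk B θ T a ∅ acc [] acc 0 0 := by
  refine ⟨fun k => ?_, by simp, by simp, h, by simp⟩
  have : ind (xorAll []) k = 0 := by simp [xorAll, ind]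
  rw [this]
  simp

theorem Walk.add_cost {θ : ℕ} {a : Str} {S acc acc' : Finset Str} {W : List (Finset Str)} {c k : ℕ}
    (h : Walk B θ T a S acc W acc' c k) (e : ℕ) : Walk B θ T a S acc W acc' (c + e) (k + e) :=
  { h with
    cost := by
      have := h.cost
      rw [Nat.add_mul, Nat.add_mul]
      omega }

theorem Walk.mono {θ : ℕ} {a : Str} {S acc acc' : Finset Str} {W : List (Finset Str)}
    {c c' k : ℕ} (h : Walk B θ T a S acc W acc' c k) (hc : c ≤ c') :
    Walk B θ T a S acc W acc' c' k :=
  { h with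
    cost := by
      have := h.cost
      have := Nat.mul_le_mul_right B hc
      omega }

/-- The data of a query. -/
structure Context (B M E : ℕ) (T : Tree) (ad : Str → ℕ) (d : ℕ → BitVec B) (n : ℕ)
    (buf : Finset Str) : Prop where
  room : Roomy B M E
  settled : T.Settled B E
  rep : Rep T ad T.Q.card d
  size_le : n.size ≤ E
  buf_le : totalLen buf ≤ cap B

section Query

variable {N : ℕ} [NeZero N] {σ : ℕ} {y : Word N} {n : ℕ} {buf : Finset Str}

theorem Context.ok (h : Context B M E T ad d n buf) : Ok B E T ad T.Q.card d :=
  ⟨h.settled.wf, h.room.le, h.room.pos, h.settled.slim, Nat.le_succ _, h.rep⟩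

theorem Context.card_lt (h : Context B M E T ad d n buf) : T.Q.card < 2 ^ E := by
  have := card_le_of_length h.settled.wf.lenQ
  omega

theorem Context.addr_size (h : Context B M E T ad d n buf) {v : Str} (hv : v ∈ T.Q) :
    (ad v).size ≤ E :=
  Nat.size_le.2 ((h.rep.lt v hv).trans h.card_lt)

/-- The states during a query. -/
def queryState (y : Word N) (n s : ℕ) (buf : Finset Str) (p : Phase) (addr : ℕ) (last : Str)
    (acc : Finset Str) (obuf : Str) (dm : Bool) : State N :=
  ⟨y, p, dm, 0, some ⟨n, s, buf, addr, last, acc, obuf⟩⟩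

omit [NeZero N] in
-- The accumulated set and the prepared output take about 12/64 of the memory. The remaining terms,
-- including the record being read, are multiples of `B` that are small compared with `2 ^ 30 * B ≤
-- M`.
theorem Context.mem_le (h : Context B M E T ad d n buf) {p : Phase} {addr : ℕ} {last : Str}
    {acc : Finset Str} {obuf : Str} {dm : Bool} (ha : addr.size ≤ E) (hl : last.length ≤ E)
    (hacc : trieSize acc ≤ M / 64) (ho : obuf.length ≤ 3 * (M / 64 + 4097 * B) + 1) :
    (queryState y n T.Q.card buf p addr last acc obuf dm).enc.mem.length + recSize * B ≤ M := by
  have h1 := Work.length_code_le ⟨n, T.Q.card, buf, addr, last, acc, obuf⟩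
  have h2 := h.size_le
  have h3 : T.Q.card.size ≤ E := Nat.size_le.2 h.card_lt
  have h4 := (trieSize_le_totalLen _).trans h.buf_le
  have h5 : cap B ≤ B := Nat.div_le_self _ _
  have h6 := h.room.le
  have h7 := h.room.large
  have h8 := h.room.pos
  simp only [queryState, State.enc]
  rw [recSize_eq]
  simp only at h1
  omega

variable (σ) in
/-- The relation of `Leads` for the programs of the machine. -/
abbrev Goes (M : ℕ) (r : Request σ) (d : ℕ → BitVec B) (s : State N) (o : List Bool) (k : ℕ)
    (t : State N) : Prop :=
  Leads maxCost State.enc (stepProg M) M r d s o k t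

theorem recSize_le_maxCost : recSize ≤ maxCost := by unfold maxCost; omega

theorem one_le_recSize : 1 ≤ recSize := by rw [recSize_eq]; omega

theorem Context.dump (h : Context B M E T ad d n buf) (a : Fin σ) {addr : ℕ} {last : Str}
    {acc : Finset Str} {dm : Bool} (ha : addr.size ≤ E) (hl : last.length ≤ E)
    (hacc : trieSize acc ≤ M / 64) {p p' : Phase}
    (hp : p = .dump ∧ p' = .next ∨ p = .fin ∧ p' = .spell) :
    ∀ (obuf : Str), obuf ≠ [] → obuf.length ≤ 3 * (M / 64 + 4097 * B) + 1 →
      ∃ k, Goes σ M (.query a) d (queryState y n T.Q.card buf p addr last acc obuf dm) obuf k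
        (queryState y n T.Q.card buf p' addr last acc [] dm) ∧ k * B ≤ B + obuf.length := by
  intro obuf
  induction hlen : obuf.length using Nat.strong_induction_on generalizing obuf with
  | _ m ih =>
    intro hne ho
    have hpos := h.room.pos
    have hm := h.mem_le (y := y) (p := p) (dm := dm) ha hl hacc (hlen ▸ ho)
    have hrec : 1 * B ≤ recSize * B := Nat.mul_le_mul_right _ one_le_recSize
    have hstep : stepProg (B := B) M (.query a) (queryState y n T.Q.card buf p addr last acc obuf dm) =
        .emit (obuf.take B) (.ret (queryState y n T.Q.card buf (if obuf.drop B = [] then p' else p)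
          addr last acc (obuf.drop B) dm)) := by
      rcases hp with ⟨rfl, rfl⟩ | ⟨rfl, rfl⟩ <;> rfl
    have hm' := h.mem_le (y := y) (p := if obuf.drop B = [] then p' else p) (dm := dm) ha hl hacc
      (obuf := obuf.drop B) (by rw [List.length_drop]; omega)
    have h1 : Goes σ M (.query a) d (queryState y n T.Q.card buf p addr last acc obuf dm)
        (obuf.take B) 1 (queryState y n T.Q.card buf (if obuf.drop B = [] then p' else p)
          addr last acc (obuf.drop B) dm) := by
      refine Leads.of_step ?_ ?_ one_pos (by unfold maxCost; omega) ?_ ?_ (by omega) (by omega)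
      all_goals rw [hstep]; simp [Prog.out, Prog.cost, Prog.res, Prog.fin]
    by_cases he : obuf.drop B = []
    · rw [if_pos he, he] at h1
      have h2 : obuf.take B = obuf := List.take_of_length_le (List.drop_eq_nil_iff.1 he)
      rw [h2] at h1
      exact ⟨1, h1, by omega⟩
    · rw [if_neg he] at h1
      have hB : B < obuf.length := by
        by_contra hh
        exact he (List.drop_eq_nil_iff.2 (by omega))
      obtain ⟨k, h2, h3⟩ := ih (obuf.drop B).length (by rw [List.length_drop]; omega) _ rfl he
        (by rw [List.length_drop]; omega)
      refine ⟨1 + k, ?_, ?_⟩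
      · have := h1.trans h2
        rwa [List.take_append_drop] at this
      · rw [List.length_drop] at h3
        rw [Nat.add_mul]
        omega

/-- A cell contributes at most `4097 * B` nodes, so a set that has just exceeded the threshold still
fits until it is sent. -/
theorem Context.enter (h : Context B M E T ad d n buf) (a : Fin σ) {v : Str} (hv : v ∈ T.Q)
    {last : Str} {acc : Finset Str} (dm : Bool) (hl : last.length ≤ E)
    (hacc : trieSize acc ≤ M / 64) :
    ∃ W acc' k, Goes σ M (.query a) d (queryState y n T.Q.card buf .enter (ad v) last acc [] dm)
        (W.flatMap trieCode) k
        (queryState y n T.Q.card buf .next (ad v) [] acc' [] (dm || !W.isEmpty)) ∧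
      Walk B (M / 64) T (charCode σ.size a) {v} acc W acc' (recSize + 1) k := by
  obtain ⟨r1, r2, r3, r4⟩ := Prog.getRec_ok h.ok hv
  set A := charCode σ.size a with hA
  set X := symmDiff acc (strip A (symmDiff (reg T.Q T.R v) (T.P v))) with hX
  have hm := h.mem_le (y := y) (p := .enter) (dm := dm) (h.addr_size hv) hl hacc (obuf := [])
    (by simp)
  have hXi : ∀ k, ind X k = ind acc k + ∑ u ∈ {v}, cellVal T A u k := by
    intro k
    rw [hX, ind_symmDiff, ind_strip, ind_symmDiff, Finset.sum_singleton, cellVal]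
  have hXs : trieSize X ≤ trieSize acc + cellSize T A v := by
    refine (trieSize_symmDiff_le _ _).trans (Nat.add_le_add_left ?_ _)
    rw [strip_symmDiff]
    exact (trieSize_symmDiff_le _ _).trans (Nat.add_le_add_left
      ((trieSize_le_totalLen _).trans (totalLen_strip_le _ _)) _)
  have hcell : cellSize T A v ≤ 4097 * B := by
    have h1 := h.settled.wt_le hv
    have h2 := h.settled.pend_le v
    have h3 : cap B ≤ B := Nat.div_le_self _ _
    have h4 := trieSize_strip_le A (reg T.Q T.R v)
    have h5 : trieSize (reg T.Q T.R v) ≤ T.wt B v := Nat.le_add_right _ _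
    unfold cellSize
    omega
  have hstep : stepProg (B := B) M (.query a)
      (queryState y n T.Q.card buf .enter (ad v) last acc [] dm) =
      enterStep M A (queryState y n T.Q.card buf .enter (ad v) last acc [] dm)
        ⟨n, T.Q.card, buf, ad v, last, acc, []⟩ := rfl
  have hrec := one_le_recSize
  by_cases hc : trieSize X ≤ M / 64
  · refine ⟨[], X, recSize, ?_, fun k => ?_, ?_, by simp, hc, ?_⟩
    · have hm' := h.mem_le (y := y) (p := .next) (dm := dm) (h.addr_size hv) (last := [])
        (by simp) hc (obuf := []) (by simp)
      have hres : (stepProg M (.query a)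
          (queryState y n T.Q.card buf .enter (ad v) last acc [] dm)).res d =
          queryState y n T.Q.card buf .next (ad v) [] X [] dm := by
        rw [hstep, enterStep]
        simp only [Prog.res_bind, r1, recOf]
        rw [← hX, if_pos hc]
        rfl
      have hd : (dm || !([] : List (Finset Str)).isEmpty) = dm := by simp
      rw [hd]
      refine Leads.of_step ?_ ?_ hrec recSize_le_maxCost hres ?_ hm (by omega)
      all_goals
        rw [hstep, enterStep]
        simp only [Prog.out_bind, Prog.cost_bind, Prog.fin_bind, r1, r2, r3, r4, recOf]
        rw [← hX, if_pos hc]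
        rfl
    · have : ind (xorAll []) k = 0 := by simp [xorAll, ind]
      rw [this, hXi, add_zero]
    · simpa using hXs
    · rw [Nat.add_mul]
      omega
  · have hlen := length_trieCode X
    have hob : (trieCode X).length ≤ 3 * (M / 64 + 4097 * B) + 1 := by omega
    have h0 : trieSize (∅ : Finset Str) ≤ M / 64 := by simp [trieSize, pre]
    obtain ⟨k, g1, g2⟩ := h.dump (y := y) a (dm := true) (h.addr_size hv) (last := []) (by simp) h0
      (Or.inl ⟨rfl, rfl⟩) _ (trieCode_ne_nil X) hob
    have hm' := h.mem_le (y := y) (p := .dump) (dm := true) (h.addr_size hv) (last := [])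
        (by simp) h0 hob
    have hres : (stepProg M (.query a)
        (queryState y n T.Q.card buf .enter (ad v) last acc [] dm)).res d =
        queryState y n T.Q.card buf .dump (ad v) [] ∅ (trieCode X) true := by
      rw [hstep, enterStep]
      simp only [Prog.res_bind, r1, recOf]
      rw [← hX, if_neg hc]
      rfl
    have g0 : Goes σ M (.query a) d (queryState y n T.Q.card buf .enter (ad v) last acc [] dm)
        [] recSize (queryState y n T.Q.card buf .dump (ad v) [] ∅ (trieCode X) true) := by
      refine Leads.of_step ?_ ?_ hrec recSize_le_maxCost hres ?_ hm (by omega)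
      all_goals
        rw [hstep, enterStep]
        simp only [Prog.out_bind, Prog.cost_bind, Prog.fin_bind, r1, r2, r3, r4, recOf]
        rw [← hX, if_neg hc]
        rfl
    refine ⟨[X], ∅, recSize + k, ?_, fun k => ?_, ?_, ?_, h0, ?_⟩
    · simpa using g0.trans g1
    · have : xorAll [X] = X := symmDiff_bot X
      rw [this, hXi, ind_empty, zero_add]
    · simpa [trieSize, pre] using hXs
    · simpa using hc
    · simp only [List.flatMap_cons, List.flatMap_nil, List.append_nil]
      rw [Nat.add_mul, Nat.add_mul]
      omega

theorem Context.next_enter (h : Context B M E T ad d n buf) (a : Fin σ) {v : Str} (hv : v ∈ T.Q)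
    {last : Str} {acc : Finset Str} {dm : Bool} (hl : last.length ≤ E)
    (hacc : trieSize acc ≤ M / 64) {x : Str × ℕ} {t : List (Str × ℕ)}
    (ht : after last ((recOf T ad v).branches (charCode σ.size a)) = x :: t)
    (hx : x.2.size ≤ E) :
    Goes σ M (.query a) d (queryState y n T.Q.card buf .next (ad v) last acc [] dm) [] recSize
      (queryState y n T.Q.card buf .enter x.2 last acc [] dm) := by
  obtain ⟨r1, r2, r3, r4⟩ := Prog.getRec_ok h.ok hv
  have hm := h.mem_le (y := y) (p := .next) (dm := dm) (h.addr_size hv) hl hacc (obuf := [])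
    (by simp)
  have hm' := h.mem_le (y := y) (p := .enter) (dm := dm) hx hl hacc (obuf := []) (by simp)
  have hstep : stepProg (B := B) M (.query a)
      (queryState y n T.Q.card buf .next (ad v) last acc [] dm) =
      nextStep a (queryState y n T.Q.card buf .next (ad v) last acc [] dm)
        ⟨n, T.Q.card, buf, ad v, last, acc, []⟩ := rfl
  refine Leads.of_step ?_ ?_ one_le_recSize recSize_le_maxCost ?_ ?_ hm (by omega)
  all_goals
    rw [hstep, nextStep]
    simp only [Prog.out_bind, Prog.cost_bind, Prog.fin_bind, Prog.res_bind, r1, r2, r3, r4, ht]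
    rfl

theorem Context.next_up (h : Context B M E T ad d n buf) (a : Fin σ) {v : Str} (hv : v ∈ T.Q)
    (hv0 : v ≠ []) {last : Str} {acc : Finset Str} {dm : Bool} (hl : last.length ≤ E)
    (hacc : trieSize acc ≤ M / 64)
    (ht : after last ((recOf T ad v).branches (charCode σ.size a)) = []) :
    Goes σ M (.query a) d (queryState y n T.Q.card buf .next (ad v) last acc [] dm) [] recSize
      (queryState y n T.Q.card buf .next (ad (par T.Q v)) v acc [] dm) := by
  obtain ⟨r1, r2, r3, r4⟩ := Prog.getRec_ok h.ok hv
  have hm := h.mem_le (y := y) (p := .next) (dm := dm) (h.addr_size hv) hl hacc (obuf := [])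
    (by simp)
  have hp := h.addr_size (par_mem h.settled.wf.root v)
  have hvl := h.settled.wf.lenQ v hv
  have hm' := h.mem_le (y := y) (p := .next) (dm := dm) hp (last := v) (by omega) hacc
    (obuf := []) (by simp)
  have hstep : stepProg (B := B) M (.query a)
      (queryState y n T.Q.card buf .next (ad v) last acc [] dm) =
      nextStep a (queryState y n T.Q.card buf .next (ad v) last acc [] dm)
        ⟨n, T.Q.card, buf, ad v, last, acc, []⟩ := rfl
  refine Leads.of_step ?_ ?_ one_le_recSize recSize_le_maxCost ?_ ?_ hm (by omega)
  all_goals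
    rw [hstep, nextStep]
    simp only [Prog.out_bind, Prog.cost_bind, Prog.fin_bind, Prog.res_bind, r1, r2, r3, r4, ht]
    rw [if_neg (show (recOf T ad v).cell ≠ [] from hv0)]
    rfl

theorem isEmpty_append_or (dm : Bool) (W W' : List (Finset Str)) :
    ((dm || !W.isEmpty) || !W'.isEmpty) = (dm || !(W ++ W').isEmpty) := by
  cases dm <;> cases W <;> simp

/-- Depth-first search by two inductions, on `E - v.length` because kids are strictly longer, and on
the kids still to be visited. A cell costs three readings of records, to be found from above, to be
entered and to be left, and one I/O for the last block of a set that is sent. -/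
theorem Context.scan (h : Context B M E T ad d n buf) (a : Fin σ) {v : Str} (hv : v ∈ T.Q) :
    ∀ (l : List (Str × ℕ)) (last : Str) (acc : Finset Str) (dm : Bool), last.length ≤ E →
      trieSize acc ≤ M / 64 →
      after last ((recOf T ad v).branches (charCode σ.size a)) = l →
      ∃ W acc' k last', last'.length ≤ E ∧
        after last' ((recOf T ad v).branches (charCode σ.size a)) = [] ∧
        Goes σ M (.query a) d (queryState y n T.Q.card buf .next (ad v) last acc [] dm)
          (W.flatMap trieCode) k
          (queryState y n T.Q.card buf .next (ad v) last' acc' [] (dm || !W.isEmpty)) ∧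
        Walk B (M / 64) T (charCode σ.size a) (branches T.Q (charCode σ.size a) l) acc W acc'
          ((branches T.Q (charCode σ.size a) l).card * (3 * recSize + 1)) k := by
  induction hlen : E - v.length using Nat.strong_induction_on generalizing v with
  | _ m ih =>
    set A := charCode σ.size a with hA
    intro l
    induction l with
    | nil =>
      intro last acc dm hl hacc ht
      have : branches T.Q A [] = ∅ := by simp [branches]
      refine ⟨[], acc, 0, last, hl, ht, ?_, ?_⟩
      · simpa using Leads.refl _
      · rw [this]
        exact (Walk.refl hacc).mono (by simp)
    | cons x l ihl =>
      intro last acc dm hl hacc ht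
      have hsub : ∀ z ∈ x :: l, z ∈ (recOf T ad v).branches A := by
        rw [← ht]
        exact fun z hz => (after_suffix _ _).subset hz
      have hnd : ((x :: l).map Prod.fst).Nodup := by
        rw [← ht]
        exact (nodup_branches A v).sublist ((after_suffix _ _).sublist.map _)
      have hdis := disjoint_branch_branches hsub hnd
      obtain ⟨c, hc, hca, rfl⟩ := mem_branches_recOf.1 (hsub x (by simp))
      obtain ⟨hcQ, hc0, hcp⟩ := mem_kids.1 hc
      have g1 := h.next_enter (y := y) a hv (dm := dm) hl hacc ht (h.addr_size hcQ)
      obtain ⟨W1, acc1, k1, g2, w2⟩ := h.enter (y := y) a hcQ (last := last) dm hl hacc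
      have hvc : v.length < c.length := hcp ▸ par_length_lt hc0
      have hcl := h.settled.wf.lenQ c hcQ
      obtain ⟨W2, acc2, k2, last2, hl2, ht2, g3, w3⟩ := ih (E - c.length) (by omega) hcQ rfl _ []
        acc1 (dm || !W1.isEmpty) (by simp) w2.small rfl
      have g4 := h.next_up (y := y) a hcQ hc0 (dm := (dm || !W1.isEmpty) || !W2.isEmpty) hl2
        w3.small ht2
      rw [hcp] at g4
      have hnext := after_of_after (nodup_branches A v) ht hc0
      obtain ⟨W3, acc3, k3, last3, hl3, ht3, g5, w5⟩ := ihl c acc2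
        ((dm || !W1.isEmpty) || !W2.isEmpty) (by omega) w3.small hnext
      have hself := branch_eq (ad := ad) hcQ hca
      have hall : after [] ((recOf T ad c).branches A) = (recOf T ad c).branches A := rfl
      rw [hall] at w3
      rw [← hA] at w2
      have w4 := (w2.trans w3 (disjoint_self_branches A c)).add_cost (recSize + recSize)
      rw [← hself] at w4
      have hcard : (branch T.Q A c).card =
          1 + (branches T.Q A ((recOf T ad c).branches A)).card := by
        rw [hself, Finset.card_union_of_disjoint (disjoint_self_branches A c),
          Finset.card_singleton]
      have w6 := (w4.mono (c' := (branch T.Q A c).card * (3 * recSize + 1)) (by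
        rw [hcard]; ring_nf; omega)).trans w5 hdis
      rw [← Nat.add_mul, ← Finset.card_union_of_disjoint hdis] at w6
      rw [branches_cons]
      refine ⟨(W1 ++ W2) ++ W3, acc3, _, last3, hl3, ht3, ?_, w6⟩
      have g := g1.trans (g2.trans (g3.trans (g4.trans g5)))
      rw [isEmpty_append_or, isEmpty_append_or] at g
      rw [List.flatMap_append, List.flatMap_append]
      convert g using 1
      · simp
      · omega
      · rw [List.append_assoc]

end Query

end BitmapIndex

/-! ### Answers to point queries. -/

namespace BitmapIndex

/-! ### Point queries -/

section

variable {σ B q : ℕ} {S : Type} {D : ℕ} {enc : S → Internal q}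
  {step : Request σ → S → Prog B S} {M : ℕ} {r : Request σ} {d : ℕ → BitVec B}

/-- Only the first program and the memory at its start depend on the state. In this way a query
begins in the state between operations as if it had entered the root already. -/
theorem Runs.of_eq {s t : S} {o : List Bool} {k : ℕ} {s' : S} {d' : ℕ → BitVec B}
    (h : Runs D enc step M r t d o k s' d') (he : step r s = step r t)
    (hl : (enc s).mem.length ≤ (enc t).mem.length) : Runs D enc step M r s d o k s' d' := by
  cases h with
  | halt h hm => exact Runs.halt (he.trans h) hm
  | step hne hc hm hm' h =>
    rw [← he] at hne hc hm hm' h ⊢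
    exact Runs.step hne hc (by omega) hm' h

end

variable {B E M : ℕ} {T : Tree} {ad : Str → ℕ} {d : ℕ → BitVec B}
variable {N : ℕ} [NeZero N] {σ : ℕ} {y : Word N} {n : ℕ} {buf : Finset Str}

/-- The relation of `Runs` for the programs of the machine. -/
abbrev Serves (M : ℕ) (r : Request σ) (s : State N) (d : ℕ → BitVec B) (o : List Bool) (k : ℕ)
    (t : State N) (d' : ℕ → BitVec B) : Prop :=
  Runs maxCost State.enc (stepProg M) M r s d o k t d'

theorem totalLen_le_card_mul {Y : Finset Str} {K : ℕ} (h : ∀ k ∈ Y, k.length + 1 ≤ K) :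
    totalLen Y ≤ Y.card * K := by
  rw [← smul_eq_mul]
  exact Finset.sum_le_card_nsmul _ _ _ h

theorem card_chg_le (a : ℕ) (x : List ℕ) : (chg a x).card ≤ x.length + 1 := by
  have : chg a x ⊆ Finset.range (x.length + 1) := fun j hj => by
    have := le_of_mem_chg hj
    rw [Finset.mem_range]
    omega
  simpa using Finset.card_le_card this

omit [NeZero N] in
theorem trieSize_frozen_le (y : Word N) (a : Fin σ) :
    trieSize (strip (charCode σ.size a) (keys σ y.str)) ≤ (N + 1) ^ 2 := by
  have hy := y.length_str
  rw [keys, strip_glue _ a.2]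
  refine (trieSize_le_totalLen _).trans ((totalLen_le_card_mul (K := N + 1) ?_).trans ?_)
  · intro k hk
    obtain ⟨j, hj, rfl⟩ := Finset.mem_image.1 hk
    have h1 := le_of_mem_chg hj
    have h2 := nat_size_le_self j
    rw [length_posCode]
    omega
  · rw [pow_two]
    refine Nat.mul_le_mul_right _ (Finset.card_image_le.trans ((card_chg_le _ _).trans ?_))
    omega

/-- Output of the answer about the frozen string. -/
theorem serves_spell (hB : 0 < B) (a : Fin σ) (dm : Bool) {m : Option Work}
    (hm : (State.enc ⟨y, .spell, dm, 0, m⟩).mem.length + B ≤ M)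
    (hm' : (State.enc ⟨y, .still, false, 0, m.map Work.normal⟩).mem.length ≤ M) :
    ∀ j : ℕ, j * B < (trieCode (strip (charCode σ.size a) (keys σ y.str))).length →
      ∃ k, Serves M (.query a) ⟨y, .spell, dm, Fin.ofNat _ j, m⟩ d
        ((trieCode (strip (charCode σ.size a) (keys σ y.str))).drop (j * B)) k
        ⟨y, .still, false, 0, m.map Work.normal⟩ d ∧
        k * B + j * B ≤ (trieCode (strip (charCode σ.size a) (keys σ y.str))).length + B := by
  set c := trieCode (strip (charCode σ.size a) (keys σ y.str)) with hc
  have hlen : c.length ≤ spellBound N := by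
    have := trieSize_frozen_le y a
    rw [hc, length_trieCode, spellBound]
    omega
  intro j
  induction hj : c.length - j using Nat.strong_induction_on generalizing j with
  | _ t ih =>
    intro hjc
    have hjl : j < c.length := (Nat.le_mul_of_pos_right j hB).trans_lt hjc
    have hval : ((Fin.ofNat (spellBound N + 1) j : Fin _) : ℕ) = j :=
      Nat.mod_eq_of_lt (by omega)
    have hstep : stepProg (B := B) M (.query a) ⟨y, .spell, dm, Fin.ofNat _ j, m⟩ =
        .emit ((c.drop (j * B)).take B) (.ret (if c.length ≤ (j + 1) * B then
          ⟨y, .done, dm, Fin.ofNat _ j, m⟩ else ⟨y, .spell, dm, Fin.ofNat _ (j + 1), m⟩)) := by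
      have : stepProg (B := B) M (.query a) ⟨y, .spell, dm, Fin.ofNat _ j, m⟩ =
          spellStep a ⟨y, .spell, dm, Fin.ofNat _ j, m⟩ := by cases m <;> rfl
      rw [this, spellStep]
      simp only [State.frozen, hval]
      rfl
    have hmax : 1 ≤ maxCost := by unfold maxCost; omega
    have hdrop : (c.drop (j * B)).drop B = c.drop ((j + 1) * B) := by
      rw [List.drop_drop, Nat.add_mul, one_mul]
    by_cases he : c.length ≤ (j + 1) * B
    · rw [if_pos he] at hstep
      have h2 : Serves M (.query a) ⟨y, .done, dm, Fin.ofNat _ j, m⟩ d [] 0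
          ⟨y, .still, false, 0, m.map Work.normal⟩ d := by
        refine Runs.halt ?_ hm'
        cases m <;> rfl
      have h1 : Leads maxCost State.enc (stepProg M) M (.query a) d
          ⟨y, .spell, dm, Fin.ofNat _ j, m⟩ (c.drop (j * B)) 1 ⟨y, .done, dm, Fin.ofNat _ j, m⟩ := by
        refine Leads.of_step ?_ ?_ one_pos hmax ?_ ?_ (by rw [one_mul]; exact hm)
          ((Nat.le_add_right _ _).trans hm)
        · rw [hstep, Prog.out, Prog.out, List.append_nil, List.take_take, min_self,
            List.take_of_length_le]
          rw [List.length_drop]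
          rw [Nat.add_mul, one_mul] at he
          omega
        all_goals rw [hstep]; rfl
      refine ⟨1, by simpa using h1 _ _ _ _ h2, ?_⟩
      rw [one_mul]
      omega
    · rw [if_neg he] at hstep
      obtain ⟨k, g1, g2⟩ := ih (c.length - (j + 1)) (by omega) (j + 1) rfl (by omega)
      have h1 : Leads maxCost State.enc (stepProg M) M (.query a) d
          ⟨y, .spell, dm, Fin.ofNat _ j, m⟩ ((c.drop (j * B)).take B) 1
            ⟨y, .spell, dm, Fin.ofNat _ (j + 1), m⟩ := by
        refine Leads.of_step ?_ ?_ one_pos hmax ?_ ?_ (by rw [one_mul]; exact hm)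
          ((Nat.le_add_right _ _).trans hm)
        · rw [hstep, Prog.out, Prog.out, List.append_nil, List.take_take, min_self]
        all_goals rw [hstep]; rfl
      refine ⟨1 + k, ?_, ?_⟩
      · have := h1 _ _ _ _ g1
        rwa [← hdrop, List.take_append_drop] at this
      · rw [Nat.add_mul] at g2 ⊢
        omega

/-- The state between operations of a machine that uses external memory. -/
def stillState (y : Word N) (n s : ℕ) (buf : Finset Str) : State N :=
  queryState y n s buf .still 0 [] ∅ [] false

/-- Every key is in the region of exactly one cell, and cells not comparable to `a` have nothing
below `a`. -/
theorem sum_cellVal (hT : T.WF E) (a k : Str) :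
    ∑ v ∈ comp T.Q a, cellVal T a v k = T.content (a ++ k) := by
  have h1 : ∑ v ∈ comp T.Q a, cellVal T a v k = ∑ v ∈ T.Q, cellVal T a v k := by
    refine Finset.sum_filter_of_ne fun v _ hne => ?_
    by_contra hno
    refine hne ?_
    rw [cellVal, ← ind_strip, ← ind_strip, strip_eq_empty (hT.pend_prefix v) hno,
      strip_eq_empty (fun k hk => prefix_of_mem_reg hk) hno, ind_empty, zero_add]
  rw [h1, Tree.content]
  simp only [cellVal]
  rw [Finset.sum_add_distrib]
  congr 1
  have h2 : ∀ v ∈ T.Q, ind (reg T.Q T.R v) (a ++ k) =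
      if own T.Q (a ++ k) = v then ind T.R (a ++ k) else 0 := by
    intro v _
    simp only [ind, mem_reg]
    split_ifs <;> simp_all
  rw [Finset.sum_congr rfl h2, Finset.sum_ite_eq, if_pos (own_mem hT.root _)]

/-- What is found adds up to the keys below the code of `a`, relative to the frozen string. The
output is bounded through the size of this set and not through the changes met on the way, which may
cancel. -/
theorem Context.query (h : Context B M E T ad d n buf) (hA : σ.size + 1 ≤ E) {K : Finset Str}
    (hK : ∀ k, ind K k = ind buf k + T.content k) (a : Fin σ) (y : Word N) :
    ∃ o k, Serves M (.query a) (stillState y n T.Q.card buf) d o k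
        (stillState y n T.Q.card buf) d ∧
      decode n o = decodeSet n (symmDiff (strip (charCode σ.size a) K)
        (strip (charCode σ.size a) (keys σ y.str))) ∧
      (o = [] ∨
        (decodeSet n (symmDiff (strip (charCode σ.size a) K)
            (strip (charCode σ.size a) (keys σ y.str))) ≠ Finset.range n ∨
          M / 64 < 4 * trieSize (strip (charCode σ.size a) K)) ∧
        o.length ≤ 16 * trieSize (strip (charCode σ.size a) K) + 3 * (N + 1) ^ 2 + 2) ∧
      k * B ≤ ((comp T.Q (charCode σ.size a)).card * (3 * recSize + 1) + recSize + 2) * B +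
        o.length := by
  set A := charCode σ.size a with hAdef
  set F := strip A (keys σ y.str) with hF
  have hroot := h.settled.wf.root
  have hAlen : A.length = σ.size := length_charCode _ _
  have hlarge := h.room.large
  have hpos := h.room.pos
  have hcap : cap B * 65536 ≤ B := Nat.div_mul_le_self _ _
  have hbuf : trieSize (strip A buf) ≤ totalLen buf :=
    (trieSize_le_totalLen _).trans (totalLen_strip_le _ _)
  have hbufM : trieSize (strip A buf) ≤ M / 64 := by
    have := h.buf_le
    omega
  have hE0 : Nat.size 0 ≤ E := by simp
  -- the walk
  obtain ⟨W1, acc1, k1, g1, w1⟩ := h.enter (y := y) a hroot (last := []) false (by simp) hbufM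
  obtain ⟨W2, acc2, k2, last, hl, ht, g2, w2⟩ := h.scan (y := y) a hroot _ [] acc1
    (false || !W1.isEmpty) (by simp) w1.small rfl
  rw [h.rep.root] at g1 g2
  have hall : after [] ((recOf T ad []).branches A) = (recOf T ad []).branches A := rfl
  rw [← hAdef, hall] at w2
  rw [← hAdef] at w1 ht
  have hnil : ([] : Str) <+: A ∨ A <+: [] := Or.inl List.nil_prefix
  have hself := branch_eq (ad := ad) hroot hnil
  have w := w1.trans w2 (disjoint_self_branches A [])
  have hcard : (comp T.Q A).card = 1 + (branches T.Q A ((recOf T ad []).branches A)).card := by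
    rw [← branch_nil, hself, Finset.card_union_of_disjoint (disjoint_self_branches A []),
      Finset.card_singleton]
  rw [← hself, branch_nil] at w
  have g := g1.trans g2
  rw [isEmpty_append_or, ← List.flatMap_append, Bool.false_or] at g
  replace w := w.mono (c' := (comp T.Q A).card * (3 * recSize + 1)) (by
    rw [hcard]; ring_nf; omega)
  generalize W1 ++ W2 = W at g w
  generalize k1 + k2 = kw at g w
  -- what has been found
  have hsum : symmDiff acc2 (xorAll W) = strip A K := by
    refine ind_injective fun k => ?_
    rw [ind_symmDiff, w.sum, sum_cellVal h.settled.wf, ind_strip, ind_strip, hK]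
  have htot := h.settled.sum_trieSize_le h.room.le hK h.buf_le A
  -- Here `cap B` has to be a small fraction of `B`: even one full set of pending changes for each
  -- prefix of the code is negligible compared with the threshold `M / 64`.
  have hgap : 3 * ((A.length + 2) * cap B) ≤ M / 4096 := by
    have h1 : (A.length + 2) * cap B * 65536 ≤ 4 * M := by
      calc (A.length + 2) * cap B * 65536 = (A.length + 2) * (cap B * 65536) := by ring
        _ ≤ (E + 1) * B := Nat.mul_le_mul (by omega) hcap
        _ = B * E + B := by ring
        _ ≤ 4 * M := by have := h.room.mul_le; omega
    omega
  have hsize : (W.map trieSize).sum + trieSize acc2 ≤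
      2 * trieSize (strip A K) + 3 * ((A.length + 2) * cap B) := by
    have := w.size
    simp only [cellSize] at this
    omega
  -- A set that was sent has more than `M / 64` nodes, so the slack `M / 4096` is dominated, and all
  -- that was found is within a constant factor of the exact set.
  have hdump : W ≠ [] → M / 64 < 4 * trieSize (strip A K) ∧
      (W.map trieSize).sum + trieSize acc2 ≤ 4 * trieSize (strip A K) := by
    intro hW
    obtain ⟨Y, W', rfl⟩ := List.exists_cons_of_ne_nil hW
    have h1 := w.large Y (by simp)
    simp only [List.map_cons, List.sum_cons] at hsize ⊢
    omega
  have hWlen : (W.flatMap trieCode).length ≤ 4 * (W.map trieSize).sum := by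
    have hl := w.large
    clear * - hl
    induction W with
    | nil => simp
    | cons Y W ih =>
      have h1 := ih fun Z hZ => hl Z (by simp [hZ])
      have h2 := hl Y (by simp)
      simp only [List.flatMap_cons, List.length_append, length_trieCode, List.map_cons,
        List.sum_cons]
      omega
  -- If nothing was sent, all cancellations took place in memory.
  have hWnil : W = [] → strip A K = acc2 := by
    rintro rfl
    rw [← hsum]
    exact (symmDiff_bot acc2).symm ▸ rfl
  -- from the initial state
  have hstart : ∀ o k t, Serves M (.query a)
      (queryState y n T.Q.card buf .enter 0 [] (strip A buf) [] false) d o k t d →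
      Serves M (.query a) (stillState y n T.Q.card buf) d o k t d := by
    intro o k t hr
    refine hr.of_eq rfl ?_
    simp only [stillState, queryState, State.enc, Work.code, List.length_append, length_trieCode]
    have : trieSize (∅ : Finset Str) = 0 := by simp [trieSize, pre]
    omega
  -- the last step at the root
  obtain ⟨r1, r2, r3, r4⟩ := Prog.getRec_ok h.ok hroot
  rw [h.rep.root] at r1 r2 r3 r4
  have hm := h.mem_le (y := y) (p := .next) (dm := !W.isEmpty) hE0 hl w.small (obuf := [])
    (by simp)
  have hstep : stepProg (B := B) M (.query a)
      (queryState y n T.Q.card buf .next 0 last acc2 [] (!W.isEmpty)) =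
      nextStep a (queryState y n T.Q.card buf .next 0 last acc2 [] (!W.isEmpty))
        ⟨n, T.Q.card, buf, 0, last, acc2, []⟩ := rfl
  have hmstill := h.mem_le (y := y) (p := .still) (dm := false) hE0 (last := []) (acc := ∅)
    (obuf := []) (by simp) (by simp [trieSize, pre]) (by simp)
  have hrec := one_le_recSize
  have hrB : B ≤ recSize * B := Nat.le_mul_of_pos_left _ hrec
  by_cases hcond : (queryState y n T.Q.card buf .next 0 last acc2 [] (!W.isEmpty)).dumped = false ∧
      decodeSet n (symmDiff acc2 ((queryState y n T.Q.card buf .next 0 last acc2 []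
        (!W.isEmpty)).frozen σ a)) = Finset.range n
  · have hW : W = [] := by simpa [queryState] using hcond.1
    have hmd := h.mem_le (y := y) (p := .done) (dm := !W.isEmpty) hE0 hl w.small (obuf := [])
      (by simp)
    have g3 : Goes σ M (.query a) d
        (queryState y n T.Q.card buf .next 0 last acc2 [] (!W.isEmpty)) [] recSize
        (queryState y n T.Q.card buf .done 0 last acc2 [] (!W.isEmpty)) := by
      refine Leads.of_step ?_ ?_ hrec recSize_le_maxCost ?_ ?_ hm (by omega)
      all_goals
        rw [hstep, nextStep]
        simp only [Prog.out_bind, Prog.cost_bind, Prog.fin_bind, Prog.res_bind, r1, r2, r3, r4]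
        rw [← hAdef, ht]
        simp only
        rw [if_pos (show (recOf T ad []).cell = [] from rfl)]
        rw [if_pos hcond]
        rfl
    have g4 : Serves M (.query a) (queryState y n T.Q.card buf .done 0 last acc2 [] (!W.isEmpty)) d
        [] 0 (stillState y n T.Q.card buf) d := Runs.halt rfl (by
          simp only [stillState]; omega)
    have g5 := hstart _ _ _ ((g.trans g3) _ _ _ _ g4)
    refine ⟨_, _, g5, ?_, Or.inl (by simp [hW]), ?_⟩
    · have hfull : decodeSet n (symmDiff acc2 F) = Finset.range n := hcond.2
      rw [hWnil hW, hfull]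
      simp [hW, decode]
    · have := w.cost
      simp only [List.append_nil]
      simp only [Nat.add_mul, Nat.zero_mul] at *
      omega
  · have hob : (trieCode acc2).length ≤ 3 * (M / 64 + 4097 * B) + 1 := by
      have := w.small
      rw [length_trieCode]
      omega
    have hmf := h.mem_le (y := y) (p := .fin) (dm := !W.isEmpty) hE0 hl w.small hob
    have g3 : Goes σ M (.query a) d
        (queryState y n T.Q.card buf .next 0 last acc2 [] (!W.isEmpty)) [] recSize
        (queryState y n T.Q.card buf .fin 0 last acc2 (trieCode acc2) (!W.isEmpty)) := by
      refine Leads.of_step ?_ ?_ hrec recSize_le_maxCost ?_ ?_ hm (by omega)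
      all_goals
        rw [hstep, nextStep]
        simp only [Prog.out_bind, Prog.cost_bind, Prog.fin_bind, Prog.res_bind, r1, r2, r3, r4]
        rw [← hAdef, ht]
        simp only
        rw [if_pos (show (recOf T ad []).cell = [] from rfl)]
        rw [if_neg hcond]
        rfl
    obtain ⟨k3, g4, c4⟩ := h.dump (y := y) a (dm := !W.isEmpty) hE0 hl w.small
      (Or.inr ⟨rfl, rfl⟩) _ (trieCode_ne_nil acc2) hob
    have hms := h.mem_le (y := y) (p := .spell) (dm := !W.isEmpty) hE0 hl w.small (obuf := [])
      (by simp)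
    obtain ⟨k4, g5, c5⟩ := serves_spell (y := y) (d := d) (M := M) hpos a (!W.isEmpty)
      (m := some ⟨n, T.Q.card, buf, 0, last, acc2, []⟩)
      ((Nat.add_le_add_left hrB _).trans hms) (by
        have := (Nat.le_add_right _ _).trans hmstill
        exact this) 0
      (by rw [zero_mul]; exact List.length_pos_of_ne_nil (trieCode_ne_nil _))
    rw [zero_mul, List.drop_zero] at g5
    have g6 := hstart _ _ _ ((g.trans (g3.trans g4)) _ _ _ _ g5)
    rw [← hAdef, ← hF] at g6 c5
    have ho : W.flatMap trieCode ++ ([] ++ trieCode acc2) ++ trieCode F =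
        (W ++ [acc2, F]).flatMap trieCode := by simp
    refine ⟨_, _, g6, ?_, Or.inr ⟨?_, ?_⟩, ?_⟩
    · rw [ho, decode_flatMap n (by simp), xorAll_append]
      congr 1
      have : xorAll [acc2, F] = symmDiff acc2 F := by
        change symmDiff acc2 (symmDiff F ⊥) = _
        rw [symmDiff_bot]
      rw [this, ← hsum, ← symmDiff_assoc, symmDiff_comm (xorAll W)]
    · by_cases hW : W = []
      · left
        rw [hWnil hW]
        intro he
        exact hcond ⟨by simp [hW, queryState], he⟩
      · exact Or.inr (hdump hW).1
    · have hFs := trieSize_frozen_le y a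
      rw [← hAdef, ← hF] at hFs
      simp only [List.nil_append, List.length_append, length_trieCode]
      by_cases hW : W = []
      · have := hWnil hW
        rw [this]
        simp only [hW, List.flatMap_nil, List.length_nil]
        omega
      · have := (hdump hW).2
        omega
    · have h1 := w.cost
      simp only [List.nil_append, List.length_append]
      simp only [Nat.add_mul, Nat.zero_mul] at *
      omega

end BitmapIndex

/-! ### Amortized cost of updates. -/

namespace BitmapIndex

/-! ### Updates -/

theorem Runs.step_of {σ B q : ℕ} {S : Type} {D : ℕ} {enc : S → Internal q}
    {step : Request σ → S → Prog B S} {M : ℕ} {r : Request σ} {d d₁ d' : ℕ → BitVec B}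
    {s t s' : S} {o : List Bool} {k₁ k : ℕ} (ho : (step r s).out d = [])
    (hk : (step r s).cost d = k₁) (hk0 : 0 < k₁) (hkD : k₁ ≤ D) (ht : (step r s).res d = t)
    (hf : (step r s).fin d = d₁) (hm : (enc s).mem.length + D * B ≤ M)
    (hm' : (enc t).mem.length ≤ M) (h : Runs D enc step M r t d₁ o k s' d') :
    Runs D enc step M r s d o (k₁ + k) s' d' := by
  subst hk ht hf
  have h1 := Runs.step (M := M) hk0 hkD ((Nat.add_le_add_left (Nat.mul_le_mul_right _
    ((Prog.reads_le_cost _ _).trans hkD)) _).trans hm) hm' h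
  rwa [ho, List.nil_append] at h1

theorem Tree.WF.mono {E E' : ℕ} {T : Tree} (h : T.WF E) (hE : E ≤ E') : T.WF E' :=
  { h with
    lenR := fun k hk => (h.lenR k hk).trans hE
    lenP := fun v k hk => (h.lenP v k hk).trans hE
    lenQ := fun v hv => (h.lenQ v hv).trans hE }

theorem Tree.Settled.mono {B E E' : ℕ} {T : Tree} (h : T.Settled B E) (hE : E ≤ E') :
    T.Settled B E' :=
  { h with wf := h.wf.mono hE }

variable {B E M : ℕ} {T : Tree} {ad : Str → ℕ} {d : ℕ → BitVec B}
variable {N : ℕ} {σ : ℕ} {n : ℕ} {buf : Finset Str}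

theorem Roomy.mem_le (h : Roomy B M E) (y : Word N) (p : Phase) {s addr : ℕ} (hn : n.size ≤ E)
    (hs : s.size ≤ E) (ha : addr.size ≤ E) (hb : totalLen buf ≤ cap B) :
    (queryState y n s buf p addr [] ∅ [] false).enc.mem.length + maxCost * B ≤ M := by
  have h1 := Work.length_code_le ⟨n, s, buf, addr, [], ∅, []⟩
  have h4 := (trieSize_le_totalLen _).trans hb
  have h5 : cap B ≤ B := Nat.div_le_self _ _
  have h6 := h.le
  have h7 := h.large
  have h8 := h.pos
  have h9 : trieSize (∅ : Finset Str) = 0 := by simp [trieSize, pre]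
  simp only [queryState, State.enc, maxCost]
  rw [recSize_eq]
  simp only [h9, List.length_nil] at h1
  omega

theorem Roomy.mem_still_le (h : Roomy B M E) (y : Word N) {s : ℕ} (hn : n.size ≤ E)
    (hs : s.size ≤ E) (hb : totalLen buf ≤ cap B) :
    (stillState y n s buf).enc.mem.length + maxCost * B ≤ M :=
  h.mem_le y .still hn hs (by simp) hb

theorem Busy.size_card {v : Str} (h : Busy B E T ad v d) : T.Q.card.size ≤ E := by
  have := card_le_of_length h.inv.wf.lenQ
  exact Nat.size_le.2 (by omega)

theorem Busy.size_addr {v : Str} (h : Busy B E T ad v d) : (ad v).size ≤ E :=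
  Nat.size_le.2 ((h.rep.lt v h.inv.mem).trans (by
    have := card_le_of_length h.inv.wf.lenQ
    omega))

variable [NeZero N]

/-- The work at the cells ends. -/
theorem serves_work (hR : Roomy B M E) (y : Word N) (hn : n.size ≤ E) (u : Update σ) :
    ∀ (T : Tree) (ad : Str → ℕ) (v : Str) (d : ℕ → BitVec B), Busy B E T ad v d →
      ∃ k T' ad' d', Serves M (.update u)
          (queryState y n T.Q.card ∅ .work (ad v) [] ∅ [] false) d [] k
          (stillState y n T'.Q.card ∅) d' ∧
        T'.Settled B E ∧ Rep T' ad' T'.Q.card d' ∧ (∀ k, T'.content k = T.content k) ∧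
        k * (64 * B) + maxCost * T'.rest B ≤ maxCost * T.pot B v := by
  intro T ad v d
  induction hp : T.pot B v using Nat.strong_induction_on generalizing T ad v d with
  | _ m ih =>
    intro h
    obtain ⟨w1, w2, w3, w4⟩ := Prog.work_spec h
    have hmax : 500 * recSize ≤ maxCost := by unfold maxCost; omega
    have hm := hR.mem_le y .work hn h.size_card h.size_addr
      (buf := ∅) (by simp [totalLen])
    have hstep : stepProg (B := B) M (.update u)
        (queryState y n T.Q.card ∅ .work (ad v) [] ∅ [] false) =
        workStep (queryState y n T.Q.card ∅ .work (ad v) [] ∅ [] false)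
          ⟨n, T.Q.card, ∅, ad v, [], ∅, []⟩ := rfl
    have ho : (stepProg M (.update u)
        (queryState y n T.Q.card ∅ .work (ad v) [] ∅ [] false)).out d = [] := by
      rw [hstep, workStep]
      simp only [Prog.out_bind, w1]
      rfl
    have hk : (stepProg M (.update u)
        (queryState y n T.Q.card ∅ .work (ad v) [] ∅ [] false)).cost d =
        (Prog.work (B := B) (ad v) T.Q.card).cost d := by
      rw [hstep, workStep]
      simp only [Prog.cost_bind]
      rfl
    have hf : (stepProg M (.update u)
        (queryState y n T.Q.card ∅ .work (ad v) [] ∅ [] false)).fin d =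
        (Prog.work (B := B) (ad v) T.Q.card).fin d := by
      rw [hstep, workStep]
      simp only [Prog.fin_bind]
      rfl
    rcases w4 with ⟨e1, e2, e3, rfl⟩ | ⟨T', ad', v', e1, e2, e3, e4⟩
    · have hmd := hR.mem_le y .done hn h.size_card (addr := 0) (by simp)
        (buf := ∅) (by simp [totalLen])
      have hms := hR.mem_still_le y hn h.size_card (buf := ∅) (by simp [totalLen])
      have hres : (stepProg M (.update u)
          (queryState y n T.Q.card ∅ .work (ad []) [] ∅ [] false)).res d =
          queryState y n T.Q.card ∅ .done 0 [] ∅ [] false := by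
        rw [hstep, workStep]
        simp only [Prog.res_bind, e1]
        rfl
      have hend : Serves M (.update u) (queryState y n T.Q.card ∅ .done 0 [] ∅ [] false) d [] 0
          (stillState y n T.Q.card ∅) d := Runs.halt rfl (by omega)
      have := Runs.step_of ho hk w2 (w3.trans hmax) hres (hf.trans e2) hm (by omega) hend
      refine ⟨_, T, ad, d, this, e3, h.rep, fun _ => rfl, ?_⟩
      -- The last visit of the root is paid for by the contribution of the root to the depth.
      have h1 := Tree.rest_le_pot_nil (B := B) h.inv.wf
      rw [hp, add_zero] at *
      calc _ ≤ maxCost * (64 * B) + maxCost * T.rest B :=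
            Nat.add_le_add_right (Nat.mul_le_mul_right _ (w3.trans hmax)) _
        _ = maxCost * (T.rest B + 64 * B) := by ring
        _ ≤ _ := Nat.mul_le_mul_left _ h1
    · have hpos := hR.pos
      obtain ⟨k, T'', ad'', d'', g1, g2, g3, g4, g5⟩ :=
        ih (T'.pot B v') (by omega) T' ad' v' _ rfl e2
      have hm' := hR.mem_le y .work hn e2.size_card e2.size_addr
        (buf := ∅) (by simp [totalLen])
      have hres : (stepProg M (.update u)
          (queryState y n T.Q.card ∅ .work (ad v) [] ∅ [] false)).res d =
          queryState y n T'.Q.card ∅ .work (ad' v') [] ∅ [] false := by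
        rw [hstep, workStep]
        simp only [Prog.res_bind, e1]
        rfl
      have := Runs.step_of ho hk w2 (w3.trans hmax) hres hf hm (by omega) g1
      refine ⟨_, T'', ad'', d'', this, g2, g3, fun k => (g4 k).trans (e4 k), ?_⟩
      rw [hp] at e3
      calc _ = (Prog.work (B := B) (ad v) T.Q.card).cost d * (64 * B) +
            (k * (64 * B) + maxCost * T''.rest B) := by ring
        _ ≤ maxCost * (64 * B) + maxCost * T'.pot B v' :=
            Nat.add_le_add (Nat.mul_le_mul_right _ (w3.trans hmax)) g5
        _ = maxCost * (T'.pot B v' + 64 * B) := by ring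
        _ ≤ _ := Nat.mul_le_mul_left _ e3

/-- A structure in external memory that represents a set of keys. -/
structure Holds (B M σ : ℕ) (K : Finset Str) (n : ℕ) (T : Tree) (ad : Str → ℕ)
    (d : ℕ → BitVec B) (buf : Finset Str) : Prop where
  context : Context B M (keyLen σ n) T ad d n buf
  content : ∀ k, ind K k = ind buf k + T.content k
  length : ∀ k ∈ buf, k.length + 1 ≤ keyLen σ n

/-- The potential of a structure in external memory. -/
def charge (B : ℕ) (T : Tree) (buf : Finset Str) : ℕ :=
  T.rest B + 2 ^ 33 * (heat [] buf + totalLen buf)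

theorem heat_le {Y : Finset Str} (hc : Y.card ≤ 4) (hE : ∀ k ∈ Y, k.length + 1 ≤ E) :
    heat [] Y ≤ 4 * E ^ 2 := by
  have : heat [] Y ≤ Y.card • (E * E) := by
    refine Finset.sum_le_card_nsmul _ _ _ fun k hk => ?_
    exact Nat.mul_le_mul (hE k hk) (by simpa using hE k hk)
  rw [smul_eq_mul] at this
  rw [pow_two]
  exact this.trans (Nat.mul_le_mul_right _ hc)

theorem size_le_keyLen (σ n : ℕ) : n.size ≤ keyLen σ n := by unfold keyLen; omega

/-- An update increases heat and length of the buffer by at most `4 * E' ^ 2` each, hence `2 ^ 33 *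
8 = 2 ^ 36`. When the buffer is loaded, its length exceeds `cap B`, so the term for the length is at
least `2 ^ 17 * B`; it pays for the access to the root and for the depth with which the work begins.
-/
theorem Holds.update {K : Finset Str} (h : Holds B M σ K n T ad d buf) (y : Word N)
    (u : Update σ) (hn : n ≤ u.lengthAfter n)
    (hl : ∀ k ∈ toggle n u, k.length + 1 ≤ keyLen σ (u.lengthAfter n))
    (hR : Roomy B M (keyLen σ (u.lengthAfter n))) :
    ∃ k T' ad' d' buf', Serves M (.update u) (stillState y n T.Q.card buf) d [] k
        (stillState y (u.lengthAfter n) T'.Q.card buf') d' ∧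
      Holds B M σ (symmDiff K (toggle n u)) (u.lengthAfter n) T' ad' d' buf' ∧
      k * (64 * B) + maxCost * charge B T' buf' ≤
        maxCost * (charge B T buf + 2 ^ 36 * keyLen σ (u.lengthAfter n) ^ 2) := by
  set n' := u.lengthAfter n with hn'
  set E' := keyLen σ n' with hE'
  set Y := symmDiff buf (toggle n u) with hY
  have hEE : keyLen σ n ≤ E' := keyLen_mono hn
  have hc4 := card_toggle n u
  have hYl : ∀ k ∈ Y, k.length + 1 ≤ E' := fun k hk => by
    rcases Finset.mem_union.1 (symmDiff_subset_union _ _ hk) with h1 | h1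
    exacts [(h.length k h1).trans hEE, hl k h1]
  have hheat : heat [] Y ≤ heat [] buf + 4 * E' ^ 2 :=
    (heat_symmDiff_le _ _ _).trans (Nat.add_le_add_left (heat_le hc4 hl) _)
  have htlen : totalLen (toggle n u) ≤ 4 * E' :=
    (totalLen_le_card_mul hl).trans (Nat.mul_le_mul_right _ hc4)
  have hlen : totalLen Y ≤ totalLen buf + 4 * E' :=
    (totalLen_symmDiff_le _ _).trans (Nat.add_le_add_left htlen _)
  have hE1 : E' ≤ E' ^ 2 := Nat.le_self_pow two_ne_zero _
  have hset := h.context.settled.mono hEE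
  have hns := size_le_keyLen σ n'
  have hs0 : T.Q.card.size ≤ E' := (Nat.size_le.2 h.context.card_lt).trans hEE
  have hms := hR.mem_still_le y ((Nat.size_le_size hn).trans hns) hs0 h.context.buf_le
  have hK : ∀ k, ind (symmDiff K (toggle n u)) k = ind Y k + T.content k := fun k => by
    rw [ind_symmDiff, hY, ind_symmDiff, h.content]
    ring
  have hstep : stepProg (B := B) M (.update u) (stillState y n T.Q.card buf) =
      updateStep u (stillState y n T.Q.card buf) ⟨n, T.Q.card, buf, 0, [], ∅, []⟩ := rfl
  by_cases hcap : totalLen Y ≤ cap B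
  · have hms' := hR.mem_still_le y (n := n') hns hs0 hcap
    refine ⟨0, T, ad, d, Y, Runs.halt ?_ ((Nat.le_add_right _ _).trans hms'),
      ⟨⟨hR, hset, h.context.rep, hns, hcap⟩, hK, hYl⟩, ?_⟩
    · rw [hstep, updateStep]
      simp only
      rw [← hY, if_pos hcap]
      rfl
    · rw [zero_mul, zero_add]
      refine Nat.mul_le_mul_left _ ?_
      unfold charge
      omega
  · have hbuf := h.context.buf_le
    have hcB : cap B ≤ B := Nat.div_le_self _ _
    have hRle := hR.le
    have hinv := hset.inv_load hYl (by omega)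
    have hrep := h.context.rep.load hset.wf Y
    have hroot := h.context.rep.root
    have hbusy : Busy B E' (T.load Y) ad [] _ := ⟨hinv, hR.le, hR.pos, hrep⟩
    obtain ⟨k, T', ad', d', g1, g2, g3, g4, g5⟩ := serves_work hR y hns u _ _ _ _ hbusy
    obtain ⟨r1, r2, r3, r4⟩ := Prog.getRec_ok h.context.ok hset.wf.root
    rw [hroot] at r1 r2 r3 r4 g1
    obtain ⟨s1, s2, s3⟩ := Prog.setRecs_spec
      [(0, { recOf T ad [] with pend := symmDiff (T.P []) Y })] d
    have hmw := hR.mem_le y .work (n := n') hns hbusy.size_card (addr := 0) (by simp)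
        (buf := ∅) (by simp [totalLen])
    have hmax : recSize + 1 * recSize ≤ maxCost := by unfold maxCost; omega
    have hrec := one_le_recSize
    have hrun : Serves M (.update u) (stillState y n T.Q.card buf) d [] ((recSize + 1 * recSize) + k)
        (stillState y n' T'.Q.card ∅) d' := by
      refine Runs.step_of ?_ ?_ (by omega) hmax ?_ ?_ hms ?_ g1
      · rw [hstep, updateStep]
        simp only
        rw [← hY, if_neg hcap]
        simp only [Prog.out_bind, r1, r2, r3, List.nil_append]
        exact (congrArg (· ++ _) s2).trans rfl
      · rw [hstep, updateStep]
        simp only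
        rw [← hY, if_neg hcap]
        simp only [Prog.cost_bind, r1, r2, r4]
        refine congrArg (recSize + ·) ?_
        exact (congrArg (· + _) s3).trans rfl
      · rw [hstep, updateStep]
        simp only
        rw [← hY, if_neg hcap]
        simp only [Prog.res_bind]
        rfl
      · rw [hstep, updateStep]
        simp only
        rw [← hY, if_neg hcap]
        simp only [Prog.fin_bind, r1, r2]
        exact s1
      · exact (Nat.le_add_right _ _).trans hmw
    have hpot := hset.pot_load_le Y
    have hrest := Tree.rest_load (B := B) hset.wf Y
    refine ⟨_, T', ad', d', ∅, hrun, ⟨⟨hR, g2, g3, hns, by simp [totalLen]⟩, fun k => ?_, by simp⟩,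
      ?_⟩
    · rw [hK, g4, Tree.content_load hset.wf, ind_empty]
      ring
    · have hB : B ≤ 65536 * totalLen Y := by
        have : B < 65536 * (cap B + 1) := Nat.lt_mul_div_succ B (by norm_num)
        omega
      have h0 : charge B T' ∅ = T'.rest B := by simp [charge, totalLen]
      rw [h0]
      have hfin : 64 * B + (T.load Y).pot B [] ≤ charge B T buf + 2 ^ 36 * E' ^ 2 := by
        unfold charge
        omega
      calc _ = (recSize + 1 * recSize) * (64 * B) + (k * (64 * B) + maxCost * T'.rest B) := by ring
        _ ≤ maxCost * (64 * B) + maxCost * (T.load Y).pot B [] :=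
            Nat.add_le_add (Nat.mul_le_mul_right _ hmax) g5
        _ = maxCost * (64 * B + (T.load Y).pot B []) := by ring
        _ ≤ _ := Nat.mul_le_mul_left _ hfin

end BitmapIndex

/-! ### Trie sizes, binomial coefficients and entropy. -/

namespace BitmapIndex

/-! ### Tries of positions -/

theorem bits_drop : ∀ (t j : ℕ), j.bits.drop t = (j / 2 ^ t).bits
  | 0, j => by simp
  | t + 1, j => by
    rw [← List.drop_drop, List.drop_one, bits_drop t j, ← Nat.div2_bits_eq_tail, Nat.div2_val,
      Nat.div_div_eq_div_mul, pow_succ]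

/-- Removing final bits of a binary expansion is division by a power of two, so the trie nodes are
codes of numbers again. -/
theorem prefix_posCode {p : Str} {j : ℕ} (h : p <+: posCode j) : ∃ t, p = posCode (j / 2 ^ t) := by
  refine ⟨(posCode j).length - p.length, ?_⟩
  have h1 := List.prefix_iff_eq_take.1 h
  rw [posCode, ← bits_drop, h1, List.length_take, min_eq_left h.length_le]
  conv_lhs => rw [posCode, List.take_reverse]
  congr 2
  simp [posCode]

/-- Few positions have a small trie. -/
theorem trieSize_image_posCode_le {D : Finset ℕ} {n : ℕ} (hD : ∀ j ∈ D, j ≤ n) (r : ℕ) :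
    trieSize (D.image posCode) ≤ D.card * r + n / 2 ^ r + 1 := by
  -- Dropping fewer than `r` bits gives at most `r` nodes per position; dropping more gives a number
  -- up to `n / 2 ^ r`.
  have h1 : pre (D.image posCode) ⊆
      (((Finset.range r).biUnion fun t => D.image fun j => j / 2 ^ t) ∪
        Finset.range (n / 2 ^ r + 1)).image posCode := by
    intro p hp
    obtain ⟨k, hk, hpk⟩ := mem_pre.1 hp
    obtain ⟨j, hj, rfl⟩ := Finset.mem_image.1 hk
    obtain ⟨t, rfl⟩ := prefix_posCode hpk
    refine Finset.mem_image_of_mem _ ?_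
    simp only [Finset.mem_union, Finset.mem_biUnion, Finset.mem_range, Finset.mem_image]
    by_cases ht : t < r
    · exact Or.inl ⟨t, ht, j, hj, rfl⟩
    · right
      have h2 : j / 2 ^ t ≤ n / 2 ^ r :=
        (Nat.div_le_div_right (hD j hj)).trans
          (Nat.div_le_div_left (Nat.pow_le_pow_right (by norm_num) (by omega)) (by positivity))
      omega
  refine (Finset.card_le_card h1).trans (Finset.card_image_le.trans
    ((Finset.card_union_le _ _).trans ?_))
  have h3 : ((Finset.range r).biUnion fun t => D.image fun j => j / 2 ^ t).card ≤ D.card * r := by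
    refine Finset.card_biUnion_le.trans ?_
    calc _ ≤ ∑ _t ∈ Finset.range r, D.card := Finset.sum_le_sum fun _ _ => Finset.card_image_le
      _ = D.card * r := by simp [mul_comm]
  rw [Finset.card_range]
  omega

theorem mem_positions {σ : ℕ} {a : Fin σ} {x : List (Fin σ)} {i : ℕ} :
    i ∈ positions a x ↔ x[i]? = some a := by
  simp only [positions, Finset.mem_filter, Finset.mem_range, and_iff_right_iff_imp]
  intro h
  by_contra hi
  rw [List.getElem?_eq_none (by omega)] at h
  simp at h

theorem positions_subset {σ : ℕ} (a : Fin σ) (x : List (Fin σ)) :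
    positions a x ⊆ Finset.range x.length := Finset.filter_subset _ _

theorem mem_chg_nat {σ : ℕ} {a : Fin σ} {x : List (Fin σ)} {j : ℕ} :
    j ∈ chg a (nat x) ↔ ¬ (j ∈ positions a x ↔ (0 < j ∧ j - 1 ∈ positions a x)) := by
  rw [mem_chg, getElem?_nat, getElem?_nat, mem_positions, mem_positions]

theorem card_chg_le_two_mul {σ : ℕ} (a : Fin σ) (x : List (Fin σ)) :
    (chg a (nat x)).card ≤ 2 * (positions a x).card := by
  have : chg a (nat x) ⊆ positions a x ∪ (positions a x).image (· + 1) := by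
    intro j hj
    rw [mem_chg_nat] at hj
    rw [Finset.mem_union, Finset.mem_image]
    by_cases h : j ∈ positions a x
    · exact Or.inl h
    · obtain ⟨h1, h2⟩ : 0 < j ∧ j - 1 ∈ positions a x := by tauto
      exact Or.inr ⟨_, h2, by omega⟩
  have h1 := (Finset.card_le_card this).trans (Finset.card_union_le _ _)
  have h2 : ((positions a x).image (· + 1)).card ≤ _ := Finset.card_image_le
  omega

/-- A change point inside the string is next to a position that is missing; the two ends are extra.
-/
theorem card_chg_le_compl {σ : ℕ} (a : Fin σ) (x : List (Fin σ)) :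
    (chg a (nat x)).card ≤ 2 * (x.length - (positions a x).card) + 2 := by
  have : chg a (nat x) ⊆ {0, x.length} ∪ ((Finset.range x.length \ positions a x) ∪
      (Finset.range x.length \ positions a x).image (· + 1)) := by
    intro j hj
    have hle := le_of_mem_chg hj
    have hlen : (nat x).length = x.length := by simp [nat]
    rw [mem_chg_nat] at hj
    simp only [Finset.mem_union, Finset.mem_insert, Finset.mem_singleton, Finset.mem_image,
      Finset.mem_sdiff, Finset.mem_range]
    by_cases h0 : j = 0
    · exact Or.inl (Or.inl h0)
    by_cases hn : j = x.length
    · exact Or.inl (Or.inr hn)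
    right
    by_cases h : j ∈ positions a x
    · have : j - 1 ∉ positions a x := by
        intro h'
        exact hj ⟨fun _ => ⟨by omega, h'⟩, fun _ => h⟩
      exact Or.inr ⟨j - 1, ⟨by omega, this⟩, by omega⟩
    · exact Or.inl ⟨by omega, h⟩
  have h1 := (Finset.card_le_card this).trans (Finset.card_union_le _ _)
  have h2 := Finset.card_union_le (Finset.range x.length \ positions a x)
    ((Finset.range x.length \ positions a x).image (· + 1))
  have h3 : ((Finset.range x.length \ positions a x).image (· + 1)).card ≤ _ :=
    Finset.card_image_le
  have h4 := Finset.card_sdiff_of_subset (positions_subset a x)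
  rw [Finset.card_range] at h4
  have h5 : ({0, x.length} : Finset ℕ).card ≤ 2 := Finset.card_le_two
  omega

theorem card_positions_le {σ : ℕ} (a : Fin σ) (x : List (Fin σ)) :
    (positions a x).card ≤ x.length := by
  simpa using Finset.card_le_card (positions_subset a x)

theorem positions_append {σ : ℕ} (a b : Fin σ) (x : List (Fin σ)) :
    positions a (x ++ [b]) = if b = a then insert x.length (positions a x) else positions a x := by
  ext i
  rw [mem_positions]
  rcases lt_trichotomy i x.length with h | h | h
  · rw [List.getElem?_append_left h, ← mem_positions]
    split_ifs
    · simp [h.ne]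
    · rfl
  · subst h
    have : x.length ∉ positions a x := fun h => by simpa using positions_subset a x h
    split_ifs with h <;> simp [this, h]
  · rw [List.getElem?_eq_none (by simp; omega)]
    have : i ∉ positions a x := fun h' => by
      have := positions_subset a x h'
      rw [Finset.mem_range] at this
      omega
    split_ifs <;> simp [this, h.ne']

theorem card_positions {σ : ℕ} (a : Fin σ) (x : List (Fin σ)) :
    (positions a x).card = x.count a := by
  induction x using List.reverseRecOn with
  | nil => simp [positions]
  | append_singleton x b ih =>
    rw [positions_append, List.count_append, List.count_singleton]
    have : x.length ∉ positions a x := fun h => by simpa using positions_subset a x h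
    by_cases h : b = a
    · subst h
      rw [if_pos rfl, Finset.card_insert_of_notMem this, ih]
      simp
    · rw [if_neg h, ih]
      simp [h]

/-! ### Binomial coefficients -/

/-- The bound (n/m)^m for binomial coefficients. A fixed real ratio survives lowering both arguments
by one, because it is at least 1. -/
theorem pow_le_choose {ρ : ℝ} (hρ : 1 ≤ ρ) : ∀ (m n : ℕ), ρ * m ≤ n → ρ ^ m ≤ n.choose m
  | 0, n, _ => by simp
  | m + 1, 0, h => by
    push_cast at h
    nlinarith [(Nat.cast_nonneg m : (0 : ℝ) ≤ m)]
  | m + 1, n + 1, h => by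
    push_cast at h
    have h1 := pow_le_choose hρ m n (by linarith)
    have h2 : ((n : ℝ) + 1) * n.choose m = (n + 1).choose (m + 1) * (m + 1) := by
      exact_mod_cast Nat.add_one_mul_choose_eq n m
    have h3 : (0 : ℝ) < m + 1 := by positivity
    refine le_of_mul_le_mul_right ?_ h3
    rw [← h2, pow_succ]
    calc ρ ^ m * ρ * (m + 1) = (ρ * (m + 1)) * ρ ^ m := by ring
      _ ≤ (n + 1) * n.choose m := mul_le_mul h h1 (by positivity) (by positivity)

/-- The size of a description of `m` positions out of `n`. -/
def spread (n m : ℕ) : ℝ := m * Real.logb 2 ((n : ℝ) / m)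

theorem spread_nonneg {n m : ℕ} (h : m ≤ n) : 0 ≤ spread n m := by
  rcases Nat.eq_zero_or_pos m with rfl | hm
  · simp [spread]
  · refine mul_nonneg (Nat.cast_nonneg _) (Real.logb_nonneg one_lt_two ?_)
    rw [le_div_iff₀ (by exact_mod_cast hm), one_mul]
    exact_mod_cast h

theorem spread_le_lg_choose {n m : ℕ} (h : m ≤ n) : spread n m ≤ lg (n.choose m) := by
  rcases Nat.eq_zero_or_pos m with rfl | hm
  · simp [spread, lg]
  · have hm' : (0 : ℝ) < m := by exact_mod_cast hm
    have h1 : 1 ≤ (n : ℝ) / m := by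
      rw [le_div_iff₀ hm', one_mul]
      exact_mod_cast h
    have h2 := pow_le_choose h1 m n (by rw [div_mul_cancel₀ _ hm'.ne'])
    rw [spread, ← Real.logb_pow, lg]
    exact Real.logb_le_logb_of_le one_lt_two (by positivity) h2

theorem one_le_logb {n m : ℕ} (hm : 0 < m) (h : 2 * m ≤ n) : 1 ≤ Real.logb 2 ((n : ℝ) / m) := by
  have hm' : (0 : ℝ) < m := by exact_mod_cast hm
  have h1 : (2 : ℝ) ≤ n / m := by
    rw [le_div_iff₀ hm']
    exact_mod_cast h
  calc (1 : ℝ) = Real.logb 2 2 := (Real.logb_self_eq_one one_lt_two).symm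
    _ ≤ _ := Real.logb_le_logb_of_le one_lt_two two_pos h1

/-- Let l = lg(n/m), so l ≥ 1. Then lg n = l + lg m ≤ l + (m - 1) ≤ m l. This lets a bitmap pay for
the code of its character. -/
theorem lg_le_spread {n m : ℕ} (hm : 0 < m) (h : 2 * m ≤ n) : lg n ≤ spread n m := by
  have hm' : (0 : ℝ) < m := by exact_mod_cast hm
  have hn' : (0 : ℝ) < n := by exact_mod_cast (show 0 < n by omega)
  have h1 := one_le_logb hm h
  have h2 : Real.logb 2 ((n : ℝ) / m) = lg n - lg m := Real.logb_div hn'.ne' hm'.ne'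
  have h3 : lg m ≤ m - 1 := by
    have h4 : (m : ℝ) ≤ 2 ^ (m - 1) := by
      have : m ≤ 2 ^ (m - 1) := by
        have := Nat.lt_two_pow_self (n := m - 1)
        omega
      exact_mod_cast this
    have h5 := Real.logb_le_logb_of_le one_lt_two hm' h4
    rw [Real.logb_pow, Real.logb_self_eq_one one_lt_two, mul_one, Nat.cast_sub hm,
      Nat.cast_one] at h5
    exact h5
  have h6 : (1 : ℝ) ≤ m := by exact_mod_cast hm
  unfold spread
  nlinarith

theorem trieSize_le_spread {D : Finset ℕ} {n m : ℕ} (hD : ∀ j ∈ D, j ≤ n) (hm : 0 < m)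
    (h : 2 * m ≤ n) (hc : D.card ≤ 4 * m) : (trieSize (D.image posCode) : ℝ) ≤ 10 * spread n m := by
  -- The top of the trie is cut where at most `m + 1` nodes remain; below, a position has at most
  -- lg(n/m) + 1 nodes.
  set r := Nat.log 2 (n / m) + 1 with hr
  have h1 := trieSize_image_posCode_le hD r
  have h2 : n / 2 ^ r ≤ m := by
    have h3 : n / m < 2 ^ r := Nat.lt_pow_succ_log_self (by norm_num) _
    rw [Nat.div_lt_iff_lt_mul hm] at h3
    exact Nat.div_le_of_le_mul h3.le
  have hm' : (0 : ℝ) < m := by exact_mod_cast hm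
  have h4 : (r : ℝ) ≤ Real.logb 2 ((n : ℝ) / m) + 1 := by
    rw [hr]
    push_cast
    gcongr
    have h5 : 2 ^ Nat.log 2 (n / m) ≤ n / m :=
      Nat.pow_log_le_self 2 (Nat.div_pos (by omega) hm).ne'
    have h6 : ((2 : ℝ) ^ Nat.log 2 (n / m)) ≤ (n : ℝ) / m :=
      (by exact_mod_cast h5 : ((2 : ℝ) ^ Nat.log 2 (n / m)) ≤ ((n / m : ℕ) : ℝ)).trans
        Nat.cast_div_le
    have h7 := Real.logb_le_logb_of_le one_lt_two (by positivity) h6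
    rwa [Real.logb_pow, Real.logb_self_eq_one one_lt_two, mul_one] at h7
  have h8 := one_le_logb hm h
  have h9 : (trieSize (D.image posCode) : ℝ) ≤ 4 * m * r + m + 1 := by
    have : trieSize (D.image posCode) ≤ 4 * m * r + m + 1 := by
      have := Nat.mul_le_mul_right r hc
      omega
    exact_mod_cast this
  have h10 : (1 : ℝ) ≤ m := by exact_mod_cast hm
  unfold spread
  nlinarith

/-! ### Tries of bitmaps -/

section Bitmap

variable {σ : ℕ} (a : Fin σ) (x : List (Fin σ))

theorem le_of_mem_chg_nat : ∀ j ∈ chg a (nat x), j ≤ x.length := fun j hj => by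
  simpa [nat] using le_of_mem_chg hj

theorem chg_eq_empty (h : (positions a x).card = 0) : chg a (nat x) = ∅ := by
  have := card_chg_le_two_mul a x
  exact Finset.card_eq_zero.1 (by omega)

/-- The number of occurrences of the rarer value of a bitmap. -/
def rare : ℕ := min (positions a x).card (x.length - (positions a x).card)

theorem trieSize_le_of_mixed (h0 : 0 < (positions a x).card)
    (h1 : (positions a x).card < x.length) :
    (trieSize ((chg a (nat x)).image posCode) : ℝ) ≤ 10 * spread x.length (rare a x) := by
  have h2 := card_chg_le_two_mul a x
  have h3 := card_chg_le_compl a x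
  have h4 : 0 < rare a x := by unfold rare; omega
  refine trieSize_le_spread (le_of_mem_chg_nat a x) h4 ?_ ?_ <;> unfold rare at * <;> omega

theorem lg_le_spread_rare (h0 : 0 < (positions a x).card)
    (h1 : (positions a x).card < x.length) : lg x.length ≤ spread x.length (rare a x) := by
  have h4 : 0 < rare a x := by unfold rare; omega
  refine lg_le_spread h4 ?_
  unfold rare
  omega

theorem trieSize_le_of_full (h1 : (positions a x).card = x.length) :
    trieSize ((chg a (nat x)).image posCode) ≤ 2 * x.length.size + 1 := by
  have h2 := trieSize_image_posCode_le (le_of_mem_chg_nat a x) x.length.size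
  have h3 := card_chg_le_compl a x
  have h4 : x.length / 2 ^ x.length.size = 0 := Nat.div_eq_of_lt (Nat.lt_size_self _)
  rw [h4] at h2
  have h5 := Nat.mul_le_mul_right x.length.size (show (chg a (nat x)).card ≤ 2 by omega)
  omega

theorem spread_rare_le : spread x.length (rare a x) ≤ answerBits a x := by
  have h := card_positions_le a x
  have h1 := spread_le_lg_choose (n := x.length) (m := rare a x) (by unfold rare; omega)
  refine h1.trans (le_of_eq ?_)
  unfold answerBits rare
  rcases min_choice (positions a x).card (x.length - (positions a x).card) with e | e
  · rw [e]
  · rw [e, Nat.choose_symm h]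

theorem answerBits_nonneg : 0 ≤ answerBits a x := by
  unfold answerBits lg
  exact Real.logb_nonneg one_lt_two (by exact_mod_cast Nat.choose_pos (card_positions_le a x))

end Bitmap

/-! ### Entropy -/

section Entropy

variable {σ : ℕ} (x : List (Fin σ))

theorem length_mul_entropy (h : 0 < x.length) :
    x.length * entropy x = ∑ a : Fin σ, spread x.length (x.count a) := by
  have hn : (x.length : ℝ) ≠ 0 := by exact_mod_cast h.ne'
  rw [entropy, Finset.mul_sum]
  refine Finset.sum_congr rfl fun a _ => ?_
  rw [spread, ← mul_assoc, mul_div_cancel₀ _ hn]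

theorem entropy_nonneg : 0 ≤ entropy x := by
  rcases Nat.eq_zero_or_pos x.length with h | h
  · simp [entropy, h]
  · have h1 := length_mul_entropy x h
    have h2 : 0 ≤ ∑ a : Fin σ, spread x.length (x.count a) :=
      Finset.sum_nonneg fun a _ => spread_nonneg List.count_le_length
    rw [← h1] at h2
    exact nonneg_of_mul_nonneg_right h2 (by exact_mod_cast h)

theorem sum_count : ∑ a : Fin σ, x.count a = x.length := by
  have := Multiset.sum_count_eq_card (s := Finset.univ) (m := (x : Multiset (Fin σ))) (by simp)
  simpa using this

/-- At most one character occurs more often than half of the time. -/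
theorem sum_majority_le {c : ℝ} (hc : 0 ≤ c) (S : Finset (Fin σ))
    (hS : ∀ a ∈ S, x.length < 2 * x.count a) : ∑ _a ∈ S, c ≤ c := by
  have h1 : S.card ≤ 1 := by
    rw [Finset.card_le_one]
    intro a ha b hb
    by_contra hab
    have h2 := hS a ha
    have h3 := hS b hb
    have h4 : ∑ e ∈ {a, b}, x.count e ≤ ∑ e : Fin σ, x.count e :=
      Finset.sum_le_sum_of_subset (Finset.subset_univ _)
    rw [Finset.sum_pair hab, sum_count] at h4
    omega
  rw [Finset.sum_const, nsmul_eq_mul]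
  have h2 : (S.card : ℝ) ≤ 1 := by exact_mod_cast h1
  nlinarith

/-- The rarer value stands for all the other characters together. Splitting their number into the
single counts only makes the logarithms larger. -/
theorem spread_rare_le_of_majority {a : Fin σ} (h : x.length < 2 * x.count a) :
    spread x.length (rare a x) ≤ ∑ b : Fin σ, spread x.length (x.count b) := by
  have hr : rare a x = x.length - x.count a := by
    rw [rare, card_positions]
    omega
  have hsum : rare a x = ∑ b ∈ Finset.univ.erase a, x.count b := by
    have h1 := sum_count x
    rw [← Finset.add_sum_erase _ _ (Finset.mem_univ a)] at h1
    omega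
  rw [spread]
  conv_lhs => rw [hsum]
  push_cast
  rw [Finset.sum_mul]
  refine (Finset.sum_le_sum fun b hb => ?_).trans (Finset.sum_le_sum_of_subset_of_nonneg
    (Finset.erase_subset a Finset.univ) fun b _ _ => spread_nonneg List.count_le_length)
  rcases Nat.eq_zero_or_pos (x.count b) with h0 | h0
  · simp [h0, spread]
  · have h1 : x.count b ≤ rare a x := by
      rw [hsum]
      exact Finset.single_le_sum (f := fun b => x.count b) (fun _ _ => Nat.zero_le _) hb
    have h2 : (0 : ℝ) < x.count b := by exact_mod_cast h0
    have h3 : (0 : ℝ) < x.length := by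
      exact_mod_cast h0.trans_le (List.count_le_length (a := b) (l := x))
    have h4 : (x.count b : ℝ) ≤ rare a x := by exact_mod_cast h1
    have h5 : (0 : ℝ) < rare a x := h2.trans_le h4
    rw [spread]
    have h6 : ((∑ i ∈ Finset.univ.erase a, x.count i : ℕ) : ℝ) = rare a x := by rw [hsum]
    push_cast at h6
    rw [h6]
    refine mul_le_mul_of_nonneg_left ?_ h2.le
    exact Real.logb_le_logb_of_le one_lt_two (by positivity)
      (div_le_div_of_nonneg_left h3.le h2 h4)

/-- For a character without majority the rarer value is the character itself. At most one character
has a majority, and its term is at most the whole sum again. -/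
theorem sum_spread_rare_le (h : 0 < x.length) :
    ∑ a : Fin σ, spread x.length (rare a x) ≤ 2 * (x.length * entropy x) := by
  rw [length_mul_entropy x h]
  set H := ∑ a : Fin σ, spread x.length (x.count a) with hH
  have hH0 : 0 ≤ H := Finset.sum_nonneg fun a _ => spread_nonneg List.count_le_length
  have h1 : ∀ a : Fin σ, spread x.length (rare a x) ≤ spread x.length (x.count a) +
      if x.length < 2 * x.count a then H else 0 := by
    intro a
    split_ifs with hm
    · have := spread_rare_le_of_majority x hm
      have := spread_nonneg (List.count_le_length (a := a) (l := x))
      linarith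
    · have : rare a x = x.count a := by
        rw [rare, card_positions]
        omega
      rw [this, add_zero]
  refine (Finset.sum_le_sum fun a _ => h1 a).trans ?_
  rw [Finset.sum_add_distrib, ← hH, ← Finset.sum_filter]
  have := sum_majority_le x hH0 (Finset.univ.filter fun a => x.length < 2 * x.count a) (by simp)
  linarith

theorem size_le_lg {n : ℕ} (h : 0 < n) : (n.size : ℝ) ≤ lg n + 1 := by
  have h1 : 2 ^ (n.size - 1) ≤ n := by
    have : 0 < n.size := Nat.size_pos.2 h
    exact Nat.lt_size.1 (by omega)
  have h2 : ((2 : ℝ) ^ (n.size - 1)) ≤ n := by exact_mod_cast h1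
  have h3 := Real.logb_le_logb_of_le one_lt_two (by positivity) h2
  rw [Real.logb_pow, Real.logb_self_eq_one one_lt_two, mul_one] at h3
  have h4 : (n.size : ℝ) ≤ (n.size - 1 : ℕ) + 1 := by exact_mod_cast (by omega : n.size ≤ n.size - 1 + 1)
  unfold lg
  linarith

theorem one_le_lg {n : ℕ} (h : 2 ≤ n) : 1 ≤ lg n := by
  have h2 : (2 : ℝ) ≤ n := by exact_mod_cast h
  calc (1 : ℝ) = Real.logb 2 2 := (Real.logb_self_eq_one one_lt_two).symm
    _ ≤ _ := Real.logb_le_logb_of_le one_lt_two two_pos h2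

theorem trieSize_glue_le (σ : ℕ) (D : ℕ → Finset ℕ) : trieSize (glue σ D) ≤
    ∑ a : Fin σ, if D a = ∅ then 0 else σ.size + 1 + trieSize ((D a).image posCode) := by
  have h1 : pre (glue σ D) ⊆ Finset.univ.biUnion fun a : Fin σ => if D a = ∅ then ∅ else
      (charCode σ.size a).inits.toFinset ∪
        (pre ((D a).image posCode)).image (charCode σ.size a ++ ·) := by
    intro p hp
    obtain ⟨k, hk, hpk⟩ := mem_pre.1 hp
    obtain ⟨a, ha, j, hj, rfl⟩ := mem_glue.1 hk
    refine Finset.mem_biUnion.2 ⟨⟨a, ha⟩, Finset.mem_univ _, ?_⟩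
    rw [if_neg (Finset.ne_empty_of_mem hj), Finset.mem_union]
    rcases prefix_comparable hpk (List.prefix_append (charCode σ.size a) (posCode j)) with h | h
    · exact Or.inl (by simpa using h)
    · obtain ⟨t, rfl⟩ := h
      exact Or.inr (Finset.mem_image.2 ⟨t, mem_pre.2 ⟨_, Finset.mem_image_of_mem _ hj,
        (List.prefix_append_right_inj _).1 hpk⟩, rfl⟩)
  refine (Finset.card_le_card h1).trans (Finset.card_biUnion_le.trans
    (Finset.sum_le_sum fun a _ => ?_))
  split_ifs
  · simp
  · refine (Finset.card_union_le _ _).trans (Nat.add_le_add ?_ Finset.card_image_le)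
    exact (List.toFinset_card_le _).trans (by simp)

/-- The trie of the keys of a string is not larger than the string, compressed. -/
theorem trieSize_keys_le (h : 2 ≤ x.length) (hσ : σ ≤ x.length) :
    (trieSize (keys σ (nat x)) : ℝ) ≤ 26 * (x.length * entropy x) + 8 * lg x.length := by
  have hlg := one_le_lg h
  -- The code of the character takes at most 3 lg n, which a mixed bitmap pays with its spread: 3 +
  -- 10 = 13. A bitmap of ones only belongs to a majority character and has at most 8 lg n nodes
  -- with its code.
  have hterm : ∀ a : Fin σ, (((if chg a (nat x) = ∅ then 0 else
      σ.size + 1 + trieSize ((chg a (nat x)).image posCode) : ℕ)) : ℝ) ≤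
        13 * spread x.length (rare a x) + if x.length < 2 * x.count a then 8 * lg x.length else 0 := by
    intro a
    have hs0 : 0 ≤ spread x.length (rare a x) := spread_nonneg (by unfold rare; omega)
    have hi0 : 0 ≤ if x.length < 2 * x.count a then 8 * lg x.length else 0 := by
      split_ifs <;> linarith
    have hle := card_positions_le a x
    have hsz : ((σ.size + 1 : ℕ) : ℝ) ≤ 3 * lg x.length := by
      have h1 : (σ.size : ℝ) ≤ x.length.size := by exact_mod_cast Nat.size_le_size hσ
      have h2 := size_le_lg (show 0 < x.length by omega)
      push_cast
      linarith
    rcases Nat.eq_zero_or_pos (positions a x).card with h0 | h0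
    · rw [if_pos (chg_eq_empty a x h0), Nat.cast_zero]
      linarith
    · have h1 : (((if chg a (nat x) = ∅ then 0 else
          σ.size + 1 + trieSize ((chg a (nat x)).image posCode) : ℕ)) : ℝ) ≤
          ((σ.size + 1 : ℕ) : ℝ) + trieSize ((chg a (nat x)).image posCode) := by
        rw [← Nat.cast_add]
        refine Nat.cast_le.2 ?_
        split_ifs <;> omega
      rcases hle.lt_or_eq with h2 | h2
      · have h3 := trieSize_le_of_mixed a x h0 h2
        have h4 := lg_le_spread_rare a x h0 h2
        linarith
      · have h3 := trieSize_le_of_full a x h2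
        have h4 : (trieSize ((chg a (nat x)).image posCode) : ℝ) ≤ 2 * x.length.size + 1 := by
          exact_mod_cast h3
        have h5 := size_le_lg (show 0 < x.length by omega)
        have h6 : x.length < 2 * x.count a := by
          rw [card_positions] at h2
          omega
        rw [if_pos h6]
        linarith
  have h1 : (trieSize (keys σ (nat x)) : ℝ) ≤ ∑ a : Fin σ, (((if chg a (nat x) = ∅ then 0 else
      σ.size + 1 + trieSize ((chg a (nat x)).image posCode) : ℕ)) : ℝ) := by
    rw [← Nat.cast_sum]
    exact Nat.cast_le.2 (trieSize_glue_le σ fun a => chg a (nat x))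
  refine h1.trans ((Finset.sum_le_sum fun a _ => hterm a).trans ?_)
  rw [Finset.sum_add_distrib, ← Finset.mul_sum, ← Finset.sum_filter]
  have h2 := sum_spread_rare_le x (by omega)
  have h3 := sum_majority_le x (c := 8 * lg x.length) (by linarith)
    (Finset.univ.filter fun a => x.length < 2 * x.count a) (by simp)
  linarith

end Entropy

end BitmapIndex

/-! ### Stored strings under updates. -/

namespace BitmapIndex

variable {B M : ℕ} {σ : ℕ}

/-! ### Admissible strings -/

section Admissible

variable {x : List (Fin σ)}

theorem Admissible.two_mul_lg_le (h : Admissible B M x) : 2 * lg x.length ≤ B := by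
  have h1 := one_le_lg h.two_le_length
  have h2 := h.two_le_blockWords
  rwa [blockWords, le_div_iff₀ (by linarith)] at h2

theorem Admissible.pos (h : Admissible B M x) : 0 < B := by
  have h1 := one_le_lg h.two_le_length
  have h2 := h.two_mul_lg_le
  have : (0 : ℝ) < B := by linarith
  exact_mod_cast this

theorem Admissible.le_memory (h : Admissible B M x) : B ≤ M := by
  have h1 := one_le_lg h.two_le_length
  have h2 := h.memory
  have h3 : (0 : ℝ) ≤ B := Nat.cast_nonneg _
  have : (B : ℝ) ≤ M := by nlinarith
  exact_mod_cast this

theorem Admissible.keyLen_le (h : Admissible B M x) :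
    (keyLen σ x.length : ℝ) ≤ 2 * lg x.length + 3 := by
  have h1 := size_le_lg (show 0 < x.length by have := h.two_le_length; omega)
  have h2 : (σ.size : ℝ) ≤ x.length.size := by exact_mod_cast Nat.size_le_size h.alphabet_le
  unfold keyLen
  push_cast
  linarith

/-- The reason for the choice of `L`: from length `2 ^ L` on, M ≥ B lg n yields room for `2 ^ 30`
blocks. -/
theorem Admissible.roomy (h : Admissible B M x) {L : ℕ} (hL : 2 ^ 30 ≤ L)
    (hx : 2 ^ L ≤ x.length) : Roomy B M (keyLen σ x.length) := by
  have h1 := h.keyLen_le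
  have h2 := h.two_mul_lg_le
  have h3 := h.memory
  have h4 : (L : ℝ) ≤ lg x.length := by
    have h5 : ((2 : ℝ) ^ L) ≤ x.length := by exact_mod_cast hx
    have h6 := Real.logb_le_logb_of_le one_lt_two (by positivity) h5
    rwa [Real.logb_pow, Real.logb_self_eq_one one_lt_two, mul_one] at h6
  have h5 : ((2 : ℝ) ^ 30) ≤ L := by exact_mod_cast hL
  have h6 : (0 : ℝ) ≤ B := Nat.cast_nonneg _
  refine ⟨h.pos, ?_, ?_, ?_⟩
  · have : (keyLen σ x.length : ℝ) ≤ 4 * B := by linarith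
    exact_mod_cast this
  · have : (2 : ℝ) ^ 30 * B ≤ M := by nlinarith
    exact_mod_cast this
  · have : (B : ℝ) * keyLen σ x.length ≤ 3 * M := by nlinarith
    exact_mod_cast this

end Admissible

/-! ### Representations -/

theorem exists_rep {E : ℕ} {T : Tree} (hT : T.WF E) (B : ℕ) :
    ∃ (ad : Str → ℕ) (d : ℕ → BitVec B), Rep T ad T.Q.card d := by
  classical
  have hpos : 0 < T.Q.card := Finset.card_pos.2 ⟨[], hT.root⟩
  obtain ⟨g⟩ : Nonempty (T.Q ≃ Fin T.Q.card) := ⟨T.Q.equivFin⟩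
  -- The swap brings the root to address 0.
  set e := g.trans (Equiv.swap (g ⟨[], hT.root⟩) ⟨0, hpos⟩) with he
  set ad : Str → ℕ := fun q => if h : q ∈ T.Q then e ⟨q, h⟩ else 0 with had
  have had' : ∀ q (h : q ∈ T.Q), ad q = e ⟨q, h⟩ := fun q h => by simp [had, h]
  refine ⟨ad, fun a => if h : a / recSize < T.Q.card then
    ((recOf T ad (e.symm ⟨a / recSize, h⟩).1).blocks B).getD (a % recSize) 0 else 0,
    ?_, ?_, ?_, ?_, ?_⟩
  · intro q hq q' hq' h
    rw [had' q hq, had' q' hq'] at h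
    exact congrArg Subtype.val (e.injective (Fin.val_injective h))
  · intro q hq
    rw [had' q hq]
    exact (e ⟨q, hq⟩).2
  · rw [had' _ hT.root, he]
    simp
  · intro q hq
    have hrec : 0 < recSize := one_le_recSize
    refine List.ext_getElem (by simp [seg]) fun i h1 h2 => ?_
    have hi : i < recSize := by simpa [seg] using h1
    have hdiv : (recSize * ad q + i) / recSize = ad q := by
      rw [Nat.mul_add_div hrec, Nat.div_eq_of_lt hi, add_zero]
    have hmod : (recSize * ad q + i) % recSize = i := by
      rw [Nat.mul_add_mod, Nat.mod_eq_of_lt hi]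
    have hlt : ad q < T.Q.card := by
      rw [had' q hq]
      exact (e ⟨q, hq⟩).2
    have hsymm : (e.symm ⟨ad q, hlt⟩).1 = q := by
      have : (⟨ad q, hlt⟩ : Fin T.Q.card) = e ⟨q, hq⟩ := Fin.ext (had' q hq)
      rw [this, Equiv.symm_apply_apply]
    simp only [seg, List.getElem_map, List.getElem_range, hdiv, hmod]
    rw [dif_pos hlt, hsymm, List.getD_eq_getElem _ _ h2]
  · intro a ha
    have hrec : 0 < recSize := one_le_recSize
    have : T.Q.card ≤ a / recSize := (Nat.le_div_iff_mul_le hrec).2 (by rwa [mul_comm])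
    rw [dif_neg (by omega)]

/-- Blank memory already represents the tree without keys, so leaving the control needs no I/Os. -/
theorem rep_trivial (B : ℕ) : Rep (B := B) (Tree.clean {[]} ∅) (fun _ => 0) 1 fun _ => 0 where
  inj := by
    intro q hq q' hq' _
    have h1 : q = [] := by simpa [Tree.clean] using hq
    have h2 : q' = [] := by simpa [Tree.clean] using hq'
    rw [h1, h2]
  lt := by simp
  root := rfl
  blocks q hq := by
    obtain rfl : q = [] := by simpa [Tree.clean] using hq
    have hk : kids {[]} [] = ∅ := by
      refine Finset.eq_empty_of_forall_notMem fun c hc => ?_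
      obtain ⟨h1, h2, _⟩ := mem_kids.1 hc
      exact h2 (by simpa using h1)
    have hg : reg {[]} ∅ [] = ∅ := Finset.filter_empty _
    have hr : recOf (Tree.clean {[]} ∅) (fun _ => 0) [] = Rec.blank := by
      simp [recOf, Tree.clean, hk, hg, Rec.blank]
    rw [hr, Rec.blocks_blank]
    exact List.ext_getElem (by simp [seg]) fun i h1 h2 => by simp [seg]
  zero _ _ := rfl

/-! ### The stored string -/

section Stores

variable (N : ℕ) [NeZero N] (B M)

/-- The number of control states of the machine. -/
def states : ℕ := Nat.card (Control N) * ((maxCost + 1) * (maxCost + 1))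

/-- The machine. -/
def machine (σ : ℕ) : Machine σ B (states N) := simMachine maxCost State.enc (stepProg (N := N) M)

/-- The configuration `c` stores the string `x`, with potential `p`. -/
inductive Stores (x : List (Fin σ)) : Config B (states N) → ℕ → Prop
  | inControl (y : Word N) (hy : y.str = nat x) (hx : x.length < N) :
      Stores x (config maxCost State.enc ⟨y, .still, false, 0, none⟩ fun _ => 0) 0
  | onDisk (y : Word N) (T : Tree) (ad : Str → ℕ) (d : ℕ → BitVec B) (buf : Finset Str)
      -- Nothing is frozen if the string was long from the beginning. Otherwise its alphabet was no
      -- larger than `N` when it was frozen, so the frozen keys have constant size.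
      (hy : y.str = [] ∨ σ ≤ N) (hx : N ≤ x.length)
      (h : Holds B M σ (symmDiff (keys σ (nat x)) (keys σ y.str)) x.length T ad d buf) :
      Stores x (config maxCost State.enc (stillState y x.length T.Q.card buf) d) (charge B T buf)

end Stores

variable {N : ℕ} [NeZero N] {x : List (Fin σ)}

theorem length_nat (x : List (Fin σ)) : (nat x).length = x.length := by simp [nat]

theorem keys_nil (σ : ℕ) : keys σ [] = ∅ := by
  refine Finset.eq_empty_of_forall_notMem fun k hk => ?_
  obtain ⟨a, _, j, hj, _⟩ := mem_glue.1 hk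
  rw [mem_chg] at hj
  simp at hj

theorem str_clip_nat (h : x.length ≤ N) (hσ : σ ≤ N) : (clip N (nat x)).str = nat x := by
  refine str_clip (by rwa [length_nat]) fun c hc => ?_
  obtain ⟨a, _, rfl⟩ := List.mem_map.1 hc
  exact a.2.trans_le hσ

theorem exists_stores {L : ℕ} [NeZero (2 ^ L)] (hL : 2 ^ 30 ≤ L) (h : Admissible B M x) :
    ∃ c, Stores B M (2 ^ L) x c 0 := by
  by_cases hx : x.length < 2 ^ L
  · exact ⟨_, .inControl (clip _ (nat x)) (str_clip_nat hx.le (h.alphabet_le.trans hx.le)) hx⟩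
  · push Not at hx
    have hR := h.roomy hL hx
    have hlen : ∀ k ∈ keys σ (nat x), k.length + 1 ≤ keyLen σ x.length := by
      have := length_keys (σ := σ) (nat x)
      rwa [length_nat] at this
    obtain ⟨T, h1, h2, h3⟩ := exists_settled hlen hR.le hR.pos (by unfold keyLen; omega)
    obtain ⟨ad, d, h4⟩ := exists_rep h1.wf B
    have h5 : charge B T ∅ = 0 := by simp [charge, totalLen, h2]
    have hy : (clip (2 ^ L) []).str = [] := by simp [clip, Word.str, nat]
    have := Stores.onDisk (M := M) (clip (2 ^ L) []) T ad d ∅ (Or.inl hy) hx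
      ⟨⟨hR, h1, h4, size_le_keyLen _ _, by simp [totalLen]⟩, fun k => ?_, by simp⟩
    · rw [h5] at this
      exact ⟨_, this⟩
    · rw [hy, keys_nil, h3, ind_empty, zero_add]
      congr 1
      exact symmDiff_bot _

theorem strip_keys_nat (a : Fin σ) (x : List (Fin σ)) :
    strip (charCode σ.size a) (keys σ (nat x)) = (chg a (nat x)).image posCode :=
  strip_glue _ a.2

theorem decodeSet_strip_keys (a : Fin σ) (x : List (Fin σ)) :
    decodeSet x.length (strip (charCode σ.size a) (keys σ (nat x))) = positions a x := by
  rw [strip_keys_nat, decodeSet_chg]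

/-! ### Updates -/

theorem Update.lengthAfter_le (u : Update σ) (n : ℕ) : n ≤ u.lengthAfter n := by
  cases u <;> simp [lengthAfter]

theorem Stores.update {L : ℕ} [NeZero (2 ^ L)] (hL : 2 ^ 30 ≤ L) {c : Config B (states (2 ^ L))}
    {p : ℕ} (h : Stores B M (2 ^ L) x c p) {u : Update σ} (hu : u.Valid x)
    (hadm : Admissible B M (u.apply x)) :
    ∃ k c' p', Exec (machine B M (2 ^ L) σ) M (.update u) c [] k c' ∧
      Stores B M (2 ^ L) (u.apply x) c' p' ∧
      k * (64 * B) + maxCost * p' ≤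
        maxCost * (p + 2 ^ 36 * keyLen σ (u.apply x).length ^ 2) := by
  have hlen := u.lengthAfter_length x
  cases h with
  | inControl y hy hx =>
    have hle : (u.apply x).length ≤ 2 ^ L := by
      have := (length_apply x u).2
      omega
    have hσ : σ ≤ 2 ^ L := hadm.alphabet_le.trans hle
    have hy' : (clip (2 ^ L) (u.applyNat y.str)).str = nat (u.apply x) := by
      rw [hy, u.applyNat_nat, str_clip_nat hle hσ]
    have hstep : stepProg (B := B) M (.update u) (⟨y, .still, false, 0, none⟩ : State (2 ^ L)) =
        growStep u ⟨y, .still, false, 0, none⟩ := rfl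
    by_cases hlt : (u.apply x).length < 2 ^ L
    · refine ⟨0, _, 0, exec_of_runs State.enc_injective (Runs.halt (s' :=
        ⟨clip (2 ^ L) (u.applyNat y.str), .still, false, 0, none⟩) ?_ (Nat.zero_le _)),
        .inControl _ hy' hlt, by simp⟩
      rw [hstep, growStep, hy', length_nat, if_pos hlt]
    -- The length reaches the threshold. The updated string is frozen, and its difference to the
    -- stored string is empty.
    · have hn : (u.apply x).length = 2 ^ L := by omega
      have hR := hadm.roomy hL hn.ge
      have hE0 : 0 < keyLen σ (u.apply x).length := by unfold keyLen; omega
      obtain ⟨t1, t2, t3⟩ := settled_trivial (B := B) hE0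
      have hcard : (Tree.clean {[]} ∅).Q.card = 1 := by simp [Tree.clean]
      have hrep : Rep (B := B) (Tree.clean {[]} ∅) (fun _ => 0) (Tree.clean {[]} ∅).Q.card
          fun _ => 0 := by
        rw [hcard]
        exact rep_trivial B
      have hst := Stores.onDisk (M := M) (clip (2 ^ L) (u.applyNat y.str)) _ _ _ ∅ (Or.inr hσ)
        hn.ge ⟨⟨hR, t1, hrep, size_le_keyLen _ _, by simp [totalLen]⟩, fun k => by
          rw [hy', symmDiff_self, t3, add_zero]
          rfl, by simp⟩
      have hch : charge B (Tree.clean {[]} ∅) ∅ = 0 := by simp [charge, totalLen, t2]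
      rw [hch] at hst
      refine ⟨0, _, 0, exec_of_runs State.enc_injective (Runs.halt ?_ ?_), hst, by simp⟩
      · rw [hstep, growStep, hy', length_nat, if_neg hlt, hcard, hn]
        rfl
      · exact (Nat.le_add_right _ _).trans
          (hR.mem_still_le _ (size_le_keyLen _ _) (Nat.size_le.2
            (hcard ▸ Nat.one_lt_two_pow hE0.ne')) (by simp [totalLen]))
  | onDisk y T ad d buf hy hx h =>
    have hl := length_toggle x u hu
    rw [← hlen] at hl
    have hR := hadm.roomy hL (hx.trans (by rw [← hlen]; exact u.lengthAfter_le _))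
    rw [← hlen] at hR
    obtain ⟨k, T', ad', d', buf', g1, g2, g3⟩ := h.update y u (u.lengthAfter_le _) hl hR
    rw [hlen] at g1 g2 g3
    refine ⟨k, _, _, exec_of_runs State.enc_injective g1,
      .onDisk y T' ad' d' buf' hy (hx.trans (length_apply x u).1) ?_, g3⟩
    rwa [keys_apply x u hu, symmDiff_right_comm]

end BitmapIndex

/-! ### Bounds for space, queries and sequences of operations. -/

namespace BitmapIndex

variable {B M : ℕ} {σ : ℕ} {x : List (Fin σ)}

/-! ### Space and query bounds -/

section

variable {N : ℕ}

theorem trieSize_keys_word_le (y : Word N) (hy : y.str = [] ∨ σ ≤ N) :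
    trieSize (keys σ y.str) ≤ N * (N + 1) * (2 * N.size + 1) := by
  rcases hy with hy | hσ
  · rw [hy, keys_nil]
    simp [trieSize, pre]
  · have hl := y.length_str
    have h1 : ∀ k ∈ keys σ y.str, k.length + 1 ≤ 2 * N.size + 1 := fun k hk => by
      have h2 := length_keys y.str k hk
      have h3 := Nat.size_le_size hl
      have h4 := Nat.size_le_size hσ
      unfold keyLen at h2
      omega
    refine (trieSize_le_totalLen _).trans ((totalLen_le_card_mul h1).trans
      (Nat.mul_le_mul_right _ ?_))
    have h5 : (keys σ y.str).card ≤ ∑ a ∈ Finset.range σ, (chg a y.str).card :=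
      Finset.card_biUnion_le.trans (Finset.sum_le_sum fun _ _ => Finset.card_image_le)
    refine h5.trans ((Finset.sum_le_card_nsmul _ _ (N + 1) fun a _ => ?_).trans ?_)
    · exact (card_chg_le _ _).trans (by omega)
    · rw [smul_eq_mul, Finset.card_range]
      exact Nat.mul_le_mul_right _ hσ

theorem comp_nil (Q : Finset Str) : comp Q [] = Q :=
  Finset.filter_true_of_mem fun _ _ => Or.inr List.nil_prefix

/-- The constant of the space bound. -/
def spaceConst (N : ℕ) : ℕ := 26 + recSize * (37 + N * (N + 1) * (2 * N.size + 1))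

theorem Stores.storedIn {c : Config B (states N)} {p : ℕ} (h : Stores B M N x c p)
    (hadm : Admissible B M x) :
    StoredIn c (spaceConst N * (x.length * entropy x + B)) := by
  have hH : 0 ≤ x.length * entropy x := mul_nonneg (Nat.cast_nonneg _) (entropy_nonneg x)
  have hB : (1 : ℝ) ≤ B := by exact_mod_cast hadm.pos
  cases h with
  | inControl y hy hx =>
    refine ⟨0, fun _ _ => rfl, ?_⟩
    have : (config (B := B) maxCost State.enc (⟨y, .still, false, 0, none⟩ : State N)
      fun _ => 0).int.mem.length = 0 := rfl
    rw [this]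
    simp only [zero_mul, add_zero, Nat.cast_zero]
    positivity
  | onDisk y T ad d buf hy hx h =>
    refine ⟨recSize * T.Q.card, h.context.rep.zero, ?_⟩
    set n := x.length with hn
    -- Below the empty prefix are all cells but the root.
    have h1 := h.context.settled.card_below_le h.context.room.le h.content h.context.buf_le []
    have h2 := card_comp_le T.Q []
    rw [comp_nil] at h2
    rw [strip_nil] at h1
    set P := N * (N + 1) * (2 * N.size + 1) with hP
    have h3 := trieSize_symmDiff_le (keys σ (nat x)) (keys σ y.str)
    have h4 := trieSize_keys_word_le (σ := σ) y hy
    have hcap : cap B ≤ B := Nat.div_le_self _ _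
    have h5 := Work.length_code_le ⟨n, T.Q.card, buf, 0, [], ∅, []⟩
    have hmem : (config (B := B) maxCost State.enc (stillState y n T.Q.card buf) d).int.mem.length =
        (Work.code ⟨n, T.Q.card, buf, 0, [], ∅, []⟩).length := rfl
    have h6 : T.Q.card.size ≤ keyLen σ n := Nat.size_le.2 h.context.card_lt
    have h7 := h.context.size_le
    have h8 := (trieSize_le_totalLen _).trans h.context.buf_le
    have h9 := h.context.room.le
    have h10 := hadm.pos
    have h11 : trieSize (∅ : Finset Str) = 0 := by simp [trieSize, pre]
    simp only [h11, List.length_nil, Nat.size_zero] at h5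
    have hm : (Work.code ⟨n, T.Q.card, buf, 0, [], ∅, []⟩).length ≤ 26 * B := by omega
    have hq : T.Q.card * B ≤ 3 * B + trieSize (keys σ (nat x)) + P := by
      have h12 : 119 * B * (below T.Q []).card ≤ trieSize (keys σ (nat x)) + P + 2 * B := by
        simp only [List.length_nil] at h1
        omega
      have h13 := Nat.mul_le_mul_right B h2
      simp only [List.length_nil] at h13
      nlinarith
    have hk := trieSize_keys_le x hadm.two_le_length hadm.alphabet_le
    have hlg := hadm.two_mul_lg_le
    have hlg1 := one_le_lg hadm.two_le_length
    have hq' : (T.Q.card : ℝ) * B ≤ 3 * B + trieSize (keys σ (nat x)) + P := by exact_mod_cast hq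
    have hm' : ((Work.code ⟨n, T.Q.card, buf, 0, [], ∅, []⟩).length : ℝ) ≤ 26 * B := by
      exact_mod_cast hm
    have hP0 : (0 : ℝ) ≤ P := Nat.cast_nonneg _
    have hR0 : (0 : ℝ) ≤ recSize := Nat.cast_nonneg _
    have hq2 : (T.Q.card : ℝ) * B ≤ (37 + P) * (n * entropy x + B) := by
      have : (P : ℝ) ≤ P * B := le_mul_of_one_le_right hP0 hB
      have : 0 ≤ P * (n * entropy x) := mul_nonneg hP0 hH
      rw [← hn] at hk
      nlinarith
    have hsc : (spaceConst N : ℝ) = 26 + recSize * (37 + P) := by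
      rw [spaceConst, ← hP]
      push_cast
      ring
    rw [hmem, hsc]
    push_cast
    have := mul_le_mul_of_nonneg_left hq2 hR0
    nlinarith

theorem Stores.mem_le {L : ℕ} [NeZero (2 ^ L)] {c : Config B (states (2 ^ L))} {p : ℕ}
    (h : Stores B M (2 ^ L) x c p) : c.int.mem.length ≤ M := by
  cases h with
  | inControl y hy hx => exact Nat.zero_le _
  | onDisk y T ad d buf hy hx h =>
    exact (Nat.le_add_right _ _).trans (h.context.room.mem_still_le y h.context.size_le
      (Nat.size_le.2 h.context.card_lt) h.context.buf_le)

/-- The constant of the bound on the size of answers. -/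
def outConst (N : ℕ) : ℕ := 178 + 147 * (N + 1) ^ 2

/-- The constant of the bound on the I/Os of a query. -/
def queryConst (N : ℕ) : ℕ :=
  (3 * recSize + 1) * (22 + (N + 1) ^ 2) + recSize + 2 + outConst N

theorem trieSize_bitmap_le (a : Fin σ) (x : List (Fin σ)) (h : 2 ≤ x.length) :
    (trieSize ((chg a (nat x)).image posCode) : ℝ) ≤ 10 * answerBits a x + 5 * lg x.length := by
  have hT := answerBits_nonneg a x
  have hlg := one_le_lg h
  rcases Nat.eq_zero_or_pos (positions a x).card with h0 | h0
  · rw [chg_eq_empty a x h0]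
    simp only [trieSize, pre, Finset.image_empty, Finset.biUnion_empty, Finset.card_empty,
      Nat.cast_zero]
    linarith
  · rcases (card_positions_le a x).lt_or_eq with h1 | h1
    · have h2 := trieSize_le_of_mixed a x h0 h1
      have h3 := spread_rare_le a x
      linarith
    · have h2 : (trieSize ((chg a (nat x)).image posCode) : ℝ) ≤ 2 * x.length.size + 1 := by
        exact_mod_cast trieSize_le_of_full a x h1
      have h3 := size_le_lg (show 0 < x.length by omega)
      linarith

/-- Only a bitmap of ones can have a trie that is not O(T + 1). Then `hd` leaves the case that `f`
is large compared with the memory, while the trie has O(lg n) nodes; so `f` is due to the frozen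
part and bounded in terms of `P`. -/
theorem length_answer_le (a : Fin σ) {f l P E : ℕ}
    (hR : Roomy B M E) (hE : x.length.size ≤ E)
    (hf : f ≤ trieSize ((chg a (nat x)).image posCode) + P)
    (hd : positions a x ≠ Finset.range x.length ∨ M / 64 < 4 * f)
    (hl : l ≤ 16 * f + 3 * P + 2) :
    (l : ℝ) ≤ (178 + 147 * P) * (answerBits a x + 1) := by
  have hT := answerBits_nonneg a x
  have hP : (0 : ℝ) ≤ P := Nat.cast_nonneg _
  have hl' : (l : ℝ) ≤ 16 * f + 3 * P + 2 := by exact_mod_cast hl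
  have hf' : (f : ℝ) ≤ trieSize ((chg a (nat x)).image posCode) + P := by exact_mod_cast hf
  rcases Nat.eq_zero_or_pos (positions a x).card with h0 | h0
  · rw [chg_eq_empty a x h0] at hf'
    simp only [trieSize, pre, Finset.image_empty, Finset.biUnion_empty, Finset.card_empty,
      Nat.cast_zero] at hf'
    nlinarith
  · rcases (card_positions_le a x).lt_or_eq with h1 | h1
    · have h2 := trieSize_le_of_mixed a x h0 h1
      have h3 := spread_rare_le a x
      nlinarith
    · have hfull : positions a x = Finset.range x.length :=
        Finset.eq_of_subset_of_card_le (positions_subset a x) (by rw [Finset.card_range, h1])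
      have h2 := hd.resolve_left (not_not.2 hfull)
      have h3 := trieSize_le_of_full a x h1
      have h4 := hR.large
      have h5 := hR.le
      have h6 := hR.pos
      have h7 : f ≤ 9 * P + 1 := by omega
      have h8 : (f : ℝ) ≤ 9 * P + 1 := by exact_mod_cast h7
      nlinarith

theorem Stores.query {L : ℕ} [NeZero (2 ^ L)] {c : Config B (states (2 ^ L))} {p : ℕ}
    (h : Stores B M (2 ^ L) x c p) (hadm : Admissible B M x) (a : Fin σ) :
    ∃ o k, Exec (machine B M (2 ^ L) σ) M (.query a) c o k c ∧
      decode x.length o = positions a x ∧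
      (o.length : ℝ) ≤ outConst (2 ^ L) * (answerBits a x + 1) ∧
      (k : ℝ) ≤ queryConst (2 ^ L) * (answerBits a x / B + lg x.length) := by
  have hT := answerBits_nonneg a x
  have hlg := one_le_lg hadm.two_le_length
  have hB := hadm.pos
  have hB' : (1 : ℝ) ≤ B := by exact_mod_cast hB
  have hBM := hadm.le_memory
  set P := (2 ^ L + 1) ^ 2 with hP
  have hP0 : (0 : ℝ) ≤ P := Nat.cast_nonneg _
  have hR0 : (0 : ℝ) ≤ recSize := Nat.cast_nonneg _
  have hout : (outConst (2 ^ L) : ℝ) = 178 + 147 * P := by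
    rw [outConst, ← hP]
    push_cast
    ring
  have hio : (queryConst (2 ^ L) : ℝ) =
      (3 * recSize + 1) * (22 + P) + recSize + 2 + (178 + 147 * P) := by
    rw [← hout, queryConst, ← hP]
    push_cast
    ring
  rw [hio, hout]
  have hdiv : ∀ k : ℝ, k * B ≤ ((3 * recSize + 1) * (22 + P) + recSize + 2 + (178 + 147 * P)) *
      (answerBits a x + lg x.length * B) →
      k ≤ ((3 * recSize + 1) * (22 + P) + recSize + 2 + (178 + 147 * P)) *
        (answerBits a x / B + lg x.length) := by
    intro k hk
    have hB0 : (0 : ℝ) < B := by linarith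
    rw [← le_div_iff₀ hB0] at hk
    refine hk.trans (le_of_eq ?_)
    field_simp
  have hlB : 1 ≤ lg x.length * B := one_le_mul_of_one_le_of_one_le hlg hB'
  cases h with
  | inControl y hy hx =>
    set F := strip (charCode σ.size a) (keys σ y.str) with hF
    have hFp : decodeSet x.length F = positions a x := by rw [hF, hy, decodeSet_strip_keys]
    have hylen : y.str.length = x.length := by rw [hy, length_nat]
    have hstep : stepProg (B := B) M (.query a) (⟨y, .still, false, 0, none⟩ : State (2 ^ L)) =
        if decodeSet y.str.length F = Finset.range y.str.length then
          .ret ⟨y, .still, false, 0, none⟩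
        else stepProg M (.query a) ⟨y, .spell, false, 0, none⟩ := rfl
    rw [hylen, hFp] at hstep
    by_cases hfull : positions a x = Finset.range x.length
    · rw [if_pos hfull] at hstep
      refine ⟨[], 0, exec_of_runs State.enc_injective (Runs.halt hstep (Nat.zero_le _)), ?_, ?_, ?_⟩
      · simp [decode, hfull]
      · simp only [List.length_nil, Nat.cast_zero]
        positivity
      · refine hdiv _ ?_
        simp only [Nat.cast_zero, zero_mul]
        positivity
    · rw [if_neg hfull] at hstep
      obtain ⟨k, g1, g2⟩ := serves_spell (y := y) (d := fun _ => (0 : BitVec B)) (M := M) hB a false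
        (m := none) (by simpa [State.enc] using hBM) (Nat.zero_le _) 0
        (by rw [zero_mul]; exact List.length_pos_of_ne_nil (trieCode_ne_nil _))
      rw [zero_mul, List.drop_zero] at g1
      rw [← hF] at g1 g2
      have hFs := trieSize_frozen_le y a
      rw [← hF, ← hP] at hFs
      have hlen : ((trieCode F).length : ℝ) ≤ 3 * P + 1 := by
        rw [length_trieCode]
        exact_mod_cast (by omega : 3 * trieSize F + 1 ≤ 3 * P + 1)
      refine ⟨_, k, exec_of_runs State.enc_injective (g1.of_eq hstep le_rfl), ?_, ?_, ?_⟩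
      · have := decode_flatMap x.length (L := [F]) (by simp)
        rw [List.flatMap_singleton] at this
        rw [this]
        have : xorAll [F] = F := symmDiff_bot F
        rw [this, hFp]
      · nlinarith
      · refine hdiv _ ?_
        have h1 : (k : ℝ) * B ≤ (trieCode F).length + B := by
          exact_mod_cast (by omega : k * B ≤ (trieCode F).length + B)
        have h2 : (k : ℝ) * B ≤ (3 * P + 2) * (lg x.length * B) := by
          have : (B : ℝ) ≤ lg x.length * B := le_mul_of_one_le_left (by linarith) hlg
          nlinarith
        refine h2.trans (mul_le_mul ?_ (by linarith) (by linarith) (by positivity))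
        nlinarith
  | onDisk y T ad d buf hy hx h =>
    have hlA : (charCode σ.size a).length = σ.size := length_charCode _ _
    obtain ⟨o, k, g1, g2, g3, g4⟩ := h.context.query (by unfold keyLen; omega) h.content a y
    set A := charCode σ.size a with hA
    -- The frozen part, sent at the end, cancels the difference that is stored.
    have hback : symmDiff (strip A (symmDiff (keys σ (nat x)) (keys σ y.str)))
        (strip A (keys σ y.str)) = strip A (keys σ (nat x)) := by
      rw [strip_symmDiff, symmDiff_symmDiff_cancel_right]
    rw [hback, decodeSet_strip_keys] at g2 g3
    set f := trieSize (strip A (symmDiff (keys σ (nat x)) (keys σ y.str))) with hf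
    have hfle : f ≤ trieSize ((chg a (nat x)).image posCode) + P := by
      have h1 := trieSize_symmDiff_le (strip A (keys σ (nat x))) (strip A (keys σ y.str))
      rw [← strip_symmDiff, ← hf, strip_keys_nat] at h1
      exact h1.trans (Nat.add_le_add_left (trieSize_frozen_le y a) _)
    have hol : (o.length : ℝ) ≤ (178 + 147 * P) * (answerBits a x + 1) := by
      rcases g3 with rfl | ⟨h1, h2⟩
      · simp only [List.length_nil, Nat.cast_zero]
        positivity
      · exact length_answer_le a h.context.room h.context.size_le hfle h1 h2
    refine ⟨o, k, exec_of_runs State.enc_injective g1, g2, hol, hdiv _ ?_⟩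
    have hcomp := card_comp_le T.Q A
    have hbelow := h.context.settled.card_below_le h.context.room.le h.content h.context.buf_le A
    rw [← hf] at hbelow
    have hcap : cap B ≤ B := Nat.div_le_self _ _
    have hcB : (comp T.Q A).card * B ≤ (2 * σ.size + 3) * B + f := by
      have h1 := Nat.mul_le_mul_right B hcomp
      have h2 := Nat.mul_le_mul_left (A.length + 2) hcap
      rw [hlA] at *
      nlinarith
    have hcB' : ((comp T.Q A).card : ℝ) * B ≤ (2 * σ.size + 3) * B + f := by exact_mod_cast hcB
    have hσ : (σ.size : ℝ) ≤ lg x.length + 1 :=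
      (Nat.cast_le.2 (Nat.size_le_size hadm.alphabet_le)).trans
        (size_le_lg (show 0 < x.length by have := hadm.two_le_length; omega))
    have hf' : (f : ℝ) ≤ 10 * answerBits a x + 5 * lg x.length + P := by
      have h1 := trieSize_bitmap_le a x hadm.two_le_length
      have h2 : (f : ℝ) ≤ trieSize ((chg a (nat x)).image posCode) + P := by exact_mod_cast hfle
      linarith
    set V := answerBits a x + lg x.length * B with hV
    have hBV : (B : ℝ) ≤ V := by
      have : (B : ℝ) ≤ lg x.length * B := le_mul_of_one_le_left (by linarith) hlg
      linarith
    have h1V : 1 ≤ V := hB'.trans hBV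
    have hcV : ((comp T.Q A).card : ℝ) * B ≤ (22 + P) * V := by
      have h1 : (σ.size : ℝ) * B ≤ lg x.length * B + B := by nlinarith
      have h2 : lg x.length ≤ lg x.length * B := le_mul_of_one_le_right (by linarith) hB'
      have h3 : (P : ℝ) ≤ P * V := le_mul_of_one_le_right hP0 h1V
      nlinarith
    have hkB : (k : ℝ) * B ≤ ((comp T.Q A).card * (3 * recSize + 1) + recSize + 2) * B +
        o.length := by exact_mod_cast g4
    have hoV : (o.length : ℝ) ≤ (178 + 147 * P) * V := by
      refine hol.trans (mul_le_mul_of_nonneg_left ?_ (by positivity))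
      linarith
    have h5 := mul_le_mul_of_nonneg_left hcV (by positivity : (0 : ℝ) ≤ 3 * recSize + 1)
    have h6 := mul_le_mul_of_nonneg_left hBV (by positivity : (0 : ℝ) ≤ recSize + 2)
    linarith

end

/-! ### Sequences of operations -/

/-- The configuration that stores the empty string. -/
def blank (B N : ℕ) [NeZero N] : Config B (states N) :=
  config maxCost State.enc (⟨clip N [], .still, false, 0, none⟩ : State N) fun _ => 0

open Classical in
/-- A configuration that stores `x`; the blank one if there is none. -/
def initial (B M N : ℕ) [NeZero N] (x : List (Fin σ)) : Config B (states N) :=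
  if h : ∃ c, Stores B M N x c 0 then h.choose else blank B N

theorem stores_initial {L : ℕ} [NeZero (2 ^ L)] (hL : 2 ^ 30 ≤ L) (h : Admissible B M x) :
    Stores B M (2 ^ L) x (initial B M (2 ^ L) x) 0 := by
  have hx := exists_stores hL h
  rw [initial, dif_pos hx]
  exact hx.choose_spec

/-- The constant of the bound on the I/Os of updates. -/
def updateConst : ℕ := maxCost * (2 ^ 36 * 49)

theorem keyLen_apply_le (h : Admissible B M x) {u : Update σ} (h' : Admissible B M (u.apply x)) :
    (keyLen σ (u.apply x).length : ℝ) ≤ 7 * lg x.length := by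
  have h1 := h'.keyLen_le
  have h2 := one_le_lg h.two_le_length
  have h3 : (0 : ℝ) < x.length := by
    exact_mod_cast (show 0 < x.length by have := h.two_le_length; omega)
  have h4 : lg (u.apply x).length ≤ lg x.length + 1 := by
    have h5 : ((u.apply x).length : ℝ) ≤ x.length * 2 := by
      have := (length_apply x u).2
      have := h.two_le_length
      exact_mod_cast (by omega : (u.apply x).length ≤ x.length * 2)
    have h6 : (0 : ℝ) < (u.apply x).length :=
      h3.trans_le (by exact_mod_cast (length_apply x u).1)
    have h7 := Real.logb_le_logb_of_le one_lt_two h6 h5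
    rwa [Real.logb_mul h3.ne' two_ne_zero, Real.logb_self_eq_one one_lt_two] at h7
  linarith

theorem Reachable.weight_nonneg {q : ℕ} {m : Machine σ B q} {x₀ : List (Fin σ)}
    {c₀ c : Config B q} {t : ℕ} {w : ℝ} (h : Reachable m M x₀ c₀ x c t w) : 0 ≤ w := by
  induction h with
  | start => exact le_rfl
  | query _ _ ih => exact ih
  | @update x _ _ _ _ _ _ _ _ _ _ _ ih =>
    have h : 0 ≤ lg x.length := by
      unfold lg Real.logb
      exact div_nonneg (Real.log_natCast_nonneg _) (Real.log_nonneg one_le_two)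
    exact add_nonneg ih (div_nonneg h (div_nonneg (Nat.cast_nonneg _) h))

/-- I/Os are weighted with `64 * B` and potential with `maxCost`. On this scale an update
contributes a constant times lg² n, which is B · lg n / b. -/
theorem Reachable.stores {L : ℕ} [NeZero (2 ^ L)] (hL : 2 ^ 30 ≤ L) {x₀ x : List (Fin σ)}
    {c₀ c : Config B (states (2 ^ L))} {t : ℕ} {w : ℝ} (h₀ : Admissible B M x₀)
    (hc₀ : Stores B M (2 ^ L) x₀ c₀ 0)
    (h : Reachable (machine B M (2 ^ L) σ) M x₀ c₀ x c t w) :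
    Admissible B M x ∧ ∃ p, Stores B M (2 ^ L) x c p ∧
      (t : ℝ) * (64 * B) + maxCost * p ≤ updateConst * (B * w) := by
  induction h with
  | start => exact ⟨h₀, 0, hc₀, by
      rw [Nat.cast_zero, zero_mul, mul_zero, mul_zero, mul_zero, add_zero]⟩
  | query h hq ih =>
    obtain ⟨hadm, p, hs, hp⟩ := ih
    obtain ⟨o, k, g, -⟩ := hs.query hadm _
    obtain ⟨-, -, rfl⟩ := hq.unique g
    exact ⟨hadm, p, hs, hp⟩
  | @update x c c' t w u out k h hu hadm' he ih =>
    obtain ⟨hadm, p, hs, hp⟩ := ih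
    obtain ⟨k', c'', p', g1, g2, g3⟩ := hs.update hL hu hadm'
    obtain ⟨-, rfl, rfl⟩ := he.unique g1
    refine ⟨hadm', p', g2, ?_⟩
    have hB : (0 : ℝ) < B := by exact_mod_cast hadm.pos
    have hlg := one_le_lg hadm.two_le_length
    have hE := keyLen_apply_le hadm hadm'
    obtain ⟨K, hK⟩ : ∃ K, K = 2 ^ 36 := ⟨_, rfl⟩
    rw [← hK] at g3
    have h1 : (k : ℝ) * (64 * B) + maxCost * p' ≤
        maxCost * (p + K * (keyLen σ (u.apply x).length : ℝ) ^ 2) := by exact_mod_cast g3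
    have h2 : B * (lg x.length / blockWords x.length B) = lg x.length ^ 2 := by
      have : lg x.length ≠ 0 := by linarith
      unfold blockWords
      field_simp
    have h3 : (keyLen σ (u.apply x).length : ℝ) ^ 2 ≤ 49 * lg x.length ^ 2 := by
      have := pow_le_pow_left₀ (Nat.cast_nonneg (α := ℝ) _) hE 2
      rw [mul_pow] at this
      linarith
    have h4 : (0 : ℝ) ≤ maxCost := Nat.cast_nonneg _
    have h5 := mul_le_mul_of_nonneg_left h3 (mul_nonneg h4 (Nat.cast_nonneg (α := ℝ) K))
    have h6 : (updateConst : ℝ) = maxCost * (K * 49) := by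
      have h7 : updateConst = maxCost * (K * 49) := congrArg (fun K => maxCost * (K * 49)) hK.symm
      exact (congrArg Nat.cast h7).trans (by rw [Nat.cast_mul, Nat.cast_mul, Nat.cast_ofNat])
    rw [h6] at hp
    rw [mul_add (B : ℝ), h2, h6, Nat.cast_add]
    linarith

end BitmapIndex
end

open BitmapIndex

/-- There are universal constants `C`, `q` and a universal code `dec` for sets of positions such that,
for every alphabet size `σ`, block size `B` and memory size `M`, some machine can store every
admissible string, and at any time in any sequence of updates and point queries: the current string
takes `O(n H₀ + B)` bits; a point query outputs a representation of `I_a(x)` of `O(T + 1)` bits in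
`O(T / B + lg n)` I/Os; every update terminates; and the updates made so far took
amortized `O(lg n / b)` I/Os each. -/
theorem theorem6 :
    ∃ (C : ℝ) (q : ℕ) (dec : ℕ → List Bool → Finset ℕ),
      ∀ σ B M : ℕ, ∃ (m : BitmapIndex.Machine σ B q)
        (init : List (Fin σ) → BitmapIndex.Config B q),
        ∀ x₀ : List (Fin σ), BitmapIndex.Admissible B M x₀ →
          ∀ (x : List (Fin σ)) (c : BitmapIndex.Config B q) (t : ℕ) (w : ℝ),
            BitmapIndex.Reachable m M x₀ (init x₀) x c t w →
              c.int.mem.length ≤ M ∧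
              BitmapIndex.StoredIn c (C * (x.length * BitmapIndex.entropy x + B)) ∧
              (∀ a : Fin σ, ∃ (out : List Bool) (k : ℕ) (c' : BitmapIndex.Config B q),
                BitmapIndex.Exec m M (.query a) c out k c' ∧
                dec x.length out = BitmapIndex.positions a x ∧
                (out.length : ℝ) ≤ C * (BitmapIndex.answerBits a x + 1) ∧
                (k : ℝ) ≤
                  C * (BitmapIndex.answerBits a x / B + BitmapIndex.lg x.length)) ∧
              (∀ u : BitmapIndex.Update σ, u.Valid x → BitmapIndex.Admissible B M (u.apply x) →
                ∃ (k : ℕ) (c' : BitmapIndex.Config B q),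
                  BitmapIndex.Exec m M (.update u) c [] k c') ∧
              (t : ℝ) ≤ C * w := by
  -- One threshold serves all alphabets, blocks and memories, so the number of control states and
  -- all constants are universal.
  obtain ⟨L, hL⟩ : ∃ L, 2 ^ 30 ≤ L := ⟨_, le_rfl⟩
  have hne : NeZero (2 ^ L) := ⟨(Nat.two_pow_pos L).ne'⟩
  refine ⟨((spaceConst (2 ^ L) + outConst (2 ^ L) + queryConst (2 ^ L) + updateConst : ℕ) : ℝ),
    states (2 ^ L), decode,
    fun σ B M => ⟨machine B M (2 ^ L) σ, initial B M (2 ^ L), fun x₀ h₀ x c t w hr => ?_⟩⟩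
  obtain ⟨hadm, p, hs, hp⟩ := Reachable.stores hL h₀ (stores_initial hL h₀) hr
  have hH := mul_nonneg (Nat.cast_nonneg (α := ℝ) x.length) (entropy_nonneg x)
  have hB : (1 : ℝ) ≤ B := by exact_mod_cast hadm.pos
  have hlg := one_le_lg hadm.two_le_length
  have hle : ∀ {k : ℕ} {r s : ℝ}, k ≤ spaceConst (2 ^ L) + outConst (2 ^ L) + queryConst (2 ^ L) + updateConst →
      0 ≤ s → r ≤ k * s →
      r ≤ ((spaceConst (2 ^ L) + outConst (2 ^ L) + queryConst (2 ^ L) + updateConst : ℕ) : ℝ) * s :=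
    fun hk hs hr => hr.trans (mul_le_mul_of_nonneg_right (Nat.cast_le.2 hk) hs)
  refine ⟨hs.mem_le, ?_, fun a => ?_, fun u hu hu' => ?_, ?_⟩
  · obtain ⟨s, hs1, hs2⟩ := hs.storedIn hadm
    exact ⟨s, hs1, hle (by omega) (by linarith) hs2⟩
  · have ha := answerBits_nonneg a x
    obtain ⟨o, k, h1, h2, h3, h4⟩ := hs.query hadm a
    exact ⟨o, k, c, h1, h2, hle (by omega) (by linarith) h3, hle (by omega) (by positivity) h4⟩
  · obtain ⟨k, c', _, h, -⟩ := hs.update hL hu hu'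
    exact ⟨k, c', h⟩
  · have hw : (t : ℝ) * 64 ≤ updateConst * w := by
      have h1 : (0 : ℝ) ≤ (maxCost : ℝ) * p := mul_nonneg (Nat.cast_nonneg _) (Nat.cast_nonneg _)
      refine le_of_mul_le_mul_right ?_ (by linarith : (0 : ℝ) < B)
      linarith
    have ht : (0 : ℝ) ≤ t := Nat.cast_nonneg _
    have hu' : (0 : ℝ) ≤ (updateConst : ℝ) := Nat.cast_nonneg _
    have hw0 : 0 ≤ w := hr.weight_nonneg
    exact hle (k := updateConst) (by omega) hw0 (by linarith)
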